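/- **Setting.** Let $M$ be a smooth $n$-manifold with volume form $\nu$, $E\to M$ a smooth real vector bundle of finite rank, $J^\infty E$ its infinite jet bundle. $\mathrm{Loc}_E$ is the algebra of pull-backs to $J^\infty E$ of smooth functions on finite jet bundles; $\Omega^{k,0}(J^\infty E)$ is the space of horizontal $k$-forms (locally $\alpha=\alpha_I\,dx^I$ with $\alpha_I$ local functions, of globally bounded order), and $d_H\alpha=D_i\alpha_I\,dx^i\wedge dx^I$ with the total derivatives $D_i$. $\mathbf E(L\,d^nx)=\mathbf E_a(L)\,\theta^a\wedge d^nx$, $\mathbf E_a(L)=(-D)_I(\partial L/\partial u^a_I)$, is the Euler–Lagrange operator. $\Omega^{k,0}_c=\Omega^{k,0}_c(J^\infty E)$ is the space of $\alpha\in\Omega^{k,0}(J^\infty E)$ such that $(j^\infty\phi)^*\alpha$ (and, if $k=n$, also the components of $\mathbf E(\alpha)$ along $j^\infty\phi$) has compact support for each compactly supported section $\phi$. Let $\Omega^{n,1}_0$ be the $\mathrm{Loc}_E$-module of forms that are locally $\xi_a\,\theta^a\wedge d^nx$ with local functions $\xi_a$, where $\theta^a=du^a-u^a_i\,dx^i$,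 and let $\omega:\Omega^{n,1}_0\times\Omega^{n,1}_0\to \mathrm{Loc}_E$ be skew-symmetric and $\mathrm{Loc}_E$-bilinear. Put $\tilde l_2(\alpha,\beta)=\omega(\mathbf E(\alpha),\mathbf E(\beta))\,\nu$ for $\alpha,\beta\in\Omega_c^{n,0}$. Let $\mathcal F$ be the space of functionals $\phi\mapsto\int_M(j^\infty\phi)^*\alpha$, $\alpha\in\Omega^{n,0}_c$, on compactly supported sections, with the bracket $\{\int\alpha,\int\beta\}=\int\tilde l_2(\alpha,\beta)$. Assume that * this bracket satisfies the Jacobi identity on $\mathcal F$; * the complex $0\to\Omega^{0,0}_c\xrightarrow{d_H}\cdots\xrightarrow{d_H}\Omega^{n-1,0}_c\xrightarrow{d_H}\Omega^{n,0}_c$ is exact in degrees $k<n$. Let $G$ be a compact Lie group acting smoothly on $E$ by (not necessarily linear) fibre-preserving automorphisms $\psi_g$ that cover the identity of $M$ and map compactly supported sections to compactly supported sections. Assume that the action is canonical: $\{\mathcal P\circ\hat\psi_g,\mathcal Q\circ\hat\psi_g\}=\{\mathcal P,\mathcal Q\}\circ\hat\psi_g$ for all $g\in G$, $\mathcal P,\mathcal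 Q\in\mathcal F$, where $\hat\psi_g(\phi)=\psi_g\circ\phi$. Let $\Omega^{k,0}_G$ be the space of $G$-invariant forms in $\Omega^{k,0}_c$. Let $\pi:J^\infty E\to J^\infty E/G$ be the projection onto the orbit space, and let $\Omega^{k,0}_c(J^\infty E/G)$ be the space of horizontal $k$-forms $h$ on $J^\infty E/G$ (assigning to each orbit of jets over $p\in M$ an element of $\Lambda^kT_p^*M$) such that $\pi^*h\in\Omega^{k,0}_G$. **Proposition.** 1. If $0\le k<n$, $\alpha\in\Omega^{k+1,0}_G$ and $\alpha=d_H\beta$ with $\beta\in\Omega^{k,0}_c$, then the average $\hat\beta=\int_G(j\psi_g)^*\beta\,dg$ over normalized Haar measure lies in $\Omega^{k,0}_G$, and $d_H\hat\beta=\alpha$. Consequently every $d_H$-closed $\alpha\in\Omega^{k,0}_G$ with $0<k<n$ is $d_H\gamma$ for some $\gamma\in\Omega^{k-1,0}_G$, and, if $n>0$, every $d_H$-closed $\alpha\in\Omega^{0,0}_G$ is zero. 2. The formula $\pi^*(\hat d_Hh)=d_H(\pi^*h)$ defines a linear differential $\hat d_H$, $\hat d_H^2=0$, on the linear spaces $\Omega^{*,0}_c(J^\infty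 E/G)$, and the complex $0\to\Omega^{0,0}_c(J^\infty E/G)\to\cdots\to\Omega^{n,0}_c(J^\infty E/G)$ is exact in degrees $k<n$. 3. The graded space $X_i=\Omega^{n-i,0}_c(J^\infty E/G)$, $0\le i\le n$, carries an sh-Lie structure $(l_k)_{k\ge1}$ (graded skew-symmetric multilinear maps $l_k$ of degree $k-2$ satisfying $$\sum_{i+j=N+1}\ \sum_{\sigma\in unsh(i,N-i)}e(\sigma)(-1)^\sigma(-1)^{i(j-1)}\,l_j\bigl(l_i(x_{\sigma(1)},\dots,x_{\sigma(i)}),x_{\sigma(i+1)},\dots,x_{\sigma(N)}\bigr)=0$$ for $N\ge1$, with $i,j\ge1$ and $e(\sigma)$ the Koszul sign) such that $l_1=\hat d_H$ (zero on $X_0$), such that $\pi^*l_2(f_1,f_2)=\tilde l_2(\pi^*f_1,\pi^*f_2)$ for $f_1,f_2\in X_0$, such that $l_k=0$ for $k\ge4$, and such that $l_2,l_3$ vanish as soon as one argument has positive degree. -/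

import Mathlib

open Set Bundle Manifold MeasureTheory
open scoped ContDiff Topology

set_option linter.unusedSectionVars false

noncomputable section

namespace HorizontalComplex

/-! ## Coordinates -/

/-- Alternating `k`-forms on `ℝⁿ`. Since Mathlib's tangent space `T_pM` of a manifold modelled on
`ℝⁿ` is `ℝⁿ`, identified through the preferred chart at `p`, this is the fibre `Λᵏ T_p^* M`. -/
abbrev Cov (n k : ℕ) : Type := EuclideanSpace ℝ (Fin n) [⋀^Fin k]→L[ℝ] ℝ

/-- Values of the derivatives of order `0, …, r` of an `F`-valued map on `ℝⁿ`: the coordinates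
`(u^a_I)`, `|I| ≤ r`, on the jet bundle. -/
abbrev JetCoord (n r : ℕ) (F : Type*) [NormedAddCommGroup F] [NormedSpace ℝ F] : Type _ :=
  (k : Fin (r + 1)) → (EuclideanSpace ℝ (Fin n) [×(k : ℕ)]→L[ℝ] F)

/-- The jet coordinates of order at most `r` of `f` at `x`. -/
def jetCoord {n : ℕ} {F : Type*} [NormedAddCommGroup F] [NormedSpace ℝ F] (r : ℕ)
    (f : EuclideanSpace ℝ (Fin n) → F) (x : EuclideanSpace ℝ (Fin n)) : JetCoord n r F :=
  fun k => iteratedFDeriv ℝ (k : ℕ) f x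

/-- The elementary tensor `dx^{i_1} ⊗ ⋯ ⊗ dx^{i_k} ⊗ v`. -/
def elemTensor {n : ℕ} {F : Type*} [NormedAddCommGroup F] [NormedSpace ℝ F] {k : ℕ}
    (i : Fin k → Fin n) (v : F) : EuclideanSpace ℝ (Fin n) [×k]→L[ℝ] F :=
  ((ContinuousMultilinearMap.mkPiAlgebra ℝ (Fin k) ℝ).compContinuousLinearMap
    (fun l => EuclideanSpace.proj (i l))).smulRight v

/-- The Euler–Lagrange expression `v^a ∑_I (-D)_I (∂L/∂u^a_I)` along `f` at `x`, in coordinates.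
`L` is given as a function of `x` and of all derivatives of `f` of order at most `r`. The sum over
(symmetric) multi-indices `I` of order `k` is written as a sum over all sequences
`(i_1, …, i_k)`; because partial derivatives commute, both sums agree. The total derivative `D_i`
is the partial derivative `∂_i` of the composite with the jet of `f`. -/
def eulerExpr {n r : ℕ} {F V : Type*} [NormedAddCommGroup F] [NormedSpace ℝ F]
    [NormedAddCommGroup V] [NormedSpace ℝ V]
    (L : EuclideanSpace ℝ (Fin n) × JetCoord n r F → V)
    (f : EuclideanSpace ℝ (Fin n) → F) (x : EuclideanSpace ℝ (Fin n)) (v : F) : V :=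
  ∑ k : Fin (r + 1), (-1 : ℝ) ^ (k : ℕ) • ∑ i : Fin (k : ℕ) → Fin n,
    iteratedFDeriv ℝ (k : ℕ)
      (fun y => fderiv ℝ L (y, jetCoord r f y) (0, Pi.single k (elemTensor i v))) x
      (fun l => EuclideanSpace.single (i l) (1 : ℝ))

section Manifold

variable {n : ℕ} {M : Type*} [TopologicalSpace M] [ChartedSpace (EuclideanSpace ℝ (Fin n)) M]

/-- Pull-back of a covector at `p` along the coordinates of the preferred chart at `q`: if
`a ∈ Λᵏ T_p^* M` then `toChart q p a` collects the components of `a` with respect to the `dx^i`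
of the chart at `q`. -/
def toChart {k : ℕ} (q p : M) (a : Cov n k) : Cov n k :=
  a.compContinuousLinearMap
    (fderiv ℝ (chartAt (EuclideanSpace ℝ (Fin n)) p ∘ (chartAt (EuclideanSpace ℝ (Fin n)) q).symm)
      (chartAt (EuclideanSpace ℝ (Fin n)) q p))

/-- The value of an `n`-covector on the standard frame `∂/∂x^1, …, ∂/∂x^n`. -/
def onFrame (a : Cov n n) : ℝ := a (fun i => EuclideanSpace.single i (1 : ℝ))

/-- `ν` is a volume form: a smooth, nowhere vanishing `n`-form on `M`. -/
structure IsVolumeForm (ν : M → Cov n n) : Prop where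
  smooth : ∀ q : M, ContDiffOn ℝ ∞
    (fun x => toChart q ((chartAt (EuclideanSpace ℝ (Fin n)) q).symm x)
      (ν ((chartAt (EuclideanSpace ℝ (Fin n)) q).symm x)))
    (chartAt (EuclideanSpace ℝ (Fin n)) q).target
  ne_zero : ∀ p, ν p ≠ 0

/-- The measure `|ν|` on `M` given by a volume form `ν = f dx^1 ∧ ⋯ ∧ dx^n`: on each chart domain it
is the image of `|f| dx`, and these measures agree on overlaps; `|ν|` is their supremum in the
lattice of measures. -/
def volumeMeasure [MeasurableSpace M] (ν : M → Cov n n) : Measure M :=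
  ⨆ q : M, Measure.map (chartAt (EuclideanSpace ℝ (Fin n)) q).symm
    ((volume.restrict (chartAt (EuclideanSpace ℝ (Fin n)) q).target).withDensity
      (fun x => ENNReal.ofReal |onFrame (toChart q ((chartAt (EuclideanSpace ℝ (Fin n)) q).symm x)
        (ν ((chartAt (EuclideanSpace ℝ (Fin n)) q).symm x)))|))

/-- The integral `∫_M λ` of an `n`-form `λ = f ν`, with `M` oriented by `ν`. -/
def integralForm [MeasurableSpace M] (ν lam : M → Cov n n) : ℝ :=
  ∫ p, onFrame (lam p) / onFrame (ν p) ∂(volumeMeasure ν)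

end Manifold

/-! ## Sections, infinite jets, local functions and forms -/

section Bundle

variable (n : ℕ) {M : Type*} [TopologicalSpace M] [ChartedSpace (EuclideanSpace ℝ (Fin n)) M]
  (F : Type*) [NormedAddCommGroup F] [NormedSpace ℝ F]
  (E : M → Type*) [TopologicalSpace (TotalSpace F E)] [∀ p, TopologicalSpace (E p)]
  [∀ p, AddCommGroup (E p)] [∀ p, Module ℝ (E p)] [FiberBundle F E]

/-- Smooth sections of `E → M`. -/
abbrev Sec : Type _ := ContMDiffSection (𝓡 n) F ∞ E

variable {n F E}

/-- `φ` has compact support. -/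
def Sec.CompactSupport (φ : Sec n F E) : Prop := IsCompact (closure {p | φ p ≠ 0})

variable (n F E) in
/-- Smooth sections of `E → M` with compact support. -/
abbrev SecC : Type _ := {φ : Sec n F E // φ.CompactSupport}

/-- The coordinate expression of a section in the preferred chart and trivialization at `q`. -/
def Sec.rep (φ : Sec n F E) (q : M) : EuclideanSpace ℝ (Fin n) → F := fun x =>
  (trivializationAt F E q ⟨(chartAt (EuclideanSpace ℝ (Fin n)) q).symm x,
    φ ((chartAt (EuclideanSpace ℝ (Fin n)) q).symm x)⟩).2

variable (n F E) in
/-- Two sections are in contact of infinite order at `p` if all their partial derivatives at `p`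
(in the preferred chart and trivialization at `p`) agree. -/
def contact (p : M) : Setoid (Sec n F E) where
  r φ φ' := ∀ k : ℕ,
    iteratedFDeriv ℝ k (φ.rep p) (chartAt (EuclideanSpace ℝ (Fin n)) p p) =
      iteratedFDeriv ℝ k (φ'.rep p) (chartAt (EuclideanSpace ℝ (Fin n)) p p)
  iseqv := ⟨fun _ _ => rfl, fun h k => (h k).symm, fun h h' k => (h k).trans (h' k)⟩

variable (n F E) in
/-- The infinite jet bundle `J^∞E`. -/
abbrev InfJet : Type _ := (p : M) × Quotient (contact n F E p)

/-- The infinite jet `j^∞φ(p)`. -/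
def Sec.jet (φ : Sec n F E) (p : M) : InfJet n F E := ⟨p, Quotient.mk (contact n F E p) φ⟩

/-- A section representing a given infinite jet. -/
def InfJet.repr (j : InfJet n F E) : Sec n F E := Quotient.out j.2

variable (F E) in
/-- The domain in `M` of the preferred chart and trivialization at `q`. -/
def dom (q : M) : Set M :=
  (chartAt (EuclideanSpace ℝ (Fin n)) q).source ∩ (trivializationAt F E q).baseSet

variable (n F E) in
/-- The image of `dom F E q` in the chart at `q`. -/
def coordDom (q : M) : Set (EuclideanSpace ℝ (Fin n)) :=
  (chartAt (EuclideanSpace ℝ (Fin n)) q).target ∩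
    (chartAt (EuclideanSpace ℝ (Fin n)) q).symm ⁻¹' (trivializationAt F E q).baseSet

/-- Over the coordinate domain at `q`, the function `A` on `J^∞E` is the smooth function `L` of the
coordinates `x^i` and `u^a_I`, `|I| ≤ r`. -/
def IsLocalRep {V : Type*} [NormedAddCommGroup V] [NormedSpace ℝ V] (q : M)
    (A : InfJet n F E → V) (r : ℕ) (L : EuclideanSpace ℝ (Fin n) × JetCoord n r F → V) : Prop :=
  ContDiffOn ℝ ∞ L (coordDom n F E q ×ˢ univ) ∧
    ∀ (φ : Sec n F E), ∀ p ∈ dom (n := n) F E q, A (φ.jet p) =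
      L (chartAt (EuclideanSpace ℝ (Fin n)) q p,
        jetCoord r (φ.rep q) (chartAt (EuclideanSpace ℝ (Fin n)) q p))

/-- A family `A q` of components with respect to the coordinates at `q`, for all `q : M`, which is
the pull-back of smooth components on some finite jet bundle `J^rE`. -/
def IsLocal {V : Type*} [NormedAddCommGroup V] [NormedSpace ℝ V]
    (A : M → InfJet n F E → V) : Prop :=
  ∃ r : ℕ, ∀ q : M, ∃ L : EuclideanSpace ℝ (Fin n) × JetCoord n r F → V, IsLocalRep q (A q) r L

/-- `P ∈ Loc_E`: pull-backs to `J^∞E` of smooth functions on finite jet bundles. -/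
def IsLocalFunction (P : InfJet n F E → ℝ) : Prop := IsLocal (fun _ : M => P)

variable (n F E) in
/-- Not necessarily smooth horizontal `k`-forms on `J^∞E`: a value in `Λᵏ T_p^* M` for each infinite
jet at `p`. -/
abbrev PreForm (k : ℕ) : Type _ := InfJet n F E → Cov n k

/-- The components `α_I` (with respect to `dx^I`) of a horizontal form in the chart at `q`. -/
def comp {k : ℕ} (q : M) (α : PreForm n F E k) : PreForm n F E k :=
  fun j => toChart q j.1 (α j)

/-- `α ∈ Ω^{k,0}(J^∞E)`: horizontal forms whose components are local functions. -/
def IsHorizontal {k : ℕ} (α : PreForm n F E k) : Prop := IsLocal (fun q => comp q α)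

/-- The horizontal differential: `(d_H α)(j^∞φ(p)) = d((j^∞φ)^*α)(p)`, where the exterior derivative
is computed in the chart at `p`. For `α = α_I dx^I` with local `α_I` this is
`D_i α_I dx^i ∧ dx^I`, because `(D_i α_I) ∘ j^∞φ = ∂_i (α_I ∘ j^∞φ)`; in particular it does
not depend on the section `φ` representing the jet. -/
def dH {k : ℕ} (α : PreForm n F E k) : PreForm n F E (k + 1) := fun j =>
  extDeriv (fun x => comp j.1 α
      ((InfJet.repr j).jet ((chartAt (EuclideanSpace ℝ (Fin n)) j.1).symm x)))
    (chartAt (EuclideanSpace ℝ (Fin n)) j.1 j.1)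

variable [VectorBundle ℝ F E]

variable (n F E) in
/-- Not necessarily smooth source forms: a value in `E_p^* ⊗ Λᵏ T_p^* M` for each infinite jet at
`p`. The contact form `θ^a ∧ d^nx` is `v ↦ v^a d^nx` (`k = n`). -/
abbrev PreSource (k : ℕ) : Type _ := (j : InfJet n F E) → (E j.1 →ₗ[ℝ] Cov n k)

/-- `ξ ∈ Ω^{n,1}_0`: in coordinates `ξ = ξ_a θ^a ∧ d^nx` with local functions `ξ_a`. -/
def IsSource (ξ : PreSource n F E n) : Prop := ∀ v : F, IsLocal (fun q (j : InfJet n F E) =>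
  toChart q j.1 (ξ j ((trivializationAt F E q).symmₗ ℝ j.1 v)))

open Classical in
/-- The Euler–Lagrange operator: for `α = L d^nx` it is `E(α) = E_a(L) θ^a ∧ d^nx`, where
`E_a(L) = ∑_I (-D)_I (∂L/∂u^a_I)`. At a jet over `p` it is computed in the chart and trivialization
at `p`, from any coordinate expression of `α`. -/
def euler [FiniteDimensional ℝ F] {k : ℕ} (α : PreForm n F E k) : PreSource n F E k := fun j =>
  if h : ∃ (r : ℕ) (L : EuclideanSpace ℝ (Fin n) × JetCoord n r F → Cov n k),
      IsLocalRep j.1 (comp j.1 α) r L then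
    ∑ a, (((Module.finBasis ℝ F).coord a).comp
        ((trivializationAt F E j.1).linearMapAt ℝ j.1)).smulRight
      (eulerExpr h.choose_spec.choose ((InfJet.repr j).rep j.1)
        (chartAt (EuclideanSpace ℝ (Fin n)) j.1 j.1) (Module.finBasis ℝ F a))
  else 0

/-- `α ∈ Ω^{k,0}_c(J^∞E)`: the form `(j^∞φ)^*α` and, if `k = n`, also the components of `E(α)` along
`j^∞φ`, have compact support for every compactly supported section `φ`. -/
structure IsOmegaC [FiniteDimensional ℝ F] {k : ℕ} (α : PreForm n F E k) : Prop where
  horizontal : IsHorizontal α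
  compact : ∀ φ : SecC n F E, ∃ K : Set M, IsCompact K ∧ ∀ p ∉ K, α (φ.1.jet p) = 0
  compact_euler : k = n →
    ∀ φ : SecC n F E, ∃ K : Set M, IsCompact K ∧ ∀ p ∉ K, euler α (φ.1.jet p) = 0

variable (n F E) in
/-- Exactness of `0 → Ω^{0,0}_c → Ω^{1,0}_c → ⋯ → Ω^{n-1,0}_c → Ω^{n,0}_c` in degrees `< n`. -/
def HorizontalExact [FiniteDimensional ℝ F] : Prop :=
  (0 < n → ∀ α : PreForm n F E 0, IsOmegaC α → dH α = 0 → α = 0) ∧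
  ∀ k : ℕ, k + 1 < n → ∀ α : PreForm n F E (k + 1), IsOmegaC α → dH α = 0 →
    ∃ β : PreForm n F E k, IsOmegaC β ∧ dH β = α

/-! ## The pairing `w` and the Poisson bracket of local functionals -/

variable (n F E) in
/-- A bilinear form on the fibre `E_p^* ⊗ Λⁿ T_p^* M` at every infinite jet. -/
abbrev Pairing : Type _ := (j : InfJet n F E) →
  ((E j.1 →ₗ[ℝ] Cov n n) →ₗ[ℝ] (E j.1 →ₗ[ℝ] Cov n n) →ₗ[ℝ] ℝ)

/-- `w` defines a skew-symmetric map `Ω^{n,1}_0 × Ω^{n,1}_0 → Loc_E` which is a `Loc_E`-module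
homomorphism in each variable; such maps are the skew tensor fields with local components. -/
structure IsSkewPairing (w : Pairing n F E) : Prop where
  skew : ∀ j ξ η, w j ξ η = - w j η ξ
  isLocal : ∀ ξ η : PreSource n F E n, IsSource ξ → IsSource η →
    IsLocalFunction (fun j => w j (ξ j) (η j))

/-- The bracket of top forms `l̃₂(Pν, Qν) = w(E(Pν), E(Qν)) ν`. -/
def topBracket [FiniteDimensional ℝ F] (ν : M → Cov n n) (w : Pairing n F E)
    (α β : PreForm n F E n) : PreForm n F E n :=
  fun j => w j (euler α j) (euler β j) • ν j.1

variable [MeasurableSpace M]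

/-- The functional `φ ↦ ∫_M (j^∞φ)^*α` on compactly supported sections. -/
def functional (ν : M → Cov n n) (α : PreForm n F E n) : SecC n F E → ℝ :=
  fun φ => integralForm ν (fun p => α (φ.1.jet p))

/-- The space `𝓕` of local functionals `∫_M Pν`, `Pν ∈ Ω^{n,0}_c(J^∞E)`. -/
def IsLocalFunctional [FiniteDimensional ℝ F] (ν : M → Cov n n) (P : SecC n F E → ℝ) : Prop :=
  ∃ α : PreForm n F E n, IsOmegaC α ∧ P = functional ν α

open Classical in
/-- The bracket `{∫Pν, ∫Qν}(φ) = ∫_M (w(E(Pν), E(Qν)) ∘ j^∞φ) ν` of local functionals. -/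
def poissonBracket [FiniteDimensional ℝ F] (ν : M → Cov n n) (w : Pairing n F E)
    (P Q : SecC n F E → ℝ) : SecC n F E → ℝ :=
  if h : IsLocalFunctional ν P ∧ IsLocalFunctional ν Q then
    functional ν (topBracket ν w h.1.choose h.2.choose)
  else 0

/-- The bracket of local functionals satisfies the Jacobi identity. -/
def JacobiIdentity [FiniteDimensional ℝ F] (ν : M → Cov n n) (w : Pairing n F E) : Prop :=
  ∀ P Q R : SecC n F E → ℝ,
    IsLocalFunctional ν P → IsLocalFunctional ν Q → IsLocalFunctional ν R →
    poissonBracket ν w (poissonBracket ν w P Q) R + poissonBracket ν w (poissonBracket ν w Q R) P +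
      poissonBracket ν w (poissonBracket ν w R P) Q = 0

end Bundle

/-! ## Group actions by bundle automorphisms -/

section Action

variable (n : ℕ) {M : Type*} [TopologicalSpace M] [ChartedSpace (EuclideanSpace ℝ (Fin n)) M]
  (F : Type*) [NormedAddCommGroup F] [NormedSpace ℝ F]
  (E : M → Type*) [TopologicalSpace (TotalSpace F E)] [∀ p, TopologicalSpace (E p)]
  [∀ p, AddCommGroup (E p)] [∀ p, Module ℝ (E p)] [FiberBundle F E]
  (d : ℕ) (G : Type*) [Group G] [TopologicalSpace G] [ChartedSpace (EuclideanSpace ℝ (Fin d)) G]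

/-- A smooth left action of the Lie group `G` on `E` by (not necessarily linear) automorphisms
`ψ_g` sending fibres to fibres and covering the identity of `M`, such that each induced map
`φ ↦ ψ_g ∘ φ` preserves the compactly supported sections. -/
structure FibreAction where
  act : G → (p : M) → E p → E p
  act_one : ∀ p v, act 1 p v = v
  act_mul : ∀ g h p v, act (g * h) p v = act g p (act h p v)
  smooth : ContMDiff ((𝓡 d).prod ((𝓡 n).prod 𝓘(ℝ, F))) ((𝓡 n).prod 𝓘(ℝ, F)) ∞
    (fun z : G × TotalSpace F E => (⟨z.2.1, act z.1 z.2.1 z.2.2⟩ : TotalSpace F E))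
  compact : ∀ (g : G) (φ : Sec n F E), φ.CompactSupport →
    IsCompact (closure {p | act g p (φ p) ≠ 0})

variable {n F E d G}

namespace FibreAction

/-- The section `ψ_g ∘ φ`. -/
def onSec (A : FibreAction n F E d G) (g : G) (φ : Sec n F E) : Sec n F E where
  toFun p := A.act g p (φ p)
  contMDiff_toFun := by
    have h1 : ContMDiff (𝓡 n) ((𝓡 d).prod ((𝓡 n).prod 𝓘(ℝ, F))) ∞
        (fun p : M => ((g, ⟨p, φ p⟩) : G × TotalSpace F E)) :=
      contMDiff_const.prodMk φ.contMDiff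
    exact A.smooth.comp h1

/-- The map `ψ̂_g : φ ↦ ψ_g ∘ φ` on compactly supported sections. -/
def onSecC (A : FibreAction n F E d G) (g : G) (φ : SecC n F E) : SecC n F E :=
  ⟨A.onSec g φ.1, A.compact g φ.1 φ.2⟩

/-! The induced map on infinite jets is well defined, by the higher chain rule. -/

section Jet

variable [IsManifold (𝓡 n) ∞ M] [VectorBundle ℝ F E] [ContMDiffVectorBundle ∞ F E (𝓡 n)]

theorem contDiffAt_rep (φ : Sec n F E) (p : M) :
    ContDiffAt ℝ ∞ (φ.rep p) (chartAt (EuclideanSpace ℝ (Fin n)) p p) := by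
  have h1 := (Bundle.contMDiffAt_section (IB := 𝓡 n) p).1 (φ.contMDiff p)
  have h2 : ContMDiffAt (𝓡 n) (𝓡 n) ∞ (chartAt (EuclideanSpace ℝ (Fin n)) p).symm
      (chartAt (EuclideanSpace ℝ (Fin n)) p p) :=
    contMDiffOn_chart_symm.contMDiffAt
      ((chartAt (EuclideanSpace ℝ (Fin n)) p).open_target.mem_nhds (mem_chart_target _ p))
  have h3 := ContMDiffAt.comp_of_eq h1 h2
    ((chartAt (EuclideanSpace ℝ (Fin n)) p).left_inv (mem_chart_source _ p))
  exact contMDiffAt_iff_contDiffAt.1 h3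

/-- The coordinate expression of `ψ_g`. -/
def localAct (A : FibreAction n F E d G) (g : G) (p : M) (z : EuclideanSpace ℝ (Fin n) × F) : F :=
  let u := (trivializationAt F E p).toOpenPartialHomeomorph.symm
    ((chartAt (EuclideanSpace ℝ (Fin n)) p).symm z.1, z.2)
  (trivializationAt F E p ⟨u.1, A.act g u.1 u.2⟩).2

theorem contDiffAt_localAct (A : FibreAction n F E d G) (g : G) (p : M) (v : F) :
    ContDiffAt ℝ ∞ (A.localAct g p) (chartAt (EuclideanSpace ℝ (Fin n)) p p, v) := by
  set x := chartAt (EuclideanSpace ℝ (Fin n)) p p with hx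
  set e := trivializationAt F E p with he
  have hxp : (chartAt (EuclideanSpace ℝ (Fin n)) p).symm x = p :=
    (chartAt (EuclideanSpace ℝ (Fin n)) p).left_inv (mem_chart_source _ p)
  have hp : p ∈ e.baseSet := mem_baseSet_trivializationAt F E p
  have hsymm : ContMDiffAt (𝓡 n) (𝓡 n) ∞ (chartAt (EuclideanSpace ℝ (Fin n)) p).symm x :=
    contMDiffOn_chart_symm.contMDiffAt
      ((chartAt (EuclideanSpace ℝ (Fin n)) p).open_target.mem_nhds (mem_chart_target _ p))
  have h1 : ContMDiffAt (𝓘(ℝ, EuclideanSpace ℝ (Fin n) × F)) ((𝓡 n).prod 𝓘(ℝ, F)) ∞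
      (fun z : EuclideanSpace ℝ (Fin n) × F =>
        ((chartAt (EuclideanSpace ℝ (Fin n)) p).symm z.1, z.2)) (x, v) := by
    refine ContMDiffAt.prodMk ?_ ?_
    · exact ContMDiffAt.comp (x := (x, v)) (g := (chartAt (EuclideanSpace ℝ (Fin n)) p).symm)
        (f := Prod.fst) hsymm (contMDiffAt_iff_contDiffAt.2 contDiffAt_fst)
    · exact contMDiffAt_iff_contDiffAt.2 contDiffAt_snd
  have hmem : ((p, v) : M × F) ∈ e.target := by rw [e.mem_target]; exact hp
  have h2 : ContMDiffAt ((𝓡 n).prod 𝓘(ℝ, F)) ((𝓡 n).prod 𝓘(ℝ, F)) ∞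
      e.toOpenPartialHomeomorph.symm (p, v) :=
    (e.contMDiffOn_symm (IB := 𝓡 n) (n := ∞)).contMDiffAt (e.open_target.mem_nhds hmem)
  have h12 := ContMDiffAt.comp_of_eq (x := (x, v)) h2 h1 (by simp [hxp])
  have h3 : ContMDiff ((𝓡 n).prod 𝓘(ℝ, F)) ((𝓡 n).prod 𝓘(ℝ, F)) ∞
      (fun u : TotalSpace F E => (⟨u.1, A.act g u.1 u.2⟩ : TotalSpace F E)) :=
    A.smooth.comp (contMDiff_const.prodMk contMDiff_id)
  set u := e.toOpenPartialHomeomorph.symm (p, v) with hu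
  have hproj : u.1 = p := e.proj_symm_apply hmem
  have hsrc : (⟨u.1, A.act g u.1 u.2⟩ : TotalSpace F E) ∈ e.source := by
    rw [e.mem_source]; change u.1 ∈ e.baseSet; rw [hproj]; exact hp
  have h4 : ContMDiffAt ((𝓡 n).prod 𝓘(ℝ, F)) ((𝓡 n).prod 𝓘(ℝ, F)) ∞ e
      (⟨u.1, A.act g u.1 u.2⟩ : TotalSpace F E) :=
    (e.contMDiffOn (IB := 𝓡 n) (n := ∞)).contMDiffAt (e.open_source.mem_nhds hsrc)
  have h43 := ContMDiffAt.comp (x := u) h4 (h3 u)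
  have h := ContMDiffAt.comp_of_eq (x := (x, v)) h43 h12 (by simp [hxp, hu])
  have h5 := contMDiffAt_snd.comp _ h
  exact contMDiffAt_iff_contDiffAt.1 h5

theorem onSec_rep_eq (A : FibreAction n F E d G) (g : G) (p : M) (φ : Sec n F E) :
    (A.onSec g φ).rep p =ᶠ[𝓝 (chartAt (EuclideanSpace ℝ (Fin n)) p p)]
      A.localAct g p ∘ fun x => (x, φ.rep p x) := by
  have hmem : (chartAt (EuclideanSpace ℝ (Fin n)) p).symm ⁻¹' (trivializationAt F E p).baseSet ∈
      𝓝 (chartAt (EuclideanSpace ℝ (Fin n)) p p) := by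
    refine ((chartAt (EuclideanSpace ℝ (Fin n)) p).continuousAt_symm
      (mem_chart_target _ p)).preimage_mem_nhds ?_
    rw [(chartAt (EuclideanSpace ℝ (Fin n)) p).left_inv (mem_chart_source _ p)]
    exact (trivializationAt F E p).open_baseSet.mem_nhds (mem_baseSet_trivializationAt F E p)
  filter_upwards [hmem] with x hx
  have hs : (⟨(chartAt (EuclideanSpace ℝ (Fin n)) p).symm x,
      φ ((chartAt (EuclideanSpace ℝ (Fin n)) p).symm x)⟩ : TotalSpace F E) ∈
      (trivializationAt F E p).source := by
    rw [(trivializationAt F E p).mem_source]; exact hx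
  have hinv := (trivializationAt F E p).symm_apply_mk_proj hs
  simp only [Function.comp_apply, localAct, Sec.rep]
  change _ = (trivializationAt F E p ⟨(_ : TotalSpace F E).1, _⟩).2
  rw [hinv]
  rfl

theorem contact_onSec (A : FibreAction n F E d G) (g : G) (p : M) (φ φ' : Sec n F E)
    (h : (contact n F E p) φ φ') : (contact n F E p) (A.onSec g φ) (A.onSec g φ') := by
  intro k
  set x := chartAt (EuclideanSpace ℝ (Fin n)) p p with hx
  have h0 : φ.rep p x = φ'.rep p x := by
    have := congrArg (fun m => m (fun _ => 0)) (h 0)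
    simpa using this
  have key : ∀ χ : Sec n F E, iteratedFDeriv ℝ k ((A.onSec g χ).rep p) x =
      (ftaylorSeries ℝ (A.localAct g p) (x, χ.rep p x)).taylorComp
        (fun m => (iteratedFDeriv ℝ m (id : EuclideanSpace ℝ (Fin n) → _) x).prod
          (iteratedFDeriv ℝ m (χ.rep p) x)) k := by
    intro χ
    rw [((A.onSec_rep_eq g p χ).iteratedFDeriv ℝ k).eq_of_nhds]
    have hk : (k : ℕ∞ω) ≤ (∞ : ℕ∞ω) := by exact_mod_cast le_top
    rw [iteratedFDeriv_comp (f := fun y => (y, χ.rep p y)) (x := x) (A.contDiffAt_localAct g p (χ.rep p x))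
      (contDiffAt_id.prodMk (contDiffAt_rep χ p)) hk]
    congr 1
    funext m
    have hm : (m : ℕ∞ω) ≤ (∞ : ℕ∞ω) := by exact_mod_cast le_top
    exact iteratedFDeriv_prodMk contDiffAt_id (contDiffAt_rep χ p) hm
  rw [key, key, h0]
  congr 1
  funext m
  rw [h m]

/-- The induced map `jψ_g` of `J^∞E`, `j^∞φ(p) ↦ j^∞(ψ_g ∘ φ)(p)`. -/
def onJet (A : FibreAction n F E d G) (g : G) (j : InfJet n F E) : InfJet n F E :=
  ⟨j.1, Quotient.map (A.onSec g) (fun φ φ' h => A.contact_onSec g j.1 φ φ' h) j.2⟩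

theorem onJet_jet (A : FibreAction n F E d G) (g : G) (φ : Sec n F E) (p : M) :
    A.onJet g (φ.jet p) = (A.onSec g φ).jet p := rfl

theorem onJet_one (A : FibreAction n F E d G) (j : InfJet n F E) : A.onJet 1 j = j := by
  obtain ⟨p, c⟩ := j
  induction c using Quotient.inductionOn with
  | h φ =>
    have : A.onSec 1 φ = φ := by ext q; exact A.act_one q (φ q)
    change (A.onSec 1 φ).jet p = φ.jet p
    rw [this]

theorem onJet_mul (A : FibreAction n F E d G) (g h : G) (j : InfJet n F E) :
    A.onJet (g * h) j = A.onJet g (A.onJet h j) := by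
  obtain ⟨p, c⟩ := j
  induction c using Quotient.inductionOn with
  | h φ =>
    have : A.onSec (g * h) φ = A.onSec g (A.onSec h φ) := by
      ext q; exact A.act_mul g h q (φ q)
    change (A.onSec (g * h) φ).jet p = (A.onSec g (A.onSec h φ)).jet p
    rw [this]

/-- Two infinite jets are equivalent if they lie in the same `G`-orbit. -/
def orbitSetoid (A : FibreAction n F E d G) : Setoid (InfJet n F E) where
  r j j' := ∃ g, A.onJet g j = j'
  iseqv := ⟨fun j => ⟨1, A.onJet_one j⟩,
    fun {j j'} ⟨g, hg⟩ => ⟨g⁻¹, by rw [← hg, ← A.onJet_mul, inv_mul_cancel, A.onJet_one]⟩,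
    fun {j j' j''} ⟨g, hg⟩ ⟨h, hh⟩ => ⟨h * g, by rw [A.onJet_mul, hg, hh]⟩⟩

/-- The orbit space `J^∞E/G`. -/
abbrev OrbitSpace (A : FibreAction n F E d G) : Type _ := Quotient A.orbitSetoid

/-- The projection `J^∞E → J^∞E/G`. -/
def proj (A : FibreAction n F E d G) (j : InfJet n F E) : A.OrbitSpace := Quotient.mk _ j

/-- `α` is `G`-invariant: `(jψ_g)^*α = α` for all `g`. As `ψ_g` covers the identity of `M`, the
pull-back of a horizontal form is the composition with `jψ_g`. -/
def IsInvariant (A : FibreAction n F E d G) {k : ℕ} (α : PreForm n F E k) : Prop :=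
  ∀ g j, α (A.onJet g j) = α j

/-- `α ∈ Ω^{k,0}_G(J^∞E)`: the `G`-invariant forms in `Ω^{k,0}_c(J^∞E)`. -/
def IsOmegaG [FiniteDimensional ℝ F] (A : FibreAction n F E d G) {k : ℕ}
    (α : PreForm n F E k) : Prop :=
  IsOmegaC α ∧ A.IsInvariant α

/-- The Haar average `∫_G (jψ_g)^*β dg`. -/
def average [MeasurableSpace G] (A : FibreAction n F E d G) (μ : Measure G) {k : ℕ}
    (β : PreForm n F E k) : PreForm n F E k :=
  fun j => ∫ g, β (A.onJet g j) ∂μ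

/-- Not necessarily smooth horizontal `k`-forms on `J^∞E/G`: a value in `Λᵏ T_p^* M` for each orbit
of jets at `p`. -/
abbrev OrbitForm (A : FibreAction n F E d G) (k : ℕ) : Type _ := A.OrbitSpace → Cov n k

/-- The pull-back `π^*h` along `π : J^∞E → J^∞E/G`. -/
def pull (A : FibreAction n F E d G) {k : ℕ} (h : A.OrbitForm k) : PreForm n F E k :=
  fun j => h (A.proj j)

/-- `h ∈ Ω^{k,0}_c(J^∞E/G)`: the horizontal forms on `J^∞E/G` with `π^*h ∈ Ω^{k,0}_G(J^∞E)`. -/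
def IsReduced [FiniteDimensional ℝ F] (A : FibreAction n F E d G) {k : ℕ}
    (h : A.OrbitForm k) : Prop :=
  A.IsOmegaG (A.pull h)

end Jet

/-- `G` acts canonically: `{𝒫 ∘ ψ̂_g, 𝒬 ∘ ψ̂_g} = {𝒫, 𝒬} ∘ ψ̂_g` for all local functionals. -/
def IsCanonical [VectorBundle ℝ F E] [FiniteDimensional ℝ F] [MeasurableSpace M]
    (A : FibreAction n F E d G) (ν : M → Cov n n) (w : Pairing n F E) : Prop :=
  ∀ (g : G) (P Q : SecC n F E → ℝ), IsLocalFunctional ν P → IsLocalFunctional ν Q →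
    poissonBracket ν w (P ∘ A.onSecC g) (Q ∘ A.onSecC g) = poissonBracket ν w P Q ∘ A.onSecC g

end FibreAction

end Action

/-! ## sh-Lie structures -/

section ShLie

/-- The Koszul sign `e(σ)` of a permutation of homogeneous elements of degrees `d`. -/
def koszulSign {k : ℕ} (d : Fin k → ℤ) (σ : Equiv.Perm (Fin k)) : ℤˣ :=
  ∏ a, ∏ b, if a < b ∧ σ b < σ a then (d (σ a) * d (σ b)).negOnePow else 1

/-- `σ` is a `(p, N - p)`-unshuffle: `σ 1 < ⋯ < σ p` and `σ (p+1) < ⋯ < σ N`. -/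
def IsUnshuffle {N : ℕ} (p : ℕ) (σ : Equiv.Perm (Fin N)) : Prop :=
  ∀ a b : Fin N, a < b → ((b : ℕ) < p ∨ p ≤ (a : ℕ)) → σ a < σ b

open Classical in
/-- An sh-Lie structure on the vector space `V` with graded pieces `X i`, `i ∈ ℤ`: graded
skew-symmetric multilinear maps `l k` of degree `k - 2`, for `k ≥ 1`, which satisfy the generalized
Jacobi identities, summed over unshuffles. (There is no `l 0`; the entry is fixed to be zero.) -/
structure ShLie (V : Type*) [AddCommGroup V] [Module ℝ V] (X : ℤ → Submodule ℝ V) where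
  l : (k : ℕ) → MultilinearMap ℝ (fun _ : Fin k => V) V
  l_zero : l 0 = 0
  degree : ∀ (k : ℕ), 1 ≤ k → ∀ (d : Fin k → ℤ) (x : Fin k → V), (∀ a, x a ∈ X (d a)) →
    l k x ∈ X ((∑ a, d a) + k - 2)
  skew : ∀ (k : ℕ) (d : Fin k → ℤ) (x : Fin k → V), (∀ a, x a ∈ X (d a)) →
    ∀ σ : Equiv.Perm (Fin k),
      l k (x ∘ σ) = ((Equiv.Perm.sign σ * koszulSign d σ : ℤˣ) : ℤ) • l k x
  jacobi : ∀ (N : ℕ) (d : Fin N → ℤ) (x : Fin N → V), (∀ a, x a ∈ X (d a)) →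
    ∑ i : Fin N, ∑ σ : Equiv.Perm (Fin N) with IsUnshuffle ((i : ℕ) + 1) σ,
      ((koszulSign d σ * Equiv.Perm.sign σ * (-1) ^ (((i : ℕ) + 1) * (N - ((i : ℕ) + 1))) : ℤˣ) :
          ℤ) •
        l (N - ((i : ℕ) + 1) + 1) (Matrix.vecCons
          (l ((i : ℕ) + 1) (fun a => x (σ ⟨a, by have := a.2; have := i.2; omega⟩)))
          (fun b : Fin (N - ((i : ℕ) + 1)) =>
            x (σ ⟨(i : ℕ) + 1 + b, by have := b.2; omega⟩))) = 0

/-- The degree `i` part of the total space of a complex `X 0 → X 1 → ⋯ → X n`, where the elements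
of `X k` have degree `n - k`. -/
def gradedPiece {n : ℕ} (X : Fin (n + 1) → Type*) [∀ k, AddCommGroup (X k)]
    [∀ k, Module ℝ (X k)] (i : ℤ) : Submodule ℝ ((k : Fin (n + 1)) → X k) where
  carrier := {v | ∀ k : Fin (n + 1), (n : ℤ) - (k : ℕ) ≠ i → v k = 0}
  zero_mem' := fun _ _ => rfl
  add_mem' := fun ha hb k hk => by simp [ha k hk, hb k hk]
  smul_mem' := fun c v hv k hk => by simp [hv k hk]

end ShLie

end HorizontalComplex

end

/-! Averaging. Since `ψ_g` covers the identity, pulling a horizontal form back means replacing `φ`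
by `ψ_g ∘ φ`, which commutes with `dH`. In coordinates the pulled-back form depends smoothly on `g`,
the base point and the jet together, so integration over the compact group keeps forms local of the
same order and commutes with `dH` (`isHorizontal_average`, `dH_average`); invariance is the right
invariance of Haar measure. The delicate point is compact support, because `ψ_g` may move the zero
section: a Baire argument gives one compact set off which every `ψ_g` fixes it
(`exists_compact_act_zero`). Invariant forms are the same as forms on the orbit space, so the
reduced complex inherits its exactness.

The bracket. The Euler form depends only on the functional, and it vanishes on exact forms.
Canonicity is an equality of integrals. Multiplying a test form by an arbitrary function of the base
localizes it to an equality for `w` itself, transported by the vertical linearization of `ψ_g`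
(`IsCanonical.pairing_eq`); together with naturality of the Euler operator this makes the bracket of
invariant forms invariant.

The Jacobiator. Exactness in degree `n` is not assumed, so a primitive of the Jacobiator has to be
produced (`exists_primitive_jac`). The Jacobi identity says that the functional of the Jacobiator is
zero, hence its Euler form is zero. The homotopy `t φ` and a partition of unity then write the
Jacobiator, minus its value along the zero section, as an exact form whose primitive vanishes
wherever `φ` does. The value along the zero section is a form on `M`, and a single vanishing
integral would not make it exact, for instance on a disconnected `M`. Instead the first argument `α`
is replaced by `ρ α`: the result is linear in `ρ`, is locally a differential operator in `ρ`, and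
has zero integral for each compactly supported `ρ`, so it is locally a divergence of operators in
`ρ`. A partition of unity, of which only finitely many members matter, gives a primitive of compact
support. The sum of both primitives is averaged. For `n = 0` there are no divergences and the same
argument shows that the Jacobiator is zero.

The algebra. Choose primitives linearly by a map `s` and put `l₃ = -s ∘ (Jacobiator)`. Boundaries
are killed by `l₂`, so the only generalized Jacobi identities with surviving terms are those with
three inputs, `l₂ l₂ + l₁ l₃ = 0`, and with four inputs, where `l₃ l₂` is `-s` of a sum that
vanishes because the bracket kills Jacobiators (`exists_shLie`). -/

noncomputable section

namespace HorizontalComplex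

/-! ### Higher derivatives and their symmetry -/

section Calculus

variable {X Y Z : Type*} [NormedAddCommGroup X] [NormedSpace ℝ X] [NormedAddCommGroup Y]
  [NormedSpace ℝ Y] [NormedAddCommGroup Z] [NormedSpace ℝ Z]

/-- Coordinate jet spaces thereby become finite-dimensional, which partitions of unity and
differentiation under the integral on them depend on. -/
instance finiteDimensional_continuousMultilinearMap [FiniteDimensional ℝ X] [FiniteDimensional ℝ Y]
    (k : ℕ) : FiniteDimensional ℝ (X [×k]→L[ℝ] Y) :=
  Module.Finite.of_injective
    ({ toFun := fun f => f.toMultilinearMap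
       map_add' := fun _ _ => rfl
       map_smul' := fun _ _ => rfl } : (X [×k]→L[ℝ] Y) →ₗ[ℝ] MultilinearMap ℝ (fun _ : Fin k => X) Y)
    (fun _ _ h => ContinuousMultilinearMap.toMultilinearMap_injective h)

instance finiteDimensional_cov (n k : ℕ) : FiniteDimensional ℝ (Cov n k) :=
  Module.Finite.of_injective
    ({ toFun := fun f => f.toContinuousMultilinearMap
       map_add' := fun _ _ => rfl
       map_smul' := fun _ _ => rfl } : Cov n k →ₗ[ℝ] (EuclideanSpace ℝ (Fin n) [×k]→L[ℝ] ℝ))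
    (fun _ _ h => ContinuousAlternatingMap.toContinuousMultilinearMap_injective h)

theorem contDiffOn_iteratedFDeriv {f : X → Y} {U : Set X} (hU : IsOpen U)
    (hf : ContDiffOn ℝ ∞ f U) (k : ℕ) : ContDiffOn ℝ ∞ (iteratedFDeriv ℝ k f) U := fun x hx =>
  ((hf.contDiffAt (hU.mem_nhds hx)).iteratedFDeriv_right (m := ∞) (i := k)
    (by exact_mod_cast le_top)).contDiffWithinAt

theorem contDiffOn_fderiv_apply {f : X → Y} {U : Set X} (hU : IsOpen U)
    (hf : ContDiffOn ℝ ∞ f U) (v : X) : ContDiffOn ℝ ∞ (fun x => fderiv ℝ f x v) U :=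
  (hf.fderiv_of_isOpen hU (by simp)).clm_apply contDiffOn_const

theorem fderiv_iteratedFDeriv_apply {g : X → Y} {U : Set X} (hU : IsOpen U)
    (hg : ContDiffOn ℝ ∞ g U) {k : ℕ} {x : X} (hx : x ∈ U) (m : Fin (k + 1) → X) :
    fderiv ℝ (fun y => iteratedFDeriv ℝ k g y (Fin.tail m)) x (m 0) =
      iteratedFDeriv ℝ (k + 1) g x m := by
  have := ((contDiffOn_iteratedFDeriv hU hg k).contDiffAt (hU.mem_nhds hx)).differentiableAt
    (by simp)
  have := ((ContinuousMultilinearMap.apply ℝ (fun _ : Fin k => X) Y (Fin.tail m)).hasFDerivAt.comp x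
    this.hasFDerivAt).fderiv
  exact congrArg (fun T => T (m 0)) this

/-- A directional derivative commutes with higher derivatives. -/
theorem iteratedFDeriv_fderiv_apply {g : X → Y} {U : Set X} (hU : IsOpen U)
    (hg : ContDiffOn ℝ ∞ g U) (v : X) (k : ℕ) : ∀ {x : X}, x ∈ U → ∀ m : Fin k → X,
    iteratedFDeriv ℝ k (fun y => fderiv ℝ g y v) x m =
      fderiv ℝ (fun y => iteratedFDeriv ℝ k g y m) x v := by
  induction k with
  | zero => intro x _ m; simp
  | succ k ih =>
    intro x hx m
    have hG : ContDiffOn ℝ ∞ (fun z => iteratedFDeriv ℝ k g z (Fin.tail m)) U :=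
      (ContinuousMultilinearMap.apply ℝ (fun _ : Fin k => X) Y
        (Fin.tail m)).contDiff.comp_contDiffOn (contDiffOn_iteratedFDeriv hU hg k)
    rw [← fderiv_iteratedFDeriv_apply hU (contDiffOn_fderiv_apply hU hg v) hx]
    have e1 : (fun z => iteratedFDeriv ℝ k (fun y => fderiv ℝ g y v) z (Fin.tail m)) =ᶠ[𝓝 x]
        fun z => fderiv ℝ (fun y => iteratedFDeriv ℝ k g y (Fin.tail m)) z v := by
      filter_upwards [hU.mem_nhds hx] with z hz using ih hz _
    have e2 : (fun y => iteratedFDeriv ℝ (k + 1) g y m) =ᶠ[𝓝 x]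
        fun z => fderiv ℝ (fun y => iteratedFDeriv ℝ k g y (Fin.tail m)) z (m 0) := by
      filter_upwards [hU.mem_nhds hx] with z hz
      rw [← fderiv_iteratedFDeriv_apply hU hg hz]
    rw [e1.fderiv_eq, e2.fderiv_eq]
    have hG' := hG.contDiffAt (hU.mem_nhds hx)
    have hdd : DifferentiableAt ℝ (fderiv ℝ fun y => iteratedFDeriv ℝ k g y (Fin.tail m)) x :=
      (hG'.fderiv_right (m := ∞) (by simp)).differentiableAt (by simp)
    -- The only analytic input is the symmetry of the second derivative of the `k`-th partial
    -- derivative.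
    have hs : IsSymmSndFDerivAt ℝ (fun y => iteratedFDeriv ℝ k g y (Fin.tail m)) x :=
      hG'.isSymmSndFDerivAt (by
        rw [minSmoothness_of_isRCLikeNormedField]
        exact WithTop.coe_le_coe.2 (le_top : (2 : ℕ∞) ≤ ⊤))
    have key : ∀ w w' : X, fderiv ℝ (fun z => fderiv ℝ
        (fun y => iteratedFDeriv ℝ k g y (Fin.tail m)) z w) x w' =
        fderiv ℝ (fderiv ℝ fun y => iteratedFDeriv ℝ k g y (Fin.tail m)) x w' w := by
      intro w w'
      rw [fderiv_clm_apply hdd (differentiableAt_const w)]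
      simp
    rw [key, key]
    exact hs.eq _ _

end Calculus

/-! ## Jet coordinates and local operators -/

section LocOp

variable {n r s : ℕ} {F F' V V' W : Type*} [NormedAddCommGroup F] [NormedSpace ℝ F]
  [NormedAddCommGroup F'] [NormedSpace ℝ F']
  [NormedAddCommGroup V] [NormedSpace ℝ V] [NormedAddCommGroup V'] [NormedSpace ℝ V']
  [NormedAddCommGroup W] [NormedSpace ℝ W]
  {U : Set (EuclideanSpace ℝ (Fin n))}

local notation "𝔼" => EuclideanSpace ℝ (Fin n)

/-- Truncation of jets. -/
def jetTrunc (F : Type*) [NormedAddCommGroup F] [NormedSpace ℝ F] (h : r ≤ s) :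
    JetCoord n s F →L[ℝ] JetCoord n r F :=
  ContinuousLinearMap.pi fun k => ContinuousLinearMap.proj (R := ℝ)
    (φ := fun k : Fin (s + 1) => 𝔼 [×(k : ℕ)]→L[ℝ] F)
    (Fin.castLE (Nat.succ_le_succ h) k)

/-- The components of the jet of a directional derivative. -/
def jetShift (r : ℕ) (F : Type*) [NormedAddCommGroup F] [NormedSpace ℝ F]
    (v : 𝔼) : JetCoord n (r + 1) F →L[ℝ] JetCoord n r F :=
  ContinuousLinearMap.pi fun k =>
    (ContinuousLinearMap.flip ((continuousMultilinearCurryLeftEquiv ℝ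
        (fun _ : Fin ((k : ℕ) + 1) => 𝔼)
        F).toContinuousLinearEquiv.toContinuousLinearMap) v).comp
    (ContinuousLinearMap.proj (R := ℝ)
      (φ := fun k : Fin (r + 2) => 𝔼 [×(k : ℕ)]→L[ℝ] F) k.succ)

theorem jetTrunc_jetCoord (h : r ≤ s) (f : 𝔼 → F)
    (x : 𝔼) : jetTrunc F h (jetCoord s f x) = jetCoord r f x := rfl

theorem contDiffOn_jetCoord (hU : IsOpen U) {f : 𝔼 → F}
    (hf : ContDiffOn ℝ ∞ f U) (r : ℕ) : ContDiffOn ℝ ∞ (jetCoord r f) U :=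
  contDiffOn_pi.2 fun k => contDiffOn_iteratedFDeriv hU hf k

/-- The source of total derivatives: differentiating a jet along the base only reads off the
coordinates one order higher. -/
theorem fderiv_jetCoord (hU : IsOpen U) {f : 𝔼 → F}
    (hf : ContDiffOn ℝ ∞ f U) {x : 𝔼} (hx : x ∈ U)
    (v : 𝔼) :
    fderiv ℝ (jetCoord r f) x v = jetShift r F v (jetCoord (r + 1) f x) := by
  have hd : ∀ k : Fin (r + 1), DifferentiableAt ℝ (iteratedFDeriv ℝ (k : ℕ) f) x := fun k =>
    ((contDiffOn_iteratedFDeriv hU hf k).contDiffAt (hU.mem_nhds hx)).differentiableAt (by simp)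
  have := hasFDerivAt_pi.2 fun k => (hd k).hasFDerivAt
  have h2 := this.fderiv
  change fderiv ℝ (jetCoord r f) x = _ at h2
  rw [h2]
  funext k
  ext m
  rfl

theorem jetCoord_congr {f f' : 𝔼 → F} {x : 𝔼}
    (h : f =ᶠ[𝓝 x] f') (r : ℕ) : jetCoord r f x = jetCoord r f' x := by
  funext k
  exact (h.iteratedFDeriv ℝ _).eq_of_nhds

/-- `A` is a local operator over `U`: the value `A f x` is a smooth function of `x` and the
`r`-jet of `f` at `x`. -/
def IsLocOp (U : Set 𝔼) (r : ℕ)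
    (A : (𝔼 → F) → 𝔼 → V) : Prop :=
  ∃ L : 𝔼 × JetCoord n r F → V, ContDiffOn ℝ ∞ L (U ×ˢ univ) ∧
    ∀ f, ContDiffOn ℝ ∞ f U → ∀ x ∈ U, A f x = L (x, jetCoord r f x)

theorem contDiffOn_id_jetCoord (hU : IsOpen U) {f : 𝔼 → F}
    (hf : ContDiffOn ℝ ∞ f U) (r : ℕ) : ContDiffOn ℝ ∞ (fun x => (x, jetCoord r f x)) U :=
  contDiffOn_id.prodMk (contDiffOn_jetCoord hU hf r)

theorem contDiffOn_comp_jetCoord (hU : IsOpen U) {L : 𝔼 × JetCoord n r F → V}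
    (hL : ContDiffOn ℝ ∞ L (U ×ˢ univ)) {f : 𝔼 → F}
    (hf : ContDiffOn ℝ ∞ f U) : ContDiffOn ℝ ∞ (fun x => L (x, jetCoord r f x)) U :=
  hL.comp (contDiffOn_id_jetCoord hU hf r) fun _ hx => ⟨hx, mem_univ _⟩

theorem isLocOp_of_contDiffOn {L : 𝔼 × JetCoord n r F → V}
    (hL : ContDiffOn ℝ ∞ L (U ×ˢ univ)) : IsLocOp U r fun f x => L (x, jetCoord r f x) :=
  ⟨L, hL, fun _ _ _ _ => rfl⟩

theorem isLocOp_of_fun {h : 𝔼 → V} (hh : ContDiffOn ℝ ∞ h U) :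
    IsLocOp U r fun (_ : 𝔼 → F) x => h x :=
  ⟨fun z => h z.1, hh.comp contDiffOn_fst fun _ hz => hz.1, fun _ _ _ _ => rfl⟩

namespace IsLocOp

variable {A : (EuclideanSpace ℝ (Fin n) → F) → EuclideanSpace ℝ (Fin n) → V}
  {B : (EuclideanSpace ℝ (Fin n) → F) → EuclideanSpace ℝ (Fin n) → V'}

theorem contDiffOn (hA : IsLocOp U r A) (hU : IsOpen U) {f : 𝔼 → F}
    (hf : ContDiffOn ℝ ∞ f U) : ContDiffOn ℝ ∞ (A f) U := by
  obtain ⟨L, hL, h⟩ := hA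
  exact (contDiffOn_comp_jetCoord hU hL hf).congr fun x hx => h f hf x hx

theorem congr {A' : (𝔼 → F) → 𝔼 → V}
    (hA : IsLocOp U r A) (h : ∀ f, ContDiffOn ℝ ∞ f U → ∀ x ∈ U, A' f x = A f x) :
    IsLocOp U r A' := by
  obtain ⟨L, hL, h'⟩ := hA
  exact ⟨L, hL, fun f hf x hx => (h f hf x hx).trans (h' f hf x hx)⟩

theorem mono (hA : IsLocOp U r A) (hrs : r ≤ s) : IsLocOp U s A := by
  obtain ⟨L, hL, h⟩ := hA
  refine ⟨fun z => L (z.1, jetTrunc F hrs z.2), ?_, fun f hf x hx => h f hf x hx⟩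
  exact hL.comp (contDiffOn_fst.prodMk ((jetTrunc F hrs).contDiff.comp_contDiffOn contDiffOn_snd))
    fun z hz => ⟨hz.1, mem_univ _⟩

theorem map (hA : IsLocOp U r A) {g : 𝔼 × V → W}
    (hg : ContDiffOn ℝ ∞ g (U ×ˢ univ)) : IsLocOp U r fun f x => g (x, A f x) := by
  obtain ⟨L, hL, h⟩ := hA
  refine ⟨fun z => g (z.1, L z), hg.comp (contDiffOn_fst.prodMk hL)
    (fun z hz => ⟨hz.1, mem_univ _⟩), fun f hf x hx => by dsimp only; rw [h f hf x hx]⟩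

theorem map_contDiff (hA : IsLocOp U r A) {g : V → W} (hg : ContDiff ℝ ∞ g) :
    IsLocOp U r fun f x => g (A f x) :=
  hA.map (g := fun z => g z.2) (hg.comp_contDiffOn contDiffOn_snd)

theorem prodMk (hA : IsLocOp U r A) (hB : IsLocOp U r B) :
    IsLocOp U r fun f x => (A f x, B f x) := by
  obtain ⟨L, hL, h⟩ := hA
  obtain ⟨L', hL', h'⟩ := hB
  exact ⟨fun z => (L z, L' z), hL.prodMk hL',
    fun f hf x hx => by dsimp only; rw [h f hf x hx, h' f hf x hx]⟩

theorem add {A' : (𝔼 → F) → 𝔼 → V}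
    (hA : IsLocOp U r A) (hA' : IsLocOp U r A') : IsLocOp U r fun f x => A f x + A' f x :=
  (hA.prodMk hA').map_contDiff (g := fun z => z.1 + z.2) (contDiff_fst.add contDiff_snd)

theorem sub {A' : (𝔼 → F) → 𝔼 → V}
    (hA : IsLocOp U r A) (hA' : IsLocOp U r A') : IsLocOp U r fun f x => A f x - A' f x :=
  (hA.prodMk hA').map_contDiff (g := fun z => z.1 - z.2) (contDiff_fst.sub contDiff_snd)

theorem smul {A : (𝔼 → F) → 𝔼 → ℝ}
    (hA : IsLocOp U r A) (hB : IsLocOp U r B) : IsLocOp U r fun f x => A f x • B f x :=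
  (hA.prodMk hB).map_contDiff (g := fun z => z.1 • z.2) (contDiff_fst.smul contDiff_snd)

theorem clm (hA : IsLocOp U r A) (T : V →L[ℝ] W) : IsLocOp U r fun f x => T (A f x) :=
  hA.map_contDiff T.contDiff

theorem sum {ι : Type*} (t : Finset ι)
    {A : ι → (𝔼 → F) → 𝔼 → V}
    (hA : ∀ i ∈ t, IsLocOp U r (A i)) : IsLocOp U r fun f x => ∑ i ∈ t, A i f x := by
  classical
  induction t using Finset.induction_on with
  | empty => simpa using isLocOp_of_fun (contDiffOn_const (c := (0 : V)))
  | insert a t ha ih =>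
    simp only [Finset.sum_insert ha]
    exact (hA a (by simp)).add (ih fun i hi => hA i (by simp [hi]))

/-- The chain rule gives the total derivative `∂_v L + (∂L/∂u) (u shifted along v)`, a smooth
function of jets of order one more. -/
theorem fderiv (hA : IsLocOp U r A) (hU : IsOpen U) (v : 𝔼) :
    IsLocOp U (r + 1) fun f x => fderiv ℝ (A f) x v := by
  obtain ⟨L, hL, h⟩ := hA
  have hUo : IsOpen (U ×ˢ (univ : Set (JetCoord n r F))) := hU.prod isOpen_univ
  refine ⟨fun z => _root_.fderiv ℝ L (z.1, jetTrunc F (Nat.le_succ r) z.2)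
    (v, jetShift r F v z.2), ?_, fun f hf x hx => ?_⟩
  · refine ContDiffOn.clm_apply ?_ ?_
    · exact (hL.fderiv_of_isOpen hUo (by simp)).comp
        (contDiffOn_fst.prodMk ((jetTrunc F _).contDiff.comp_contDiffOn contDiffOn_snd))
        fun z hz => ⟨hz.1, mem_univ _⟩
    · exact contDiffOn_const.prodMk ((jetShift r F v).contDiff.comp_contDiffOn contDiffOn_snd)
  · have e : A f =ᶠ[𝓝 x] fun y => L (y, jetCoord r f y) := by
      filter_upwards [hU.mem_nhds hx] with y hy using h f hf y hy
    dsimp only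
    rw [e.fderiv_eq]
    have hL' : DifferentiableAt ℝ L (x, jetCoord r f x) :=
      (hL.contDiffAt (hUo.mem_nhds ⟨hx, mem_univ _⟩)).differentiableAt (by simp)
    have hj : DifferentiableAt ℝ (jetCoord r f) x :=
      ((contDiffOn_jetCoord hU hf r).contDiffAt (hU.mem_nhds hx)).differentiableAt (by simp)
    have := (hL'.hasFDerivAt.comp x ((hasFDerivAt_id x).prodMk hj.hasFDerivAt)).fderiv
    change _root_.fderiv ℝ (fun y => L (y, jetCoord r f y)) x = _ at this
    rw [this]
    simp only [ContinuousLinearMap.comp_apply, ContinuousLinearMap.prod_apply,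
      ContinuousLinearMap.id_apply, fderiv_jetCoord hU hf hx, jetTrunc_jetCoord]

theorem iteratedFDeriv_apply (hA : IsLocOp U r A) (hU : IsOpen U) (k : ℕ) :
    ∀ m : Fin k → 𝔼,
      IsLocOp U (r + k) fun f x => iteratedFDeriv ℝ k (A f) x m := by
  induction k with
  | zero => intro m; simpa using hA
  | succ k ih =>
    intro m
    refine ((ih (Fin.tail m)).fderiv hU (m 0)).congr fun f hf x hx => ?_
    exact (fderiv_iteratedFDeriv_apply hU (hA.contDiffOn hU hf) hx m).symm

/-- Precomposition with a linear map of the fibres. -/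
theorem comp_left (hA : IsLocOp U r A) (hU : IsOpen U) (T : F' →L[ℝ] F) :
    IsLocOp U r fun f x => A (fun y => T (f y)) x := by
  obtain ⟨L, hL, h⟩ := hA
  let S : JetCoord n r F' →L[ℝ] JetCoord n r F := ContinuousLinearMap.pi fun k =>
    (ContinuousLinearMap.compContinuousMultilinearMapL ℝ
      (fun _ : Fin (k : ℕ) => 𝔼) F' F T).comp (ContinuousLinearMap.proj k)
  refine ⟨fun z => L (z.1, S z.2), ?_, fun f hf x hx => ?_⟩
  · exact hL.comp (contDiffOn_fst.prodMk (S.contDiff.comp_contDiffOn contDiffOn_snd))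
      fun z hz => ⟨hz.1, mem_univ _⟩
  · dsimp only
    rw [h (fun y => T (f y)) (T.contDiff.comp_contDiffOn hf) x hx]
    congr 2
    funext k
    exact T.iteratedFDeriv_comp_left (hf.contDiffAt (hU.mem_nhds hx)) (by exact_mod_cast le_top)

end IsLocOp

theorem isLocOp_eval : IsLocOp U 0 fun (f : 𝔼 → F) x => f x := by
  refine ⟨fun z => z.2 0 0, ?_, fun f _ x _ => by simp [jetCoord]⟩
  refine ContDiff.contDiffOn ?_
  exact ((ContinuousMultilinearMap.apply ℝ (fun _ : Fin 0 => 𝔼) F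
    0).comp (ContinuousLinearMap.proj (R := ℝ)
      (φ := fun k : Fin 1 => 𝔼 [×(k : ℕ)]→L[ℝ] F) 0)).contDiff.comp
    contDiff_snd

/-- The differential of a function of jets along a fixed vertical jet. -/
theorem isLocOp_fderiv_vertical (hU : IsOpen U)
    {L : 𝔼 × JetCoord n r F → V} (hL : ContDiffOn ℝ ∞ L (U ×ˢ univ))
    (u : JetCoord n r F) : IsLocOp U r fun f x => fderiv ℝ L (x, jetCoord r f x) (0, u) :=
  isLocOp_of_contDiffOn (contDiffOn_fderiv_apply (hU.prod isOpen_univ) hL (0, u))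

/-- Each coefficient `∂L/∂u_I` has order `r` and is differentiated at most `r` times, hence the
order `r + r`. -/
theorem isLocOp_eulerExpr (hU : IsOpen U)
    {L : 𝔼 × JetCoord n r F → V} (hL : ContDiffOn ℝ ∞ L (U ×ˢ univ))
    (v : F) : IsLocOp U (r + r) fun f x => eulerExpr L f x v := by
  unfold eulerExpr
  refine IsLocOp.sum _ fun k _ => ?_
  have h : IsLocOp U (r + r) fun f x => ∑ i : Fin (k : ℕ) → Fin n,
    iteratedFDeriv ℝ (k : ℕ)
      (fun y => fderiv ℝ L (y, jetCoord r f y) (0, Pi.single k (elemTensor i v))) x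
      (fun l => EuclideanSpace.single (i l) (1 : ℝ)) := by
    refine IsLocOp.sum _ fun i _ => ?_
    exact ((isLocOp_fderiv_vertical hU hL _).iteratedFDeriv_apply hU _ _).mono (by omega)
  exact h.map_contDiff (contDiff_const_smul ((-1 : ℝ) ^ (k : ℕ)))

end LocOp

/-! ## Integration by parts -/

section FirstVariation

variable {n r : ℕ} {F V : Type*} [NormedAddCommGroup F] [NormedSpace ℝ F]
  [NormedAddCommGroup V] [NormedSpace ℝ V] {U : Set (EuclideanSpace ℝ (Fin n))}

local notation "𝔼" => EuclideanSpace ℝ (Fin n)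

/-- `(∂_I χ) C = (-1)^{|I|} χ ∂_I C` up to a divergence of local operators. -/
theorem exists_divergence (hU : IsOpen U) (k : ℕ) : ∀ (r : ℕ) (i : Fin k → Fin n)
    {C : (𝔼 → F × ℝ) → 𝔼 → V}, IsLocOp U r C →
    ∃ Q : Fin n → (𝔼 → F × ℝ) → 𝔼 → V,
      (∀ j, IsLocOp U (r + k) (Q j)) ∧
      (∀ j h x, (∀ᶠ y in 𝓝 x, (h y).2 = 0) → Q j h x = 0) ∧
      (∀ j h x, (∀ᶠ y in 𝓝 x, C h y = 0) → Q j h x = 0) ∧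
      ∀ h, ContDiffOn ℝ ∞ h U → ∀ x ∈ U,
        iteratedFDeriv ℝ k (fun y => (h y).2) x (fun l => EuclideanSpace.single (i l) (1 : ℝ)) •
            C h x =
          (-1 : ℝ) ^ k • (h x).2 •
            iteratedFDeriv ℝ k (C h) x (fun l => EuclideanSpace.single (i l) (1 : ℝ)) +
          ∑ j, fderiv ℝ (Q j h) x (EuclideanSpace.single j (1 : ℝ)) := by
  induction k with
  | zero =>
    intro r i C _
    refine ⟨fun _ _ _ => 0, fun _ => isLocOp_of_fun contDiffOn_const, fun _ _ _ _ => rfl,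
      fun _ _ _ _ => rfl, fun h _ x _ => by simp⟩
  | succ k ih =>
    intro r i C hC
    set m : Fin (k + 1) → 𝔼 :=
      fun l => EuclideanSpace.single (i l) (1 : ℝ) with hm
    -- One derivative is moved at a time: the induction hypothesis treats the remaining indices,
    -- with `∂_{i 0} C` in place of `C`.
    obtain ⟨Q, hQ, hQ0, hQC, hQe⟩ := ih (r + 1) (Fin.tail i) (hC.fderiv hU (m 0))
    have hsnd : IsLocOp U 0 fun (h : 𝔼 → F × ℝ) x => (h x).2 :=
      isLocOp_eval.clm (ContinuousLinearMap.snd ℝ F ℝ)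
    have hχ : IsLocOp U k fun (h : 𝔼 → F × ℝ) x =>
        iteratedFDeriv ℝ k (fun y => (h y).2) x (Fin.tail m) :=
      (hsnd.iteratedFDeriv_apply hU k (Fin.tail m)).mono (by omega)
    have hχC : IsLocOp U (r + (k + 1)) fun (h : 𝔼 → F × ℝ) x =>
        iteratedFDeriv ℝ k (fun y => (h y).2) x (Fin.tail m) • C h x :=
      (hχ.mono (by omega)).smul (hC.mono (by omega))
    have hQ' : ∀ j, IsLocOp U (r + (k + 1)) (Q j) := fun j => (hQ j).mono (by omega)
    -- By Leibniz, `(∂_{i 0} ∂_J χ) C = ∂_{i 0} ((∂_J χ) C) - (∂_J χ) ∂_{i 0} C` with `J` the tail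
    -- of `i`. The first term is a new flux in the direction `i 0`; the second is covered by
    -- induction, hence the sign of `Q`.
    refine ⟨fun j h x => (if j = i 0 then
      iteratedFDeriv ℝ k (fun y => (h y).2) x (Fin.tail m) • C h x else 0) - Q j h x,
      fun j => IsLocOp.sub ?_ (hQ' j), fun j h x h0 => ?_, fun j h x h0 => ?_, fun h hh x hx => ?_⟩
    · split_ifs
      · exact hχC
      · exact isLocOp_of_fun contDiffOn_const
    · have e : (fun y => (h y).2) =ᶠ[𝓝 x] fun _ => 0 := h0
      have e' := (e.iteratedFDeriv ℝ k).eq_of_nhds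
      dsimp only
      rw [e', hQ0 j h x h0]
      cases k with
      | zero => simp
      | succ k => simp
    · have e : C h =ᶠ[𝓝 x] fun _ => 0 := h0
      have e' : ∀ᶠ y in 𝓝 x, fderiv ℝ (C h) y (m 0) = 0 := by
        filter_upwards [eventually_eventually_nhds.2 h0] with y hy
        have : C h =ᶠ[𝓝 y] fun _ => 0 := hy
        rw [this.fderiv_eq]
        simp
      dsimp only
      rw [e.eq_of_nhds, hQC j h x e']
      simp
    · have hd : ∀ {A : (𝔼 → F × ℝ) → 𝔼 → V} {s : ℕ},
          IsLocOp U s A → DifferentiableAt ℝ (A h) x := fun hA =>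
        ((hA.contDiffOn hU hh).contDiffAt (hU.mem_nhds hx)).differentiableAt (by simp)
      have hdχ : DifferentiableAt ℝ
          (fun x => iteratedFDeriv ℝ k (fun y => (h y).2) x (Fin.tail m)) x :=
        ((hχ.contDiffOn hU hh).contDiffAt (hU.mem_nhds hx)).differentiableAt (by simp)
      have e1 : ∀ j, fderiv ℝ (fun x => (if j = i 0 then
          iteratedFDeriv ℝ k (fun y => (h y).2) x (Fin.tail m) • C h x else 0) - Q j h x) x
            (EuclideanSpace.single j 1) =
          (if j = i 0 then fderiv ℝ (fun x => iteratedFDeriv ℝ k (fun y => (h y).2) x (Fin.tail m)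
            • C h x) x (m 0) else 0) - fderiv ℝ (Q j h) x (EuclideanSpace.single j 1) := by
        intro j
        split_ifs with hj
        · rw [fderiv_fun_sub (hd hχC) (hd (hQ j)), hj]
          rfl
        · rw [fderiv_fun_sub (differentiableAt_const _) (hd (hQ j))]
          simp
      simp only [e1, Finset.sum_sub_distrib, Finset.sum_ite_eq', Finset.mem_univ, if_true]
      rw [fderiv_fun_smul hdχ (hd hC)]
      have e2 := hQe h hh x hx
      change iteratedFDeriv ℝ k (fun y => (h y).2) x (Fin.tail m) • fderiv ℝ (C h) x (m 0) =
        (-1 : ℝ) ^ k • (h x).2 • iteratedFDeriv ℝ k (fun y => fderiv ℝ (C h) y (m 0)) x (Fin.tail m)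
          + _ at e2
      -- The derivatives of `C` arrive with `i 0` innermost and have to be brought back into the
      -- order of `i`.
      rw [iteratedFDeriv_fderiv_apply hU (hC.contDiffOn hU hh) _ _ hx,
        fderiv_iteratedFDeriv_apply hU (hC.contDiffOn hU hh) hx] at e2
      rw [← fderiv_iteratedFDeriv_apply hU (hsnd.contDiffOn hU hh) hx m]
      simp only [_root_.add_apply, _root_.smul_apply,
        ContinuousLinearMap.smulRight_apply]
      rw [e2, pow_succ]
      module

/-- Multilinear expansion in the standard basis. It is responsible for sums over all index
sequences, rather than over symmetric multi-indices, in `eulerExpr`. -/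
theorem smulRight_eq_sum_elemTensor {k : ℕ} (T : 𝔼 [×k]→L[ℝ] ℝ) (v : F) :
    T.smulRight v = ∑ i : Fin k → Fin n,
      T (fun l => EuclideanSpace.single (i l) (1 : ℝ)) • elemTensor i v := by
  ext m
  have hm : m = fun l => ∑ a, m l a • EuclideanSpace.single a (1 : ℝ) := by
    funext l
    conv_lhs => rw [← (EuclideanSpace.basisFun (Fin n) ℝ).sum_repr (m l)]
    simp
  have : T m = ∑ i : Fin k → Fin n, (∏ l, m l (i l)) •
      T (fun l => EuclideanSpace.single (i l) (1 : ℝ)) := by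
    conv_lhs => rw [hm]
    rw [ContinuousMultilinearMap.map_sum]
    exact Finset.sum_congr rfl fun i _ => T.map_smul_univ _ _
  simp only [ContinuousMultilinearMap.smulRight_apply, this, _root_.sum_apply,
    _root_.smul_apply, Finset.sum_smul]
  refine Finset.sum_congr rfl fun i _ => ?_
  simp only [elemTensor, ContinuousMultilinearMap.smulRight_apply,
    ContinuousMultilinearMap.compContinuousLinearMap_apply,
    ContinuousMultilinearMap.mkPiAlgebra_apply, smul_smul, smul_eq_mul]
  rw [mul_comm]
  rfl

theorem jetCoord_smul_const (hU : IsOpen U) {χ : 𝔼 → ℝ}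
    (hχ : ContDiffOn ℝ ∞ χ U) (v : F) {x : 𝔼} (hx : x ∈ U) :
    jetCoord r (fun y => χ y • v) x = ∑ k : Fin (r + 1), ∑ i : Fin (k : ℕ) → Fin n,
      iteratedFDeriv ℝ (k : ℕ) χ x (fun l => EuclideanSpace.single (i l) (1 : ℝ)) •
        Pi.single k (elemTensor i v) := by
  have h1 : jetCoord r (fun y => χ y • v) x =
      ∑ k : Fin (r + 1), Pi.single k ((iteratedFDeriv ℝ (k : ℕ) χ x).smulRight v) := by
    rw [Finset.univ_sum_single]
    funext k
    exact ((ContinuousLinearMap.id ℝ ℝ).smulRight v).iteratedFDeriv_comp_left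
      (hχ.contDiffAt (hU.mem_nhds hx)) (by exact_mod_cast le_top)
  rw [h1]
  refine Finset.sum_congr rfl fun k _ => ?_
  rw [smulRight_eq_sum_elemTensor]
  simp only [← Pi.single_smul]
  exact map_sum (AddMonoidHom.single
    (fun k : Fin (r + 1) => 𝔼 [×(k : ℕ)]→L[ℝ] F) k) _ _

/-- The first variation formula: the differential of `L` in the direction of the jet of `χ v` is
`χ E_v(L)` up to a divergence. -/
theorem exists_firstVariation (hU : IsOpen U)
    {L : 𝔼 × JetCoord n r F → V} (hL : ContDiffOn ℝ ∞ L (U ×ˢ univ))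
    (v : F) :
    ∃ P : Fin n → (𝔼 → F × ℝ) → 𝔼 → V,
      (∀ j, IsLocOp U (r + r) (P j)) ∧
      (∀ j h x, (∀ᶠ y in 𝓝 x, (h y).2 = 0) → P j h x = 0) ∧
      (∀ j h x, (∀ᶠ y in 𝓝 x, ∀ u, L (y, u) = 0) → P j h x = 0) ∧
      ∀ h, ContDiffOn ℝ ∞ h U → ∀ x ∈ U,
        fderiv ℝ L (x, jetCoord r (fun y => (h y).1) x) (0, jetCoord r (fun y => (h y).2 • v) x) =
          (h x).2 • eulerExpr L (fun y => (h y).1) x v +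
            ∑ j, fderiv ℝ (P j h) x (EuclideanSpace.single j (1 : ℝ)) := by
  have hC : ∀ (k : Fin (r + 1)) (i : Fin (k : ℕ) → Fin n), IsLocOp U r
      fun (h : 𝔼 → F × ℝ) x =>
        fderiv ℝ L (x, jetCoord r (fun y => (h y).1) x) (0, Pi.single k (elemTensor i v)) :=
    fun k i => (isLocOp_fderiv_vertical hU hL _).comp_left hU (ContinuousLinearMap.fst ℝ F ℝ)
  -- One integration by parts for each index sequence `i`, with `C` the partial derivative of `L` in
  -- the direction `elemTensor i v`.
  choose Q hQ hQ0 hQC hQe using fun (k : Fin (r + 1)) (i : Fin (k : ℕ) → Fin n) =>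
    exists_divergence hU (k : ℕ) r i (hC k i)
  refine ⟨fun j h x => ∑ k, ∑ i, Q k i j h x, fun j => ?_, fun j h x h0 => ?_, fun j h x h0 => ?_,
    fun h hh x hx => ?_⟩
  · exact IsLocOp.sum _ fun k _ => IsLocOp.sum _ fun i _ => (hQ k i j).mono (by omega)
  · exact Finset.sum_eq_zero fun k _ => Finset.sum_eq_zero fun i _ => hQ0 k i j h x h0
  · refine Finset.sum_eq_zero fun k _ => Finset.sum_eq_zero fun i _ => hQC k i j h x ?_
    filter_upwards [eventually_eventually_nhds.2 h0] with y hy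
    have : L =ᶠ[𝓝 (y, jetCoord r (fun y => (h y).1) y)] fun _ => 0 :=
      ((continuous_fst.tendsto (y, jetCoord r (fun y => (h y).1) y)).eventually hy).mono
        fun z hz => hz z.2
    rw [this.fderiv_eq]
    simp
  · have hχ : ContDiffOn ℝ ∞ (fun y => (h y).2) U := contDiff_snd.comp_contDiffOn hh
    rw [jetCoord_smul_const hU hχ v hx]
    have hd : ∀ k i j, DifferentiableAt ℝ (Q k i j h) x := fun k i j =>
      (((hQ k i j).contDiffOn hU hh).contDiffAt (hU.mem_nhds hx)).differentiableAt (by simp)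
    have e1 : ∀ j, fderiv ℝ (fun x => ∑ k, ∑ i, Q k i j h x) x (EuclideanSpace.single j (1 : ℝ)) =
        ∑ k, ∑ i, fderiv ℝ (Q k i j h) x (EuclideanSpace.single j (1 : ℝ)) := by
      intro j
      rw [fderiv_fun_sum fun k _ => DifferentiableAt.fun_sum fun i _ => hd k i j]
      simp only [_root_.sum_apply]
      refine Finset.sum_congr rfl fun k _ => ?_
      rw [fderiv_fun_sum fun i _ => hd k i j, _root_.sum_apply]
    simp only [e1]
    rw [Finset.sum_comm]
    simp only [Finset.sum_comm (s := (Finset.univ : Finset (Fin n)))]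
    have e2 : ∀ (t : JetCoord n r F), ((0 : 𝔼), t) =
        ContinuousLinearMap.inr ℝ _ _ t := fun t => rfl
    simp only [e2, map_sum, map_smul]
    unfold eulerExpr
    rw [Finset.smul_sum, ← Finset.sum_add_distrib]
    refine Finset.sum_congr rfl fun k _ => ?_
    rw [Finset.smul_sum, Finset.smul_sum, ← Finset.sum_add_distrib]
    refine Finset.sum_congr rfl fun i _ => ?_
    rw [smul_comm]
    exact hQe k i h hh x hx

end FirstVariation

/-! ## Integrals -/

section Integrals

variable {X : Type*} [NormedAddCommGroup X] [NormedSpace ℝ X] [FiniteDimensional ℝ X]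
  [MeasurableSpace X] [BorelSpace X] {W : Type*} [NormedAddCommGroup W] [NormedSpace ℝ W]

/-- Integration by parts against the constant function `1`. -/
theorem integral_fderiv_apply_eq_zero (μ : Measure X) [μ.IsAddHaarMeasure] {g : X → W}
    (hg : ContDiff ℝ 1 g) (hc : HasCompactSupport g) (v : X) : ∫ x, fderiv ℝ g x v ∂μ = 0 := by
  have h1 : Continuous fun x => fderiv ℝ g x v := (hg.continuous_fderiv (by simp)).clm_apply
    continuous_const
  have h2 : HasCompactSupport fun x => fderiv ℝ g x v := hc.fderiv_apply ℝ v
  have := integral_smul_fderiv_eq_neg_fderiv_smul_of_integrable (𝕜 := ℝ) (μ := μ) (v := v)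
    (f := fun _ : X => (1 : ℝ)) (g := g) (by simp)
    (by simpa using h1.integrable_of_hasCompactSupport h2)
    (by simpa using hg.continuous.integrable_of_hasCompactSupport hc)
    (fun _ _ => differentiableAt_const _) (fun _ _ => hg.differentiable (by simp) _)
  simpa using this

variable {G : Type*} [TopologicalSpace G] [MeasurableSpace G] [OpensMeasurableSpace G]
  {Z : Type*} [NormedAddCommGroup Z] [NormedSpace ℝ Z] [FiniteDimensional ℝ Z]

/-- Dominated differentiation: the derivative is bounded on the compact product of `K` with a small
closed ball, and a constant bound is integrable over `K`. -/
theorem hasFDerivAt_setIntegral {μ : Measure G} [IsFiniteMeasureOnCompacts μ] {K : Set G}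
    (hK : IsCompact K) (hKm : MeasurableSet K) {H : G → Z → W} {H' : G → Z → Z →L[ℝ] W}
    {U : Set Z} (hU : IsOpen U) (hH : ∀ z ∈ U, ContinuousOn (fun g => H g z) K)
    (hH' : ContinuousOn (fun p : G × Z => H' p.1 p.2) (K ×ˢ U))
    (hd : ∀ g ∈ K, ∀ z ∈ U, HasFDerivAt (H g) (H' g z) z) {z : Z} (hz : z ∈ U) :
    HasFDerivAt (fun z => ∫ g in K, H g z ∂μ) (∫ g in K, H' g z ∂μ) z := by
  obtain ⟨ε, hε, hεU⟩ := Metric.nhds_basis_closedBall.mem_iff.1 (hU.mem_nhds hz)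
  obtain ⟨C, hC⟩ := (hK.prod (isCompact_closedBall z ε)).exists_bound_of_continuousOn
    (hH'.mono (prod_mono subset_rfl hεU))
  have hsec : ∀ z ∈ U, ContinuousOn (fun g => H' g z) K := fun z hz =>
    hH'.comp (continuousOn_id.prodMk continuousOn_const) fun g hg => ⟨hg, hz⟩
  refine hasFDerivAt_integral_of_dominated_of_fderiv_le (bound := fun _ => C)
    (F' := fun z g => H' g z) (Metric.ball_mem_nhds z hε) ?_ ?_ ?_ ?_ ?_ ?_
  · filter_upwards [hU.mem_nhds hz] with z' hz'
    exact (hH z' hz').aestronglyMeasurable_of_isCompact hK hKm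
  · exact (hH z hz).integrableOn_compact' hK hKm
  · exact (hsec z hz).aestronglyMeasurable_of_isCompact hK hKm
  · filter_upwards [ae_restrict_mem hKm] with g hg z' hz'
    exact hC (g, z') ⟨hg, Metric.ball_subset_closedBall hz'⟩
  · exact integrableOn_const hK.measure_lt_top.ne
  · filter_upwards [ae_restrict_mem hKm] with g hg z' hz'
    exact hd g hg z' (hεU (Metric.ball_subset_closedBall hz'))

theorem setIntegral_clm_apply {μ : Measure G} [IsFiniteMeasureOnCompacts μ] {K : Set G}
    (hK : IsCompact K) (hKm : MeasurableSet K) {φ : G → Z →L[ℝ] W} (hφ : ContinuousOn φ K) (v : Z) :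
    IntegrableOn (fun g => φ g v) K μ ∧ (∫ g in K, φ g ∂μ) v = ∫ g in K, φ g v ∂μ :=
  have h : IntegrableOn φ K μ := hφ.integrableOn_compact' hK hKm
  ⟨h.apply_continuousLinearMap v, ContinuousLinearMap.integral_apply h v⟩

set_option synthInstance.maxHeartbeats 200000 in
/-- Integrals over compact parameter spaces of smooth functions are smooth. -/
theorem contDiffOn_setIntegral [CompleteSpace W] {μ : Measure G} [IsFiniteMeasureOnCompacts μ]
    {K : Set G} (hK : IsCompact K) (hKm : MeasurableSet K) {H : G → Z → W}
    {U : Set Z} (hU : IsOpen U) (hs : ∀ g ∈ K, ContDiffOn ℝ ∞ (H g) U)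
    (hc : ∀ k : ℕ, ContinuousOn (fun p : G × Z => iteratedFDeriv ℝ k (H p.1) p.2) (K ×ˢ U)) :
    ContDiffOn ℝ ∞ (fun z => ∫ g in K, H g z ∂μ) U := by
  have hsec : ∀ k, ∀ z ∈ U, ContinuousOn (fun g => iteratedFDeriv ℝ k (H g) z) K := fun k z hz =>
    (hc k).comp (continuousOn_id.prodMk continuousOn_const) fun g hg => ⟨hg, hz⟩
  have hint : ∀ k, ∀ z ∈ U, IntegrableOn (fun g => iteratedFDeriv ℝ k (H g) z) K μ :=
    fun k z hz => (hsec k z hz).integrableOn_compact' hK hKm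
  have hcont : ∀ k, ContinuousOn (fun p : G × Z => fderiv ℝ (iteratedFDeriv ℝ k (H p.1)) p.2)
      (K ×ˢ U) := by
    intro k
    have e : (fun p : G × Z => fderiv ℝ (iteratedFDeriv ℝ k (H p.1)) p.2) = fun p =>
        continuousMultilinearCurryLeftEquiv ℝ (fun _ : Fin (k + 1) => Z) W
          (iteratedFDeriv ℝ (k + 1) (H p.1) p.2) := by
      funext p
      rw [fderiv_iteratedFDeriv]
      rfl
    rw [e]
    exact (LinearIsometryEquiv.continuous _).comp_continuousOn (hc (k + 1))
  have hder : ∀ k, ∀ z ∈ U, HasFDerivAt (fun z => ∫ g in K, iteratedFDeriv ℝ k (H g) z ∂μ)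
      (∫ g in K, fderiv ℝ (iteratedFDeriv ℝ k (H g)) z ∂μ) z := by
    intro k z hz
    refine hasFDerivAt_setIntegral hK hKm hU (hsec k) (hcont k) (fun g hg z hz => ?_) hz
    exact (((contDiffOn_iteratedFDeriv hU (hs g hg) k).contDiffAt
      (hU.mem_nhds hz)).differentiableAt (by simp)).hasFDerivAt
  -- The integrals of all iterated derivatives form a Taylor series of the integral, because `hder`
  -- differentiates each of them under the integral.
  have hT : HasFTaylorSeriesUpToOn ∞ (fun z => ∫ g in K, H g z ∂μ)
      (fun z k => ∫ g in K, iteratedFDeriv ℝ k (H g) z ∂μ) U := by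
    refine ⟨fun z hz => ?_, fun k _ z hz => ?_, fun k _ => ?_⟩
    · have := (ContinuousMultilinearMap.apply ℝ (fun _ : Fin 0 => Z) W 0).integral_comp_comm
        (hint 0 z hz)
      change (ContinuousMultilinearMap.apply ℝ (fun _ : Fin 0 => Z) W 0)
        (∫ g in K, iteratedFDeriv ℝ 0 (H g) z ∂μ) = _
      rw [← this]
      simp
    · have h := (hder k z hz).hasFDerivWithinAt (s := U)
      convert h using 1
      have hc' : ContinuousOn (fun g => fderiv ℝ (iteratedFDeriv ℝ k (H g)) z) K :=
        (hcont k).comp (continuousOn_id.prodMk continuousOn_const) fun g hg => ⟨hg, hz⟩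
      ext v m
      change (∫ g in K, iteratedFDeriv ℝ (k + 1) (H g) z ∂μ) (Fin.cons v m) = _
      obtain ⟨h1, h2⟩ := setIntegral_clm_apply (μ := μ) hK hKm hc' v
      rw [ContinuousMultilinearMap.integral_apply (hint (k + 1) z hz), h2,
        ContinuousMultilinearMap.integral_apply h1]
      rfl
    · exact fun z hz => (hder k z hz).continuousAt.continuousWithinAt
  exact hT.contDiffOn

end Integrals

/-! ## Prolongation of smooth maps to jets -/

section Prolongation

variable {X Y Z : Type*} [NormedAddCommGroup X] [NormedSpace ℝ X] [NormedAddCommGroup Y]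
  [NormedSpace ℝ Y] [NormedAddCommGroup Z] [NormedSpace ℝ Z]

theorem natCast_le_infty (k : ℕ) : (k : ℕ∞ω) ≤ (∞ : ℕ∞ω) := by exact_mod_cast le_top

/-- A summand of the Faà di Bruno formula is linear in the outer derivative and multilinear in the
inner ones, so it is smooth in all of them. -/
theorem contDiff_compAlongOrderedFinpartition [CompleteSpace Z] {k : ℕ} (c : OrderedFinpartition k) :
    ContDiff ℝ ∞ (fun p : (Y [×c.length]→L[ℝ] Z) × (∀ i, X [×c.partSize i]→L[ℝ] Y) =>
      c.compAlongOrderedFinpartition p.1 p.2) := by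
  have h := (c.compAlongOrderedFinpartitionL ℝ X Y Z).analyticOnNhd_uncurry_of_multilinear
    (s := univ)
  exact contDiff_iff_contDiffAt.2 fun p => (h p (mem_univ p)).contDiffAt

/-- Higher partial derivatives as higher derivatives. -/
theorem iteratedFDeriv_partial {Ψ : X × Y → Z} {O : Set (X × Y)} (hO : IsOpen O)
    (hΨ : ContDiffOn ℝ ∞ Ψ O) (k : ℕ) : ∀ {x : X} {y : Y}, (x, y) ∈ O → ∀ m : Fin k → Y,
    iteratedFDeriv ℝ k (fun y => Ψ (x, y)) y m =
      iteratedFDeriv ℝ k Ψ (x, y) (fun i => (0, m i)) := by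
  induction k with
  | zero => intro x y _ m; simp
  | succ k ih =>
    intro x y hxy m
    have hsec : IsOpen {y' | (x, y') ∈ O} := hO.preimage (Continuous.prodMk_right x)
    have hΨx : ContDiffOn ℝ ∞ (fun y => Ψ (x, y)) {y' | (x, y') ∈ O} :=
      hΨ.comp (contDiff_prodMk_right x).contDiffOn fun _ h => h
    rw [← fderiv_iteratedFDeriv_apply hsec hΨx hxy m]
    have e : (fun y' => iteratedFDeriv ℝ k (fun y => Ψ (x, y)) y' (Fin.tail m)) =ᶠ[𝓝 y]
        fun y' => iteratedFDeriv ℝ k Ψ (x, y') (fun i => (0, Fin.tail m i)) := by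
      filter_upwards [hsec.mem_nhds hxy] with y' hy' using ih hy' _
    rw [e.fderiv_eq]
    have hd : DifferentiableAt ℝ
        (fun p => iteratedFDeriv ℝ k Ψ p (fun i => ((0 : X), Fin.tail m i))) (x, y) :=
      (ContinuousMultilinearMap.apply ℝ (fun _ : Fin k => X × Y) Z
        _).differentiableAt.comp _ (((contDiffOn_iteratedFDeriv hO hΨ k).contDiffAt
          (hO.mem_nhds hxy)).differentiableAt (by simp))
    have := (hd.hasFDerivAt.comp y (hasFDerivAt_prodMk_right x y)).fderiv
    refine (congrArg (fun T => T (m 0)) this).trans ?_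
    exact fderiv_iteratedFDeriv_apply hO hΨ hxy fun i => ((0 : X), m i)

theorem contDiffOn_iteratedFDeriv_partial {Ψ : X × Y → Z} {O : Set (X × Y)} (hO : IsOpen O)
    (hΨ : ContDiffOn ℝ ∞ Ψ O) (k : ℕ) :
    ContDiffOn ℝ ∞ (fun p : X × Y => iteratedFDeriv ℝ k (fun y => Ψ (p.1, y)) p.2) O := by
  refine ((ContinuousMultilinearMap.compContinuousLinearMapL (𝕜 := ℝ) (F := Z)
    (fun _ : Fin k => ContinuousLinearMap.inr ℝ X Y)).contDiff.comp_contDiffOn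
      (contDiffOn_iteratedFDeriv hO hΨ k)).congr fun p hp => ?_
  ext m
  exact iteratedFDeriv_partial hO hΨ k hp m

/-- Higher partial derivatives commute with the derivative with respect to a real parameter. -/
theorem hasDerivAt_iteratedFDeriv_param {f : ℝ × Y → Z} {O : Set (ℝ × Y)} (hO : IsOpen O)
    (hf : ContDiffOn ℝ ∞ f O) (k : ℕ) {t : ℝ} {y : Y} (h : (t, y) ∈ O) :
    HasDerivAt (fun t => iteratedFDeriv ℝ k (fun y => f (t, y)) y)
      (iteratedFDeriv ℝ k (fun y => fderiv ℝ f (t, y) (1, 0)) y) t := by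
  have hd : DifferentiableAt ℝ (fun p : ℝ × Y => iteratedFDeriv ℝ k (fun y => f (p.1, y)) p.2)
      (t, y) := ((contDiffOn_iteratedFDeriv_partial hO hf k).contDiffAt
        (hO.mem_nhds h)).differentiableAt (by simp)
  have h1 := hd.hasFDerivAt.comp_hasDerivAt t ((hasDerivAt_id t).prodMk (hasDerivAt_const t y))
  suffices he : iteratedFDeriv ℝ k (fun y => fderiv ℝ f (t, y) (1, 0)) y =
      fderiv ℝ (fun p : ℝ × Y => iteratedFDeriv ℝ k (fun y => f (p.1, y)) p.2) (t, y) (1, 0) by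
    rw [he]
    exact h1
  ext m
  have hf' := contDiffOn_fderiv_apply hO hf (1, (0 : Y))
  rw [iteratedFDeriv_partial hO hf' k h m, iteratedFDeriv_fderiv_apply hO hf _ _ h]
  have e : (fun p : ℝ × Y => iteratedFDeriv ℝ k f p (fun i => ((0 : ℝ), m i))) =ᶠ[𝓝 (t, y)]
      fun p => iteratedFDeriv ℝ k (fun y => f (p.1, y)) p.2 m := by
    filter_upwards [hO.mem_nhds h] with p hp using (iteratedFDeriv_partial hO hf k hp m).symm
  rw [e.fderiv_eq]
  have := ((ContinuousMultilinearMap.apply ℝ (fun _ : Fin k => Y) Z m).hasFDerivAt.comp (t, y)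
    hd.hasFDerivAt).fderiv
  exact congrArg (fun T => T ((1 : ℝ), (0 : Y))) this

variable {n r : ℕ} {F F' : Type*} [NormedAddCommGroup F] [NormedSpace ℝ F]
  [NormedAddCommGroup F'] [NormedSpace ℝ F']

local notation "𝔼" => EuclideanSpace ℝ (Fin n)

theorem hasDerivAt_jetCoord_param {f : ℝ × 𝔼 → F}
    {O : Set (ℝ × 𝔼)} (hO : IsOpen O) (hf : ContDiffOn ℝ ∞ f O) {t : ℝ}
    {x : 𝔼} (h : (t, x) ∈ O) :
    HasDerivAt (fun t => jetCoord r (fun y => f (t, y)) x)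
      (jetCoord r (fun y => fderiv ℝ f (t, y) (1, 0)) x) t :=
  hasDerivAt_pi.2 fun k => hasDerivAt_iteratedFDeriv_param hO hf k h

/-- The action of a fibre-preserving map `(x, v) ↦ (x, Ψ (x, v))` on jets. -/
def prolong (r : ℕ) (Ψ : 𝔼 × F → F')
    (z : 𝔼 × JetCoord n r F) : JetCoord n r F' := fun k =>
  -- The Faà di Bruno formula for `y ↦ Ψ (y, f y)`. The inner map is `y ↦ (y, f y)`, so `id`
  -- supplies the base component of its derivatives, and `z.2 0 0` is the value of `f`.
  ∑ c : OrderedFinpartition (k : ℕ), c.compAlongOrderedFinpartition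
    (iteratedFDeriv ℝ c.length Ψ (z.1, z.2 0 0))
    (fun m => (iteratedFDeriv ℝ (c.partSize m) id z.1).prod
      (z.2 ⟨c.partSize m, (c.partSize_le m).trans_lt k.2⟩))

theorem jetCoord_prolong {Ψ : 𝔼 × F → F'} {f : 𝔼 → F}
    {x : 𝔼} (hΨ : ContDiffAt ℝ ∞ Ψ (x, f x)) (hf : ContDiffAt ℝ ∞ f x) :
    jetCoord r (fun y => Ψ (y, f y)) x = prolong r Ψ (x, jetCoord r f x) := by
  funext k
  refine (iteratedFDeriv_comp (g := Ψ) (f := fun y => (y, f y)) hΨ (contDiffAt_id.prodMk hf)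
    (natCast_le_infty k)).trans ?_
  refine Finset.sum_congr rfl fun c _ => ?_
  have h0 : jetCoord r f x 0 0 = f x := rfl
  dsimp only
  rw [h0]
  refine congrArg (c.compAlongOrderedFinpartition _) (funext fun m => ?_)
  exact iteratedFDeriv_prodMk contDiffAt_id hf (natCast_le_infty _)

/-- The parameter in `X` will be a coordinate on the group, so that prolonged actions are smooth
jointly in the group element and the jet. -/
theorem contDiffOn_prolong [CompleteSpace F'] {Ψ : X × (𝔼 × F) → F'}
    {O : Set X} {U : Set 𝔼} (hO : IsOpen O) (hU : IsOpen U)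
    (hΨ : ContDiffOn ℝ ∞ Ψ (O ×ˢ (U ×ˢ univ))) :
    ContDiffOn ℝ ∞ (fun p : X × (𝔼 × JetCoord n r F) =>
      prolong r (fun z => Ψ (p.1, z)) p.2) (O ×ˢ (U ×ˢ univ)) := by
  refine contDiffOn_pi.2 fun k => ?_
  refine ContDiffOn.sum fun c _ => ?_
  refine (contDiff_compAlongOrderedFinpartition c).comp_contDiffOn (ContDiffOn.prodMk ?_ ?_)
  · refine (contDiffOn_iteratedFDeriv_partial (hO.prod (hU.prod isOpen_univ)) hΨ c.length).comp
      (f := fun p : X × (𝔼 × JetCoord n r F) => (p.1, (p.2.1, p.2.2 0 0)))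
      (ContDiff.contDiffOn ?_) fun p hp => ⟨hp.1, hp.2.1, mem_univ _⟩
    refine contDiff_fst.prodMk ((contDiff_fst.comp contDiff_snd).prodMk ?_)
    exact ((ContinuousMultilinearMap.apply ℝ (fun _ : Fin 0 => 𝔼) F
      0).comp (ContinuousLinearMap.proj (R := ℝ)
      (φ := fun k : Fin (r + 1) => 𝔼 [×(k : ℕ)]→L[ℝ] F) 0)).contDiff.comp
      (contDiff_snd.comp contDiff_snd)
  · refine contDiffOn_pi.2 fun m => ContDiff.contDiffOn ?_
    have h1 : ContDiff ℝ ∞ fun p : X × (𝔼 × JetCoord n r F) =>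
        iteratedFDeriv ℝ (c.partSize m) (id : 𝔼 → _) p.2.1 :=
      (contDiff_id.iteratedFDeriv_right (m := ∞) (n := ∞) (by exact_mod_cast le_top)).comp
        (contDiff_fst.comp contDiff_snd)
    have h2 : ContDiff ℝ ∞ fun p : X × (𝔼 × JetCoord n r F) =>
        p.2.2 ⟨c.partSize m, (c.partSize_le m).trans_lt k.2⟩ :=
      (ContinuousLinearMap.proj (R := ℝ)
        (φ := fun k : Fin (r + 1) => 𝔼 [×(k : ℕ)]→L[ℝ] F)
        ⟨c.partSize m, (c.partSize_le m).trans_lt k.2⟩).contDiff.comp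
        (contDiff_snd.comp contDiff_snd)
    exact (ContinuousMultilinearMap.prodL ℝ (fun _ : Fin (c.partSize m) =>
      𝔼) 𝔼 F).contDiff.comp (h1.prodMk h2)

/-- The action of a change of the base coordinates on jets. -/
def jetPullback (r : ℕ) (κ : 𝔼 → 𝔼)
    (z : 𝔼 × JetCoord n r F) : JetCoord n r F := fun k =>
  ∑ c : OrderedFinpartition (k : ℕ), c.compAlongOrderedFinpartition
    (z.2 ⟨c.length, c.length_le.trans_lt k.2⟩) (fun m => iteratedFDeriv ℝ (c.partSize m) κ z.1)

theorem jetCoord_comp {κ : 𝔼 → 𝔼}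
    {f : 𝔼 → F} {x : 𝔼}
    (hf : ContDiffAt ℝ ∞ f (κ x)) (hκ : ContDiffAt ℝ ∞ κ x) :
    jetCoord r (fun y => f (κ y)) x = jetPullback r κ (x, jetCoord r f (κ x)) := by
  funext k
  exact iteratedFDeriv_comp (g := f) (f := κ) hf hκ (natCast_le_infty k)

theorem contDiffOn_jetPullback [CompleteSpace F]
    {κ : 𝔼 → 𝔼}
    {U : Set 𝔼} (hU : IsOpen U) (hκ : ContDiffOn ℝ ∞ κ U) :
    ContDiffOn ℝ ∞ (jetPullback (F := F) r κ) (U ×ˢ univ) := by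
  refine contDiffOn_pi.2 fun k => ?_
  refine ContDiffOn.sum fun c _ => ?_
  refine (contDiff_compAlongOrderedFinpartition c).comp_contDiffOn (ContDiffOn.prodMk ?_ ?_)
  · exact ((ContinuousLinearMap.proj (R := ℝ)
      (φ := fun k : Fin (r + 1) => 𝔼 [×(k : ℕ)]→L[ℝ] F)
      ⟨c.length, c.length_le.trans_lt k.2⟩).contDiff.comp contDiff_snd).contDiffOn
  · exact contDiffOn_pi.2 fun m => (contDiffOn_iteratedFDeriv hU hκ _).comp contDiffOn_fst
      fun z hz => hz.1

end Prolongation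

/-! ## Coordinates on the manifold and on the jet bundle -/

section Coordinates

variable {n : ℕ} {M : Type*} [TopologicalSpace M] [ChartedSpace (EuclideanSpace ℝ (Fin n)) M]

local notation "𝔼" => EuclideanSpace ℝ (Fin n)
local notation "cht" => chartAt (EuclideanSpace ℝ (Fin n))

/-- The change of coordinates from the chart at `q` to the chart at `q'`. -/
def transition (q q' : M) : 𝔼 → 𝔼 :=
  cht q' ∘ (cht q).symm

theorem isOpen_transition_source (q q' : M) :
    IsOpen ((cht q).target ∩ (cht q).symm ⁻¹' (cht q').source) :=
  (cht q).isOpen_inter_preimage_symm (cht q').open_source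

theorem transition_apply (q q' : M) {p : M} (hp : p ∈ (cht q).source) :
    transition q q' (cht q p) = cht q' p := by
  simp [transition, (cht q).left_inv hp]

theorem transition_transition_eventuallyEq (q q' q'' : M) {p : M} (hq : p ∈ (cht q).source)
    (hq' : p ∈ (cht q').source) :
    transition q q'' =ᶠ[𝓝 (cht q p)] transition q' q'' ∘ transition q q' := by
  have : (cht q).target ∩ (cht q).symm ⁻¹' (cht q').source ∈ 𝓝 (cht q p) :=
    (isOpen_transition_source q q').mem_nhds ⟨(cht q).map_source hq, by
      simpa [(cht q).left_inv hq] using hq'⟩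
  filter_upwards [this] with x hx
  simp only [transition, Function.comp_apply]
  rw [(cht q').left_inv hx.2]

theorem transition_self_eventuallyEq (q : M) {p : M} (hq : p ∈ (cht q).source) :
    transition q q =ᶠ[𝓝 (cht q p)] id := by
  filter_upwards [(cht q).open_target.mem_nhds ((cht q).map_source hq)] with x hx
  exact (cht q).right_inv hx

theorem toChart_eq {k : ℕ} (q p : M) (a : Cov n k) :
    toChart q p a = a.compContinuousLinearMap (fderiv ℝ (transition q p) (cht q p)) := rfl

/-- The linear map `a ↦ toChart q p a`. -/
def toChartL (k : ℕ) (q p : M) : Cov n k →L[ℝ] Cov n k :=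
  ContinuousAlternatingMap.compContinuousLinearMapCLM (fderiv ℝ (transition q p) (cht q p))

theorem toChartL_apply {k : ℕ} (q p : M) (a : Cov n k) : toChartL k q p a = toChart q p a := rfl

variable [IsManifold (𝓡 n) ∞ M]

theorem contDiffOn_transition (q q' : M) : ContDiffOn ℝ ∞ (transition q q')
    ((cht q).target ∩ (cht q).symm ⁻¹' (cht q').source) := by
  have h := contDiffOn_ext_coord_change (I := 𝓡 n) (n := ∞) q' q
  simpa [transition, extChartAt, OpenPartialHomeomorph.extend] using h
  
theorem contDiffAt_transition (q q' : M) {p : M} (hq : p ∈ (cht q).source)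
    (hq' : p ∈ (cht q').source) : ContDiffAt ℝ ∞ (transition q q') (cht q p) :=
  (contDiffOn_transition q q').contDiffAt ((isOpen_transition_source q q').mem_nhds
    ⟨(cht q).map_source hq, by simpa [(cht q).left_inv hq] using hq'⟩)

theorem fderiv_transition_comp (q q' q'' : M) {p : M} (hq : p ∈ (cht q).source)
    (hq' : p ∈ (cht q').source) (hq'' : p ∈ (cht q'').source) :
    fderiv ℝ (transition q q'') (cht q p) =
      (fderiv ℝ (transition q' q'') (cht q' p)).comp (fderiv ℝ (transition q q') (cht q p)) := by
  rw [(transition_transition_eventuallyEq q q' q'' hq hq').fderiv_eq]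
  have h1 := (contDiffAt_transition q q' hq hq').differentiableAt (by simp)
  have h2 := (contDiffAt_transition q' q'' hq' hq'').differentiableAt (by simp)
  rw [← transition_apply q q' hq] at h2 ⊢
  exact fderiv_comp _ h2 h1

theorem fderiv_transition_self (q : M) {p : M} (hq : p ∈ (cht q).source) :
    fderiv ℝ (transition q q) (cht q p) = ContinuousLinearMap.id ℝ _ := by
  rw [(transition_self_eventuallyEq q hq).fderiv_eq, fderiv_id]

theorem toChart_self {k : ℕ} (p : M) (a : Cov n k) : toChart p p a = a := by
  rw [toChart_eq, fderiv_transition_self p (mem_chart_source _ p)]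
  rfl

theorem toChart_change {k : ℕ} (q q' : M) {p : M} (hq : p ∈ (cht q).source)
    (hq' : p ∈ (cht q').source) (a : Cov n k) :
    toChart q p a =
      (toChart q' p a).compContinuousLinearMap (fderiv ℝ (transition q q') (cht q p)) := by
  rw [toChart_eq, toChart_eq, fderiv_transition_comp q q' p hq hq' (mem_chart_source _ p)]
  rfl

/-- The inverse of `toChart q p`. -/
def ofChart {k : ℕ} (q p : M) (a : Cov n k) : Cov n k :=
  a.compContinuousLinearMap (fderiv ℝ (transition p q) (cht p p))

theorem ofChart_toChart {k : ℕ} {q p : M} (hq : p ∈ (cht q).source) (a : Cov n k) :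
    ofChart q p (toChart q p a) = a := by
  rw [ofChart, ← toChart_change p q (mem_chart_source _ p) hq, toChart_self]

theorem toChart_ofChart {k : ℕ} {q p : M} (hq : p ∈ (cht q).source) (a : Cov n k) :
    toChart q p (ofChart q p a) = a := by
  have h := fderiv_transition_comp q p q hq (mem_chart_source _ p) hq
  rw [fderiv_transition_self q hq] at h
  have : toChart q p (ofChart q p a) = a.compContinuousLinearMap
    ((fderiv ℝ (transition p q) (cht p p)).comp (fderiv ℝ (transition q p) (cht q p))) := rfl
  rw [this, ← h]
  rfl

theorem toChart_injective {k : ℕ} {q p : M} (hq : p ∈ (cht q).source) :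
    Function.Injective (toChart (n := n) (k := k) q p) :=
  Function.LeftInverse.injective (ofChart_toChart hq)

/-- A top form is its value on the frame times the determinant form, which is multiplied by `T.det`.
-/
theorem onFrame_comp (a : Cov n n)
    (T : 𝔼 →L[ℝ] 𝔼) :
    onFrame (a.compContinuousLinearMap T) = T.det * onFrame a := by
  set b := (EuclideanSpace.basisFun (Fin n) ℝ).toBasis with hb
  have hbi : ∀ i, b i = EuclideanSpace.single i (1 : ℝ) := fun i => by simp [hb]
  have h := a.toAlternatingMap.eq_smul_basis_det b
  have h1 : ∀ v, a v = a b * b.det v := fun v => congrArg (fun f => f v) h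
  have h2 : onFrame a = a b := congrArg a (funext fun i => (hbi i).symm)
  have h3 : onFrame (a.compContinuousLinearMap T) = a (T ∘ b) :=
    congrArg a (funext fun i => congrArg T (hbi i).symm)
  rw [h3, h1, h2]
  have := b.det_comp T.toLinearMap b
  rw [b.det_self, mul_one] at this
  change a b * b.det (T.toLinearMap ∘ b) = _
  rw [this, mul_comm]

end Coordinates

/-! ### Changes of coordinates for sections and jets -/

section Jets

variable {n : ℕ} {M : Type*} [TopologicalSpace M] [ChartedSpace (EuclideanSpace ℝ (Fin n)) M]
  [IsManifold (𝓡 n) ∞ M]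
  {F : Type*} [NormedAddCommGroup F] [NormedSpace ℝ F] [FiniteDimensional ℝ F]
  {E : M → Type*} [TopologicalSpace (TotalSpace F E)] [∀ p, TopologicalSpace (E p)]
  [∀ p, AddCommGroup (E p)] [∀ p, Module ℝ (E p)] [FiberBundle F E] [VectorBundle ℝ F E]
  [ContMDiffVectorBundle ∞ F E (𝓡 n)]

local notation "𝔼" => EuclideanSpace ℝ (Fin n)
local notation "cht" => chartAt (EuclideanSpace ℝ (Fin n))

theorem isOpen_dom (q : M) : IsOpen (dom (n := n) F E q) :=
  (cht q).open_source.inter (trivializationAt F E q).open_baseSet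

theorem mem_dom_self (q : M) : q ∈ dom (n := n) F E q :=
  ⟨mem_chart_source _ q, mem_baseSet_trivializationAt F E q⟩

theorem isOpen_coordDom (q : M) : IsOpen (coordDom n F E q) :=
  (cht q).isOpen_inter_preimage_symm (trivializationAt F E q).open_baseSet

theorem chart_mem_coordDom {q p : M} (hp : p ∈ dom (n := n) F E q) : cht q p ∈ coordDom n F E q :=
  ⟨(cht q).map_source hp.1, by simpa [(cht q).left_inv hp.1] using hp.2⟩

theorem chart_symm_mem_dom {q : M} {x : 𝔼} (hx : x ∈ coordDom n F E q) :
    (cht q).symm x ∈ dom (n := n) F E q :=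
  ⟨(cht q).map_target hx.1, hx.2⟩

/-- The inverse of the coordinates at `q` on the total space. -/
def ofCoord (q : M) (z : 𝔼 × F) : TotalSpace F E :=
  (trivializationAt F E q).toOpenPartialHomeomorph.symm ((cht q).symm z.1, z.2)

theorem ofCoord_proj {q : M} {z : 𝔼 × F} (hz : z.1 ∈ coordDom n F E q) :
    (ofCoord (E := E) q z).1 = (cht q).symm z.1 :=
  (trivializationAt F E q).proj_symm_apply ((trivializationAt F E q).mem_target.2 hz.2)

theorem contMDiffOn_ofCoord (q : M) : ContMDiffOn 𝓘(ℝ, 𝔼 × F)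
    ((𝓡 n).prod 𝓘(ℝ, F)) ∞ (ofCoord (n := n) (F := F) (E := E) q) (coordDom n F E q ×ˢ univ) := by
  intro z hz
  refine ContMDiffAt.contMDiffWithinAt ?_
  have h1 : ContMDiffAt (𝓘(ℝ, 𝔼 × F)) ((𝓡 n).prod 𝓘(ℝ, F)) ∞
      (fun z : 𝔼 × F => ((cht q).symm z.1, z.2)) z := by
    refine ContMDiffAt.prodMk ?_ (contMDiffAt_iff_contDiffAt.2 contDiffAt_snd)
    exact ContMDiffAt.comp z (contMDiffOn_chart_symm.contMDiffAt
      ((cht q).open_target.mem_nhds hz.1.1)) (contMDiffAt_iff_contDiffAt.2 contDiffAt_fst)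
  have h2 : ContMDiffAt ((𝓡 n).prod 𝓘(ℝ, F)) ((𝓡 n).prod 𝓘(ℝ, F)) ∞
      (trivializationAt F E q).toOpenPartialHomeomorph.symm ((cht q).symm z.1, z.2) :=
    ((trivializationAt F E q).contMDiffOn_symm (IB := 𝓡 n) (n := ∞)).contMDiffAt
      ((trivializationAt F E q).open_target.mem_nhds
        ((trivializationAt F E q).mem_target.2 hz.1.2))
  exact ContMDiffAt.comp z h2 h1

theorem contMDiffOn_trivialization_snd (q : M) : ContMDiffOn ((𝓡 n).prod 𝓘(ℝ, F)) 𝓘(ℝ, F) ∞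
    (fun u : TotalSpace F E => (trivializationAt F E q u).2) (trivializationAt F E q).source :=
  fun u hu => (contMDiffAt_snd.comp u (((trivializationAt F E q).contMDiffOn
    (IB := 𝓡 n) (n := ∞)).contMDiffAt ((trivializationAt F E q).open_source.mem_nhds
      hu))).contMDiffWithinAt

theorem contDiffOn_rep (φ : Sec n F E) (q : M) : ContDiffOn ℝ ∞ (φ.rep q) (coordDom n F E q) := by
  intro x hx
  have h1 : ContMDiffAt 𝓘(ℝ, 𝔼) (𝓡 n) ∞ (cht q).symm x :=
    contMDiffOn_chart_symm.contMDiffAt ((cht q).open_target.mem_nhds hx.1)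
  have h2 := ContMDiffAt.comp x (φ.contMDiff ((cht q).symm x)) h1
  have h3 : ContMDiffAt ((𝓡 n).prod 𝓘(ℝ, F)) 𝓘(ℝ, F) ∞
      (fun u : TotalSpace F E => (trivializationAt F E q u).2)
      ⟨(cht q).symm x, φ ((cht q).symm x)⟩ :=
    (contMDiffOn_trivialization_snd q).contMDiffAt ((trivializationAt F E q).open_source.mem_nhds
      (by rw [(trivializationAt F E q).mem_source]; exact hx.2))
  exact (contMDiffAt_iff_contDiffAt.1 (ContMDiffAt.comp x h3 h2)).contDiffWithinAt

theorem ofCoord_rep (φ : Sec n F E) {q : M} {x : 𝔼}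
    (hx : x ∈ coordDom n F E q) :
    ofCoord q (x, φ.rep q x) = (⟨(cht q).symm x, φ ((cht q).symm x)⟩ : TotalSpace F E) :=
  have hs : (⟨(cht q).symm x, φ ((cht q).symm x)⟩ : TotalSpace F E) ∈
      (trivializationAt F E q).source := by
    rw [(trivializationAt F E q).mem_source]; exact hx.2
  (trivializationAt F E q).symm_apply_mk_proj hs

/-- The change of fibre coordinates. -/
def fibreChange (q q' : M) (z : 𝔼 × F) : F :=
  (trivializationAt F E q' (ofCoord q z)).2

/-- The part of the coordinate domain at `q` which lies in the domain at `q'`. -/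
def overlap (q q' : M) : Set 𝔼 :=
  coordDom n F E q ∩ (cht q).symm ⁻¹' dom (n := n) F E q'

theorem isOpen_overlap (q q' : M) : IsOpen (overlap (n := n) (F := F) (E := E) q q') := by
  have : overlap (n := n) (F := F) (E := E) q q' =
      coordDom n F E q ∩ ((cht q).target ∩ (cht q).symm ⁻¹' dom (n := n) F E q') := by
    ext x
    exact ⟨fun h => ⟨h.1, h.1.1, h.2⟩, fun h => ⟨h.1, h.2.2⟩⟩
  rw [this]
  exact (isOpen_coordDom q).inter ((cht q).isOpen_inter_preimage_symm (isOpen_dom q'))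

theorem chart_mem_overlap {q q' p : M} (hp : p ∈ dom (n := n) F E q)
    (hp' : p ∈ dom (n := n) F E q') : cht q p ∈ overlap (n := n) (F := F) (E := E) q q' :=
  ⟨chart_mem_coordDom hp, by simpa [(cht q).left_inv hp.1] using hp'⟩

theorem contDiffOn_fibreChange (q q' : M) :
    ContDiffOn ℝ ∞ (fibreChange (n := n) (F := F) (E := E) q q') (overlap (n := n) (F := F) (E := E) q q' ×ˢ univ) := by
  intro z hz
  have h1 := (contMDiffOn_ofCoord (E := E) q).contMDiffAt
    (((isOpen_coordDom q).prod isOpen_univ).mem_nhds (show z ∈ _ from ⟨hz.1.1, mem_univ _⟩))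
  have hm : ofCoord q z ∈ (trivializationAt F E q').source := by
    rw [(trivializationAt F E q').mem_source]
    rw [ofCoord_proj hz.1.1]
    exact hz.1.2.2
  have h2 := (contMDiffOn_trivialization_snd (n := n) (F := F) (E := E) q').contMDiffAt
    ((trivializationAt F E q').open_source.mem_nhds hm)
  exact (contMDiffAt_iff_contDiffAt.1 (ContMDiffAt.comp z h2 h1)).contDiffWithinAt

theorem contDiffOn_transition_overlap (q q' : M) :
    ContDiffOn ℝ ∞ (transition q q') (overlap (n := n) (F := F) (E := E) q q') :=
  (contDiffOn_transition q q').mono fun _ hx => ⟨hx.1.1, hx.2.1⟩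

theorem mapsTo_transition_overlap (q q' : M) : MapsTo (transition q q')
    (overlap (n := n) (F := F) (E := E) q q') (overlap (n := n) (F := F) (E := E) q' q) := by
  intro x hx
  exact chart_mem_overlap hx.2 (chart_symm_mem_dom hx.1)

theorem transition_transition {q q' : M} {x : 𝔼}
    (hx : x ∈ overlap (n := n) (F := F) (E := E) q q') :
    transition q' q (transition q q' x) = x := by
  simp only [transition, Function.comp_apply]
  rw [(cht q').left_inv hx.2.1, (cht q).right_inv hx.1.1]

theorem rep_change (φ : Sec n F E) {q q' : M} {x : 𝔼}
    (hx : x ∈ overlap (n := n) (F := F) (E := E) q q') :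
    φ.rep q' (transition q q' x) = fibreChange (E := E) q q' (x, φ.rep q x) := by
  rw [fibreChange, ofCoord_rep φ hx.1]
  simp only [Sec.rep, transition, Function.comp_apply]
  rw [(cht q').left_inv hx.2.1]

variable (E) in
/-- The change of jet coordinates from `q` to `q'`. -/
def jetChange (r : ℕ) (q q' : M) (z : 𝔼 × JetCoord n r F) :
    JetCoord n r F :=
  -- The fibre coordinates change first, in the chart at `q`; the result is then composed with the
  -- transition from `q'` to `q`, whose base point is the image of `z.1`.
  jetPullback r (transition q' q)
    (transition q q' z.1, prolong r (fibreChange (E := E) q q') z)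

theorem contDiffOn_jetChange (r : ℕ) (q q' : M) :
    ContDiffOn ℝ ∞ (jetChange (F := F) E r q q') (overlap (n := n) (F := F) (E := E) q q' ×ˢ univ) := by
  have h1 : ContDiffOn ℝ ∞ (prolong r (fibreChange (n := n) (F := F) (E := E) q q'))
      (overlap (n := n) (F := F) (E := E) q q' ×ˢ univ) := by
    have := contDiffOn_prolong (X := ℝ) (r := r) (Ψ := fun p => fibreChange (E := E) q q' p.2)
      (O := univ) (U := overlap (n := n) (F := F) (E := E) q q') isOpen_univ (isOpen_overlap q q')
      ((contDiffOn_fibreChange (F := F) (E := E) q q').comp contDiffOn_snd fun p hp => hp.2)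
    exact this.comp (contDiff_prodMk_right (0 : ℝ)).contDiffOn fun z hz => ⟨mem_univ _, hz⟩
  refine (contDiffOn_jetPullback (isOpen_overlap (F := F) (E := E) q' q)
    (contDiffOn_transition_overlap q' q)).comp (ContDiffOn.prodMk ?_ h1)
    fun z hz => ⟨mapsTo_transition_overlap q q' hz.1, mem_univ _⟩
  exact (contDiffOn_transition_overlap q q').comp contDiffOn_fst fun z hz => hz.1

theorem jetCoord_change (r : ℕ) (φ : Sec n F E) {q q' p : M} (hp : p ∈ dom (n := n) F E q)
    (hp' : p ∈ dom (n := n) F E q') :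
    jetCoord r (φ.rep q') (cht q' p) =
      jetChange E r q q' (cht q p, jetCoord r (φ.rep q) (cht q p)) := by
  have ho := chart_mem_overlap (E := E) hp hp'
  have ho' := chart_mem_overlap (E := E) hp' hp
  have hxq : transition q' q (cht q' p) = cht q p := transition_apply q' q hp'.1
  have hrep := (contDiffOn_rep φ q).contDiffAt ((isOpen_coordDom q).mem_nhds ho.1)
  have hΨ := (contDiffOn_fibreChange (F := F) (E := E) q q').contDiffAt
    (((isOpen_overlap q q').prod isOpen_univ).mem_nhds
      (show (cht q p, φ.rep q (cht q p)) ∈ _ from ⟨ho, mem_univ _⟩))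
  have e : φ.rep q' =ᶠ[𝓝 (cht q' p)]
      fun y => fibreChange (E := E) q q' (transition q' q y, φ.rep q (transition q' q y)) := by
    filter_upwards [(isOpen_overlap q' q).mem_nhds ho'] with y hy
    have := rep_change φ (mapsTo_transition_overlap q' q hy)
    rwa [transition_transition hy] at this
  have hc : ContDiffAt ℝ ∞ (fun x => fibreChange (E := E) q q' (x, φ.rep q x)) (cht q p) :=
    ContDiffAt.comp (g := fibreChange (n := n) (F := F) (E := E) q q')
      (f := fun x => (x, φ.rep q x)) (cht q p) hΨ (contDiffAt_id.prodMk hrep)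
  rw [jetCoord_congr e, jetCoord_comp (f := fun x => fibreChange (E := E) q q' (x, φ.rep q x))
    (by rw [hxq]; exact hc)
    ((contDiffOn_transition_overlap q' q).contDiffAt ((isOpen_overlap q' q).mem_nhds ho')), hxq,
    jetCoord_prolong hΨ hrep, jetChange]
  simp only [transition_apply q q' hp.1]

/-- Contact is defined in the preferred coordinates at `p` only; `jetChange` depends on the jet
alone and carries the equality to any `q`. -/
theorem jetCoord_eq_of_jet_eq {φ φ' : Sec n F E} {p : M} (h : φ.jet p = φ'.jet p) {q : M}
    (hp : p ∈ dom (n := n) F E q) (r : ℕ) :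
    jetCoord r (φ.rep q) (cht q p) = jetCoord r (φ'.rep q) (cht q p) := by
  have h' : (contact n F E p) φ φ' := Quotient.exact (eq_of_heq (Sigma.mk.inj h).2)
  rw [jetCoord_change r φ (mem_dom_self p) hp, jetCoord_change r φ' (mem_dom_self p) hp]
  congr 2
  funext k
  exact h' k

theorem repr_jet (j : InfJet n F E) : (InfJet.repr j).jet j.1 = j := by
  obtain ⟨p, c⟩ := j
  exact congrArg (Sigma.mk p) (Quotient.out_eq c)

end Jets

/-! ## Variational calculus in coordinates -/

section Variation

variable {n r : ℕ} {F F' V : Type*} [NormedAddCommGroup F] [NormedSpace ℝ F]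
  [NormedAddCommGroup F'] [NormedSpace ℝ F'] [NormedAddCommGroup V] [NormedSpace ℝ V]
  {U : Set (EuclideanSpace ℝ (Fin n))}

local notation "𝔼" => EuclideanSpace ℝ (Fin n)

theorem elemTensor_add {k : ℕ} (i : Fin k → Fin n) (v w : F) :
    elemTensor i (v + w) = elemTensor i v + elemTensor i w := by
  ext m
  simp [elemTensor]

theorem elemTensor_smul {k : ℕ} (i : Fin k → Fin n) (c : ℝ) (v : F) :
    elemTensor i (c • v) = c • elemTensor i v := by
  ext m
  simp only [elemTensor, ContinuousMultilinearMap.smulRight_apply, _root_.smul_apply]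
  exact smul_comm _ _ _

theorem isLinearMap_eulerExpr (hU : IsOpen U) {L : 𝔼 × JetCoord n r F → V}
    (hL : ContDiffOn ℝ ∞ L (U ×ˢ univ)) {f : 𝔼 → F} (hf : ContDiffOn ℝ ∞ f U) {x : 𝔼}
    (hx : x ∈ U) : IsLinearMap ℝ (eulerExpr L f x) := by
  have hs : ∀ (k : ℕ) (u : JetCoord n r F),
      ContDiffAt ℝ k (fun y => fderiv ℝ L (y, jetCoord r f y) (0, u)) x := fun k u =>
    (((isLocOp_fderiv_vertical hU hL u).contDiffOn hU hf).contDiffAt (hU.mem_nhds hx)).of_le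
      (natCast_le_infty k)
  have h0 : ∀ (y : 𝔼) (u u' : JetCoord n r F), fderiv ℝ L (y, jetCoord r f y) (0, u + u') =
      fderiv ℝ L (y, jetCoord r f y) (0, u) + fderiv ℝ L (y, jetCoord r f y) (0, u') := by
    intro y u u'
    rw [← map_add, Prod.mk_add_mk, add_zero]
  have h1 : ∀ (y : 𝔼) (c : ℝ) (u : JetCoord n r F), fderiv ℝ L (y, jetCoord r f y) (0, c • u) =
      c • fderiv ℝ L (y, jetCoord r f y) (0, u) := by
    intro y c u
    rw [← map_smul, Prod.smul_mk, smul_zero]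
  constructor
  · intro v w
    simp only [eulerExpr, ← Finset.sum_add_distrib, ← smul_add]
    refine Finset.sum_congr rfl fun k _ => congrArg _ (Finset.sum_congr rfl fun i _ => ?_)
    simp only [elemTensor_add, Pi.single_add, h0]
    have := iteratedFDeriv_add_apply (hs k (Pi.single k (elemTensor i v)))
      (hs k (Pi.single k (elemTensor i w)))
    exact DFunLike.congr_fun this _
  · intro c v
    simp only [eulerExpr, Finset.smul_sum]
    refine Finset.sum_congr rfl fun k _ => Finset.sum_congr rfl fun i _ => ?_
    simp only [elemTensor_smul, Pi.single_smul, h1]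
    have := iteratedFDeriv_const_smul_apply (a := c) (hs k (Pi.single k (elemTensor i v)))
    rw [smul_comm]
    refine congrArg _ ?_
    exact DFunLike.congr_fun this _

theorem eulerExpr_congr_field {L : 𝔼 × JetCoord n r F → V} {f f' : 𝔼 → F} {x : 𝔼}
    (h : f =ᶠ[𝓝 x] f') (v : F) : eulerExpr L f x v = eulerExpr L f' x v := by
  unfold eulerExpr
  refine Finset.sum_congr rfl fun k _ => congrArg _ (Finset.sum_congr rfl fun i _ => ?_)
  have : (fun y => fderiv ℝ L (y, jetCoord r f y) (0, Pi.single k (elemTensor i v))) =ᶠ[𝓝 x]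
      fun y => fderiv ℝ L (y, jetCoord r f' y) (0, Pi.single k (elemTensor i v)) := by
    filter_upwards [h.eventuallyEq_nhds] with y hy
    rw [jetCoord_congr hy]
  rw [(this.iteratedFDeriv ℝ _).eq_of_nhds]

theorem eulerExpr_clm {W : Type*} [NormedAddCommGroup W] [NormedSpace ℝ W] (hU : IsOpen U)
    {L : 𝔼 × JetCoord n r F → V}
    (hL : ContDiffOn ℝ ∞ L (U ×ˢ univ)) {f : 𝔼 → F} (hf : ContDiffOn ℝ ∞ f U) {x : 𝔼}
    (hx : x ∈ U) (T : V →L[ℝ] W) (v : F) :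
    eulerExpr (fun z => T (L z)) f x v = T (eulerExpr L f x v) := by
  simp only [eulerExpr, map_sum, map_smul]
  refine Finset.sum_congr rfl fun k _ => congrArg _ (Finset.sum_congr rfl fun i _ => ?_)
  have e : (fun y => fderiv ℝ (fun z => T (L z)) (y, jetCoord r f y)
      (0, Pi.single k (elemTensor i v))) =ᶠ[𝓝 x]
      fun y => T (fderiv ℝ L (y, jetCoord r f y) (0, Pi.single k (elemTensor i v))) := by
    filter_upwards [hU.mem_nhds hx] with y hy
    have hd : DifferentiableAt ℝ L (y, jetCoord r f y) :=
      (hL.contDiffAt ((hU.prod isOpen_univ).mem_nhds ⟨hy, mem_univ _⟩)).differentiableAt (by simp)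
    have := (T.hasFDerivAt.comp _ hd.hasFDerivAt).fderiv
    exact DFunLike.congr_fun this _
  rw [(e.iteratedFDeriv ℝ _).eq_of_nhds]
  have := T.iteratedFDeriv_comp_left (i := (k : ℕ))
    (((isLocOp_fderiv_vertical hU hL (Pi.single k (elemTensor i v))).contDiffOn hU hf).contDiffAt
      (hU.mem_nhds hx)) (natCast_le_infty _)
  exact DFunLike.congr_fun this _

/-- The first variation formula for variations with values in the fibre. -/
theorem exists_firstVariation_field [FiniteDimensional ℝ F] (hU : IsOpen U)
    {L : 𝔼 × JetCoord n r F → V} (hL : ContDiffOn ℝ ∞ L (U ×ˢ univ)) :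
    ∃ P : Fin n → (𝔼 → F × F) → 𝔼 → V,
      (∀ j, IsLocOp U (r + r) (P j)) ∧
      (∀ j h x, (∀ᶠ y in 𝓝 x, (h y).2 = 0) → P j h x = 0) ∧
      (∀ j h x, (∀ᶠ y in 𝓝 x, ∀ u, L (y, u) = 0) → P j h x = 0) ∧
      ∀ f s, ContDiffOn ℝ ∞ f U → ContDiffOn ℝ ∞ s U → ∀ x ∈ U,
        fderiv ℝ L (x, jetCoord r f x) (0, jetCoord r s x) = eulerExpr L f x (s x) +
            ∑ j, fderiv ℝ (P j fun y => (f y, s y)) x (EuclideanSpace.single j (1 : ℝ)) := by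
  set b := Module.finBasis ℝ F with hb
  choose P hP hP0 hPL hPe using fun a => exists_firstVariation hU hL (b a)
  -- A fibre-valued variation is a sum of scalar ones along a basis: `T a` keeps `f` and the `a`-th
  -- coordinate of `s`.
  let T : ∀ a, F × F →L[ℝ] F × ℝ := fun a => (ContinuousLinearMap.fst ℝ F F).prod
    ((b.coord a).toContinuousLinearMap.comp (ContinuousLinearMap.snd ℝ F F))
  have hloc : ∀ a j, IsLocOp U (r + r) fun (h : 𝔼 → F × F) x => P a j (fun y => T a (h y)) x :=
    fun a j => (hP a j).comp_left hU (T a)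
  refine ⟨fun j h x => ∑ a, P a j (fun y => T a (h y)) x,
    fun j => IsLocOp.sum _ fun a _ => hloc a j, fun j h x hx => ?_,
    fun j h x hx => Finset.sum_eq_zero fun a _ => hPL a j _ x hx, fun f s hf hs x hx => ?_⟩
  · refine Finset.sum_eq_zero fun a _ => hP0 a j _ x ?_
    filter_upwards [hx] with y hy
    simp [T, hy]
  · have hfs : ContDiffOn ℝ ∞ (fun y => (f y, s y)) U := hf.prodMk hs
    have hc : ∀ a, ContDiffOn ℝ ∞ (fun y => b.coord a (s y)) U := fun a =>
      (b.coord a).toContinuousLinearMap.contDiff.comp_contDiffOn hs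
    have h1 : jetCoord r s x = ∑ a, jetCoord r (fun y => b.coord a (s y) • b a) x := by
      have : s = fun y => ∑ a, b.coord a (s y) • b a := by
        funext y; exact (b.sum_repr (s y)).symm
      funext k
      rw [Finset.sum_apply]
      change iteratedFDeriv ℝ (k : ℕ) s x = ∑ a, iteratedFDeriv ℝ (k : ℕ) _ x
      conv_lhs => rw [this]
      exact iteratedFDeriv_fun_sum_apply fun a _ =>
        (((hc a).contDiffAt (hU.mem_nhds hx)).of_le (natCast_le_infty _)).smul contDiffAt_const
    have h2 : eulerExpr L f x (s x) = ∑ a, b.coord a (s x) • eulerExpr L f x (b a) := by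
      conv_lhs => rw [← b.sum_repr (s x)]
      have hl := isLinearMap_eulerExpr hU hL hf hx
      rw [← hl.mk'_apply, map_sum]
      simp
    have h3 : ∀ j, fderiv ℝ (fun x => ∑ a, P a j (fun y => T a (f y, s y)) x) x =
        ∑ a, fderiv ℝ (P a j (fun y => T a (f y, s y))) x := fun j =>
      fderiv_fun_sum fun a _ => (((hloc a j).contDiffOn hU hfs).contDiffAt
        (hU.mem_nhds hx)).differentiableAt (by simp)
    have h4 : ∀ u : Fin (Module.finrank ℝ F) → JetCoord n r F,
        fderiv ℝ L (x, jetCoord r f x) (0, ∑ a, u a) =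
          ∑ a, fderiv ℝ L (x, jetCoord r f x) (0, u a) := by
      intro u
      rw [← map_sum]
      congr 1
      ext <;> simp [Prod.fst_sum, Prod.snd_sum]
    rw [h1, h4, h2]
    simp only [h3, _root_.sum_apply]
    rw [Finset.sum_comm, ← Finset.sum_add_distrib]
    refine Finset.sum_congr rfl fun a _ => ?_
    exact hPe a (fun y => T a (f y, s y)) ((T a).contDiff.comp_contDiffOn hfs) x hx

theorem hasDerivAt_comp_jetCoord_param (hU : IsOpen U) {L : 𝔼 × JetCoord n r F → V}
    (hL : ContDiffOn ℝ ∞ L (U ×ˢ univ)) {f : ℝ × 𝔼 → F} (hf : ContDiffOn ℝ ∞ f (univ ×ˢ U))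
    {x : 𝔼} (hx : x ∈ U) (t : ℝ) :
    HasDerivAt (fun t => L (x, jetCoord r (fun y => f (t, y)) x))
      (fderiv ℝ L (x, jetCoord r (fun y => f (t, y)) x)
        (0, jetCoord r (fun y => fderiv ℝ f (t, y) (1, 0)) x)) t := by
  have h1 := hasDerivAt_jetCoord_param (r := r) (isOpen_univ.prod hU) hf (t := t)
    (show (t, x) ∈ _ from ⟨mem_univ _, hx⟩)
  have hd : DifferentiableAt ℝ L (x, jetCoord r (fun y => f (t, y)) x) :=
    (hL.contDiffAt ((hU.prod isOpen_univ).mem_nhds ⟨hx, mem_univ _⟩)).differentiableAt (by simp)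
  exact hd.hasFDerivAt.comp_hasDerivAt t ((hasDerivAt_const t x).prodMk h1)

/-- Jets of the members of a smooth family depend smoothly on all parameters. -/
theorem contDiffOn_jetCoord_param (hU : IsOpen U) {f : ℝ × 𝔼 → F}
    (hf : ContDiffOn ℝ ∞ f (univ ×ˢ U)) :
    ContDiffOn ℝ ∞ (fun p : ℝ × 𝔼 => jetCoord r (fun y => f (p.1, y)) p.2) (univ ×ˢ U) :=
  contDiffOn_pi.2 fun k => contDiffOn_iteratedFDeriv_partial (isOpen_univ.prod hU) hf k

theorem contDiffOn_section {f : ℝ × 𝔼 → F} (hf : ContDiffOn ℝ ∞ f (univ ×ˢ U)) (t : ℝ) :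
    ContDiffOn ℝ ∞ (fun y => f (t, y)) U :=
  hf.comp (contDiff_prodMk_right t).contDiffOn fun _ h => ⟨mem_univ _, h⟩

/-- The integral of the divergence of a field supported in a compact subset of `U`. -/
theorem setIntegral_fderiv_eq_zero [FiniteDimensional ℝ V] {C : Set 𝔼} (hU : IsOpen U)
    (hC : IsCompact C) (hCU : C ⊆ U) {g : 𝔼 → V} (hg : ContDiffOn ℝ ∞ g U)
    (h0 : ∀ x ∈ U, x ∉ C → g x = 0) (v : 𝔼) :
    IntegrableOn (fun x => fderiv ℝ g x v) C ∧ ∫ x in C, fderiv ℝ g x v = 0 := by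
  classical
  -- The extension by zero is smooth on all of space, since it vanishes on the open complement of
  -- `C`.
  set g' : 𝔼 → V := fun x => if x ∈ U then g x else 0 with hg'
  have h0' : ∀ x ∉ C, g' x = 0 := by
    intro x hx
    by_cases h : x ∈ U
    · simp [hg', h, h0 x h hx]
    · simp [hg', h]
  have hCo : IsOpen Cᶜ := hC.isClosed.isOpen_compl
  have e1 : ∀ x ∈ U, g' =ᶠ[𝓝 x] g := fun x hx => by
    filter_upwards [hU.mem_nhds hx] with y hy
    simp [hg', hy]
  have e2 : ∀ x ∉ C, g' =ᶠ[𝓝 x] fun _ => 0 := fun x hx => by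
    filter_upwards [hCo.mem_nhds hx] with y hy using h0' y hy
  have hs : ContDiff ℝ ∞ g' := contDiff_iff_contDiffAt.2 fun x => by
    by_cases hx : x ∈ C
    · exact (hg.contDiffAt (hU.mem_nhds (hCU hx))).congr_of_eventuallyEq (e1 x (hCU hx))
    · exact contDiffAt_const.congr_of_eventuallyEq (e2 x hx)
  have hcs : HasCompactSupport g' := HasCompactSupport.intro hC h0'
  have h := integral_fderiv_apply_eq_zero (μ := volume) (hs.of_le (by simp)) hcs v
  have h2 : ∀ x ∉ C, fderiv ℝ g' x v = 0 := fun x hx => by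
    rw [(e2 x hx).fderiv_eq]; simp
  have h3 : EqOn (fun x => fderiv ℝ g' x v) (fun x => fderiv ℝ g x v) C := fun x hx => by
    dsimp only
    rw [(e1 x (hCU hx)).fderiv_eq]
  have hi : IntegrableOn (fun x => fderiv ℝ g' x v) C :=
    (((hs.continuous_fderiv (by simp)).clm_apply
      continuous_const).integrable_of_hasCompactSupport (hcs.fderiv_apply ℝ v)).integrableOn
  refine ⟨hi.congr_fun h3 hC.measurableSet, ?_⟩
  rw [← setIntegral_congr_fun hC.measurableSet h3, setIntegral_eq_integral_of_forall_compl_eq_zero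
    h2, h]

theorem continuousOn_eulerExpr_field [FiniteDimensional ℝ F] (hU : IsOpen U)
    {L : 𝔼 × JetCoord n r F → V}
    (hL : ContDiffOn ℝ ∞ L (U ×ˢ univ)) {f s : 𝔼 → F} (hf : ContDiffOn ℝ ∞ f U)
    (hs : ContinuousOn s U) : ContinuousOn (fun x => eulerExpr L f x (s x)) U := by
  set b := Module.finBasis ℝ F with hb
  have : ContinuousOn (fun x => ∑ a, b.coord a (s x) • eulerExpr L f x (b a)) U :=
    continuousOn_finsetSum _ fun a _ => ContinuousOn.smul
      ((b.coord a).toContinuousLinearMap.continuous.comp_continuousOn hs)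
      ((isLocOp_eulerExpr hU hL (b a)).contDiffOn hU hf).continuousOn
  refine this.congr fun x hx => ?_
  conv_lhs => rw [← b.sum_repr (s x)]
  have hl := isLinearMap_eulerExpr hU hL hf hx
  rw [← hl.mk'_apply, map_sum]
  simp

/-- The derivative of the action integral along a family which is constant outside of a compact
subset of `U` is given by the Euler–Lagrange expression. -/
theorem hasDerivAt_setIntegral_family [FiniteDimensional ℝ F] [FiniteDimensional ℝ V]
    {C : Set 𝔼} (hU : IsOpen U)
    (hC : IsCompact C) (hCU : C ⊆ U) {L : 𝔼 × JetCoord n r F → V}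
    (hL : ContDiffOn ℝ ∞ L (U ×ˢ univ)) {f : ℝ × 𝔼 → F} (hf : ContDiffOn ℝ ∞ f (univ ×ˢ U))
    (h0 : ∀ t, ∀ x ∈ U, x ∉ C → f (t, x) = f (0, x)) :
    HasDerivAt (fun t => ∫ x in C, L (x, jetCoord r (fun y => f (t, y)) x))
      (∫ x in C, eulerExpr L (fun y => f (0, y)) x (fderiv ℝ f (0, x) (1, 0))) 0 := by
  have hO : IsOpen ((univ : Set ℝ) ×ˢ U) := isOpen_univ.prod hU
  have hf' : ContDiffOn ℝ ∞ (fun p => fderiv ℝ f p (1, 0)) (univ ×ˢ U) :=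
    contDiffOn_fderiv_apply hO hf _
  have hj := contDiffOn_jetCoord_param (r := r) hU hf
  have hj' := contDiffOn_jetCoord_param (r := r) hU hf'
  have hUo : IsOpen (U ×ˢ (univ : Set (JetCoord n r F))) := hU.prod isOpen_univ
  let D : 𝔼 → ℝ → V := fun x t => fderiv ℝ L (x, jetCoord r (fun y => f (t, y)) x)
        (0, jetCoord r (fun y => fderiv ℝ f (t, y) (1, 0)) x)
  have hLj : ContinuousOn (fun p : ℝ × 𝔼 => L (p.2, jetCoord r (fun y => f (p.1, y)) p.2))
      (univ ×ˢ U) := hL.continuousOn.comp (continuousOn_snd.prodMk hj.continuousOn)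
      fun p hp => ⟨hp.2, mem_univ _⟩
  have hDc : ContinuousOn (fun p : ℝ × 𝔼 => D p.2 p.1) (univ ×ˢ U) := by
    refine ContinuousOn.clm_apply ?_ (continuousOn_const.prodMk hj'.continuousOn)
    exact (hL.fderiv_of_isOpen hUo (m := ∞) (by simp)).continuousOn.comp
      (continuousOn_snd.prodMk hj.continuousOn) fun p hp => ⟨hp.2, mem_univ _⟩
  -- The integration variable `x ∈ C` is the parameter here, and the differentiation is in `t`.
  have key := hasFDerivAt_setIntegral (μ := (volume : Measure 𝔼)) hC hC.measurableSet
    (H := fun x t => L (x, jetCoord r (fun y => f (t, y)) x))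
    (H' := fun x t => (1 : ℝ →L[ℝ] ℝ).smulRight (D x t)) (U := univ) isOpen_univ
    (fun t _ => hLj.comp (continuousOn_const.prodMk continuousOn_id)
      fun x hx => ⟨mem_univ _, hCU hx⟩) ?_
    (fun x hx t _ => hasDerivAt_iff_hasFDerivAt.1
      (hasDerivAt_comp_jetCoord_param hU hL hf (hCU hx) t)) (mem_univ 0)
  · have h1 := key.hasDerivAt
    have hcs : ContinuousOn (fun x => (1 : ℝ →L[ℝ] ℝ).smulRight (D x 0)) C := by
      have : ContinuousOn (fun x => D x 0) C := hDc.comp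
        (continuousOn_const.prodMk continuousOn_id) fun x hx => ⟨mem_univ _, hCU hx⟩
      exact ((ContinuousLinearMap.smulRightL ℝ ℝ V 1).continuous.comp_continuousOn this)
    rw [(setIntegral_clm_apply hC hC.measurableSet hcs 1).2] at h1
    convert h1 using 1
    simp only [ContinuousLinearMap.smulRight_apply, one_apply_eq_self, one_smul]
    obtain ⟨P, hP, hP0, -, hPe⟩ := exists_firstVariation_field hU hL
    have hf0 := contDiffOn_section hf 0
    have hf0' := contDiffOn_section hf' 0
    set s : 𝔼 → F := fun y => fderiv ℝ f (0, y) (1, 0) with hs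
    -- The family does not move outside `C`, so its velocity vanishes there.
    have hsC : ∀ x ∈ U, x ∉ C → s x = 0 := by
      intro x hx hxC
      have hd : DifferentiableAt ℝ f (0, x) := (hf.contDiffAt
        (hO.mem_nhds ⟨mem_univ _, hx⟩)).differentiableAt (by simp)
      have h2 := hd.hasFDerivAt.comp_hasDerivAt (0 : ℝ)
        ((hasDerivAt_id (0 : ℝ)).prodMk (hasDerivAt_const (0 : ℝ) x))
      have h3 : HasDerivAt (f ∘ fun t => (id t, x)) 0 (0 : ℝ) := by
        have : (f ∘ fun t => (id t, x)) = fun _ => f (0, x) := funext fun t => h0 t x hx hxC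
        rw [this]; exact hasDerivAt_const _ _
      exact h2.unique h3
    have hg : ∀ j, ContDiffOn ℝ ∞ (P j fun y => (f (0, y), s y)) U := fun j =>
      (hP j).contDiffOn hU (hf0.prodMk hf0')
    -- The fluxes are local in the velocity, hence supported in `C`, and their divergence integrates
    -- to zero. Only the Euler–Lagrange term of the first variation survives.
    have hdiv := fun j => setIntegral_fderiv_eq_zero hU hC hCU (hg j) (fun x hx hxC =>
      hP0 j _ x (by
        filter_upwards [hU.mem_nhds hx, hC.isClosed.isOpen_compl.mem_nhds hxC] with y hy hyC
          using hsC y hy hyC)) (EuclideanSpace.single j (1 : ℝ))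
    have he : EqOn (fun x => D x 0) (fun x => eulerExpr L (fun y => f (0, y)) x (s x) +
        ∑ j, fderiv ℝ (P j fun y => (f (0, y), s y)) x (EuclideanSpace.single j (1 : ℝ))) C :=
      fun x hx => hPe _ _ hf0 hf0' x (hCU hx)
    rw [setIntegral_congr_fun hC.measurableSet he, integral_add, integral_finsetSum]
    · rw [Finset.sum_eq_zero fun j _ => (hdiv j).2, add_zero]
    · exact fun j _ => (hdiv j).1
    · exact ((continuousOn_eulerExpr_field hU hL hf0 hf0'.continuousOn).mono
        hCU).integrableOn_compact' hC hC.measurableSet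
    · exact integrable_finsetSum _ fun j _ => (hdiv j).1
  · have : ContinuousOn (fun p : 𝔼 × ℝ => D p.1 p.2) (C ×ˢ univ) :=
      hDc.comp (continuousOn_snd.prodMk continuousOn_fst) fun p hp => ⟨mem_univ _, hCU hp.1⟩
    exact ((ContinuousLinearMap.smulRightL ℝ ℝ V 1).continuous.comp_continuousOn this)

/-- The fundamental lemma of the calculus of variations. -/
theorem eqOn_zero_of_setIntegral_smul_eq_zero [FiniteDimensional ℝ V] (hU : IsOpen U) {g : 𝔼 → V}
    (hg : ContinuousOn g U)
    (h : ∀ χ : 𝔼 → ℝ, ContDiff ℝ ∞ χ → HasCompactSupport χ → tsupport χ ⊆ U →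
      ∫ x in tsupport χ, χ x • g x = 0) : ∀ x ∈ U, g x = 0 := by
  have h1 := hU.ae_eq_zero_of_integral_contDiff_smul_eq_zero (μ := volume)
    (hg.locallyIntegrableOn hU.measurableSet) fun χ hχ hc hs => by
      rw [← h χ hχ hc hs, setIntegral_eq_integral_of_forall_compl_eq_zero]
      intro x hx
      rw [image_eq_zero_of_notMem_tsupport hx, zero_smul]
  have h2 : g =ᵐ[volume.restrict U] fun _ => 0 := (ae_restrict_iff' hU.measurableSet).2 h1
  exact fun x hx => Measure.eqOn_open_of_ae_eq h2 hU hg continuousOn_const hx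

theorem contDiffOn_add_smul {f s : 𝔼 → F} (hf : ContDiffOn ℝ ∞ f U) (hs : ContDiffOn ℝ ∞ s U) :
    ContDiffOn ℝ ∞ (fun p : ℝ × 𝔼 => f p.2 + p.1 • s p.2) (univ ×ˢ U) :=
  (hf.comp contDiffOn_snd fun _ h => h.2).add
    (contDiffOn_fst.smul (hs.comp contDiffOn_snd fun _ h => h.2))

theorem fderiv_add_smul (hU : IsOpen U) {f s : 𝔼 → F} (hf : ContDiffOn ℝ ∞ f U)
    (hs : ContDiffOn ℝ ∞ s U) {x : 𝔼} (hx : x ∈ U) :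
    fderiv ℝ (fun p : ℝ × 𝔼 => f p.2 + p.1 • s p.2) (0, x) (1, 0) = s x := by
  have hd := ((contDiffOn_add_smul hf hs).contDiffAt ((isOpen_univ.prod hU).mem_nhds
    (show ((0 : ℝ), x) ∈ _ from ⟨mem_univ _, hx⟩))).differentiableAt (by simp)
  have h2 := hd.hasFDerivAt.comp_hasDerivAt (0 : ℝ)
        ((hasDerivAt_id (0 : ℝ)).prodMk (hasDerivAt_const (0 : ℝ) x))
  have h3 : HasDerivAt (fun t : ℝ => f x + t • s x) ((1 : ℝ) • s x) 0 :=
    ((hasDerivAt_id (0 : ℝ)).smul_const (s x)).const_add (f x)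
  rw [one_smul] at h3
  exact h2.unique h3

/-- A function which is given by test variations of an action integral. -/
theorem eulerExpr_eq_of_integral [FiniteDimensional ℝ F] [FiniteDimensional ℝ V] (hU : IsOpen U)
    {L : 𝔼 × JetCoord n r F → V}
    (hL : ContDiffOn ℝ ∞ L (U ×ˢ univ)) {f : 𝔼 → F} (hf : ContDiffOn ℝ ∞ f U) (v : F)
    {e : 𝔼 → V} (he : ContinuousOn e U)
    (h : ∀ χ : 𝔼 → ℝ, ContDiff ℝ ∞ χ → HasCompactSupport χ → tsupport χ ⊆ U →
      HasDerivAt (fun t : ℝ => ∫ x in tsupport χ, L (x, jetCoord r (fun y => f y + t • χ y • v) x))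
        (∫ x in tsupport χ, χ x • e x) 0) : ∀ x ∈ U, eulerExpr L f x v = e x := by
  have hE : ContinuousOn (fun x => eulerExpr L f x v) U :=
    ((isLocOp_eulerExpr hU hL v).contDiffOn hU hf).continuousOn
  -- The Euler–Lagrange expression is determined by derivatives of the action along test variations.
  -- Its later properties are deduced from this, without computing with the sum over `(-D)_I`.
  have := eqOn_zero_of_setIntegral_smul_eq_zero hU (hE.sub he) fun χ hχ hc hs => ?_
  · exact fun x hx => sub_eq_zero.1 (this x hx)
  have hsm : ContDiffOn ℝ ∞ (fun y => χ y • v) U := (hχ.smul contDiff_const).contDiffOn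
  have h1 := hasDerivAt_setIntegral_family hU hc hs hL (contDiffOn_add_smul hf hsm)
    fun t x _ hxC => by simp [image_eq_zero_of_notMem_tsupport hxC]
  have h2 : EqOn (fun x => eulerExpr L (fun y => f y + (0 : ℝ) • χ y • v) x
      (fderiv ℝ (fun p : ℝ × 𝔼 => f p.2 + p.1 • χ p.2 • v) (0, x) (1, 0)))
      (fun x => χ x • eulerExpr L f x v) (tsupport χ) := fun x hx => by
    dsimp only
    rw [fderiv_add_smul hU hf hsm (hs hx)]
    simp only [zero_smul, add_zero]
    exact (isLinearMap_eulerExpr hU hL hf (hs hx)).map_smul _ _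
  rw [setIntegral_congr_fun hc.measurableSet h2] at h1
  have h3 := h1.unique (h χ hχ hc hs)
  have i1 : IntegrableOn (fun x => χ x • eulerExpr L f x v) (tsupport χ) :=
    ((hχ.continuous.continuousOn.smul hE).mono hs).integrableOn_compact' hc hc.measurableSet
  have i2 : IntegrableOn (fun x => χ x • e x) (tsupport χ) :=
    ((hχ.continuous.continuousOn.smul he).mono hs).integrableOn_compact' hc hc.measurableSet
  simp only [Pi.sub_apply, smul_sub]
  rw [integral_sub i1 i2, h3, sub_self]

end Variation

/-! ## Naturality of the Euler–Lagrange expression -/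

section Naturality

variable {n r r' : ℕ} {F F' V : Type*} [NormedAddCommGroup F] [NormedSpace ℝ F]
  [FiniteDimensional ℝ F] [NormedAddCommGroup F'] [NormedSpace ℝ F'] [FiniteDimensional ℝ F']
  [NormedAddCommGroup V] [NormedSpace ℝ V] [FiniteDimensional ℝ V]
  {U U' : Set (EuclideanSpace ℝ (Fin n))}

local notation "𝔼" => EuclideanSpace ℝ (Fin n)

theorem det_fderiv_ne_zero (hU : IsOpen U) (hU' : IsOpen U') {κ κ' : 𝔼 → 𝔼}
    (hκ : ContDiffOn ℝ ∞ κ U) (hκ' : ContDiffOn ℝ ∞ κ' U') (hm : MapsTo κ U U')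
    (hl : ∀ x ∈ U, κ' (κ x) = x) {x : 𝔼} (hx : x ∈ U) : (fderiv ℝ κ x).det ≠ 0 := by
  have h1 : DifferentiableAt ℝ κ x := (hκ.contDiffAt (hU.mem_nhds hx)).differentiableAt (by simp)
  have h2 : DifferentiableAt ℝ κ' (κ x) :=
    (hκ'.contDiffAt (hU'.mem_nhds (hm hx))).differentiableAt (by simp)
  have h3 : fderiv ℝ (κ' ∘ κ) x = ContinuousLinearMap.id ℝ 𝔼 := by
    have : κ' ∘ κ =ᶠ[𝓝 x] id := by filter_upwards [hU.mem_nhds hx] with y hy using hl y hy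
    rw [this.fderiv_eq, fderiv_id]
  rw [fderiv_comp _ h2 h1] at h3
  intro h0
  have h4 := congrArg ContinuousLinearMap.det h3
  have h5 : ((fderiv ℝ κ' (κ x)).comp (fderiv ℝ κ x)).det =
      (fderiv ℝ κ' (κ x)).det * (fderiv ℝ κ x).det := by
    simp [ContinuousLinearMap.det, LinearMap.det_comp]
  rw [h5, h0, mul_zero] at h4
  simp [ContinuousLinearMap.det] at h4

theorem continuousOn_det_fderiv (hU : IsOpen U) {κ : 𝔼 → 𝔼} (hκ : ContDiffOn ℝ ∞ κ U) :
    ContinuousOn (fun x => (fderiv ℝ κ x).det) U :=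
  ContinuousLinearMap.continuous_det.comp_continuousOn
    (hκ.continuousOn_fderiv_of_isOpen hU (by simp))

/-- The Euler–Lagrange expression of an `n`-form is natural with respect to fibre-preserving
maps covering diffeomorphisms of the base. -/
theorem eulerExpr_naturality (hU : IsOpen U) (hU' : IsOpen U') {κ κ' : 𝔼 → 𝔼}
    (hκ : ContDiffOn ℝ ∞ κ U) (hκ' : ContDiffOn ℝ ∞ κ' U') (hm : MapsTo κ U U')
    (hm' : MapsTo κ' U' U) (hl : ∀ x ∈ U, κ' (κ x) = x)
    (hr : ∀ y ∈ U', κ (κ' y) = y) {Ψ : 𝔼 × F → F'} (hΨ : ContDiffOn ℝ ∞ Ψ (U ×ˢ univ))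
    {L : 𝔼 × JetCoord n r F → V} (hL : ContDiffOn ℝ ∞ L (U ×ˢ univ))
    {L' : 𝔼 × JetCoord n r' F' → V} (hL' : ContDiffOn ℝ ∞ L' (U' ×ˢ univ))
    (H : ∀ f, ContDiffOn ℝ ∞ f U → ∀ x ∈ U, L (x, jetCoord r f x) =
      (fderiv ℝ κ x).det • L' (κ x, jetCoord r' (fun y => Ψ (κ' y, f (κ' y))) (κ x)))
    {f : 𝔼 → F} (hf : ContDiffOn ℝ ∞ f U) {x : 𝔼} (hx : x ∈ U) (v : F) :
    eulerExpr L f x v = (fderiv ℝ κ x).det • eulerExpr L' (fun y => Ψ (κ' y, f (κ' y))) (κ x)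
      (fderiv ℝ Ψ (x, f x) (0, v)) := by
  have hΨo : IsOpen (U ×ˢ (univ : Set F)) := hU.prod isOpen_univ
  -- Lagrangians transform with the determinant but integrals with its absolute value. Near `x` both
  -- differ by the constant sign `ε`, which cancels in the end.
  obtain ⟨ε, hε, hεx⟩ : ∃ ε : ℝ, ε * ε = 1 ∧ 0 < ε * (fderiv ℝ κ x).det := by
    rcases (det_fderiv_ne_zero hU hU' hκ hκ' hm hl hx).lt_or_gt with h | h
    · exact ⟨-1, by norm_num, by linarith⟩
    · exact ⟨1, by norm_num, by linarith⟩
  set U₁ := U ∩ {x | 0 < ε * (fderiv ℝ κ x).det} with hU₁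
  have hU₁o : IsOpen U₁ := ((continuousOn_const.mul
    (continuousOn_det_fderiv hU hκ)).isOpen_inter_preimage hU isOpen_Ioi)
  have hsub : U₁ ⊆ U := inter_subset_left
  have habs : ∀ x ∈ U₁, |(fderiv ℝ κ x).det| = ε * (fderiv ℝ κ x).det := by
    intro x hx
    have h1 : |ε| = 1 := by
      have : |ε| * |ε| = 1 := by rw [← abs_mul, hε, abs_one]
      nlinarith [abs_nonneg ε]
    have h2 : 0 < ε * (fderiv ℝ κ x).det := hx.2
    rw [← abs_of_pos h2, abs_mul, h1, one_mul]
  set s' : 𝔼 → F' := fun y => fderiv ℝ Ψ (κ' y, f (κ' y)) (0, v) with hs'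
  have hfκ : ContDiffOn ℝ ∞ (fun y => f (κ' y)) U' := hf.comp hκ' hm'
  have hf' : ContDiffOn ℝ ∞ (fun y => Ψ (κ' y, f (κ' y))) U' :=
    hΨ.comp (hκ'.prodMk hfκ) fun y hy => ⟨hm' hy, mem_univ _⟩
  have hs'c : ContinuousOn s' U' := (((contDiffOn_fderiv_apply hΨo hΨ (0, v)).comp
    (hκ'.prodMk hfκ)) fun y hy => ⟨hm' hy, mem_univ _⟩).continuousOn
  have hec : ContinuousOn (fun x => (fderiv ℝ κ x).det •
      eulerExpr L' (fun y => Ψ (κ' y, f (κ' y))) (κ x) (fderiv ℝ Ψ (x, f x) (0, v))) U := by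
    refine (continuousOn_det_fderiv hU hκ).smul ?_
    refine ((continuousOn_eulerExpr_field hU' hL' hf' hs'c).comp hκ.continuousOn hm).congr
      fun x hx => ?_
    simp only [Function.comp_apply, hs', hl x hx]
  refine eulerExpr_eq_of_integral hU₁o (hL.mono (prod_mono hsub subset_rfl)) (hf.mono hsub) v
    (hec.mono hsub) (fun χ hχ hc hs => ?_) x ⟨hx, hεx⟩
  have hsU := hs.trans hsub
  have hinj : InjOn κ (tsupport χ) := fun a ha b hb hab => by
    rw [← hl a (hsU ha), hab, hl b (hsU hb)]
  have hd : ∀ x ∈ tsupport χ, HasFDerivWithinAt κ (fderiv ℝ κ x) (tsupport χ) x := fun x hx =>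
    ((hκ.contDiffAt (hU.mem_nhds (hsU hx))).differentiableAt
      (by simp)).hasFDerivAt.hasFDerivWithinAt
  have hC' : IsCompact (κ '' tsupport χ) := hc.isCompact.image_of_continuousOn
    (hκ.continuousOn.mono hsU)
  have hC'U : κ '' tsupport χ ⊆ U' := (image_mono hsU).trans hm.image_subset
  have cov : ∀ g : 𝔼 → V, ∫ x in tsupport χ, (fderiv ℝ κ x).det • g (κ x) =
      ε • ∫ y in κ '' tsupport χ, g y := by
    intro g
    rw [integral_image_eq_integral_abs_det_fderiv_smul volume hc.measurableSet hd hinj,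
      ← integral_smul]
    refine setIntegral_congr_fun hc.measurableSet fun x hx => ?_
    rw [habs x (hs hx), smul_smul, ← mul_assoc, hε, one_mul]
  -- The test variation `f + t χ v`, transported to the target. It is not linear in `t`, which is
  -- why derivatives of the action were treated for general families.
  set Φ : ℝ × 𝔼 → F' := fun p => Ψ (κ' p.2, f (κ' p.2) + p.1 • χ (κ' p.2) • v) with hΦ
  have hχv : ContDiffOn ℝ ∞ (fun y => χ (κ' y) • v) U' :=
    (hχ.comp_contDiffOn hκ').smul contDiffOn_const
  have hΦs : ContDiffOn ℝ ∞ Φ (univ ×ˢ U') := by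
    refine hΨ.comp ((hκ'.comp contDiffOn_snd fun _ h => h.2).prodMk
      (contDiffOn_add_smul hfκ hχv)) fun p hp => ⟨hm' hp.2, mem_univ _⟩
  have hΦ0 : ∀ t, ∀ y ∈ U', y ∉ κ '' tsupport χ → Φ (t, y) = Φ (0, y) := by
    intro t y hy hyC
    have : χ (κ' y) = 0 := by
      by_contra h
      exact hyC ⟨κ' y, subset_tsupport _ h, hr y hy⟩
    simp [hΦ, this]
  have hD := (hasDerivAt_setIntegral_family hU' hC' hC'U hL' hΦs hΦ0).const_smul ε
  have e1 : (fun t : ℝ => ∫ x in tsupport χ, L (x, jetCoord r (fun y => f y + t • χ y • v) x)) =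
      fun t => ε • ∫ y in κ '' tsupport χ, L' (y, jetCoord r' (fun y => Φ (t, y)) y) := by
    funext t
    rw [← cov]
    refine setIntegral_congr_fun hc.measurableSet fun x hx => ?_
    exact H (fun y => f y + t • χ y • v) (hf.add (contDiff_const.smul
      (hχ.smul contDiff_const)).contDiffOn) x (hsU hx)
  -- The velocity of `Φ` at `t = 0` is `χ` times the vertical derivative of `Ψ`, by the chain rule.
  have e2 : ∫ x in tsupport χ, χ x • ((fderiv ℝ κ x).det • eulerExpr L'
      (fun y => Ψ (κ' y, f (κ' y))) (κ x) (fderiv ℝ Ψ (x, f x) (0, v))) =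
      ε • ∫ y in κ '' tsupport χ,
        eulerExpr L' (fun y => Φ (0, y)) y (fderiv ℝ Φ (0, y) (1, 0)) := by
    rw [← cov]
    refine setIntegral_congr_fun hc.measurableSet fun x hx => ?_
    have hΦf : (fun y => Φ (0, y)) = fun y => Ψ (κ' y, f (κ' y)) := by
      funext y; simp [hΦ]
    have hxU' := hm (hsU hx)
    have h1 : fderiv ℝ Φ (0, κ x) (1, 0) = χ x • fderiv ℝ Ψ (x, f x) (0, v) := by
      have hd1 := ((hΦs.contDiffAt ((isOpen_univ.prod hU').mem_nhds
        (show ((0 : ℝ), κ x) ∈ _ from ⟨mem_univ _, hxU'⟩))).differentiableAt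
          (by simp)).hasFDerivAt.comp_hasDerivAt (0 : ℝ)
        ((hasDerivAt_id (0 : ℝ)).prodMk (hasDerivAt_const (0 : ℝ) (κ x)))
      have hd2 : HasDerivAt (fun t : ℝ => (x, f x + t • χ x • v)) (0, (1 : ℝ) • χ x • v) 0 :=
        (hasDerivAt_const (0 : ℝ) x).prodMk
          (((hasDerivAt_id (0 : ℝ)).smul_const (χ x • v)).const_add (f x))
      have hd3 : HasFDerivAt Ψ (fderiv ℝ Ψ (x, f x)) (x, f x + (0 : ℝ) • χ x • v) := by
        rw [zero_smul, add_zero]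
        exact ((hΨ.contDiffAt (hΨo.mem_nhds ⟨hsU hx, mem_univ _⟩)).differentiableAt
          (by simp)).hasFDerivAt
      have hd4 := hd3.comp_hasDerivAt (0 : ℝ) hd2
      have he : (Φ ∘ fun t : ℝ => (id t, κ x)) = Ψ ∘ fun t : ℝ => (x, f x + t • χ x • v) := by
        funext t
        simp [hΦ, hl x (hsU hx)]
      rw [he] at hd1
      rw [hd1.unique hd4, one_smul, ← map_smul]
      simp
    rw [hΦf, h1, (isLinearMap_eulerExpr hU' hL' hf' hxU').map_smul, smul_comm]
  rw [e1, e2]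
  exact hD

/-- A variation supported in `C` changes each local operator `B j` only in `C`, so the change of the
divergence integrates to zero. -/
theorem integral_divergence_variation {B : Fin n → (𝔼 → F) → 𝔼 → V} (hU : IsOpen U)
    (hB : ∀ j, IsLocOp U r (B j)) {f s : 𝔼 → F} (hf : ContDiffOn ℝ ∞ f U)
    (hs : ContDiffOn ℝ ∞ s U) {C : Set 𝔼} (hC : IsCompact C) (hCU : C ⊆ U)
    (h0 : ∀ x ∈ U, x ∉ C → s x = 0) :
    ∫ x in C, ∑ j, fderiv ℝ (B j fun y => f y + s y) x (EuclideanSpace.single j (1 : ℝ)) =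
      ∫ x in C, ∑ j, fderiv ℝ (B j f) x (EuclideanSpace.single j (1 : ℝ)) := by
  have hfs := hf.add hs
  have hc1 : ∀ j (f : 𝔼 → F), ContDiffOn ℝ ∞ f U → IntegrableOn (fun x =>
      fderiv ℝ (B j f) x (EuclideanSpace.single j (1 : ℝ))) C := fun j f hf =>
    ((contDiffOn_fderiv_apply hU ((hB j).contDiffOn hU hf) _).continuousOn.mono
      hCU).integrableOn_compact' hC hC.measurableSet
  rw [integral_finsetSum _ fun j _ => hc1 j _ hfs, integral_finsetSum _ fun j _ => hc1 j f hf]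
  refine Finset.sum_congr rfl fun j _ => sub_eq_zero.1 ?_
  rw [← integral_sub (hc1 j _ hfs) (hc1 j f hf)]
  obtain ⟨L, hL, hBL⟩ := hB j
  have := (setIntegral_fderiv_eq_zero (g := fun x => B j (fun y => f y + s y) x - B j f x) hU hC hCU
    (((hB j).contDiffOn hU hfs).sub ((hB j).contDiffOn hU hf)) (fun x hx hxC => by
      have e : (fun y => f y + s y) =ᶠ[𝓝 x] f := by
        filter_upwards [hU.mem_nhds hx, hC.isClosed.isOpen_compl.mem_nhds hxC] with y hy hyC
        rw [h0 y hy hyC, add_zero]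
      rw [hBL _ hfs x hx, hBL _ hf x hx, jetCoord_congr e, sub_self])
      (EuclideanSpace.single j (1 : ℝ))).2
  rw [← this]
  refine setIntegral_congr_fun hC.measurableSet fun x hx => ?_
  have hd : ∀ (f : 𝔼 → F), ContDiffOn ℝ ∞ f U → DifferentiableAt ℝ (B j f) x := fun f hf =>
    (((hB j).contDiffOn hU hf).contDiffAt (hU.mem_nhds (hCU hx))).differentiableAt (by simp)
  have := fderiv_fun_sub (hd _ hfs) (hd _ hf)
  exact (DFunLike.congr_fun this _).symm

/-- The action of a divergence is constant along test variations. -/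
theorem eulerExpr_divergence (hU : IsOpen U) {B : Fin n → (𝔼 → F) → 𝔼 → V}
    (hB : ∀ j, IsLocOp U r' (B j)) {L : 𝔼 × JetCoord n r F → V}
    (hL : ContDiffOn ℝ ∞ L (U ×ˢ univ))
    (H : ∀ f, ContDiffOn ℝ ∞ f U → ∀ x ∈ U, L (x, jetCoord r f x) =
      ∑ j, fderiv ℝ (B j f) x (EuclideanSpace.single j (1 : ℝ)))
    {f : 𝔼 → F} (hf : ContDiffOn ℝ ∞ f U) {x : 𝔼} (hx : x ∈ U) (v : F) :
    eulerExpr L f x v = 0 := by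
  refine eulerExpr_eq_of_integral hU hL hf v (e := fun _ => 0) continuousOn_const
    (fun χ hχ hc hs => ?_) x hx
  simp only [smul_zero, integral_zero]
  convert hasDerivAt_const (0 : ℝ) (∫ x in tsupport χ, L (x, jetCoord r f x)) using 1
  funext t
  have hsm : ContDiffOn ℝ ∞ (fun y => t • χ y • v) U :=
    (contDiff_const.smul (hχ.smul contDiff_const)).contDiffOn
  rw [setIntegral_congr_fun hc.measurableSet fun x hx => H _ (hf.add hsm) x (hs hx),
    setIntegral_congr_fun hc.measurableSet fun x hx => H _ hf x (hs hx)]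
  exact integral_divergence_variation hU hB hf hsm hc hs fun x _ hxC => by
    simp [image_eq_zero_of_notMem_tsupport hxC]

/-- A linear differential operator whose values have vanishing integrals is a divergence. -/
theorem exists_eq_divergence_of_integral_eq_zero (hU : IsOpen U)
    {A : (𝔼 → ℝ) → 𝔼 → V} (hA : IsLocOp U r A)
    (hlin : ∀ (t : ℝ) (ρ : 𝔼 → ℝ), ContDiffOn ℝ ∞ ρ U → ∀ x ∈ U,
      A (fun y => t * ρ y) x = t • A ρ x)
    (hint : ∀ χ : 𝔼 → ℝ, ContDiff ℝ ∞ χ → HasCompactSupport χ → tsupport χ ⊆ U →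
      ∫ x in tsupport χ, A χ x = 0) :
    ∃ P : Fin n → (𝔼 → ℝ) → 𝔼 → V,
      (∀ j, IsLocOp U (r + r) (P j)) ∧
      (∀ j ρ x, (∀ᶠ y in 𝓝 x, ρ y = 0) → P j ρ x = 0) ∧
      ∀ ρ, ContDiffOn ℝ ∞ ρ U → ∀ x ∈ U,
        A ρ x = ∑ j, fderiv ℝ (P j ρ) x (EuclideanSpace.single j (1 : ℝ)) := by
  obtain ⟨L, hL, hAL⟩ := hA
  obtain ⟨P, hP, hP0, -, hPe⟩ := exists_firstVariation_field hU hL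
  have h0 : ContDiffOn ℝ ∞ (fun _ : 𝔼 => (0 : ℝ)) U := contDiffOn_const
  -- By homogeneity the action along `t χ` is `t` times an integral that vanishes by hypothesis, so
  -- the Euler–Lagrange expression at the zero function is zero.
  have hE : ∀ x ∈ U, eulerExpr L (fun _ => 0) x 1 = 0 := by
    refine eulerExpr_eq_of_integral hU hL h0 1 (e := fun _ => 0) continuousOn_const
      fun χ hχ hc hs => ?_
    simp only [smul_zero, integral_zero]
    convert hasDerivAt_const (0 : ℝ) (0 : V) using 1
    funext t
    have h2 : t • ∫ x in tsupport χ, A χ x = 0 := by rw [hint χ hχ hc hs, smul_zero]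
    rw [← h2, ← integral_smul]
    refine setIntegral_congr_fun hc.measurableSet fun x hx => ?_
    rw [← hlin t χ hχ.contDiffOn x (hs hx), hAL _ (contDiff_const.mul hχ).contDiffOn x (hs hx)]
    simp [smul_eq_mul]
  let T : ℝ →L[ℝ] ℝ × ℝ := ContinuousLinearMap.inr ℝ ℝ ℝ
  refine ⟨fun j ρ => P j fun y => T (ρ y), fun j => (hP j).comp_left hU T,
    fun j ρ x hx => hP0 j _ x (by filter_upwards [hx] with y hy; simp [T, hy]),
    fun ρ hρ x hx => ?_⟩
  -- The first variation formula at the zero function in the direction `ρ`.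
  have h1 := hPe _ _ h0 hρ x hx
  have h2 : eulerExpr L (fun _ => 0) x (ρ x) = 0 := by
    have := (isLinearMap_eulerExpr hU hL h0 hx).map_smul (ρ x) 1
    rwa [hE x hx, smul_zero, smul_eq_mul, mul_one] at this
  rw [h2, zero_add] at h1
  refine Eq.trans ?_ h1
  -- Since `A` is homogeneous, its derivative at zero in the direction `ρ` is `A ρ` itself. Thus the
  -- first variation is already the claim.
  have h3 := hasDerivAt_comp_jetCoord_param hU hL (contDiffOn_add_smul h0 hρ) hx 0
  have h4 : (fun t : ℝ => L (x, jetCoord r (fun y => (0 : ℝ) + t • ρ y) x)) =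
      fun t => t • A ρ x := by
    funext t
    rw [← hlin t ρ hρ x hx, hAL _ (contDiffOn_const.mul hρ) x hx]
    simp [smul_eq_mul]
  rw [h4] at h3
  have h5 := h3.unique ((hasDerivAt_id (0 : ℝ)).smul_const (A ρ x))
  rw [one_smul] at h5
  rw [← h5]
  have e : (fun y => fderiv ℝ (fun p : ℝ × 𝔼 => (0 : ℝ) + p.1 • ρ p.2) (0, y) (1, 0)) =ᶠ[𝓝 x]
      ρ := by
    filter_upwards [hU.mem_nhds hx] with y hy using fderiv_add_smul hU h0 hρ hy
  rw [jetCoord_congr e]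
  simp

end Naturality

/-! ## Sections with prescribed coordinate expressions, horizontal forms -/

section Forms

variable {n : ℕ} {X : Type*} [NormedAddCommGroup X] [NormedSpace ℝ X]

local notation "𝔼" => EuclideanSpace ℝ (Fin n)

/-- The inclusion of alternating into multilinear maps has a left inverse, which is continuous by
finite dimension. -/
theorem contDiffOn_cov_iff {k : ℕ} {g : X → Cov n k} {s : Set X} : ContDiffOn ℝ ∞ g s ↔
    ContDiffOn ℝ ∞ (fun x => (g x).toContinuousMultilinearMap) s := by
  let ι : Cov n k →ₗ[ℝ] (EuclideanSpace ℝ (Fin n) [×k]→L[ℝ] ℝ) :=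
    { toFun := fun f => f.toContinuousMultilinearMap
      map_add' := fun _ _ => rfl
      map_smul' := fun _ _ => rfl }
  have hι : LinearMap.ker ι = ⊥ := LinearMap.ker_eq_bot.2 fun _ _ h =>
    ContinuousAlternatingMap.toContinuousMultilinearMap_injective h
  obtain ⟨l, hl⟩ := ι.exists_leftInverse_of_injective hι
  refine ⟨fun h => ι.toContinuousLinearMap.contDiff.comp_contDiffOn h, fun h => ?_⟩
  refine (l.toContinuousLinearMap.contDiff.comp_contDiffOn h).congr fun x _ => ?_
  exact (DFunLike.congr_fun hl (g x)).symm

theorem contDiffOn_comp_clm {k : ℕ} {g : X → Cov n k} {T : X → 𝔼 →L[ℝ] 𝔼} {s : Set X}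
    (hg : ContDiffOn ℝ ∞ g s) (hT : ContDiffOn ℝ ∞ T s) :
    ContDiffOn ℝ ∞ (fun x => (g x).compContinuousLinearMap (T x)) s := by
  rw [contDiffOn_cov_iff] at hg ⊢
  have h : ContDiff ℝ ∞ fun T : Fin k → (𝔼 →L[ℝ] 𝔼) =>
      ContinuousMultilinearMap.compContinuousLinearMapContinuousMultilinear ℝ
        (fun _ : Fin k => 𝔼) (fun _ => 𝔼) ℝ T := ContinuousMultilinearMap.contDiff _
  have h2 : ContDiffOn ℝ ∞ (fun x => (fun _ : Fin k => T x)) s := contDiffOn_pi.2 fun _ => hT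
  exact (h.comp_contDiffOn h2).clm_apply hg

theorem extDeriv_add_apply {k : ℕ} {g g' : 𝔼 → Cov n k} {x : 𝔼} (hg : DifferentiableAt ℝ g x)
    (hg' : DifferentiableAt ℝ g' x) :
    extDeriv (fun y => g y + g' y) x = extDeriv g x + extDeriv g' x := extDeriv_add hg hg'

/-- The exterior derivative is a fixed linear image, the alternatization, of `∑ dx^i ⊗ ∂_i A`, so
the statement reduces to total derivatives. -/
theorem isLocOp_extDeriv {F : Type*} [NormedAddCommGroup F] [NormedSpace ℝ F] {k r : ℕ}
    {U : Set 𝔼} (hU : IsOpen U) {A : (𝔼 → F) → 𝔼 → Cov n k} (hA : IsLocOp U r A) :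
    IsLocOp U (r + 1) fun f x => extDeriv (A f) x := by
  have h1 : IsLocOp U (r + 1) fun f x => ∑ i, (EuclideanSpace.proj (𝕜 := ℝ) i).smulRight
      (fderiv ℝ (A f) x (EuclideanSpace.single i (1 : ℝ))) := by
    refine IsLocOp.sum _ fun i _ => ?_
    exact (hA.fderiv hU (EuclideanSpace.single i (1 : ℝ))).map_contDiff
      (g := fun a => (EuclideanSpace.proj (𝕜 := ℝ) i : 𝔼 →L[ℝ] ℝ).smulRight a)
      (contDiff_const.smulRight contDiff_id)
  refine (h1.clm (ContinuousAlternatingMap.alternatizeUncurryFinCLM ℝ 𝔼 ℝ)).congr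
    fun f _ x _ => ?_
  change ContinuousAlternatingMap.alternatizeUncurryFinCLM ℝ 𝔼 ℝ (fderiv ℝ (A f) x) = _
  congr 1
  ext1 v
  simp only [_root_.sum_apply, ContinuousLinearMap.smulRight_apply]
  conv_lhs => rw [← (EuclideanSpace.basisFun (Fin n) ℝ).sum_repr v]
  simp

end Forms

section Sections

variable {n : ℕ} {M : Type*} [TopologicalSpace M] [ChartedSpace (EuclideanSpace ℝ (Fin n)) M]
  [IsManifold (𝓡 n) ∞ M]
  {F : Type*} [NormedAddCommGroup F] [NormedSpace ℝ F] [FiniteDimensional ℝ F]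
  {E : M → Type*} [TopologicalSpace (TotalSpace F E)] [∀ p, TopologicalSpace (E p)]
  [∀ p, AddCommGroup (E p)] [∀ p, Module ℝ (E p)] [FiberBundle F E] [VectorBundle ℝ F E]
  [ContMDiffVectorBundle ∞ F E (𝓡 n)]

local notation "cht" => chartAt (EuclideanSpace ℝ (Fin n))
local notation "𝔼" => EuclideanSpace ℝ (Fin n)

theorem rep_add (φ ψ : Sec n F E) {q : M} {x : 𝔼} (hx : x ∈ coordDom n F E q) :
    (φ + ψ : Sec n F E).rep q x = φ.rep q x + ψ.rep q x :=
  ((trivializationAt F E q).linear ℝ hx.2).map_add _ _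

theorem rep_smul (c : ℝ) (φ : Sec n F E) {q : M} {x : 𝔼} (hx : x ∈ coordDom n F E q) :
    (c • φ : Sec n F E).rep q x = c • φ.rep q x :=
  ((trivializationAt F E q).linear ℝ hx.2).map_smul _ _

theorem rep_zero {q : M} {x : 𝔼} (hx : x ∈ coordDom n F E q) :
    (0 : Sec n F E).rep q x = 0 :=
  ((trivializationAt F E q).linear ℝ hx.2).map_zero

theorem rep_eq_zero_iff (φ : Sec n F E) {q : M} {x : 𝔼} (hx : x ∈ coordDom n F E q) :
    φ.rep q x = 0 ↔ φ ((cht q).symm x) = 0 := by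
  refine ⟨fun h => ?_, fun h => ?_⟩
  · have := (trivializationAt F E q).symmₗ_linearMapAt (R := ℝ) hx.2 (φ ((cht q).symm x))
    rw [(trivializationAt F E q).coe_linearMapAt_of_mem (R := ℝ) hx.2] at this
    change (trivializationAt F E q).symmₗ ℝ _ (φ.rep q x) = _ at this
    rw [← this, h, map_zero]
  · rw [Sec.rep, h]
    exact ((trivializationAt F E q).linear ℝ hx.2).map_zero

theorem Sec.CompactSupport.of_forall_notMem [T2Space M] {φ : Sec n F E} {K : Set M}
    (hK : IsCompact K) (h : ∀ p ∉ K, φ p = 0) : φ.CompactSupport :=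
  hK.of_isClosed_subset isClosed_closure (hK.isClosed.closure_subset_iff.2 fun p hp => by
    by_contra hpK
    exact hp (h p hpK))

theorem Sec.CompactSupport.exists_compact {φ : Sec n F E} (h : φ.CompactSupport) :
    ∃ K : Set M, IsCompact K ∧ ∀ p ∉ K, φ p = 0 :=
  ⟨_, h, fun p hp => by
    by_contra h0
    exact hp (subset_closure h0)⟩

/-- The section `φ + t s`. -/
def SecC.addSMul [T2Space M] (φ : SecC n F E) (t : ℝ) (s : SecC n F E) : SecC n F E :=
  ⟨φ.1 + t • s.1, by
    obtain ⟨K, hK, h⟩ := φ.2.exists_compact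
    obtain ⟨K', hK', h'⟩ := s.2.exists_compact
    refine .of_forall_notMem (hK.union hK') fun p hp => ?_
    rw [mem_union, not_or] at hp
    simp [h p hp.1, h' p hp.2]⟩

theorem isCompact_image_chart_symm {q : M} {C : Set 𝔼} (hC : IsCompact C)
    (hCq : C ⊆ (cht q).target) : IsCompact ((cht q).symm '' C) :=
  hC.image_of_continuousOn ((cht q).continuousOn_symm.mono hCq)

/-- Extension by zero. In a Hausdorff manifold the image of `C` is closed, so the section is zero
near every point outside of it. -/
theorem exists_sec_of_coord [T2Space M] (q : M) {C : Set 𝔼} (hC : IsCompact C)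
    (hCq : C ⊆ coordDom n F E q) {f : 𝔼 → F} (hf : ContDiffOn ℝ ∞ f (coordDom n F E q))
    (h0 : ∀ x ∈ coordDom n F E q, x ∉ C → f x = 0) :
    ∃ φ : SecC n F E, (∀ x ∈ coordDom n F E q, φ.1.rep q x = f x) ∧
      ∀ p ∉ (cht q).symm '' C, φ.1 p = 0 := by
  classical
  have hK : IsCompact ((cht q).symm '' C) :=
    isCompact_image_chart_symm hC fun x hx => (hCq hx).1
  let σ : ∀ p, E p := fun p => if p ∈ dom (n := n) F E q then
    (trivializationAt F E q).symm p (f (cht q p)) else 0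
  have hσ0 : ∀ p ∉ (cht q).symm '' C, σ p = 0 := by
    intro p hp
    by_cases h : p ∈ dom (n := n) F E q
    · have hfp : f (cht q p) = 0 := h0 _ (chart_mem_coordDom h) fun hc =>
        hp ⟨cht q p, hc, (cht q).left_inv h.1⟩
      simp only [σ, h, if_true, hfp]
      rw [← (trivializationAt F E q).coe_symmₗ (R := ℝ) h.2]
      exact map_zero _
    · simp [σ, h]
  have hsm : ContMDiff (𝓡 n) ((𝓡 n).prod 𝓘(ℝ, F)) ∞
      (fun p => (⟨p, σ p⟩ : TotalSpace F E)) := by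
    intro p
    by_cases h : p ∈ (cht q).symm '' C
    · obtain ⟨x, hx, rfl⟩ := h
      have hpd := chart_symm_mem_dom (E := E) (hCq hx)
      have h1 : ContMDiffAt (𝓡 n) 𝓘(ℝ, 𝔼 × F) ∞
          (fun p => (cht q p, f (cht q p))) ((cht q).symm x) := by
        have hc : ContMDiffAt (𝓡 n) 𝓘(ℝ, 𝔼) ∞ (cht q) ((cht q).symm x) :=
          contMDiffOn_chart.contMDiffAt ((cht q).open_source.mem_nhds hpd.1)
        have hg : ContDiffAt ℝ ∞ (fun x => (x, f x)) (cht q ((cht q).symm x)) := by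
          rw [(cht q).right_inv (hCq hx).1]
          exact contDiffAt_id.prodMk (hf.contDiffAt ((isOpen_coordDom q).mem_nhds (hCq hx)))
        exact ContMDiffAt.comp _ (contMDiffAt_iff_contDiffAt.2 hg) hc
      have h2 : ContMDiffAt 𝓘(ℝ, 𝔼 × F) ((𝓡 n).prod 𝓘(ℝ, F)) ∞
          (ofCoord (n := n) (F := F) (E := E) q)
          (cht q ((cht q).symm x), f (cht q ((cht q).symm x))) :=
        (contMDiffOn_ofCoord q).contMDiffAt (((isOpen_coordDom q).prod isOpen_univ).mem_nhds
          ⟨chart_mem_coordDom hpd, mem_univ _⟩)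
      refine (ContMDiffAt.comp (f := fun p => (cht q p, f (cht q p))) ((cht q).symm x) h2
        h1).congr_of_eventuallyEq ?_
      filter_upwards [(isOpen_dom q).mem_nhds hpd] with p hp
      simp only [Function.comp_apply, ofCoord, σ, hp, if_true]
      rw [(cht q).left_inv hp.1]
      exact (trivializationAt F E q).mk_symm hp.2 _
    · refine (contMDiff_zeroSection ℝ E p).congr_of_eventuallyEq ?_
      filter_upwards [hK.isClosed.isOpen_compl.mem_nhds h] with p' hp'
      simp only [zeroSection]
      rw [hσ0 p' hp']
  refine ⟨⟨⟨σ, hsm⟩, .of_forall_notMem hK hσ0⟩, fun x hx => ?_, hσ0⟩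
  have hpd := chart_symm_mem_dom (E := E) hx
  change (trivializationAt F E q ⟨_, σ _⟩).2 = _
  simp only [σ, hpd, if_true]
  rw [(trivializationAt F E q).apply_mk_symm hpd.2, (cht q).right_inv hx.1]

/-- A function on an open subset of the coordinate domain is the coordinate expression of a section
near a given point. -/
theorem exists_secC_rep_eventuallyEq [T2Space M] (q : M) {U : Set 𝔼} (hU : IsOpen U)
    (hUq : U ⊆ coordDom n F E q) {f : 𝔼 → F} (hf : ContDiffOn ℝ ∞ f U) {x : 𝔼} (hx : x ∈ U) :
    ∃ φ : SecC n F E, φ.1.rep q =ᶠ[𝓝 x] f := by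
  obtain ⟨W, hW, hxW, hWU⟩ := exists_compact_subset hU hx
  obtain ⟨ε, hε, hεW⟩ := Metric.mem_nhds_iff.1 (mem_interior_iff_mem_nhds.1 hxW)
  -- The outer radius `ε / 2` keeps the closed support inside the ball of radius `ε`, which lies in
  -- the compact set `W`.
  let b : ContDiffBump x := ⟨ε / 4, ε / 2, by positivity, by linarith⟩
  have hbs : tsupport b ⊆ W := by
    rw [b.tsupport_eq]
    exact (Metric.closedBall_subset_ball (by simp only [b]; linarith)).trans hεW
  have hbf : ContDiffOn ℝ ∞ (fun y => b y • f y) (coordDom n F E q) := by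
    intro y _
    by_cases hy : y ∈ U
    · exact (b.contDiff.contDiffAt.smul (hf.contDiffAt (hU.mem_nhds hy))).contDiffWithinAt
    · have hy' : y ∉ tsupport b := fun h => hy (hWU (hbs h))
      refine ContDiffAt.contDiffWithinAt ((contDiffAt_const (c := (0 : F))).congr_of_eventuallyEq ?_)
      filter_upwards [(isClosed_tsupport b).isOpen_compl.mem_nhds hy'] with z hz
      rw [image_eq_zero_of_notMem_tsupport hz, zero_smul]
  obtain ⟨φ, hφ, -⟩ := exists_sec_of_coord q hW (hWU.trans hUq) hbf fun y _ hyW => by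
    rw [image_eq_zero_of_notMem_tsupport fun h => hyW (hbs h), zero_smul]
  refine ⟨φ, ?_⟩
  filter_upwards [b.eventuallyEq_one, hU.mem_nhds hx] with y hy hyU
  rw [hφ y (hUq hyU), hy]
  simp

theorem jet_eq_of_rep_eventuallyEq {φ ψ : Sec n F E} {q p : M} (hp : p ∈ dom (n := n) F E q)
    (h : φ.rep q =ᶠ[𝓝 (cht q p)] ψ.rep q) : φ.jet p = ψ.jet p := by
  refine congrArg (Sigma.mk p) (Quotient.sound fun k => ?_)
  have h1 := jetCoord_change (E := E) k φ hp (mem_dom_self p)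
  have h2 := jetCoord_change (E := E) k ψ hp (mem_dom_self p)
  rw [jetCoord_congr h, ← h2] at h1
  exact congrFun h1 (Fin.last k)

theorem jet_eq_of_eventuallyEq {φ ψ : Sec n F E} {p : M} (h : ∀ᶠ p' in 𝓝 p, φ p' = ψ p') :
    φ.jet p = ψ.jet p := by
  refine jet_eq_of_rep_eventuallyEq (mem_dom_self p) ?_
  have hc : Filter.Tendsto (cht p).symm (𝓝 (cht p p)) (𝓝 p) := by
    have := (cht p).continuousAt_symm (mem_chart_target _ p)
    rwa [ContinuousAt, (cht p).left_inv (mem_chart_source _ p)] at this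
  filter_upwards [hc.eventually h] with x hx
  simp only [Sec.rep, hx]

/-- Cutting a section off does not change its jet at `p`. Hence forms on the jet bundle are
determined by compactly supported sections, the only ones that functionals see. -/
theorem exists_secC_jet [T2Space M] (φ : Sec n F E) (p : M) :
    ∃ ψ : SecC n F E, ψ.1.jet p = φ.jet p := by
  obtain ⟨ψ, hψ⟩ := exists_secC_rep_eventuallyEq (E := E) p (isOpen_coordDom p) subset_rfl
    (contDiffOn_rep φ p) (chart_mem_coordDom (mem_dom_self p))
  exact ⟨ψ, jet_eq_of_rep_eventuallyEq (mem_dom_self p) hψ⟩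

theorem exists_secC_jet_eq [T2Space M] (j : InfJet n F E) :
    ∃ (ψ : SecC n F E) (p : M), ψ.1.jet p = j := by
  obtain ⟨ψ, hψ⟩ := exists_secC_jet (InfJet.repr j) j.1
  exact ⟨ψ, j.1, hψ.trans (repr_jet j)⟩

end Sections

/-! ## Coordinate representations of functions and forms on the jet bundle -/

section Representations

variable {n : ℕ} {M : Type*} [TopologicalSpace M] [ChartedSpace (EuclideanSpace ℝ (Fin n)) M]
  [IsManifold (𝓡 n) ∞ M]
  {F : Type*} [NormedAddCommGroup F] [NormedSpace ℝ F] [FiniteDimensional ℝ F]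
  {E : M → Type*} [TopologicalSpace (TotalSpace F E)] [∀ p, TopologicalSpace (E p)]
  [∀ p, AddCommGroup (E p)] [∀ p, Module ℝ (E p)] [FiberBundle F E] [VectorBundle ℝ F E]
  [ContMDiffVectorBundle ∞ F E (𝓡 n)]
  {V W : Type*} [NormedAddCommGroup V] [NormedSpace ℝ V] [NormedAddCommGroup W] [NormedSpace ℝ W]

local notation "cht" => chartAt (EuclideanSpace ℝ (Fin n))
local notation "𝔼" => EuclideanSpace ℝ (Fin n)

/-- Over `U`, the function `B` is the smooth function `L` of the jet coordinates at `q`. -/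
def RepOn (q : M) (B : InfJet n F E → V) (r : ℕ) (U : Set 𝔼) (L : 𝔼 × JetCoord n r F → V) :
    Prop :=
  ContDiffOn ℝ ∞ L (U ×ˢ univ) ∧ ∀ (φ : Sec n F E), ∀ x ∈ U,
    B (φ.jet ((cht q).symm x)) = L (x, jetCoord r (φ.rep q) x)

theorem RepOn.mono {q : M} {B : InfJet n F E → V} {r : ℕ} {U U' : Set 𝔼}
    {L : 𝔼 × JetCoord n r F → V} (h : RepOn q B r U L) (hU : U' ⊆ U) : RepOn q B r U' L :=
  ⟨h.1.mono (prod_mono hU subset_rfl), fun φ x hx => h.2 φ x (hU hx)⟩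

theorem RepOn.raise {q : M} {B : InfJet n F E → V} {r s : ℕ} {U : Set 𝔼}
    {L : 𝔼 × JetCoord n r F → V} (h : RepOn q B r U L) (hrs : r ≤ s) :
    RepOn q B s U fun z => L (z.1, jetTrunc F hrs z.2) :=
  ⟨h.1.comp (contDiffOn_fst.prodMk ((jetTrunc F hrs).contDiff.comp_contDiffOn contDiffOn_snd))
    fun _ hz => ⟨hz.1, mem_univ _⟩, fun φ x hx => h.2 φ x hx⟩

theorem RepOn.contDiffOn {q : M} {B : InfJet n F E → V} {r : ℕ} {U : Set 𝔼}
    {L : 𝔼 × JetCoord n r F → V} (h : RepOn q B r U L) (hU : IsOpen U)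
    (hUq : U ⊆ coordDom n F E q) (φ : Sec n F E) :
    ContDiffOn ℝ ∞ (fun x => B (φ.jet ((cht q).symm x))) U :=
  (contDiffOn_comp_jetCoord hU h.1 ((contDiffOn_rep φ q).mono hUq)).congr fun x hx => h.2 φ x hx

theorem exists_repOn_of_isLocOp {q : M} {B : InfJet n F E → V} {r : ℕ} {U : Set 𝔼}
    (hUq : U ⊆ coordDom n F E q) {A : (𝔼 → F) → 𝔼 → V} (hA : IsLocOp U r A)
    (h : ∀ (φ : Sec n F E), ∀ x ∈ U, B (φ.jet ((cht q).symm x)) = A (φ.rep q) x) :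
    ∃ L, RepOn q B r U L := by
  obtain ⟨L, hL, hA⟩ := hA
  exact ⟨L, hL, fun φ x hx => (h φ x hx).trans (hA _ ((contDiffOn_rep φ q).mono hUq) x hx)⟩

theorem isLocalRep_iff_repOn {q : M} {B : InfJet n F E → V} {r : ℕ}
    {L : 𝔼 × JetCoord n r F → V} :
    IsLocalRep q B r L ↔ RepOn q B r (coordDom n F E q) L := by
  refine and_congr_right fun _ => ⟨fun h φ x hx => ?_, fun h φ p hp => ?_⟩
  · rw [h φ _ (chart_symm_mem_dom hx), (cht q).right_inv hx.1]
  · have := h φ _ (chart_mem_coordDom hp)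
    rwa [(cht q).left_inv hp.1] at this

theorem isLocal_iff_repOn {B : M → InfJet n F E → V} :
    IsLocal B ↔ ∃ r : ℕ, ∀ q, ∃ L, RepOn q (B q) r (coordDom n F E q) L := by
  simp only [IsLocal, isLocalRep_iff_repOn]

theorem isHorizontal_iff_repOn {k : ℕ} {α : PreForm n F E k} :
    IsHorizontal α ↔ ∃ r : ℕ, ∀ q, ∃ L, RepOn q (comp q α) r (coordDom n F E q) L :=
  isLocal_iff_repOn

/-- The form `α` is given by local functions of order at most `r` near each point. -/
def LocallyHorizontal {k : ℕ} (r : ℕ) (α : PreForm n F E k) : Prop :=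
  ∀ p : M, ∃ (q : M) (U : Set 𝔼) (L : 𝔼 × JetCoord n r F → Cov n k), IsOpen U ∧
    U ⊆ coordDom n F E q ∧ p ∈ dom (n := n) F E q ∧ cht q p ∈ U ∧ RepOn q (comp q α) r U L

theorem RepOn.change {k r : ℕ} {α : PreForm n F E k} {q : M} {U : Set 𝔼}
    {L : 𝔼 × JetCoord n r F → Cov n k} (h : RepOn q (comp q α) r U L)
    (q' : M) :
    RepOn q' (comp q' α) r (overlap (n := n) (F := F) (E := E) q' q ∩ transition q' q ⁻¹' U)
      (fun z => (L (transition q' q z.1, jetChange E r q' q z)).compContinuousLinearMap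
        (fderiv ℝ (transition q' q) z.1)) := by
  constructor
  · refine contDiffOn_comp_clm (h.1.comp (ContDiffOn.prodMk
      ((contDiffOn_transition_overlap (F := F) (E := E) q' q).comp contDiffOn_fst
        fun z hz => hz.1.1)
      ((contDiffOn_jetChange (E := E) r q' q).mono fun z hz => ⟨hz.1.1, mem_univ _⟩))
      fun z hz => ⟨hz.1.2, mem_univ _⟩) ?_
    exact ((contDiffOn_transition_overlap (F := F) (E := E) q' q).fderiv_of_isOpen
      (isOpen_overlap q' q) (by simp)).comp contDiffOn_fst fun z hz => hz.1.1
  · intro φ x hx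
    have hp := hx.1.2
    have hp' := chart_symm_mem_dom hx.1.1
    have h1 := h.2 φ _ hx.2
    have hxp : cht q' ((cht q').symm x) = x := (cht q').right_inv hx.1.1.1
    have h2 : (cht q).symm (transition q' q x) = (cht q').symm x := by
      simp only [transition, Function.comp_apply]
      exact (cht q).left_inv hp.1
    rw [h2] at h1
    have h3 := jetCoord_change (E := E) r φ hp' hp
    rw [hxp] at h3
    change toChart q' ((cht q').symm x) _ = _
    rw [toChart_change q' q hp'.1 hp.1, hxp]
    change (comp q α (φ.jet ((cht q').symm x))).compContinuousLinearMap _ = _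
    rw [h1]
    dsimp only
    rw [← h3]
    rfl

/-- Local representatives of one common order can be glued by a partition of unity on the
finite-dimensional coordinate jet space, because the condition on a value is convex. -/
theorem LocallyHorizontal.exists_repOn {k r : ℕ} {α : PreForm n F E k}
    (h : LocallyHorizontal r α) (q : M) : ∃ L, RepOn q (comp q α) r (coordDom n F E q) L := by
  classical
  let O : TopologicalSpace.Opens (𝔼 × JetCoord n r F) :=
    ⟨coordDom n F E q ×ˢ univ, (isOpen_coordDom q).prod isOpen_univ⟩
  -- The admissible values at `z` are a single covector if `z` is the jet of a section. Coordinates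
  -- that come from no section, such as non-symmetric tensors, impose no condition.
  let t : O → Set (Cov n k) := fun z => {ℓ | ∀ (φ : Sec n F E),
    jetCoord r (φ.rep q) z.1.1 = z.1.2 → comp q α (φ.jet ((cht q).symm z.1.1)) = ℓ}
  have ht : ∀ z, Convex ℝ (t z) := by
    intro z a ha b hb c d _ _ hcd φ hφ
    rw [← ha φ hφ, ← hb φ hφ, ← add_smul, hcd, one_smul]
  have : LocallyCompactSpace O := O.2.locallyCompactSpace
  obtain ⟨g, hg⟩ := exists_contMDiffMap_forall_mem_convex_of_local (n := ⊤)
    𝓘(ℝ, 𝔼 × JetCoord n r F) ht fun z => by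
      obtain ⟨q', U, L, hU, hUq, hp, hpU, hL⟩ := h ((cht q).symm z.1.1)
      obtain ⟨L', hL'⟩ : ∃ L', RepOn q (comp q α) r _ L' := ⟨_, hL.change q⟩
      set U' := overlap (n := n) (F := F) (E := E) q q' ∩ transition q q' ⁻¹' U with hU'
      have hU'o : IsOpen U' := (contDiffOn_transition_overlap
        q q').continuousOn.isOpen_inter_preimage (isOpen_overlap q q') hU
      have hz : z.1.1 ∈ U' := ⟨⟨z.2.1, hp⟩, hpU⟩
      refine ⟨{y : O | y.1.1 ∈ U'}, (hU'o.preimage (continuous_fst.comp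
        continuous_subtype_val)).mem_nhds hz, fun y => L' y.1, ?_, ?_⟩
      rotate_left
      · intro y hy φ hφ
        exact (hL'.2 φ y.1.1 hy).trans (by rw [hφ])
      · intro y hy
        refine ContMDiffAt.contMDiffWithinAt ?_
        have := hL'.1.contDiffAt ((hU'o.prod isOpen_univ).mem_nhds
          (show y.1 ∈ _ from ⟨hy, mem_univ _⟩))
        exact contMDiffAt_subtype_iff.2 (contMDiffAt_iff_contDiffAt.2 this)
  refine ⟨fun z => if hz : z ∈ O then g ⟨z, hz⟩ else 0, fun z hz => ?_, fun φ x hx => ?_⟩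
  · refine ContDiffAt.contDiffWithinAt (contMDiffAt_iff_contDiffAt.1 ?_)
    have := g.contMDiff ⟨z, hz⟩
    refine (contMDiffAt_subtype_iff (U := O) (x := ⟨z, hz⟩)).1 ?_
    refine this.congr_of_eventuallyEq (Filter.Eventually.of_forall fun y => ?_)
    exact dif_pos y.2
  · have hm : (x, jetCoord r (φ.rep q) x) ∈ O := ⟨hx, mem_univ _⟩
    dsimp only
    rw [dif_pos hm]
    exact hg ⟨_, hm⟩ φ rfl

theorem LocallyHorizontal.isHorizontal {k r : ℕ} {α : PreForm n F E k}
    (h : LocallyHorizontal r α) : IsHorizontal α :=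
  isHorizontal_iff_repOn.2 ⟨r, h.exists_repOn⟩

theorem LocallyHorizontal.zero {k r : ℕ} : LocallyHorizontal r (0 : PreForm n F E k) := fun p =>
  ⟨p, coordDom n F E p, fun _ => 0, isOpen_coordDom p, subset_rfl, mem_dom_self p,
    chart_mem_coordDom (mem_dom_self p), contDiffOn_const, fun _ _ _ => map_zero (toChartL k p _)⟩

theorem LocallyHorizontal.add {k r : ℕ} {α β : PreForm n F E k} (hα : LocallyHorizontal r α)
    (hβ : LocallyHorizontal r β) : LocallyHorizontal r (α + β) := fun p => by
  obtain ⟨L, hL⟩ := hα.exists_repOn p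
  obtain ⟨L', hL'⟩ := hβ.exists_repOn p
  refine ⟨p, coordDom n F E p, fun z => L z + L' z, isOpen_coordDom p, subset_rfl, mem_dom_self p,
    chart_mem_coordDom (mem_dom_self p), hL.1.add hL'.1, fun φ x hx => ?_⟩
  dsimp only
  rw [← hL.2 φ x hx, ← hL'.2 φ x hx]
  exact map_add (toChartL k p _) _ _

theorem LocallyHorizontal.sum {k r : ℕ} {ι : Type*} (t : Finset ι) {α : ι → PreForm n F E k}
    (h : ∀ i ∈ t, LocallyHorizontal r (α i)) : LocallyHorizontal r (∑ i ∈ t, α i) := by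
  classical
  induction t using Finset.induction_on with
  | empty => exact .zero
  | insert i t hi ih =>
    rw [Finset.sum_insert hi]
    exact (h i (Finset.mem_insert_self i t)).add
      (ih fun i' hi' => h i' (Finset.mem_insert_of_mem hi'))

theorem LocallyHorizontal.congr {k r : ℕ} {α : PreForm n F E k}
    (h : ∀ p : M, ∃ β : PreForm n F E k, LocallyHorizontal r β ∧
      ∀ᶠ p' in 𝓝 p, ∀ φ : Sec n F E, α (φ.jet p') = β (φ.jet p')) : LocallyHorizontal r α := by
  intro p
  obtain ⟨β, hβ, e⟩ := h p
  obtain ⟨q, U, L, hU, hUq, hp, hpU, hL⟩ := hβ p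
  obtain ⟨N, hN, hNo, hpN⟩ := mem_nhds_iff.1 e
  refine ⟨q, U ∩ ((cht q).target ∩ (cht q).symm ⁻¹' N), L, hU.inter
    ((cht q).isOpen_inter_preimage_symm hNo), inter_subset_left.trans hUq, hp,
    ⟨hpU, (cht q).map_source hp.1, by simpa [(cht q).left_inv hp.1] using hpN⟩,
    (hL.mono inter_subset_left).1, fun φ x hx => ?_⟩
  rw [← hL.2 φ x hx.1]
  exact congrArg (toChart q _) (hN hx.2.2 φ)

theorem IsHorizontal.zero {k : ℕ} : IsHorizontal (0 : PreForm n F E k) :=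
  isHorizontal_iff_repOn.2 ⟨0, fun q => ⟨fun _ => 0, contDiffOn_const, fun _ _ _ =>
    map_zero (toChartL k q _)⟩⟩

theorem IsHorizontal.exists_order {k : ℕ} {α : PreForm n F E k} (hα : IsHorizontal α) :
    ∃ r : ℕ, ∀ s, r ≤ s → ∀ q, ∃ L, RepOn q (comp q α) s (coordDom n F E q) L := by
  obtain ⟨r, h⟩ := isHorizontal_iff_repOn.1 hα
  exact ⟨r, fun s hs q => ⟨_, (h q).choose_spec.raise hs⟩⟩

theorem IsHorizontal.add {k : ℕ} {α β : PreForm n F E k} (hα : IsHorizontal α)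
    (hβ : IsHorizontal β) : IsHorizontal (α + β) := by
  obtain ⟨r, h⟩ := hα.exists_order
  obtain ⟨s, h'⟩ := hβ.exists_order
  refine isHorizontal_iff_repOn.2 ⟨max r s, fun q => ?_⟩
  obtain ⟨L, hL⟩ := h _ (le_max_left r s) q
  obtain ⟨L', hL'⟩ := h' _ (le_max_right r s) q
  exact ⟨fun z => L z + L' z, hL.1.add hL'.1, fun φ x hx => by
    dsimp only
    rw [← hL.2 φ x hx, ← hL'.2 φ x hx]
    exact map_add (toChartL k q _) _ _⟩

/-- Multiplication by a function on the base. -/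
theorem IsHorizontal.base_smul {k : ℕ} {α : PreForm n F E k} (hα : IsHorizontal α) {ρ : M → ℝ}
    (hρ : ContMDiff (𝓡 n) 𝓘(ℝ, ℝ) ∞ ρ) : IsHorizontal (fun j => ρ j.1 • α j) := by
  obtain ⟨r, h⟩ := isHorizontal_iff_repOn.1 hα
  refine isHorizontal_iff_repOn.2 ⟨r, fun q => ?_⟩
  obtain ⟨L, hL⟩ := h q
  have h1 : ContDiffOn ℝ ∞ (fun z : 𝔼 × JetCoord n r F => ρ ((cht q).symm z.1))
      (coordDom n F E q ×ˢ univ) := by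
    refine ContDiffOn.comp (t := coordDom n F E q) (g := fun x => ρ ((cht q).symm x))
      (fun x hx => ?_) contDiffOn_fst fun z hz => hz.1
    exact (contMDiffAt_iff_contDiffAt.1 ((hρ _).comp x (contMDiffOn_chart_symm.contMDiffAt
      ((cht q).open_target.mem_nhds hx.1)))).contDiffWithinAt
  refine ⟨fun z => ρ ((cht q).symm z.1) • L z, h1.smul hL.1, fun φ x hx => ?_⟩
  · dsimp only
    rw [← hL.2 φ x hx]
    exact map_smul (toChartL k q _) _ _

theorem IsHorizontal.smul {k : ℕ} {α : PreForm n F E k} (hα : IsHorizontal α) (c : ℝ) :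
    IsHorizontal (c • α) :=
  hα.base_smul (ρ := fun _ => c) contMDiff_const

theorem IsHorizontal.neg {k : ℕ} {α : PreForm n F E k} (hα : IsHorizontal α) :
    IsHorizontal (-α) := by
  rw [← neg_one_smul ℝ α]
  exact hα.smul (-1 : ℝ)

theorem IsHorizontal.sub {k : ℕ} {α β : PreForm n F E k} (hα : IsHorizontal α)
    (hβ : IsHorizontal β) : IsHorizontal (α - β) := by
  rw [sub_eq_add_neg]; exact hα.add hβ.neg

theorem IsHorizontal.sum {k : ℕ} {ι : Type*} (t : Finset ι) {α : ι → PreForm n F E k}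
    (h : ∀ i ∈ t, IsHorizontal (α i)) : IsHorizontal (∑ i ∈ t, α i) := by
  classical
  induction t using Finset.induction_on with
  | empty => exact IsHorizontal.zero
  | insert a t ha ih =>
    rw [Finset.sum_insert ha]
    exact (h a (by simp)).add (ih fun i hi => h i (by simp [hi]))

/-! ## The horizontal differential -/

theorem IsHorizontal.eventually_comp_jet {k : ℕ} {α : PreForm n F E k} (φ : Sec n F E) {q q' : M}
    {x : 𝔼} (hx : x ∈ overlap (n := n) (F := F) (E := E) q q') :
    (fun y => comp q α (φ.jet ((cht q).symm y))) =ᶠ[𝓝 x] fun y =>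
      (comp q' α (φ.jet ((cht q').symm (transition q q' y)))).compContinuousLinearMap
        (fderiv ℝ (transition q q') y) := by
  filter_upwards [(isOpen_overlap q q').mem_nhds hx] with y hy
  have h2 : (cht q').symm (transition q q' y) = (cht q).symm y := by
    simp only [transition, Function.comp_apply]
    exact (cht q').left_inv hy.2.1
  rw [h2]
  have := toChart_change q q' (chart_symm_mem_dom hy.1).1 hy.2.1 (α (φ.jet ((cht q).symm y)))
  rwa [(cht q).right_inv hy.1.1] at this

theorem two_le_infty : minSmoothness ℝ 2 ≤ (∞ : ℕ∞ω) := by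
  rw [minSmoothness_of_isRCLikeNormedField]
  exact natCast_le_infty 2

/-- The definition uses a chosen section for the jet. In coordinates the result is a local operator
of order `r + 1`, so every section with the same jet gives the same value. -/
theorem dH_apply_self {k : ℕ} {α : PreForm n F E k} (hα : IsHorizontal α) (φ : Sec n F E) (p : M) :
    dH α (φ.jet p) = extDeriv (fun x => comp p α (φ.jet ((cht p).symm x))) (cht p p) := by
  obtain ⟨r, h⟩ := isHorizontal_iff_repOn.1 hα
  obtain ⟨L, hL⟩ := h p
  obtain ⟨L', hL', hLL'⟩ := isLocOp_extDeriv (isOpen_coordDom (F := F) (E := E) p)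
    (isLocOp_of_contDiffOn hL.1)
  have hp := chart_mem_coordDom (mem_dom_self (n := n) (F := F) (E := E) p)
  have key : ∀ ψ : Sec n F E,
      extDeriv (fun x => comp p α (ψ.jet ((cht p).symm x))) (cht p p) =
        L' (cht p p, jetCoord (r + 1) (ψ.rep p) (cht p p)) := by
    intro ψ
    rw [← hLL' _ (contDiffOn_rep ψ p) _ hp]
    refine Filter.EventuallyEq.extDeriv_eq ?_
    filter_upwards [(isOpen_coordDom p).mem_nhds hp] with y hy using hL.2 ψ y hy
  have e : dH α (φ.jet p) = extDeriv (fun x => comp p α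
      ((InfJet.repr (φ.jet p)).jet ((cht p).symm x))) (cht p p) := rfl
  rw [e, key, key]
  congr 2
  exact jetCoord_eq_of_jet_eq (p := p) (repr_jet (φ.jet p)) (mem_dom_self p) _

/-- Exterior differentiation commutes with pull-back along the transition map, so the chart centred
at the point can be exchanged for the one at `q`. -/
theorem comp_dH {k : ℕ} {α : PreForm n F E k} (hα : IsHorizontal α) (φ : Sec n F E) {q : M}
    {x : 𝔼} (hx : x ∈ coordDom n F E q) :
    comp q (dH α) (φ.jet ((cht q).symm x)) =
      extDeriv (fun y => comp q α (φ.jet ((cht q).symm y))) x := by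
  set p := (cht q).symm x with hp
  have hpd : p ∈ dom (n := n) F E q := chart_symm_mem_dom hx
  have hxp : cht q p = x := (cht q).right_inv hx.1
  have hxo : x ∈ overlap (n := n) (F := F) (E := E) q p := ⟨hx, mem_dom_self p⟩
  rw [(IsHorizontal.eventually_comp_jet (α := α) φ hxo).extDeriv_eq]
  obtain ⟨r, h⟩ := isHorizontal_iff_repOn.1 hα
  obtain ⟨L, hL⟩ := h p
  have hcp : transition q p x = cht p p := by rw [← hxp]; exact transition_apply q p hpd.1
  have hd : DifferentiableAt ℝ (fun y => comp p α (φ.jet ((cht p).symm y))) (transition q p x) := by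
    rw [hcp]
    exact ((hL.contDiffOn (isOpen_coordDom p) subset_rfl φ).contDiffAt
      ((isOpen_coordDom p).mem_nhds (chart_mem_coordDom (mem_dom_self p)))).differentiableAt
        (by simp)
  have hκ : ContDiffAt ℝ ∞ (transition q p) x := (contDiffOn_transition_overlap q p).contDiffAt
    ((isOpen_overlap (F := F) (E := E) q p).mem_nhds hxo)
  have := extDeriv_pullback hd hκ two_le_infty
  rw [this, hcp, ← dH_apply_self hα φ p]
  change toChart q p _ = _
  rw [toChart_eq, hxp]

theorem IsHorizontal.dH {k : ℕ} {α : PreForm n F E k} (hα : IsHorizontal α) :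
    IsHorizontal (dH α) := by
  obtain ⟨r, h⟩ := isHorizontal_iff_repOn.1 hα
  refine isHorizontal_iff_repOn.2 ⟨r + 1, fun q => ?_⟩
  obtain ⟨L, hL⟩ := h q
  refine exists_repOn_of_isLocOp subset_rfl (isLocOp_extDeriv (isOpen_coordDom q)
    (isLocOp_of_contDiffOn hL.1)) fun φ x hx => ?_
  rw [comp_dH hα φ hx]
  refine Filter.EventuallyEq.extDeriv_eq ?_
  filter_upwards [(isOpen_coordDom q).mem_nhds hx] with y hy using hL.2 φ y hy

theorem IsHorizontal.contDiffAt_comp_self {k : ℕ} {α : PreForm n F E k} (hα : IsHorizontal α)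
    (φ : Sec n F E) (p : M) :
    ContDiffAt ℝ ∞ (fun x => comp p α (φ.jet ((cht p).symm x))) (cht p p) := by
  obtain ⟨r, h⟩ := isHorizontal_iff_repOn.1 hα
  obtain ⟨L, hL⟩ := h p
  exact (hL.contDiffOn (isOpen_coordDom p) subset_rfl φ).contDiffAt
    ((isOpen_coordDom p).mem_nhds (chart_mem_coordDom (mem_dom_self p)))

theorem InfJet.ind {P : InfJet n F E → Prop} (h : ∀ (φ : Sec n F E) (p : M), P (φ.jet p))
    (j : InfJet n F E) : P j := by
  rw [← repr_jet j]; exact h _ _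

theorem dH_add {k : ℕ} {α β : PreForm n F E k} (hα : IsHorizontal α) (hβ : IsHorizontal β) :
    HorizontalComplex.dH (α + β) = HorizontalComplex.dH α + HorizontalComplex.dH β := by
  refine funext fun j => ?_
  induction j using InfJet.ind with
  | h φ p =>
  rw [Pi.add_apply, dH_apply_self hα, dH_apply_self hβ, dH_apply_self (hα.add hβ)]
  rw [← extDeriv_add_apply ((hα.contDiffAt_comp_self φ p).differentiableAt (by simp))
    ((hβ.contDiffAt_comp_self φ p).differentiableAt (by simp))]
  refine congrFun (congrArg extDeriv (funext fun x => ?_)) _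
  exact map_add (toChartL k p _) _ _

theorem dH_smul {k : ℕ} {α : PreForm n F E k} (hα : IsHorizontal α) (c : ℝ) :
    HorizontalComplex.dH (c • α) = c • HorizontalComplex.dH α := by
  refine funext fun j => ?_
  induction j using InfJet.ind with
  | h φ p =>
  rw [Pi.smul_apply, dH_apply_self hα, dH_apply_self (hα.smul c)]
  refine Eq.trans (congrFun (congrArg extDeriv (funext fun x => ?_)) _)
    (extDeriv_smul (𝕜 := ℝ) c fun x => comp p α (φ.jet ((cht p).symm x)))
  exact map_smul (toChartL (n := n) k p ((cht p).symm x)) c _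

theorem dH_dH {k : ℕ} {α : PreForm n F E k} (hα : IsHorizontal α) :
    HorizontalComplex.dH (HorizontalComplex.dH α) = 0 := by
  refine funext fun j => ?_
  induction j using InfJet.ind with
  | h φ p =>
  rw [Pi.zero_apply, dH_apply_self hα.dH]
  have hp := chart_mem_coordDom (mem_dom_self (n := n) (F := F) (E := E) p)
  have e : (fun x => comp p (HorizontalComplex.dH α) (φ.jet ((cht p).symm x))) =ᶠ[𝓝 (cht p p)]
      extDeriv (fun y => comp p α (φ.jet ((cht p).symm y))) := by
    filter_upwards [(isOpen_coordDom p).mem_nhds hp] with y hy using comp_dH hα φ hy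
  rw [e.extDeriv_eq]
  exact extDeriv_extDeriv_apply (hα.contDiffAt_comp_self φ p) two_le_infty

/-- The horizontal differential is local. -/
theorem dH_congr {k : ℕ} {α β : PreForm n F E k} (hα : IsHorizontal α) (hβ : IsHorizontal β)
    (φ ψ : Sec n F E) {p : M} (h : ∀ᶠ p' in 𝓝 p, α (φ.jet p') = β (ψ.jet p')) :
    HorizontalComplex.dH α (φ.jet p) = HorizontalComplex.dH β (ψ.jet p) := by
  rw [dH_apply_self hα, dH_apply_self hβ]
  refine Filter.EventuallyEq.extDeriv_eq ?_
  have hc : Filter.Tendsto (cht p).symm (𝓝 (cht p p)) (𝓝 p) := by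
    have := (cht p).continuousAt_symm (mem_chart_target _ p)
    rwa [ContinuousAt, (cht p).left_inv (mem_chart_source _ p)] at this
  filter_upwards [hc.eventually h] with x hx
  exact congrArg (toChart (n := n) p ((cht p).symm x)) hx

end Representations

/-! ## The Euler–Lagrange operator in arbitrary coordinates -/

section Frame

variable {n : ℕ}

/-- `onFrame` as a continuous linear map. -/
def onFrameL (n : ℕ) : Cov n n →L[ℝ] ℝ :=
  LinearMap.toContinuousLinearMap
    { toFun := onFrame
      map_add' := fun _ _ => rfl
      map_smul' := fun _ _ => rfl }

theorem onFrameL_apply (a : Cov n n) : onFrameL n a = onFrame a := rfl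

theorem onFrame_injective : Function.Injective (onFrame (n := n)) := by
  intro a b hab
  refine ContinuousAlternatingMap.toAlternatingMap_injective ?_
  refine (EuclideanSpace.basisFun (Fin n) ℝ).toBasis.ext_alternating fun v hv => ?_
  have hs : Function.Bijective v := Finite.injective_iff_bijective.1 hv
  set σ : Equiv.Perm (Fin n) := Equiv.ofBijective v hs with hσ
  have h1 : (fun i => (EuclideanSpace.basisFun (Fin n) ℝ).toBasis (v i)) =
      (fun i => EuclideanSpace.single i (1 : ℝ)) ∘ σ := by
    funext i; simp [hσ]
  rw [h1, AlternatingMap.map_perm, AlternatingMap.map_perm]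
  exact congrArg _ hab

theorem comp_clm_top (a : Cov n n)
    (T : EuclideanSpace ℝ (Fin n) →L[ℝ] EuclideanSpace ℝ (Fin n)) :
    a.compContinuousLinearMap T = T.det • a :=
  onFrame_injective (by rw [onFrame_comp, ← onFrameL_apply (T.det • a), map_smul]; rfl)

theorem onFrame_eq_zero_iff {a : Cov n n} : onFrame a = 0 ↔ a = 0 :=
  ⟨fun h => onFrame_injective (h.trans (map_zero (onFrameL n)).symm), fun h => by
    rw [h]; exact map_zero (onFrameL n)⟩

/-- Top forms are multiples of a nonzero one. -/
theorem eq_div_smul_of_ne_zero (a : Cov n n) {b : Cov n n} (hb : b ≠ 0) :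
    a = (onFrame a / onFrame b) • b := by
  refine onFrame_injective ?_
  rw [← onFrameL_apply (_ • b), map_smul, onFrameL_apply, smul_eq_mul,
    div_mul_cancel₀ _ (fun h => hb (onFrame_eq_zero_iff.1 h))]

end Frame

section Euler

variable {n : ℕ} {M : Type*} [TopologicalSpace M] [ChartedSpace (EuclideanSpace ℝ (Fin n)) M]
  [IsManifold (𝓡 n) ∞ M] [T2Space M]
  {F : Type*} [NormedAddCommGroup F] [NormedSpace ℝ F] [FiniteDimensional ℝ F]
  {E : M → Type*} [TopologicalSpace (TotalSpace F E)] [∀ p, TopologicalSpace (E p)]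
  [∀ p, AddCommGroup (E p)] [∀ p, Module ℝ (E p)] [FiberBundle F E] [VectorBundle ℝ F E]
  [ContMDiffVectorBundle ∞ F E (𝓡 n)]

local notation "cht" => chartAt (EuclideanSpace ℝ (Fin n))
local notation "𝔼" => EuclideanSpace ℝ (Fin n)

theorem source_ext {k : ℕ} {q p : M} (hp : p ∈ dom (n := n) F E q) {ξ η : E p →ₗ[ℝ] Cov n k}
    (h : ∀ v, toChart q p (ξ ((trivializationAt F E q).symmₗ ℝ p v)) =
      toChart q p (η ((trivializationAt F E q).symmₗ ℝ p v))) : ξ = η := by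
  ext1 e
  have := toChart_injective hp.1 (h ((trivializationAt F E q).linearMapAt ℝ p e))
  rwa [(trivializationAt F E q).symmₗ_linearMapAt hp.2] at this

/-- Replaces the chosen section in the definition by an arbitrary one with the same jet, and the sum
over a basis by linearity in the fibre vector. The representative `L` remains the chosen one, hence
the existential. -/
theorem euler_apply_self {k : ℕ} {α : PreForm n F E k} (hα : IsHorizontal α) (p : M) :
    ∃ r L, RepOn p (comp p α) r (coordDom n F E p) L ∧ ∀ (φ : Sec n F E) (e : E p),
      euler α (φ.jet p) e = eulerExpr L (φ.rep p) (cht p p)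
        ((trivializationAt F E p).linearMapAt ℝ p e) := by
  obtain ⟨r, h⟩ := hα
  have hex : ∃ (r : ℕ) (L : 𝔼 × JetCoord n r F → Cov n k), IsLocalRep p (comp p α) r L :=
    ⟨r, h p⟩
  refine ⟨hex.choose, hex.choose_spec.choose, isLocalRep_iff_repOn.1 hex.choose_spec.choose_spec,
    fun φ e => ?_⟩
  have hL := isLocalRep_iff_repOn.1 hex.choose_spec.choose_spec
  set L := hex.choose_spec.choose with hLdef
  have hx := chart_mem_coordDom (mem_dom_self (n := n) (F := F) (E := E) p)
  have h1 : euler α (φ.jet p) e = ∑ a, ((Module.finBasis ℝ F).coord a)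
      ((trivializationAt F E p).linearMapAt ℝ p e) •
      eulerExpr L ((InfJet.repr (φ.jet p)).rep p) (cht p p) (Module.finBasis ℝ F a) := by
    have h0 : euler α (φ.jet p) = ∑ a, (((Module.finBasis ℝ F).coord a).comp
        ((trivializationAt F E p).linearMapAt ℝ p)).smulRight
      (eulerExpr L ((InfJet.repr (φ.jet p)).rep p) (cht p p) (Module.finBasis ℝ F a)) :=
      dif_pos hex
    refine (DFunLike.congr_fun h0 e).trans ?_
    exact LinearMap.sum_apply _ _ _
  have h2 : ∀ v, eulerExpr L ((InfJet.repr (φ.jet p)).rep p) (cht p p) v =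
      eulerExpr L (φ.rep p) (cht p p) v := by
    intro v
    obtain ⟨L', _, h'⟩ := isLocOp_eulerExpr (isOpen_coordDom p) hL.1 v
    refine (h' _ (contDiffOn_rep _ p) _ hx).trans (Eq.trans ?_ (h' _ (contDiffOn_rep _ p) _ hx).symm)
    congr 2
    exact jetCoord_eq_of_jet_eq (p := p) (repr_jet (φ.jet p)) (mem_dom_self p) _
  rw [h1]
  simp only [h2]
  have hl := isLinearMap_eulerExpr (isOpen_coordDom p) hL.1 (contDiffOn_rep φ p) hx
  rw [← hl.mk'_apply]
  conv_rhs => rw [← (Module.finBasis ℝ F).sum_repr ((trivializationAt F E p).linearMapAt ℝ p e)]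
  rw [map_sum]
  simp

/-- A change of trivialization is linear on fibres and thus equal to its vertical derivative. -/
theorem fderiv_fibreChange {q q' : M} {x : 𝔼}
    (hx : x ∈ overlap (n := n) (F := F) (E := E) q q') (u v : F) :
    fderiv ℝ (fibreChange (n := n) (F := F) (E := E) q q') (x, u) (0, v) =
      (trivializationAt F E q').linearMapAt ℝ ((cht q).symm x)
        ((trivializationAt F E q).symmₗ ℝ ((cht q).symm x) v) := by
  set p := (cht q).symm x
  set T : F →ₗ[ℝ] F := ((trivializationAt F E q').linearMapAt ℝ p).comp
    ((trivializationAt F E q).symmₗ ℝ p) with hT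
  have hΨ : ∀ w, fibreChange (n := n) (F := F) (E := E) q q' (x, w) = T w := by
    intro w
    rw [hT, LinearMap.comp_apply, (trivializationAt F E q').coe_linearMapAt_of_mem hx.2.2,
      (trivializationAt F E q).coe_symmₗ hx.1.2, fibreChange, ofCoord,
      ← (trivializationAt F E q).mk_symm hx.1.2]
  have hd : DifferentiableAt ℝ (fibreChange (n := n) (F := F) (E := E) q q') (x, u) :=
    ((contDiffOn_fibreChange q q').contDiffAt
      (((isOpen_overlap q q').prod isOpen_univ).mem_nhds ⟨hx, mem_univ _⟩)).differentiableAt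
      (by simp)
  have h1 := hd.hasFDerivAt.comp u (hasFDerivAt_prodMk_right x u)
  have h2 : HasFDerivAt (fibreChange (n := n) (F := F) (E := E) q q' ∘ fun w => (x, w))
      T.toContinuousLinearMap u := by
    have : (fibreChange (n := n) (F := F) (E := E) q q' ∘ fun w => (x, w)) =
      T.toContinuousLinearMap := funext hΨ
    rw [this]; exact T.toContinuousLinearMap.hasFDerivAt
  exact DFunLike.congr_fun (h1.unique h2) v

/-- The Euler–Lagrange operator can be computed in any coordinates. -/
theorem toChart_euler {α : PreForm n F E n} (hα : IsHorizontal α) {q : M} {r : ℕ} {U : Set 𝔼}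
    (hU : IsOpen U) (hUq : U ⊆ coordDom n F E q) {L : 𝔼 × JetCoord n r F → Cov n n}
    (hL : RepOn q (comp q α) r U L) (φ : Sec n F E) {x : 𝔼} (hx : x ∈ U) (v : F) :
    toChart q ((cht q).symm x) (euler α (φ.jet ((cht q).symm x))
      ((trivializationAt F E q).symmₗ ℝ ((cht q).symm x) v)) = eulerExpr L (φ.rep q) x v := by
  set p := (cht q).symm x with hp
  have hxp : cht q p = x := (cht q).right_inv (hUq hx).1
  obtain ⟨r₀, L₀, hL₀, he⟩ := euler_apply_self hα p
  set U₁ := overlap (n := n) (F := F) (E := E) q p ∩ U with hU₁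
  have hU₁o : IsOpen U₁ := (isOpen_overlap q p).inter hU
  set U' := overlap (n := n) (F := F) (E := E) p q ∩ transition p q ⁻¹' U with hU'
  have hU'o : IsOpen U' := (contDiffOn_transition_overlap
    p q).continuousOn.isOpen_inter_preimage (isOpen_overlap p q) hU
  have hx₁ : x ∈ U₁ := ⟨⟨hUq hx, mem_dom_self p⟩, hx⟩
  have hm : MapsTo (transition q p) U₁ U' := fun y hy =>
    ⟨mapsTo_transition_overlap q p hy.1, by
      rw [mem_preimage, transition_transition hy.1]; exact hy.2⟩
  have hm' : MapsTo (transition p q) U' U₁ := fun y hy =>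
    ⟨mapsTo_transition_overlap p q hy.1, hy.2⟩
  -- Naturality for the transition of charts and trivializations from `q` to `p`. Its determinant
  -- factor is exactly the one by which top forms change.
  have key := eulerExpr_naturality hU₁o hU'o (κ := transition q p) (κ' := transition p q)
    ((contDiffOn_transition_overlap (F := F) (E := E) q p).mono inter_subset_left)
    ((contDiffOn_transition_overlap (F := F) (E := E) p q).mono inter_subset_left) hm hm'
    (fun y hy => transition_transition hy.1) (fun y hy => transition_transition hy.1)
    (Ψ := fibreChange (n := n) (F := F) (E := E) q p)
    ((contDiffOn_fibreChange q p).mono (prod_mono inter_subset_left subset_rfl))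
    (L := L) (hL.1.mono (prod_mono inter_subset_right subset_rfl))
    (L' := L₀) (hL₀.1.mono (prod_mono (fun y hy => hy.1.1) subset_rfl)) ?_
    ((contDiffOn_rep φ q).mono (inter_subset_right.trans hUq)) hx₁ v
  · rw [key, toChart_eq, comp_clm_top, hxp, he, fderiv_fibreChange hx₁.1]
    congr 1
    have hκx : transition q p x = cht p p := by
      rw [← hxp]; exact transition_apply q p (chart_symm_mem_dom (E := E) (hUq hx)).1
    rw [hκx]
    refine eulerExpr_congr_field ?_ _
    have : U' ∈ 𝓝 (cht p p) := hU'o.mem_nhds (hκx ▸ hm hx₁)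
    filter_upwards [this] with y hy
    rw [← rep_change φ (hm' hy).1, transition_transition hy.1]
  -- Naturality asks for the relation between the Lagrangians on arbitrary functions. Near `y` each
  -- of them is the coordinate expression of a section, for which the relation is known.
  · intro f hf y hy
    obtain ⟨ψ, hψ⟩ := exists_secC_rep_eventuallyEq (E := E) q hU₁o
      (inter_subset_right.trans hUq) hf hy
    have hyU' := hm hy
    rw [← jetCoord_congr hψ, ← hL.2 ψ.1 y hy.2,
      (IsHorizontal.eventually_comp_jet (α := α) ψ.1 hy.1).eq_of_nhds, comp_clm_top,
      hL₀.2 ψ.1 _ hyU'.1.1]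
    congr 3
    refine jetCoord_congr ?_ _
    have hc : Filter.Tendsto (transition p q) (𝓝 (transition q p y)) (𝓝 y) := by
      have := ((contDiffOn_transition_overlap (F := F) (E := E) p q).contDiffAt
        ((isOpen_overlap p q).mem_nhds hyU'.1)).continuousAt
      rwa [ContinuousAt, transition_transition hy.1] at this
    filter_upwards [hU'o.mem_nhds hyU', hc.eventually hψ] with z hz hzψ
    rw [← hzψ, ← rep_change ψ.1 (hm' hz).1, transition_transition hz.1]

theorem euler_eq_of_repOn {α : PreForm n F E n} (hα : IsHorizontal α) {p : M} {r : ℕ} {U : Set 𝔼}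
    (hU : IsOpen U) (hUq : U ⊆ coordDom n F E p) {L : 𝔼 × JetCoord n r F → Cov n n}
    (hL : RepOn p (comp p α) r U L) (φ : Sec n F E) (hx : cht p p ∈ U) (v : F) :
    euler α (φ.jet p) ((trivializationAt F E p).symmₗ ℝ p v) =
      eulerExpr L (φ.rep p) (cht p p) v := by
  have := toChart_euler hα hU hUq hL φ hx v
  rwa [(cht p).left_inv (mem_chart_source _ p), toChart_self] at this

theorem source_ext_self {k : ℕ} {p : M} {ξ η : E p →ₗ[ℝ] Cov n k}
    (h : ∀ v, ξ ((trivializationAt F E p).symmₗ ℝ p v) =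
      η ((trivializationAt F E p).symmₗ ℝ p v)) : ξ = η :=
  source_ext (n := n) (F := F) (mem_dom_self p) fun v => congrArg _ (h v)

theorem isSource_euler {α : PreForm n F E n} (hα : IsHorizontal α) : IsSource (euler α) := by
  intro v
  obtain ⟨r, h⟩ := isHorizontal_iff_repOn.1 hα
  refine isLocal_iff_repOn.2 ⟨r + r, fun q => ?_⟩
  obtain ⟨L, hL⟩ := h q
  exact exists_repOn_of_isLocOp subset_rfl (isLocOp_eulerExpr (isOpen_coordDom q) hL.1 v)
    fun φ x hx => toChart_euler hα (isOpen_coordDom q) subset_rfl hL φ hx v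

theorem RepOn.prodMk {V W : Type*} [NormedAddCommGroup V] [NormedSpace ℝ V]
    [NormedAddCommGroup W] [NormedSpace ℝ W] {q : M} {B : InfJet n F E → V}
    {B' : InfJet n F E → W} {r : ℕ} {U : Set 𝔼} {L : 𝔼 × JetCoord n r F → V}
    {L' : 𝔼 × JetCoord n r F → W} (h : RepOn q B r U L) (h' : RepOn q B' r U L') :
    RepOn q (fun j => (B j, B' j)) r U fun z => (L z, L' z) :=
  ⟨h.1.prodMk h'.1, fun φ x hx => Prod.ext (h.2 φ x hx) (h'.2 φ x hx)⟩

theorem euler_add {α β : PreForm n F E n} (hα : IsHorizontal α) (hβ : IsHorizontal β) :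
    euler (α + β) = euler α + euler β := by
  refine funext fun j => ?_
  induction j using InfJet.ind with
  | h φ p =>
  obtain ⟨r, h⟩ := hα.exists_order
  obtain ⟨s, h'⟩ := hβ.exists_order
  obtain ⟨L, hL⟩ := h _ (le_max_left r s) p
  obtain ⟨L', hL'⟩ := h' _ (le_max_right r s) p
  have hx := chart_mem_coordDom (mem_dom_self (n := n) (F := F) (E := E) p)
  have ho := isOpen_coordDom (n := n) (F := F) (E := E) p
  refine source_ext_self (n := _) (F := F) (E := E) (p := p) fun v => ?_
  have hLL := hL.prodMk hL'
  -- Additivity in the Lagrangian is obtained by viewing both representatives as one with values in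
  -- a product, followed by the linear map "sum".
  have hsum : RepOn p (comp p (α + β)) (max r s) (coordDom n F E p)
      (fun z => (ContinuousLinearMap.fst ℝ (Cov n n) (Cov n n) +
        ContinuousLinearMap.snd ℝ (Cov n n) (Cov n n)) (L z, L' z)) :=
    ⟨(ContinuousLinearMap.contDiff _).comp_contDiffOn hLL.1, fun ψ x hx => by
      simp only [_root_.add_apply, ContinuousLinearMap.coe_fst', ContinuousLinearMap.coe_snd']
      rw [← hL.2 ψ x hx, ← hL'.2 ψ x hx]
      exact map_add (toChartL n p _) _ _⟩
  refine (euler_eq_of_repOn (hα.add hβ) ho subset_rfl hsum φ hx v).trans ?_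
  refine Eq.trans ?_ (congrArg₂ (· + ·) (euler_eq_of_repOn hα ho subset_rfl hL φ hx v).symm
    (euler_eq_of_repOn hβ ho subset_rfl hL' φ hx v).symm)
  rw [eulerExpr_clm ho hLL.1 (contDiffOn_rep φ p) hx, _root_.add_apply,
    ← eulerExpr_clm ho hLL.1 (contDiffOn_rep φ p) hx,
    ← eulerExpr_clm ho hLL.1 (contDiffOn_rep φ p) hx]
  rfl

theorem euler_smul {α : PreForm n F E n} (hα : IsHorizontal α) (c : ℝ) :
    euler (c • α) = c • euler α := by
  refine funext fun j => ?_
  induction j using InfJet.ind with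
  | h φ p =>
  obtain ⟨r, h⟩ := isHorizontal_iff_repOn.1 hα
  obtain ⟨L, hL⟩ := h p
  have hx := chart_mem_coordDom (mem_dom_self (n := n) (F := F) (E := E) p)
  have ho := isOpen_coordDom (n := n) (F := F) (E := E) p
  refine source_ext_self (n := _) (F := F) (E := E) (p := p) fun v => ?_
  have hsum : RepOn p (comp p (c • α)) r (coordDom n F E p)
      (fun z => (c • ContinuousLinearMap.id ℝ (Cov n n)) (L z)) :=
    ⟨(ContinuousLinearMap.contDiff _).comp_contDiffOn hL.1, fun ψ x hx => by
      refine Eq.trans ?_ (congrArg (fun a => c • a) (hL.2 ψ x hx))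
      exact map_smul (toChartL n p _) c _⟩
  refine (euler_eq_of_repOn (hα.smul c) ho subset_rfl hsum φ hx v).trans ?_
  refine Eq.trans ?_ (congrArg (c • ·) (euler_eq_of_repOn hα ho subset_rfl hL φ hx v).symm)
  rw [eulerExpr_clm ho hL.1 (contDiffOn_rep φ p) hx]
  rfl

/-- The Euler–Lagrange operator is local. -/
theorem euler_congr {α β : PreForm n F E n} (hα : IsHorizontal α) (hβ : IsHorizontal β) {p : M}
    (h : ∀ᶠ p' in 𝓝 p, ∀ φ : Sec n F E, α (φ.jet p') = β (φ.jet p')) (φ : Sec n F E) :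
    euler α (φ.jet p) = euler β (φ.jet p) := by
  obtain ⟨r, h'⟩ := isHorizontal_iff_repOn.1 hβ
  obtain ⟨L, hL⟩ := h' p
  obtain ⟨N, hN, hNo, hpN⟩ := mem_nhds_iff.1 h
  set U := coordDom n F E p ∩ ((cht p).target ∩ (cht p).symm ⁻¹' N) with hU
  have hUo : IsOpen U := (isOpen_coordDom p).inter ((cht p).isOpen_inter_preimage_symm hNo)
  have hx : cht p p ∈ U := ⟨chart_mem_coordDom (mem_dom_self p), mem_chart_target _ p, by
    simpa [(cht p).left_inv (mem_chart_source _ p)] using hpN⟩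
  have hL' : RepOn p (comp p α) r U L := ⟨(hL.mono inter_subset_left).1, fun ψ x hx => by
    rw [← hL.2 ψ x hx.1]
    exact congrArg (toChart p _) (hN hx.2.2 ψ)⟩
  refine source_ext_self (n := _) (F := F) (E := E) (p := p) fun v => ?_
  exact (euler_eq_of_repOn hα hUo inter_subset_left hL' φ hx v).trans
    (euler_eq_of_repOn hβ hUo inter_subset_left (hL.mono inter_subset_left) φ hx v).symm

theorem euler_zero : euler (0 : PreForm n F E n) = 0 := by
  have := euler_smul (n := n) (F := F) (E := E) IsHorizontal.zero 0
  rwa [smul_zero, zero_smul] at this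

theorem euler_sum {ι : Type*} (t : Finset ι) {α : ι → PreForm n F E n}
    (h : ∀ i ∈ t, IsHorizontal (α i)) : euler (∑ i ∈ t, α i) = ∑ i ∈ t, euler (α i) := by
  classical
  induction t using Finset.induction_on with
  | empty => exact euler_zero
  | insert a t ha ih =>
    rw [Finset.sum_insert ha, Finset.sum_insert ha, euler_add (h a (by simp))
      (.sum t fun i hi => h i (by simp [hi])), ih fun i hi => h i (by simp [hi])]

end Euler

/-! ### Exact forms have vanishing Euler–Lagrange form -/

section Exact

variable {m : ℕ} {M : Type*} [TopologicalSpace M] [ChartedSpace (EuclideanSpace ℝ (Fin (m + 1))) M]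
  [IsManifold (𝓡 (m + 1)) ∞ M] [T2Space M]
  {F : Type*} [NormedAddCommGroup F] [NormedSpace ℝ F] [FiniteDimensional ℝ F]
  {E : M → Type*} [TopologicalSpace (TotalSpace F E)] [∀ p, TopologicalSpace (E p)]
  [∀ p, AddCommGroup (E p)] [∀ p, Module ℝ (E p)] [FiberBundle F E] [VectorBundle ℝ F E]
  [ContMDiffVectorBundle ∞ F E (𝓡 (m + 1))]

local notation "cht" => chartAt (EuclideanSpace ℝ (Fin (m + 1)))
local notation "𝔼" => EuclideanSpace ℝ (Fin (m + 1))

/-- The components of a form of codegree one, as a vector field. -/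
def fluxL (j : Fin (m + 1)) : Cov (m + 1) m →L[ℝ] ℝ :=
  LinearMap.toContinuousLinearMap
    { toFun := fun a => (-1) ^ (j : ℕ) * a (j.removeNth fun i => EuclideanSpace.single i (1 : ℝ))
      map_add' := fun a b => by simp [mul_add]
      map_smul' := fun c a => by simp [mul_left_comm] }

/-- The signs of the alternating sum are built into `fluxL`, so that the differential of a form of
codegree one is an ordinary divergence. -/
theorem onFrame_extDeriv {g : 𝔼 → Cov (m + 1) m} {x : 𝔼} (hg : DifferentiableAt ℝ g x) :
    onFrame (extDeriv g x) =
      ∑ j, fderiv ℝ (fun y => fluxL j (g y)) x (EuclideanSpace.single j (1 : ℝ)) := by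
  rw [onFrame, extDeriv_apply hg]
  refine Finset.sum_congr rfl fun j _ => ?_
  have h1 : DifferentiableAt ℝ (fun y => (g y) (j.removeNth fun i =>
      EuclideanSpace.single i (1 : ℝ))) x := by
    let ev : Cov (m + 1) m →ₗ[ℝ] ℝ :=
      { toFun := fun a => a (j.removeNth fun i => EuclideanSpace.single i (1 : ℝ))
        map_add' := fun a b => rfl
        map_smul' := fun c a => rfl }
    exact ev.toContinuousLinearMap.differentiableAt.comp x hg
  have h2 : (fun y => fluxL j (g y)) = fun y => ((-1 : ℝ) ^ (j : ℕ)) • (g y) (j.removeNth fun i =>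
      EuclideanSpace.single i (1 : ℝ)) := rfl
  rw [h2, fderiv_fun_const_smul h1]
  simp

/-- Euler–Lagrange expressions of exact forms vanish. -/
theorem euler_dH {β : PreForm (m + 1) F E m} (hβ : IsHorizontal β) : euler (dH β) = 0 := by
  refine funext fun j => ?_
  induction j using InfJet.ind with
  | h φ p =>
  obtain ⟨r, h⟩ := isHorizontal_iff_repOn.1 hβ
  obtain ⟨B, hB⟩ := h p
  obtain ⟨s, h'⟩ := isHorizontal_iff_repOn.1 hβ.dH
  obtain ⟨L, hL⟩ := h' p
  have ho := isOpen_coordDom (n := m + 1) (F := F) (E := E) p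
  have hx := chart_mem_coordDom (mem_dom_self (n := m + 1) (F := F) (E := E) p)
  refine source_ext_self (n := _) (F := F) (E := E) (p := p) fun v => ?_
  refine (euler_eq_of_repOn hβ.dH ho subset_rfl hL φ hx v).trans ?_
  refine onFrame_eq_zero_iff.1 ?_
  rw [← onFrameL_apply, ← eulerExpr_clm ho hL.1 (contDiffOn_rep φ p) hx]
  have hlo := isLocOp_of_contDiffOn hB.1
  refine eulerExpr_divergence ho (B := fun j f x => fluxL j (B (x, jetCoord r f x)))
    (fun j => hlo.clm (fluxL j)) ((onFrameL (m + 1)).contDiff.comp_contDiffOn hL.1) ?_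
    (contDiffOn_rep φ p) hx v
  -- The divergence identity is needed for all functions; near `x` they are coordinate expressions
  -- of sections.
  intro f hf x hx
  obtain ⟨ψ, hψ⟩ := exists_secC_rep_eventuallyEq (E := E) p ho subset_rfl hf hx
  rw [← jetCoord_congr hψ, Function.comp_apply, ← hL.2 ψ.1 x hx, comp_dH hβ ψ.1 hx, onFrameL_apply]
  have e : (fun y => comp p β (ψ.1.jet ((cht p).symm y))) =ᶠ[𝓝 x]
      fun y => B (y, jetCoord r f y) := by
    filter_upwards [ho.mem_nhds hx, hψ.eventuallyEq_nhds] with y hy hyψ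
    rw [hB.2 ψ.1 y hy, jetCoord_congr hyψ]
  rw [e.extDeriv_eq]
  exact onFrame_extDeriv (((hlo.contDiffOn ho hf).contDiffAt (ho.mem_nhds hx)).differentiableAt
    (by simp))

end Exact

/-! ## Integration of top forms -/

section Measure

variable {n : ℕ} {M : Type*} [TopologicalSpace M] [ChartedSpace (EuclideanSpace ℝ (Fin n)) M]
  [IsManifold (𝓡 n) ∞ M]

local notation "cht" => chartAt (EuclideanSpace ℝ (Fin n))
local notation "𝔼" => EuclideanSpace ℝ (Fin n)

/-- The component of an `n`-form in the chart at `q`. -/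
def frameCoord (lam : M → Cov n n) (q : M) (x : 𝔼) : ℝ :=
  onFrame (toChart q ((cht q).symm x) (lam ((cht q).symm x)))

theorem IsVolumeForm.contDiffOn_frameCoord {ν : M → Cov n n} (hν : IsVolumeForm ν) (q : M) :
    ContDiffOn ℝ ∞ (frameCoord ν q) (cht q).target :=
  (onFrameL n).contDiff.comp_contDiffOn (hν.smooth q)

theorem IsVolumeForm.frameCoord_ne_zero {ν : M → Cov n n} (hν : IsVolumeForm ν) {q : M} {x : 𝔼}
    (hx : x ∈ (cht q).target) : frameCoord ν q x ≠ 0 := by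
  intro h
  have h1 := onFrame_eq_zero_iff.1 h
  have h2 : toChart q ((cht q).symm x) (0 : Cov n n) = 0 := map_zero (toChartL n q _)
  exact hν.ne_zero _ (toChart_injective ((cht q).map_target hx) (h1.trans h2.symm))

theorem frameCoord_change (lam : M → Cov n n) (q q' : M) {x : 𝔼} (hx : x ∈ (cht q).target)
    (hx' : (cht q).symm x ∈ (cht q').source) :
    frameCoord lam q x = (fderiv ℝ (transition q q') x).det *
      frameCoord lam q' (transition q q' x) := by
  have h : (cht q').symm (transition q q' x) = (cht q).symm x := (cht q').left_inv hx'
  rw [frameCoord, frameCoord, h, toChart_change q q' ((cht q).map_target hx) hx', onFrame_comp,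
    (cht q).right_inv hx]

/-- Quotients of top forms can be computed in any chart. -/
theorem onFrame_div_onFrame (lam : M → Cov n n) {ν : M → Cov n n} (hν : ∀ p, ν p ≠ 0) {q p : M}
    (hp : p ∈ (cht q).source) :
    onFrame (lam p) / onFrame (ν p) =
      frameCoord lam q (cht q p) / frameCoord ν q (cht q p) := by
  have h1 := eq_div_smul_of_ne_zero (lam p) (hν p)
  have h2 : frameCoord lam q (cht q p) =
      (onFrame (lam p) / onFrame (ν p)) * frameCoord ν q (cht q p) := by
    rw [frameCoord, frameCoord, (cht q).left_inv hp]
    conv_lhs => rw [h1]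
    have h3 := map_smul ((onFrameL n).comp (toChartL n q p)) (onFrame (lam p) / onFrame (ν p)) (ν p)
    exact h3
  have h4 : frameCoord ν q (cht q p) ≠ 0 := by
    intro h
    rw [frameCoord, (cht q).left_inv hp] at h
    have h5 : toChart q p (0 : Cov n n) = 0 := map_zero (toChartL n q _)
    exact hν _ (toChart_injective hp ((onFrame_eq_zero_iff.1 h).trans h5.symm))
  rw [h2, mul_div_cancel_right₀ _ h4]

variable [MeasurableSpace M] [BorelSpace M]

/-- The measure `|ν|` on the domain of the chart at `q`. -/
def chartMeasure (ν : M → Cov n n) (q : M) : Measure M :=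
  Measure.map (cht q).symm ((volume.restrict (cht q).target).withDensity
    (fun x => ENNReal.ofReal |frameCoord ν q x|))

theorem aemeasurable_chart_symm (q : M) (f : 𝔼 → ENNReal) :
    AEMeasurable (cht q).symm ((volume.restrict (cht q).target).withDensity f) :=
  ((cht q).continuousOn_symm.aemeasurable (cht q).open_target.measurableSet).mono_ac
    (withDensity_absolutelyContinuous _ _)

theorem measurableSet_chart_preimage (q : M) {A : Set M} (hA : MeasurableSet A) :
    MeasurableSet ((cht q).target ∩ (cht q).symm ⁻¹' A) := by
  have h1 : Measurable ((cht q).target.domRestrict (cht q).symm) :=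
    (continuousOn_iff_continuous_domRestrict.1 (cht q).continuousOn_symm).measurable
  have h2 := (cht q).open_target.measurableSet.subtype_image (h1 hA)
  rwa [show Subtype.val '' ((cht q).target.domRestrict (cht q).symm ⁻¹' A) =
    (cht q).target ∩ (cht q).symm ⁻¹' A from
      Subtype.image_preimage_coe (cht q).target ((cht q).symm ⁻¹' A)] at h2

theorem chartMeasure_apply (ν : M → Cov n n) (q : M) {A : Set M} (hA : MeasurableSet A) :
    chartMeasure ν q A = ∫⁻ x in (cht q).target ∩ (cht q).symm ⁻¹' A,
      ENNReal.ofReal |frameCoord ν q x| := by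
  rw [chartMeasure, Measure.map_apply_of_aemeasurable (aemeasurable_chart_symm q _) hA,
    withDensity_apply', Measure.restrict_restrict₀, inter_comm]
  exact ((cht q).continuousOn_symm.aemeasurable
    (cht q).open_target.measurableSet).nullMeasurableSet_preimage hA

/-- The change of variables formula: the densities transform by the absolute value of the Jacobian
determinant. -/
theorem chartMeasure_compat (ν : M → Cov n n) (q q' : M) {A : Set M} (hA : MeasurableSet A)
    (hq : A ⊆ (cht q).source) (hq' : A ⊆ (cht q').source) :
    chartMeasure ν q A = chartMeasure ν q' A := by
  rw [chartMeasure_apply ν q hA, chartMeasure_apply ν q' hA]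
  set B := (cht q).target ∩ (cht q).symm ⁻¹' A with hB
  have hBo : B ⊆ (cht q).target ∩ (cht q).symm ⁻¹' (cht q').source := fun x hx => ⟨hx.1, hq' hx.2⟩
  have himg : transition q q' '' B = (cht q').target ∩ (cht q').symm ⁻¹' A := by
    ext y
    constructor
    · rintro ⟨x, hx, rfl⟩
      refine ⟨(cht q').map_source (hq' hx.2), ?_⟩
      change (cht q').symm (cht q' ((cht q).symm x)) ∈ A
      rw [(cht q').left_inv (hq' hx.2)]; exact hx.2
    · rintro ⟨h1, h2⟩
      refine ⟨cht q ((cht q').symm y), ⟨(cht q).map_source (hq h2), ?_⟩, ?_⟩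
      · rw [mem_preimage, (cht q).left_inv (hq h2)]; exact h2
      · change cht q' ((cht q).symm (cht q ((cht q').symm y))) = y
        rw [(cht q).left_inv (hq h2), (cht q').right_inv h1]
  have hinj : InjOn (transition q q') B := fun x hx y hy hxy =>
    (cht q).symm.injOn hx.1 hy.1 ((cht q').injOn (hq' hx.2) (hq' hy.2) hxy)
  have hd : ∀ x ∈ B, HasFDerivWithinAt (transition q q') (fderiv ℝ (transition q q') x) B x :=
    fun x hx => (((contDiffOn_transition q q').contDiffAt
      ((isOpen_transition_source q q').mem_nhds (hBo hx))).differentiableAt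
      (by simp)).hasFDerivAt.hasFDerivWithinAt
  rw [← himg, lintegral_image_eq_lintegral_abs_det_fderiv_mul _
    (measurableSet_chart_preimage q hA) hd hinj]
  refine setLIntegral_congr_fun (measurableSet_chart_preimage q hA) fun x hx => ?_
  rw [← ENNReal.ofReal_mul (abs_nonneg _), ← abs_mul, ← frameCoord_change ν q q' hx.1 (hq' hx.2)]

theorem chartMeasure_compl_source (ν : M → Cov n n) (q : M) :
    chartMeasure ν q (cht q).sourceᶜ = 0 := by
  rw [chartMeasure_apply ν q (cht q).open_source.measurableSet.compl]
  have : (cht q).target ∩ (cht q).symm ⁻¹' (cht q).sourceᶜ = ∅ := by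
    ext x
    simp only [mem_inter_iff, mem_preimage, mem_compl_iff, mem_empty_iff_false, iff_false, not_and,
      not_not]
    exact fun hx => (cht q).map_target hx
  rw [this, Measure.restrict_empty, lintegral_zero_measure]

theorem chartMeasure_inter_source (ν : M → Cov n n) (q : M) (A : Set M) :
    chartMeasure ν q (A ∩ (cht q).source) = chartMeasure ν q A := by
  have h : chartMeasure ν q (A \ (cht q).source) = 0 :=
    measure_mono_null (fun x hx => hx.2) (chartMeasure_compl_source ν q)
  rw [← measure_inter_add_sdiff (μ := chartMeasure ν q) A (cht q).open_source.measurableSet, h,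
    add_zero]

/-- On the domain of one chart all the chart measures are dominated by the measure of that chart, so
the supremum adds nothing there. -/
theorem volumeMeasure_restrict (ν : M → Cov n n) (q : M) :
    (volumeMeasure ν).restrict (cht q).source = chartMeasure ν q := by
  have hS := (cht q).open_source.measurableSet
  refine le_antisymm ?_ ?_
  -- The right-hand side bounds every chart measure, hence the supremum; its second summand is
  -- invisible on the chart domain.
  · have h : volumeMeasure ν ≤ chartMeasure ν q +
        (volumeMeasure ν).restrict (cht q).sourceᶜ := by
      refine iSup_le fun q' => Measure.le_iff.2 fun A hA => ?_
      change chartMeasure ν q' A ≤ _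
      rw [← measure_inter_add_sdiff A hS, Measure.add_apply]
      refine add_le_add ?_ ?_
      · rw [← chartMeasure_inter_source, chartMeasure_compat ν q' q ((hA.inter hS).inter
          (cht q').open_source.measurableSet) inter_subset_right
          (fun x hx => hx.1.2)]
        exact measure_mono fun x hx => hx.1.1
      · rw [Measure.restrict_apply hA]
        exact Measure.le_iff'.1 (le_iSup (chartMeasure ν) q') _
    refine Measure.le_iff.2 fun A hA => ?_
    rw [Measure.restrict_apply hA]
    refine (Measure.le_iff'.1 h _).trans ?_
    rw [Measure.add_apply, Measure.restrict_apply (hA.inter hS)]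
    have : A ∩ (cht q).source ∩ (cht q).sourceᶜ = ∅ := by ext; simp
    rw [this, measure_empty, add_zero]
    exact measure_mono inter_subset_left
  · refine Measure.le_iff.2 fun A hA => ?_
    rw [Measure.restrict_apply hA, ← chartMeasure_inter_source]
    exact Measure.le_iff'.1 (le_iSup (chartMeasure ν) q) _

theorem isLocallyFiniteMeasure_volumeMeasure {ν : M → Cov n n} (hν : IsVolumeForm ν) :
    IsLocallyFiniteMeasure (volumeMeasure ν) := by
  refine ⟨fun p => ?_⟩
  obtain ⟨K, hK, hKt, hKc⟩ := exists_compact_subset (cht p).open_target (mem_chart_target _ p)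
  have hK' : (cht p).symm '' interior K ∈ 𝓝 p := by
    have h := (cht p).symm.image_mem_nhds (mem_chart_target _ p)
      (isOpen_interior.mem_nhds hKt)
    rwa [(cht p).left_inv (mem_chart_source _ p)] at h
  obtain ⟨O, hO, hOo, hpO⟩ := mem_nhds_iff.1 hK'
  refine ⟨O, hOo.mem_nhds hpO, ?_⟩
  have hOs : O ⊆ (cht p).source := hO.trans (by
    rintro _ ⟨x, hx, rfl⟩; exact (cht p).map_target (hKc (interior_subset hx)))
  have h1 : volumeMeasure ν O = chartMeasure ν p O := by
    rw [← volumeMeasure_restrict, Measure.restrict_apply hOo.measurableSet,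
      inter_eq_self_of_subset_left hOs]
  rw [h1, chartMeasure_apply ν p hOo.measurableSet]
  have hsub : (cht p).target ∩ (cht p).symm ⁻¹' O ⊆ K := by
    rintro x ⟨hx, hxO⟩
    obtain ⟨y, hy, hyx⟩ := hO hxO
    rw [← (cht p).symm.injOn (hKc (interior_subset hy)) hx hyx]
    exact interior_subset hy
  refine (lintegral_mono_set hsub).trans_lt ?_
  have hc : ContinuousOn (fun x => |frameCoord ν p x|) K :=
    ((hν.contDiffOn_frameCoord p).continuousOn.mono hKc).abs
  exact (hc.integrableOn_compact hK).lintegral_lt_top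

/-- The integral of a form which vanishes outside a compact subset of a chart domain on which the
chart has constant orientation. -/
theorem integralForm_eq_chart {ν lam : M → Cov n n} (hν : IsVolumeForm ν) {q : M} {C : Set 𝔼}
    (hC : IsCompact C) (hCq : C ⊆ (cht q).target) {ε : ℝ}
    (hε : ∀ x ∈ C, |frameCoord ν q x| = ε * frameCoord ν q x)
    (h0 : ∀ p ∉ (cht q).symm '' C, lam p = 0)
    (hc : Continuous fun p => onFrame (lam p) / onFrame (ν p)) :
    integralForm ν lam = ε * ∫ x in C, frameCoord lam q x := by
  have h1 : integralForm ν lam = ∫ p, onFrame (lam p) / onFrame (ν p) ∂(chartMeasure ν q) := by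
    rw [← volumeMeasure_restrict, setIntegral_eq_integral_of_forall_compl_eq_zero]
    · rfl
    · intro p hp
      rw [h0 p, onFrame_eq_zero_iff.2 rfl, zero_div]
      rintro ⟨x, hx, rfl⟩
      exact hp ((cht q).map_target (hCq hx))
  rw [h1, chartMeasure, integral_map (aemeasurable_chart_symm q _) hc.aestronglyMeasurable,
    integral_withDensity_eq_integral_toReal_smul₀, ← integral_const_mul]
  rotate_left
  · exact (((hν.contDiffOn_frameCoord q).continuousOn.abs).aemeasurable
      (cht q).open_target.measurableSet).ennreal_ofReal
  · exact Filter.Eventually.of_forall fun _ => ENNReal.ofReal_lt_top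
  -- The density `|ν_q|` cancels the denominator `ν_q` up to the sign `ε`.
  have h2 : ∀ x ∈ (cht q).target, (ENNReal.ofReal |frameCoord ν q x|).toReal •
      (onFrame (lam ((cht q).symm x)) / onFrame (ν ((cht q).symm x))) =
      C.indicator (fun x => ε * frameCoord lam q x) x := by
    intro x hx
    by_cases hxC : x ∈ C
    · rw [indicator_of_mem hxC, ENNReal.toReal_ofReal (abs_nonneg _), hε x hxC,
        onFrame_div_onFrame lam hν.ne_zero ((cht q).map_target hx), (cht q).right_inv hx,
        smul_eq_mul]
      have := hν.frameCoord_ne_zero hx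
      field_simp
    · rw [indicator_of_notMem hxC, h0, onFrame_eq_zero_iff.2 rfl, zero_div, smul_zero]
      rintro ⟨y, hy, hyx⟩
      exact hxC ((cht q).symm.injOn (hCq hy) hx hyx ▸ hy)
  rw [setIntegral_congr_fun (cht q).open_target.measurableSet h2,
    setIntegral_indicator hC.measurableSet, inter_eq_self_of_subset_right hCq]

theorem IsVolumeForm.exists_sign {ν : M → Cov n n} (hν : IsVolumeForm ν) {q : M} {x : 𝔼}
    (hx : x ∈ (cht q).target) : ∃ (U : Set 𝔼) (ε : ℝ), IsOpen U ∧ x ∈ U ∧ U ⊆ (cht q).target ∧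
      ε ≠ 0 ∧ ∀ y ∈ U, |frameCoord ν q y| = ε * frameCoord ν q y := by
  have hc := (hν.contDiffOn_frameCoord q).continuousOn
  rcases lt_or_gt_of_ne (hν.frameCoord_ne_zero hx) with h | h
  · refine ⟨(cht q).target ∩ frameCoord ν q ⁻¹' Iio 0, -1,
      hc.isOpen_inter_preimage (cht q).open_target isOpen_Iio, ⟨hx, h⟩, inter_subset_left,
      by norm_num, fun y hy => ?_⟩
    rw [abs_of_neg hy.2, neg_one_mul]
  · refine ⟨(cht q).target ∩ frameCoord ν q ⁻¹' Ioi 0, 1,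
      hc.isOpen_inter_preimage (cht q).open_target isOpen_Ioi, ⟨hx, h⟩, inter_subset_left,
      by norm_num, fun y hy => ?_⟩
    rw [abs_of_pos hy.2, one_mul]

end Measure

/-! ### Compact supports and local functionals -/

section CompactAlong

variable {n : ℕ} {M : Type*} [TopologicalSpace M] [ChartedSpace (EuclideanSpace ℝ (Fin n)) M]
  [IsManifold (𝓡 n) ∞ M] [T2Space M]
  {F : Type*} [NormedAddCommGroup F] [NormedSpace ℝ F] [FiniteDimensional ℝ F]
  {E : M → Type*} [TopologicalSpace (TotalSpace F E)] [∀ p, TopologicalSpace (E p)]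
  [∀ p, AddCommGroup (E p)] [∀ p, Module ℝ (E p)] [FiberBundle F E] [VectorBundle ℝ F E]
  [ContMDiffVectorBundle ∞ F E (𝓡 n)]

/-- `(j^∞φ)^*α` has compact support for every compactly supported section `φ`. -/
def CompactAlong {k : ℕ} (α : PreForm n F E k) : Prop :=
  ∀ φ : SecC n F E, ∃ K : Set M, IsCompact K ∧ ∀ p ∉ K, α (φ.1.jet p) = 0

theorem CompactAlong.add {k : ℕ} {α β : PreForm n F E k} (hα : CompactAlong α)
    (hβ : CompactAlong β) : CompactAlong (α + β) := fun φ => by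
  obtain ⟨K, hK, h⟩ := hα φ
  obtain ⟨K', hK', h'⟩ := hβ φ
  refine ⟨K ∪ K', hK.union hK', fun p hp => ?_⟩
  rw [mem_union, not_or] at hp
  rw [Pi.add_apply, h p hp.1, h' p hp.2, add_zero]

theorem CompactAlong.smul {k : ℕ} {α : PreForm n F E k} (hα : CompactAlong α) (c : ℝ) :
    CompactAlong (c • α) := fun φ => by
  obtain ⟨K, hK, h⟩ := hα φ
  exact ⟨K, hK, fun p hp => by rw [Pi.smul_apply, h p hp, smul_zero]⟩

end CompactAlong

section Functional

variable {n : ℕ} {M : Type*} [TopologicalSpace M] [ChartedSpace (EuclideanSpace ℝ (Fin n)) M]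
  [IsManifold (𝓡 n) ∞ M] [T2Space M] [MeasurableSpace M] [BorelSpace M]
  {F : Type*} [NormedAddCommGroup F] [NormedSpace ℝ F] [FiniteDimensional ℝ F]
  {E : M → Type*} [TopologicalSpace (TotalSpace F E)] [∀ p, TopologicalSpace (E p)]
  [∀ p, AddCommGroup (E p)] [∀ p, Module ℝ (E p)] [FiberBundle F E] [VectorBundle ℝ F E]
  [ContMDiffVectorBundle ∞ F E (𝓡 n)]

local notation "cht" => chartAt (EuclideanSpace ℝ (Fin n))
local notation "𝔼" => EuclideanSpace ℝ (Fin n)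

variable {ν : M → Cov n n}

theorem continuous_density (hν : IsVolumeForm ν) {α : PreForm n F E n} (hα : IsHorizontal α)
    (φ : Sec n F E) : Continuous fun p => onFrame (α (φ.jet p)) / onFrame (ν p) := by
  rw [continuous_iff_continuousAt]
  intro p
  have h1 : ContinuousAt (fun x => frameCoord (fun p => α (φ.jet p)) p x / frameCoord ν p x)
      (cht p p) := by
    refine ContinuousAt.div ?_ ?_ (hν.frameCoord_ne_zero (mem_chart_target _ p))
    · exact (onFrameL n).continuous.continuousAt.comp (hα.contDiffAt_comp_self φ p).continuousAt
    · exact ((hν.contDiffOn_frameCoord p).continuousOn).continuousAt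
        ((cht p).open_target.mem_nhds (mem_chart_target _ p))
  refine (ContinuousAt.comp (f := cht p) h1
    ((cht p).continuousAt (mem_chart_source _ p))).congr ?_
  filter_upwards [(cht p).open_source.mem_nhds (mem_chart_source _ p)] with p' hp'
  exact (onFrame_div_onFrame (fun p => α (φ.jet p)) hν.ne_zero hp').symm

theorem integrable_density (hν : IsVolumeForm ν) {α : PreForm n F E n} (hα : IsHorizontal α)
    (hc : CompactAlong α) (φ : SecC n F E) :
    Integrable (fun p => onFrame (α (φ.1.jet p)) / onFrame (ν p)) (volumeMeasure ν) := by
  have := isLocallyFiniteMeasure_volumeMeasure hν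
  obtain ⟨K, hK, h⟩ := hc φ
  refine (continuous_density hν hα φ.1).integrable_of_hasCompactSupport
    (HasCompactSupport.intro hK fun p hp => ?_)
  rw [h p hp, onFrame_eq_zero_iff.2 rfl, zero_div]

theorem functional_add (hν : IsVolumeForm ν) {α β : PreForm n F E n} (hα : IsHorizontal α)
    (hβ : IsHorizontal β) (hαc : CompactAlong α) (hβc : CompactAlong β) :
    functional ν (α + β) = functional ν α + functional ν β := by
  funext φ
  refine Eq.trans ?_ (integral_add (integrable_density hν hα hαc φ)
    (integrable_density hν hβ hβc φ))
  refine integral_congr_ae (Filter.Eventually.of_forall fun p => ?_)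
  exact add_div _ _ _

theorem functional_smul (ν : M → Cov n n) (α : PreForm n F E n) (c : ℝ) :
    functional ν (c • α) = c • functional ν α := by
  funext φ
  refine Eq.trans ?_ (integral_const_mul c _)
  refine integral_congr_ae (Filter.Eventually.of_forall fun p => ?_)
  exact mul_div_assoc _ _ _

theorem functional_sub (hν : IsVolumeForm ν) {α β : PreForm n F E n} (hα : IsHorizontal α)
    (hβ : IsHorizontal β) (hαc : CompactAlong α) (hβc : CompactAlong β) :
    functional ν (α - β) = functional ν α - functional ν β := by
  have h : α - β = α + (-1 : ℝ) • β := by rw [neg_one_smul ℝ β, sub_eq_add_neg]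
  rw [h, functional_add hν hα (hβ.smul _) hαc (hβc.smul _), functional_smul,
    neg_one_smul ℝ (functional ν β), sub_eq_add_neg]

/-- The change of a local functional under a variation supported in a chart. -/
theorem functional_sub_eq_chart (hν : IsVolumeForm ν) {α : PreForm n F E n} (hα : IsHorizontal α)
    (hαc : CompactAlong α) {q : M} {C : Set 𝔼} (hC : IsCompact C) (hCq : C ⊆ (cht q).target)
    {ε : ℝ} (hε : ∀ x ∈ C, |frameCoord ν q x| = ε * frameCoord ν q x) {φ ψ : SecC n F E}
    (h : ∀ p ∉ (cht q).symm '' C, φ.1 p = ψ.1 p) :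
    functional ν α φ - functional ν α ψ = ε * ∫ x in C,
      (onFrame (comp q α (φ.1.jet ((cht q).symm x))) -
        onFrame (comp q α (ψ.1.jet ((cht q).symm x)))) := by
  have hd : ∀ p, onFrame (α (φ.1.jet p) - α (ψ.1.jet p)) / onFrame (ν p) =
      onFrame (α (φ.1.jet p)) / onFrame (ν p) - onFrame (α (ψ.1.jet p)) / onFrame (ν p) :=
    fun p => sub_div _ _ _
  have h1 : functional ν α φ - functional ν α ψ =
      integralForm ν (fun p => α (φ.1.jet p) - α (ψ.1.jet p)) := by
    refine (integral_sub (integrable_density hν hα hαc φ)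
      (integrable_density hν hα hαc ψ)).symm.trans ?_
    exact integral_congr_ae (Filter.Eventually.of_forall fun p => (hd p).symm)
  rw [h1, integralForm_eq_chart hν hC hCq hε]
  · congr 2
  · intro p hp
    have hcl := (isCompact_image_chart_symm hC hCq).isClosed
    have : φ.1.jet p = ψ.1.jet p := jet_eq_of_eventuallyEq (by
      filter_upwards [hcl.isOpen_compl.mem_nhds hp] with p' hp'
      exact h p' hp')
    rw [this, sub_self]
  · exact ((continuous_density hν hα φ.1).sub (continuous_density hν hα ψ.1)).congr
      fun p => (hd p).symm

/-- A local functional which vanishes identically has vanishing Euler–Lagrange form. -/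
theorem euler_eq_zero_of_functional_eq_zero (hν : IsVolumeForm ν) {α : PreForm n F E n}
    (hα : IsHorizontal α) (hαc : CompactAlong α) (h : functional ν α = 0) : euler α = 0 := by
  refine funext fun j => ?_
  obtain ⟨φ, p, rfl⟩ := exists_secC_jet_eq j
  obtain ⟨r, L, hL, he⟩ := euler_apply_self hα p
  have hx0 := chart_mem_coordDom (mem_dom_self (n := n) (F := F) (E := E) p)
  obtain ⟨U', ε, hU', hxU, hUt, hε0, hε⟩ := hν.exists_sign (mem_chart_target _ p)
  set U := U' ∩ coordDom n F E p with hUdef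
  have hU : IsOpen U := hU'.inter (isOpen_coordDom p)
  have hf := contDiffOn_rep φ.1 p
  ext1 e
  refine (he φ.1 e).trans ?_
  set v := (trivializationAt F E p).linearMapAt ℝ p e
  have hLU : ContDiffOn ℝ ∞ L (U ×ˢ univ) := hL.1.mono (prod_mono inter_subset_right subset_rfl)
  refine onFrame_eq_zero_iff.1 ?_
  rw [← onFrameL_apply, ← eulerExpr_clm hU hLU (hf.mono inter_subset_right) ⟨hxU, hx0⟩]
  refine eulerExpr_eq_of_integral hU ((onFrameL n).contDiff.comp_contDiffOn hLU)
    (hf.mono inter_subset_right) v (e := fun _ => 0) continuousOn_const ?_ _ ⟨hxU, hx0⟩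
  intro χ hχ hχc hχU
  obtain ⟨s, hs, hs0⟩ := exists_sec_of_coord (F := F) (E := E) p hχc
    (hχU.trans inter_subset_right) (f := fun x => χ x • v) (hχ.smul contDiff_const).contDiffOn
    (fun x _ hx => by rw [image_eq_zero_of_notMem_tsupport hx, zero_smul])
  -- The functional vanishes at both the varied and the original section, and they differ only
  -- inside the chart, so the action over the chart is constant in `t`.
  have hconst : ∀ t : ℝ, (∫ x in tsupport χ, onFrameL n
      (L (x, jetCoord r (fun y => φ.1.rep p y + t • χ y • v) x))) =
      ∫ x in tsupport χ, onFrameL n (L (x, jetCoord r (φ.1.rep p) x)) := by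
    intro t
    set ψ := φ.addSMul t s
    have hrep : ∀ x ∈ coordDom n F E p, ψ.1.rep p x = φ.1.rep p x + t • χ x • v := fun x hx => by
      refine (rep_add φ.1 (t • s.1) hx).trans ?_
      rw [rep_smul t s.1 hx, hs x hx]
    have h1 := functional_sub_eq_chart hν hα hαc (q := p) hχc (fun x hx => hUt (hχU hx).1)
      (fun x hx => hε x (hχU hx).1) (φ := ψ) (ψ := φ) (fun p' hp' => by
        change φ.1 p' + t • s.1 p' = _
        rw [hs0 p' hp', smul_zero, add_zero])
    rw [h, Pi.zero_apply, Pi.zero_apply, sub_zero, eq_comm, mul_eq_zero, or_iff_right hε0] at h1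
    have hint : ∀ θ : SecC n F E, IntegrableOn (fun x =>
        onFrame (comp p α (θ.1.jet ((cht p).symm x)))) (tsupport χ) := fun θ =>
      ContinuousOn.integrableOn_compact hχc ((onFrameL n).continuous.comp_continuousOn
        (((hL.contDiffOn (isOpen_coordDom p) subset_rfl θ.1).continuousOn).mono
          (hχU.trans inter_subset_right)))
    rw [integral_sub (hint ψ) (hint φ), sub_eq_zero] at h1
    have hcoord : ∀ θ : SecC n F E, ∀ x ∈ tsupport χ,
        onFrame (comp p α (θ.1.jet ((cht p).symm x))) =
          onFrameL n (L (x, jetCoord r (θ.1.rep p) x)) := fun θ x hx =>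
      congrArg onFrame (hL.2 θ.1 x (hχU hx).2)
    rw [setIntegral_congr_fun hχc.measurableSet (hcoord ψ),
      setIntegral_congr_fun hχc.measurableSet (hcoord φ)] at h1
    rw [← h1]
    refine setIntegral_congr_fun hχc.measurableSet fun x hx => ?_
    have : jetCoord r (ψ.1.rep p) x = jetCoord r (fun y => φ.1.rep p y + t • χ y • v) x :=
      jetCoord_congr (by
        filter_upwards [(isOpen_coordDom p).mem_nhds (hχU hx).2] with y hy
        exact hrep y hy) r
    change onFrameL n (L (x, _)) = onFrameL n (L (x, _))
    rw [this]
  have hfun : (fun t : ℝ => ∫ x in tsupport χ, ((onFrameL n) ∘ L)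
      (x, jetCoord r (fun y => φ.1.rep p y + t • χ y • v) x)) =
      fun _ => ∫ x in tsupport χ, onFrameL n (L (x, jetCoord r (φ.1.rep p) x)) := funext hconst
  rw [hfun]
  simp only [smul_zero, integral_zero]
  exact hasDerivAt_const _ _

/-- Consequently `poissonBracket`, defined through chosen forms, does not depend on the choice: it
sees them only through their Euler forms. -/
theorem euler_eq_of_functional_eq (hν : IsVolumeForm ν) {α β : PreForm n F E n}
    (hα : IsHorizontal α) (hβ : IsHorizontal β) (hαc : CompactAlong α) (hβc : CompactAlong β)
    (h : functional ν α = functional ν β) : euler α = euler β := by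
  have hβ' : CompactAlong ((-1 : ℝ) • β) := hβc.smul _
  have h0 := euler_eq_zero_of_functional_eq_zero hν (hα.add (hβ.smul (-1))) (hαc.add hβ') (by
    rw [functional_add hν hα (hβ.smul _) hαc hβ', functional_smul, h, neg_one_smul ℝ,
      add_neg_cancel])
  rw [euler_add hα (hβ.smul _), euler_smul hβ] at h0
  have h1 : euler α + -euler β = 0 := by rw [← neg_one_smul ℝ (euler β)]; exact h0
  exact add_neg_eq_zero.1 h1

theorem poissonBracket_functional (hν : IsVolumeForm ν) (w : Pairing n F E)
    {α β : PreForm n F E n} (hα : IsOmegaC α) (hβ : IsOmegaC β) :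
    poissonBracket ν w (functional ν α) (functional ν β) =
      functional ν (topBracket ν w α β) := by
  have h : IsLocalFunctional ν (functional ν α) ∧ IsLocalFunctional ν (functional ν β) :=
    ⟨⟨α, hα, rfl⟩, ⟨β, hβ, rfl⟩⟩
  have e : ∀ γ δ : PreForm n F E n, euler α = euler γ → euler β = euler δ →
      topBracket ν w γ δ = topBracket ν w α β := fun γ δ h1 h2 => by
    unfold topBracket
    rw [h1, h2]
  rw [poissonBracket, dif_pos h, e _ _ (euler_eq_of_functional_eq hν hα.horizontal h.1.choose_spec.1.horizontal hα.compact
      h.1.choose_spec.1.compact h.1.choose_spec.2) (euler_eq_of_functional_eq hν hβ.horizontal h.2.choose_spec.1.horizontal hβ.compact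
      h.2.choose_spec.1.compact h.2.choose_spec.2)]

end Functional

/-! ## Euler–Lagrange expressions depending on an auxiliary function -/

section Param

variable {n r : ℕ} {F F' V : Type*} [NormedAddCommGroup F] [NormedSpace ℝ F]
  [NormedAddCommGroup F'] [NormedSpace ℝ F'] [NormedAddCommGroup V] [NormedSpace ℝ V]

local notation "𝔼" => EuclideanSpace ℝ (Fin n)

variable (n r) in
/-- The map of jets induced by a linear map of the values. -/
def jetMap (T : F →L[ℝ] F') : JetCoord n r F →L[ℝ] JetCoord n r F' :=
  ContinuousLinearMap.pi fun k =>
    (ContinuousLinearMap.compContinuousMultilinearMapL ℝ (fun _ : Fin (k : ℕ) => 𝔼) F F' T).comp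
      (ContinuousLinearMap.proj (R := ℝ) (φ := fun k : Fin (r + 1) => 𝔼 [×(k : ℕ)]→L[ℝ] F) k)

theorem jetMap_single (T : F →L[ℝ] F') (k : Fin (r + 1)) (i : Fin (k : ℕ) → Fin n) (v : F) :
    jetMap n r T (Pi.single k (elemTensor i v)) = Pi.single k (elemTensor i (T v)) := by
  funext l
  rcases eq_or_ne l k with rfl | h
  · simp only [jetMap, ContinuousLinearMap.coe_pi', Pi.single_eq_same]
    ext m
    simp [elemTensor]
  · simp only [jetMap, ContinuousLinearMap.coe_pi', Pi.single_eq_of_ne h]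
    ext m
    simp [h]

theorem jetCoord_prodMk {U : Set 𝔼} (hU : IsOpen U) {f : 𝔼 → F} {g : 𝔼 → F'}
    (hf : ContDiffOn ℝ ∞ f U) (hg : ContDiffOn ℝ ∞ g U) {x : 𝔼} (hx : x ∈ U) :
    jetCoord r (fun y => (f y, g y)) x =
      jetMap n r (.inl ℝ F F') (jetCoord r f x) + jetMap n r (.inr ℝ F F') (jetCoord r g x) := by
  funext k
  have h := iteratedFDeriv_prodMk (i := (k : ℕ)) (hf.contDiffAt (hU.mem_nhds hx))
    (hg.contDiffAt (hU.mem_nhds hx)) (natCast_le_infty _)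
  refine h.trans ?_
  ext m <;> simp [jetMap, jetCoord]

/-- An Euler–Lagrange expression with a fixed auxiliary function `ρ` is a partial Euler–Lagrange
expression of the pair. -/
theorem eulerExpr_param {U : Set 𝔼} (hU : IsOpen U) {L : 𝔼 × JetCoord n r (F × F') → V}
    (hL : ContDiffOn ℝ ∞ L (U ×ˢ univ)) {f : 𝔼 → F} {ρ : 𝔼 → F'} (hf : ContDiffOn ℝ ∞ f U)
    (hρ : ContDiffOn ℝ ∞ ρ U) {x : 𝔼} (hx : x ∈ U) (v : F)  :
    eulerExpr (fun z : 𝔼 × JetCoord n r F => L (z.1, jetMap n r (.inl ℝ F F') z.2 +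
      jetMap n r (.inr ℝ F F') (jetCoord r ρ z.1))) f x v =
      eulerExpr L (fun y => (f y, ρ y)) x (v, 0) := by
  have hL' : ContDiffOn ℝ ∞ (fun z : 𝔼 × JetCoord n r F => L (z.1, jetMap n r (.inl ℝ F F') z.2 +
      jetMap n r (.inr ℝ F F') (jetCoord r ρ z.1))) (U ×ˢ univ) := by
    have h2 : ContDiffOn ℝ ∞ (fun z : 𝔼 × JetCoord n r F => jetMap n r (.inl ℝ F F') z.2 +
      jetMap n r (.inr ℝ F F') (jetCoord r ρ z.1)) (U ×ˢ univ) := ContDiffOn.add ?_ ?_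
    · have h3 := contDiffOn_fst.prodMk h2
      exact ContDiffOn.comp hL h3 fun z (hz : z ∈ U ×ˢ univ) => ⟨hz.1, mem_univ _⟩
    · exact ((jetMap n r (.inl ℝ F F')).contDiff.comp contDiff_snd).contDiffOn
    · exact (jetMap n r (.inr ℝ F F')).contDiff.comp_contDiffOn
        ((contDiffOn_jetCoord hU hρ r).comp contDiffOn_fst fun z hz => hz.1)
  refine Finset.sum_congr rfl fun k _ => congrArg _ (Finset.sum_congr rfl fun i _ => ?_)
  refine congrArg (fun T : 𝔼 [×(k : ℕ)]→L[ℝ] V => T _) ?_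
  refine Filter.EventuallyEq.eq_of_nhds (Filter.EventuallyEq.iteratedFDeriv ℝ ?_ k)
  filter_upwards [hU.mem_nhds hx] with y hy
  have hy1 : U ×ˢ univ ∈ 𝓝 (y, jetCoord r f y) := (hU.prod isOpen_univ).mem_nhds ⟨hy, mem_univ _⟩
  have hy2 : U ×ˢ univ ∈ 𝓝 (y, jetCoord r (fun y => (f y, ρ y)) y) :=
    (hU.prod isOpen_univ).mem_nhds ⟨hy, mem_univ _⟩
  have d1 := ((hL'.contDiffAt hy1).differentiableAt (by simp)).hasFDerivAt.comp
      (jetCoord r f y) (hasFDerivAt_prodMk_right y (jetCoord r f y))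
  have d2 := ((hL.contDiffAt hy2).differentiableAt (by simp)).hasFDerivAt
  -- The jet of the pair is affine in the jet of `f` when `ρ` is frozen, so the differentials agree
  -- by the chain rule along `u ↦ (u, jet of ρ)`.
  rw [jetCoord_prodMk hU hf hρ hy] at d2 ⊢
  have d3 : HasFDerivAt (fun u : JetCoord n r F => (y, jetMap n r (.inl ℝ F F') u +
      jetMap n r (.inr ℝ F F') (jetCoord r ρ y)))
      (((0 : JetCoord n r F →L[ℝ] 𝔼)).prod (jetMap n r (.inl ℝ F F'))) (jetCoord r f y) :=
    (hasFDerivAt_const _ _).prodMk ((jetMap n r (.inl ℝ F F')).hasFDerivAt.add_const _)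
  have d4 := d2.comp (jetCoord r f y) d3
  have := DFunLike.congr_fun (d1.unique d4) (Pi.single k (elemTensor i v))
  simpa [jetMap_single] using this

/-- A Lagrangian has vanishing Euler–Lagrange expression along `f` if its differential vanishes
along the jet of `f`. -/
theorem eulerExpr_eq_zero_of_fderiv {L : 𝔼 × JetCoord n r F → V} {f : 𝔼 → F} {x : 𝔼}
    (h : ∀ᶠ y in 𝓝 x, fderiv ℝ L (y, jetCoord r f y) = 0) (v : F) : eulerExpr L f x v = 0 := by
  refine Finset.sum_eq_zero fun k _ => smul_eq_zero_of_right _ (Finset.sum_eq_zero fun i _ => ?_)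
  have h1 : (fun y => fderiv ℝ L (y, jetCoord r f y) (0, Pi.single k (elemTensor i v))) =ᶠ[𝓝 x]
      fun _ => 0 := by
    filter_upwards [h] with y hy
    rw [hy]; rfl
  rw [(h1.iteratedFDeriv ℝ _).eq_of_nhds, iteratedFDeriv_fun_zero]
  rfl

/-- Every summand contains two factors that vanish along the jet of `f`, so by Leibniz its
differential vanishes there as well. -/
theorem eulerExpr_bilinear_eq_zero {ι : Type*} [Fintype ι] {U : Set 𝔼} (hU : IsOpen U)
    {A B : ι → 𝔼 × JetCoord n r F → ℝ} {W : ι → ι → 𝔼 × JetCoord n r F → ℝ}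
    (hA : ∀ a, ContDiffOn ℝ ∞ (A a) (U ×ˢ univ)) (hB : ∀ a, ContDiffOn ℝ ∞ (B a) (U ×ˢ univ))
    (hW : ∀ a b, ContDiffOn ℝ ∞ (W a b) (U ×ˢ univ)) {f : 𝔼 → F} {x : 𝔼} (hx : x ∈ U)
    (hA0 : ∀ a, ∀ᶠ y in 𝓝 x, A a (y, jetCoord r f y) = 0)
    (hB0 : ∀ a, ∀ᶠ y in 𝓝 x, B a (y, jetCoord r f y) = 0) (v : F) :
    eulerExpr (fun z => ∑ a, ∑ b, A a z * B b z * W a b z) f x v = 0 := by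
  refine eulerExpr_eq_zero_of_fderiv ?_ v
  filter_upwards [hU.mem_nhds hx, Filter.eventually_all.2 hA0, Filter.eventually_all.2 hB0] with
    y hy h1 h2
  have hn : U ×ˢ univ ∈ 𝓝 (y, jetCoord r f y) := (hU.prod isOpen_univ).mem_nhds ⟨hy, mem_univ _⟩
  have hd : ∀ {g : 𝔼 × JetCoord n r F → ℝ}, ContDiffOn ℝ ∞ g (U ×ˢ univ) →
      HasFDerivAt g (fderiv ℝ g (y, jetCoord r f y)) (y, jetCoord r f y) := fun hg =>
    ((hg.contDiffAt hn).differentiableAt (by simp)).hasFDerivAt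
  have h := HasFDerivAt.fun_sum (u := Finset.univ) fun a _ =>
    HasFDerivAt.fun_sum (u := Finset.univ) fun b _ =>
      ((hd (hA a)).mul (hd (hB b))).mul (hd (hW a b))
  exact h.fderiv.trans (by simp [h1, h2])

end Param

/-! ## The bracket of top forms in coordinates -/

/-- The standard volume form of `ℝⁿ`. -/
def volCov (n : ℕ) : Cov n n where
  toMultilinearMap := (EuclideanSpace.basisFun (Fin n) ℝ).toBasis.det.toMultilinearMap
  cont := by
    change Continuous fun v => (EuclideanSpace.basisFun (Fin n) ℝ).toBasis.det v
    simp only [Module.Basis.det_apply]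
    refine Continuous.matrix_det (continuous_pi fun i => continuous_pi fun j => ?_)
    simp only [Module.Basis.toMatrix_apply, OrthonormalBasis.coe_toBasis_repr_apply,
      EuclideanSpace.basisFun_repr]
    fun_prop
  map_eq_zero_of_eq' := (EuclideanSpace.basisFun (Fin n) ℝ).toBasis.det.map_eq_zero_of_eq'

theorem onFrame_volCov (n : ℕ) : onFrame (volCov n) = 1 := by
  have h := (EuclideanSpace.basisFun (Fin n) ℝ).toBasis.det_self
  refine Eq.trans ?_ h
  refine congrArg (EuclideanSpace.basisFun (Fin n) ℝ).toBasis.det (funext fun i => ?_)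
  simp

theorem eq_onFrame_smul_volCov {n : ℕ} (a : Cov n n) : a = onFrame a • volCov n :=
  onFrame_injective (by
    rw [← onFrameL_apply (_ • _), map_smul, onFrameL_apply, onFrame_volCov, smul_eq_mul, mul_one])

section Bracket

variable {n : ℕ} {M : Type*} [TopologicalSpace M] [ChartedSpace (EuclideanSpace ℝ (Fin n)) M]
  [IsManifold (𝓡 n) ∞ M] [T2Space M]
  {F : Type*} [NormedAddCommGroup F] [NormedSpace ℝ F] [FiniteDimensional ℝ F]
  {E : M → Type*} [TopologicalSpace (TotalSpace F E)] [∀ p, TopologicalSpace (E p)]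
  [∀ p, AddCommGroup (E p)] [∀ p, Module ℝ (E p)] [FiberBundle F E] [VectorBundle ℝ F E]
  [ContMDiffVectorBundle ∞ F E (𝓡 n)]

local notation "cht" => chartAt (EuclideanSpace ℝ (Fin n))
local notation "𝔼" => EuclideanSpace ℝ (Fin n)

theorem fibreChange_apply {q q' : M} {x : 𝔼}
    (hx : x ∈ overlap (n := n) (F := F) (E := E) q q') (v : F) :
    fibreChange (n := n) (F := F) (E := E) q q' (x, v) =
      (trivializationAt F E q').linearMapAt ℝ ((cht q).symm x)
        ((trivializationAt F E q).symmₗ ℝ ((cht q).symm x) v) := by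
  rw [(trivializationAt F E q').coe_linearMapAt_of_mem hx.2.2,
    (trivializationAt F E q).coe_symmₗ hx.1.2, fibreChange, ofCoord,
    ← (trivializationAt F E q).mk_symm hx.1.2]

theorem contDiffOn_comp_chart_symm {ρ : M → ℝ} (hρ : ContMDiff (𝓡 n) 𝓘(ℝ, ℝ) ∞ ρ) (q : M) :
    ContDiffOn ℝ ∞ (fun x => ρ ((cht q).symm x)) (cht q).target := fun x hx =>
  (contMDiffAt_iff_contDiffAt.1 ((hρ _).comp x (contMDiffOn_chart_symm.contMDiffAt
    ((cht q).open_target.mem_nhds hx)))).contDiffWithinAt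

/-- The source form `ℓ(θ) ∧ d^nx` in the coordinates at `p`, cut off by `χ`. -/
def cutoffSource (p : M) (χ : M → ℝ) (l : F →ₗ[ℝ] ℝ) : PreSource n F E n := fun j =>
  (l.comp ((trivializationAt F E p).linearMapAt ℝ j.1)).smulRight
    (χ j.1 • ofChart p j.1 (volCov n))

theorem cutoffSource_apply {p : M} {χ : M → ℝ} {l : F →ₗ[ℝ] ℝ} {j : InfJet n F E}
    (hj : j.1 ∈ dom (n := n) F E p) (v : F) :
    toChart (n := n) p j.1 (cutoffSource p χ l j ((trivializationAt F E p).symmₗ ℝ j.1 v)) =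
      (l v * χ j.1) • volCov n := by
  have h1 : (trivializationAt F E p).linearMapAt ℝ j.1
      ((trivializationAt F E p).symmₗ ℝ j.1 v) = v :=
    (trivializationAt F E p).linearMapAt_symmₗ hj.2 v
  have h2 : cutoffSource p χ l j ((trivializationAt F E p).symmₗ ℝ j.1 v) =
      l v • χ j.1 • ofChart p j.1 (volCov n) := by
    refine Eq.trans ?_ (congrArg (fun u => l u • χ j.1 • ofChart p j.1 (volCov n)) h1)
    rfl
  rw [h2, ← toChartL_apply, map_smul, map_smul, toChartL_apply, toChart_ofChart hj.1, smul_smul]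

/-- The support of the cut-off lies in the coordinate domain at `p`. A chart at `q` therefore sees
either smooth transition functions times `χ`, or zero. -/
theorem isSource_cutoffSource (p : M) {χ : M → ℝ} (hχ : ContMDiff (𝓡 n) 𝓘(ℝ, ℝ) ∞ χ)
    (hχp : tsupport χ ⊆ dom (n := n) F E p) (l : F →ₗ[ℝ] ℝ) :
    IsSource (cutoffSource (n := n) (E := E) p χ l) := by
  intro v
  refine isLocal_iff_repOn.2 ⟨0, fun q => ?_⟩
  set g : 𝔼 → Cov n n := fun x => toChart q ((cht q).symm x)
    ((l ((trivializationAt F E p).linearMapAt ℝ ((cht q).symm x)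
      ((trivializationAt F E q).symmₗ ℝ ((cht q).symm x) v))) •
        χ ((cht q).symm x) • ofChart p ((cht q).symm x) (volCov n)) with hg
  have hgs : ContDiffOn ℝ ∞ g (coordDom n F E q) := by
    intro x hx
    refine ContDiffAt.contDiffWithinAt ?_
    by_cases hxp : (cht q).symm x ∈ dom (n := n) F E p
    · have hxo : x ∈ overlap (n := n) (F := F) (E := E) q p := ⟨hx, hxp⟩
      have hO := isOpen_overlap (n := n) (F := F) (E := E) q p
      have h1 : ∀ y ∈ overlap (n := n) (F := F) (E := E) q p, g y =
          (l (fibreChange (n := n) (F := F) (E := E) q p (y, v)) * χ ((cht q).symm y)) •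
          (volCov n).compContinuousLinearMap (fderiv ℝ (transition q p) y) := by
        intro y hy
        rw [hg]
        dsimp only
        rw [← fibreChange_apply hy, smul_smul, ← toChartL_apply, map_smul, toChartL_apply,
          toChart_change q p ((cht q).map_target hy.1.1) hy.2.1, toChart_ofChart hy.2.1,
          (cht q).right_inv hy.1.1]
      have h2 : ContDiffOn ℝ ∞ (fun y => l (fibreChange (n := n) (F := F) (E := E) q p (y, v)))
          (overlap (n := n) (F := F) (E := E) q p) :=
        l.toContinuousLinearMap.contDiff.comp_contDiffOn
          ((contDiffOn_fibreChange q p).comp (contDiffOn_id.prodMk contDiffOn_const)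
            fun y hy => ⟨hy, mem_univ _⟩)
      have h3 : ContDiffOn ℝ ∞ (fderiv ℝ (transition q p))
          (overlap (n := n) (F := F) (E := E) q p) :=
        (contDiffOn_transition_overlap q p).fderiv_of_isOpen hO (by simp)
      have h4 := contDiffOn_comp_clm (contDiffOn_const (c := volCov n)) h3
      refine ContDiffAt.congr_of_eventuallyEq (((h2.mul ((contDiffOn_comp_chart_symm hχ q).mono
        fun y hy => hy.1.1)).smul h4).contDiffAt (hO.mem_nhds hxo)) ?_
      filter_upwards [hO.mem_nhds hxo] with y hy
      exact h1 y hy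
    · refine (contDiffAt_const (c := (0 : Cov n n))).congr_of_eventuallyEq ?_
      have h1 : (tsupport χ)ᶜ ∈ 𝓝 ((cht q).symm x) :=
        (isClosed_tsupport χ).isOpen_compl.mem_nhds fun h => hxp (hχp h)
      filter_upwards [((cht q).continuousAt_symm hx.1).preimage_mem_nhds h1] with y hy
      rw [hg]
      dsimp only
      rw [image_eq_zero_of_notMem_tsupport hy, zero_smul, smul_zero]
      exact map_zero (toChartL n q _)
  refine ⟨fun z => g z.1, hgs.comp contDiffOn_fst fun z hz => hz.1, fun φ x hx => rfl⟩

theorem exists_cutoff (p : M) {O : Set M} (hO : O ∈ 𝓝 p) : ∃ χ : M → ℝ,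
    ContMDiff (𝓡 n) 𝓘(ℝ, ℝ) ∞ χ ∧ tsupport χ ⊆ O ∧ HasCompactSupport χ ∧
      ∀ᶠ p' in 𝓝 p, χ p' = 1 := by
  obtain ⟨f, -, hf⟩ := (SmoothBumpFunction.nhds_basis_tsupport (I := 𝓡 n) p).mem_iff.1 hO
  exact ⟨f, f.contMDiff, hf, f.hasCompactSupport, f.eventuallyEq_one⟩

/-- The coordinate of a source form. -/
def sourceCoord (q : M) (ξ : PreSource n F E n) (a : Fin (Module.finrank ℝ F))
    (j : InfJet n F E) : ℝ :=
  onFrame (toChart q j.1 (ξ j ((trivializationAt F E q).symmₗ ℝ j.1 (Module.finBasis ℝ F a))))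

/-- Where the cut-off equals one, the cut-off coordinate forms are a frame of the fibre of source
forms. -/
theorem eq_sum_sourceCoord {p : M} {χ : M → ℝ} (ξ : PreSource n F E n) {j : InfJet n F E}
    (hj : j.1 ∈ dom (n := n) F E p) (h1 : χ j.1 = 1) :
    ξ j = ∑ a, sourceCoord p ξ a j • cutoffSource p χ ((Module.finBasis ℝ F).coord a) j := by
  refine source_ext hj fun v => ?_
  set S : F →ₗ[ℝ] Cov n n := ((toChartL n p j.1 : Cov n n →L[ℝ] Cov n n) : Cov n n →ₗ[ℝ]
    Cov n n).comp ((ξ j).comp ((trivializationAt F E p).symmₗ ℝ j.1)) with hS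
  have e1 : toChart p j.1 (ξ j ((trivializationAt F E p).symmₗ ℝ j.1 v)) = S v := rfl
  have e2 : ∀ a, S (Module.finBasis ℝ F a) = sourceCoord p ξ a j • volCov n := fun a =>
    eq_onFrame_smul_volCov _
  rw [e1, ← (Module.finBasis ℝ F).sum_repr v, map_sum S]
  simp only [map_smul S, e2]
  rw [(Module.finBasis ℝ F).sum_repr v, LinearMap.sum_apply, ← toChartL_apply, map_sum]
  refine Finset.sum_congr rfl fun a _ => ?_
  rw [LinearMap.smul_apply, map_smul, toChartL_apply, cutoffSource_apply hj, h1, mul_one,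
    smul_comm]
  rfl

variable {ν : M → Cov n n} {w : Pairing n F E}

/-- The bracket of source forms is a bilinear expression in their coordinates. -/
theorem exists_pairing_coord (hν : IsVolumeForm ν) (hw : IsSkewPairing w) (p : M) :
    ∃ (U : Set 𝔼) (s : ℕ) (W : Fin (Module.finrank ℝ F) → Fin (Module.finrank ℝ F) →
      𝔼 × JetCoord n s F → ℝ), IsOpen U ∧ cht p p ∈ U ∧ U ⊆ coordDom n F E p ∧
      (∀ a b, ContDiffOn ℝ ∞ (W a b) (U ×ˢ univ)) ∧
      ∀ (ξ η : PreSource n F E n) (φ : Sec n F E), ∀ x ∈ U,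
        onFrame (toChart p ((cht p).symm x) (w (φ.jet ((cht p).symm x))
          (ξ (φ.jet ((cht p).symm x))) (η (φ.jet ((cht p).symm x))) • ν ((cht p).symm x))) =
        ∑ a, ∑ b, sourceCoord p ξ a (φ.jet ((cht p).symm x)) *
          sourceCoord p η b (φ.jet ((cht p).symm x)) * W a b (x, jetCoord s (φ.rep p) x) := by
  obtain ⟨χ, hχ, hχs, -, hχ1⟩ := exists_cutoff (n := n) p ((isOpen_dom (n := n) (F := F) (E := E) p).mem_nhds
    (mem_dom_self p))
  set Θ : Fin (Module.finrank ℝ F) → PreSource n F E n := fun a =>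
    cutoffSource p χ ((Module.finBasis ℝ F).coord a) with hΘ
  have hΘs : ∀ a, IsSource (Θ a) := fun a => isSource_cutoffSource p hχ hχs _
  -- The locality of `w` is given only for globally defined source forms. This is the reason for the
  -- cut-offs, which are equal to one on the final neighbourhood `U`.
  have hloc : ∀ a b, ∃ r, ∀ s, r ≤ s → ∃ L, RepOn p (fun j => w j (Θ a j) (Θ b j)) s
      (coordDom n F E p) L := by
    intro a b
    obtain ⟨r, h⟩ := isLocal_iff_repOn.1 (hw.isLocal _ _ (hΘs a) (hΘs b))
    obtain ⟨L, hL⟩ := h p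
    exact ⟨r, fun s hs => ⟨_, hL.raise hs⟩⟩
  choose r hr using hloc
  set s := Finset.univ.sup fun a => Finset.univ.sup (r a) with hs
  have hrs : ∀ a b, r a b ≤ s := fun a b =>
    (Finset.le_sup (f := r a) (Finset.mem_univ b)).trans
      (Finset.le_sup (f := fun a => Finset.univ.sup (r a)) (Finset.mem_univ a))
  choose L hL using fun a b => hr a b s (hrs a b)
  have hx0 := chart_mem_coordDom (mem_dom_self (n := n) (F := F) (E := E) p)
  have hev : ∀ᶠ x in 𝓝 (cht p p), x ∈ coordDom n F E p ∧ χ ((cht p).symm x) = 1 := by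
    refine Filter.Eventually.and ((isOpen_coordDom p).mem_nhds hx0) ?_
    have h := (cht p).continuousAt_symm (mem_chart_target _ p)
    rw [ContinuousAt, (cht p).left_inv (mem_chart_source _ p)] at h
    exact h.eventually hχ1
  obtain ⟨U, hU, hUo, hxU⟩ := mem_nhds_iff.1 hev
  refine ⟨U, s, fun a b z => L a b z * frameCoord ν p z.1, hUo, hxU, fun x hx => (hU hx).1,
    fun a b => ?_, fun ξ η φ x hx => ?_⟩
  · refine ((hL a b).1.mono (prod_mono (fun x hx => (hU hx).1) subset_rfl)).mul ?_
    exact (hν.contDiffOn_frameCoord p).comp contDiffOn_fst fun z hz => (hU hz.1).1.1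
  · have hxd := chart_symm_mem_dom (hU hx).1
    have h1 : χ (φ.jet ((cht p).symm x)).1 = 1 := (hU hx).2
    have e0 := map_smul ((onFrameL n).comp (toChartL n p ((cht p).symm x)))
      (w (φ.jet ((cht p).symm x))
          (ξ (φ.jet ((cht p).symm x))) (η (φ.jet ((cht p).symm x)))) (ν ((cht p).symm x))
    refine Eq.trans e0 ?_
    have e1 : w (φ.jet ((cht p).symm x))
        (ξ (φ.jet ((cht p).symm x))) (η (φ.jet ((cht p).symm x))) =
        ∑ a, ∑ b, sourceCoord p ξ a (φ.jet ((cht p).symm x)) *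
          sourceCoord p η b (φ.jet ((cht p).symm x)) * L a b (x, jetCoord s (φ.rep p) x) := by
      rw [eq_sum_sourceCoord (χ := χ) ξ hxd h1, eq_sum_sourceCoord (χ := χ) η hxd h1,
        map_sum (w (φ.jet ((cht p).symm x))), LinearMap.sum_apply]
      refine Finset.sum_congr rfl fun a _ => ?_
      rw [map_sum]
      refine Finset.sum_congr rfl fun b _ => ?_
      rw [map_smul, map_smul, LinearMap.smul_apply, ← (hL a b).2 φ x (hU hx).1, smul_eq_mul,
        smul_eq_mul]
      ring
    rw [e1, smul_eq_mul, Finset.sum_mul]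
    refine Finset.sum_congr rfl fun a _ => ?_
    rw [Finset.sum_mul]
    refine Finset.sum_congr rfl fun b _ => ?_
    rw [mul_assoc]
    rfl

/-! ## The bracket of top forms -/

theorem isHorizontal_topBracket (hν : IsVolumeForm ν) (hw : IsSkewPairing w)
    {α β : PreForm n F E n} (hα : IsHorizontal α) (hβ : IsHorizontal β) :
    IsHorizontal (topBracket ν w α β) := by
  obtain ⟨r, h⟩ := isLocal_iff_repOn.1 (hw.isLocal _ _ (isSource_euler hα) (isSource_euler hβ))
  refine isHorizontal_iff_repOn.2 ⟨r, fun q => ?_⟩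
  obtain ⟨L, hL⟩ := h q
  refine ⟨fun z => L z • toChart q ((cht q).symm z.1) (ν ((cht q).symm z.1)), ?_, fun φ x hx => ?_⟩
  · exact hL.1.smul ((hν.smooth q).comp contDiffOn_fst fun z hz => hz.1.1)
  · dsimp only
    rw [← hL.2 φ x hx]
    exact map_smul (toChartL n q _) _ _

theorem topBracket_add_left {α α' : PreForm n F E n} (hα : IsHorizontal α)
    (hα' : IsHorizontal α') (β : PreForm n F E n) :
    topBracket ν w (α + α') β = topBracket ν w α β + topBracket ν w α' β := by
  funext j
  change w j (euler (α + α') j) (euler β j) • ν j.1 = w j (euler α j) (euler β j) • ν j.1 +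
    w j (euler α' j) (euler β j) • ν j.1
  rw [euler_add hα hα', ← add_smul, Pi.add_apply, map_add]
  rfl

theorem topBracket_smul_left {α : PreForm n F E n} (hα : IsHorizontal α) (c : ℝ)
    (β : PreForm n F E n) : topBracket ν w (c • α) β = c • topBracket ν w α β := by
  funext j
  change w j (euler (c • α) j) (euler β j) • ν j.1 = c • w j (euler α j) (euler β j) • ν j.1
  rw [euler_smul hα, Pi.smul_apply, map_smul, smul_smul]
  rfl

theorem topBracket_skew (hw : IsSkewPairing w) (α β : PreForm n F E n) :
    topBracket ν w α β = -topBracket ν w β α := by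
  funext j
  change w j (euler α j) (euler β j) • ν j.1 = -(w j (euler β j) (euler α j) • ν j.1)
  rw [hw.skew]
  exact neg_smul (w j (euler β j) (euler α j)) (ν j.1)

theorem topBracket_congr_left {α α' : PreForm n F E n} {j : InfJet n F E}
    (h : euler α j = euler α' j) (β : PreForm n F E n) :
    topBracket ν w α β j = topBracket ν w α' β j := by
  change w j (euler α j) (euler β j) • ν j.1 = w j (euler α' j) (euler β j) • ν j.1
  rw [h]

theorem topBracket_of_euler_eq_zero {α : PreForm n F E n} {j : InfJet n F E} (h : euler α j = 0)
    (β : PreForm n F E n) : topBracket ν w α β j = 0 := by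
  change w j (euler α j) (euler β j) • ν j.1 = 0
  rw [h, map_zero, LinearMap.zero_apply, zero_smul]

theorem sourceCoord_euler {α : PreForm n F E n} (hα : IsHorizontal α) {q : M} {r : ℕ} {U : Set 𝔼}
    (hU : IsOpen U) (hUq : U ⊆ coordDom n F E q) {L : 𝔼 × JetCoord n r F → Cov n n}
    (hL : RepOn q (comp q α) r U L) (φ : Sec n F E) {x : 𝔼} (hx : x ∈ U)
    (a : Fin (Module.finrank ℝ F)) :
    sourceCoord q (euler α) a (φ.jet ((cht q).symm x)) =
      eulerExpr (fun z => onFrameL n (L z)) (φ.rep q) x (Module.finBasis ℝ F a) := by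
  rw [eulerExpr_clm hU hL.1 ((contDiffOn_rep φ q).mono hUq) hx,
    ← toChart_euler hα hU hUq hL φ hx]
  rfl

theorem exists_repOn_sourceCoord_euler {α : PreForm n F E n} (hα : IsHorizontal α) {q : M}
    {U : Set 𝔼} (hU : IsOpen U) (hUq : U ⊆ coordDom n F E q) : ∃ r : ℕ, ∀ s, r ≤ s → ∀ a, ∃ L,
      RepOn q (sourceCoord q (euler α) a) s U L := by
  obtain ⟨r, h⟩ := isHorizontal_iff_repOn.1 hα
  obtain ⟨L, hL⟩ := h q
  have hL := hL.mono hUq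
  refine ⟨r + r, fun s hs a => ?_⟩
  obtain ⟨L', h'⟩ := exists_repOn_of_isLocOp (B := sourceCoord q (euler α) a) hUq
    (isLocOp_eulerExpr hU ((onFrameL n).contDiff.comp_contDiffOn hL.1) (Module.finBasis ℝ F a))
    fun φ x hx => sourceCoord_euler hα hU hUq hL φ hx a
  exact ⟨_, h'.raise hs⟩

/-- The Euler–Lagrange form of a bracket vanishes near the jets where both Euler–Lagrange forms
vanish. -/
theorem euler_topBracket_eq_zero (hν : IsVolumeForm ν) (hw : IsSkewPairing w)
    {α β : PreForm n F E n} (hα : IsHorizontal α) (hβ : IsHorizontal β) (φ : Sec n F E) {p : M}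
    (h1 : ∀ᶠ p' in 𝓝 p, euler α (φ.jet p') = 0) (h2 : ∀ᶠ p' in 𝓝 p, euler β (φ.jet p') = 0) :
    euler (topBracket ν w α β) (φ.jet p) = 0 := by
  obtain ⟨U, s, W, hU, hxU, hUp, hW, hb⟩ := exists_pairing_coord hν hw p
  obtain ⟨r₁, hr₁⟩ := exists_repOn_sourceCoord_euler hα hU hUp
  obtain ⟨r₂, hr₂⟩ := exists_repOn_sourceCoord_euler hβ hU hUp
  set R := max s (max r₁ r₂) with hR
  choose A hA using hr₁ R ((le_max_left _ _).trans (le_max_right _ _))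
  choose B hB using hr₂ R ((le_max_right _ _).trans (le_max_right _ _))
  have hsR : s ≤ R := le_max_left _ _
  set W' : Fin (Module.finrank ℝ F) → Fin (Module.finrank ℝ F) → 𝔼 × JetCoord n R F → ℝ :=
    fun a b z => W a b (z.1, jetTrunc F hsR z.2) with hW'
  have hWs : ∀ a b, ContDiffOn ℝ ∞ (W' a b) (U ×ˢ univ) := fun a b =>
    (hW a b).comp (contDiffOn_fst.prodMk ((jetTrunc F hsR).contDiff.comp_contDiffOn
      contDiffOn_snd)) fun z hz => ⟨hz.1, mem_univ _⟩
  -- Near `p` the bracket is bilinear in the components of the two Euler forms, all of which vanish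
  -- along `φ`.
  set L : 𝔼 × JetCoord n R F → ℝ := fun z => ∑ a, ∑ b, A a z * B b z * W' a b z with hL
  have hLs : ContDiffOn ℝ ∞ L (U ×ˢ univ) := ContDiffOn.sum fun a _ => ContDiffOn.sum fun b _ =>
    ((hA a).1.mul (hB b).1).mul (hWs a b)
  set T : ℝ →L[ℝ] Cov n n := (ContinuousLinearMap.id ℝ ℝ).smulRight (volCov n) with hT
  have hrep : RepOn p (comp p (topBracket ν w α β)) R U (fun z => T (L z)) := by
    refine ⟨T.contDiff.comp_contDiffOn hLs, fun ψ x hx => ?_⟩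
    refine (eq_onFrame_smul_volCov _).trans ?_
    refine congrArg (fun c : ℝ => c • volCov n) ?_
    refine (hb (euler α) (euler β) ψ x hx).trans ?_
    refine Finset.sum_congr rfl fun a _ => Finset.sum_congr rfl fun b _ => ?_
    rw [(hA a).2 ψ x hx, (hB b).2 ψ x hx, hW']
    dsimp only
    rw [jetTrunc_jetCoord]
  have hchart : ∀ {ξ : PreSource n F E n}, (∀ᶠ p' in 𝓝 p, ξ (φ.jet p') = 0) →
      ∀ a, ∀ᶠ x in 𝓝 (cht p p), sourceCoord p ξ a (φ.jet ((cht p).symm x)) = 0 := by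
    intro ξ hξ a
    have h := (cht p).continuousAt_symm (mem_chart_target _ p)
    rw [ContinuousAt, (cht p).left_inv (mem_chart_source _ p)] at h
    filter_upwards [h.eventually hξ] with x hx
    rw [sourceCoord, hx]
    exact map_zero ((onFrameL n).comp (toChartL n p ((cht p).symm x)))
  refine source_ext_self (n := n) (F := F) (E := E) (p := p) fun v => ?_
  refine (euler_eq_of_repOn (isHorizontal_topBracket hν hw hα hβ) hU hUp hrep φ hxU v).trans ?_
  rw [eulerExpr_clm hU hLs ((contDiffOn_rep φ p).mono hUp) hxU, eulerExpr_bilinear_eq_zero hU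
    (fun a => (hA a).1) (fun a => (hB a).1) hWs hxU, map_zero]
  · rfl
  · intro a
    filter_upwards [hU.mem_nhds hxU, hchart h1 a] with y hy h
    rw [← (hA a).2 φ y hy, h]
  · intro a
    filter_upwards [hU.mem_nhds hxU, hchart h2 a] with y hy h
    rw [← (hB a).2 φ y hy, h]

theorem IsOmegaC.zero {k : ℕ} : IsOmegaC (0 : PreForm n F E k) where
  horizontal := .zero
  compact _ := ⟨∅, isCompact_empty, fun _ _ => rfl⟩
  compact_euler h _ := by
    subst h
    exact ⟨∅, isCompact_empty, fun p _ => by rw [euler_zero]; rfl⟩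

theorem IsOmegaC.add {k : ℕ} {α β : PreForm n F E k} (hα : IsOmegaC α) (hβ : IsOmegaC β) :
    IsOmegaC (α + β) where
  horizontal := hα.horizontal.add hβ.horizontal
  compact := CompactAlong.add hα.compact hβ.compact
  compact_euler h φ := by
    subst h
    obtain ⟨K, hK, h⟩ := hα.compact_euler rfl φ
    obtain ⟨K', hK', h'⟩ := hβ.compact_euler rfl φ
    refine ⟨K ∪ K', hK.union hK', fun p hp => ?_⟩
    rw [mem_union, not_or] at hp
    rw [euler_add hα.horizontal hβ.horizontal, Pi.add_apply, h p hp.1, h' p hp.2, add_zero]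

theorem IsOmegaC.smul {k : ℕ} {α : PreForm n F E k} (hα : IsOmegaC α) (c : ℝ) :
    IsOmegaC (c • α) where
  horizontal := hα.horizontal.smul c
  compact := CompactAlong.smul hα.compact c
  compact_euler h φ := by
    subst h
    obtain ⟨K, hK, h⟩ := hα.compact_euler rfl φ
    exact ⟨K, hK, fun p hp => by
      rw [euler_smul hα.horizontal, Pi.smul_apply, h p hp, smul_zero]⟩

/-- For the support of the bracket one compactly supported Euler form suffices. Its own Euler form
involves derivatives in the fibre; off both supports the bracket is a product of two vanishing
factors, so these derivatives vanish too. This is where the Euler condition in `IsOmegaC` is needed.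
-/
theorem IsOmegaC.topBracket (hν : IsVolumeForm ν) (hw : IsSkewPairing w)
    {α β : PreForm n F E n} (hα : IsOmegaC α) (hβ : IsOmegaC β) :
    IsOmegaC (topBracket ν w α β) where
  horizontal := isHorizontal_topBracket hν hw hα.horizontal hβ.horizontal
  compact φ := by
    obtain ⟨K, hK, h⟩ := hα.compact_euler rfl φ
    exact ⟨K, hK, fun p hp => topBracket_of_euler_eq_zero (h p hp) β⟩
  compact_euler _ φ := by
    obtain ⟨K, hK, h⟩ := hα.compact_euler rfl φ
    obtain ⟨K', hK', h'⟩ := hβ.compact_euler rfl φ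
    refine ⟨K ∪ K', hK.union hK', fun p hp => ?_⟩
    rw [mem_union, not_or] at hp
    refine euler_topBracket_eq_zero hν hw hα.horizontal hβ.horizontal φ.1 ?_ ?_
    · filter_upwards [hK.isClosed.isOpen_compl.mem_nhds hp.1] with p' hp' using h p' hp'
    · filter_upwards [hK'.isClosed.isOpen_compl.mem_nhds hp.2] with p' hp' using h' p' hp'

end Bracket

/-! ## The homotopy formula -/

section Homotopy

variable {n r : ℕ} {F : Type*} [NormedAddCommGroup F] [NormedSpace ℝ F] [FiniteDimensional ℝ F]
  {U : Set (EuclideanSpace ℝ (Fin n))}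

local notation "𝔼" => EuclideanSpace ℝ (Fin n)

theorem jetCoord_smul (hU : IsOpen U) {f : 𝔼 → F} (hf : ContDiffOn ℝ ∞ f U) (t : ℝ) {x : 𝔼}
    (hx : x ∈ U) : jetCoord r (fun y => t • f y) x = t • jetCoord r f x := by
  funext k
  exact iteratedFDeriv_const_smul_apply ((hf.contDiffAt (hU.mem_nhds hx)).of_le
    (natCast_le_infty _))

theorem continuous_eulerExpr_smul (hU : IsOpen U) {L : 𝔼 × JetCoord n r F → ℝ}
    (hL : ContDiffOn ℝ ∞ L (U ×ˢ univ)) {f : 𝔼 → F} (hf : ContDiffOn ℝ ∞ f U) {x : 𝔼}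
    (hx : x ∈ U) (v : F) : Continuous fun t : ℝ => eulerExpr L (fun y => t • f y) x v := by
  obtain ⟨Λ, hΛ, h⟩ := isLocOp_eulerExpr hU hL v
  have h1 : (fun t : ℝ => eulerExpr L (fun y => t • f y) x v) =
      fun t => Λ (x, t • jetCoord (r + r) f x) := by
    funext t
    have hft : ContDiffOn ℝ ∞ (fun y => t • f y) U := contDiffOn_const.smul hf
    rw [← jetCoord_smul hU hf t hx]
    exact h _ hft x hx
  rw [h1]
  refine hΛ.continuousOn.comp_continuous (by fun_prop) fun t => ⟨hx, mem_univ _⟩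

/-- A Lagrangian is determined by its values along the zero section and its Euler–Lagrange
expression, up to a divergence. -/
theorem exists_homotopy_divergence (hU : IsOpen U) {L : 𝔼 × JetCoord n r F → ℝ}
    (hL : ContDiffOn ℝ ∞ L (U ×ˢ univ)) :
    ∃ Q : Fin n → (𝔼 → F) → 𝔼 → ℝ,
      (∀ j, IsLocOp U (r + r) (Q j)) ∧
      (∀ j f x, (∀ᶠ y in 𝓝 x, f y = 0) → Q j f x = 0) ∧
      (∀ j f x, (∀ᶠ y in 𝓝 x, ∀ u, L (y, u) = 0) → Q j f x = 0) ∧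
      ∀ f, ContDiffOn ℝ ∞ f U → ∀ x ∈ U,
        L (x, jetCoord r f x) - L (x, 0) =
          (∫ t in (0 : ℝ)..1, eulerExpr L (fun y => t • f y) x (f x)) +
            ∑ j, fderiv ℝ (Q j f) x (EuclideanSpace.single j (1 : ℝ)) := by
  obtain ⟨P, hP, hP0, hPL, hPe⟩ := exists_firstVariation_field hU hL
  have hcl : IsCompact (Icc (0 : ℝ) 1) := isCompact_Icc
  have hpair : ∀ {f : 𝔼 → F}, ContDiffOn ℝ ∞ f U →
      ContDiffOn ℝ ∞ (fun p : ℝ × 𝔼 => (p.1 • f p.2, f p.2)) (univ ×ˢ U) := fun {f} hf => by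
    have h1 : ContDiffOn ℝ ∞ (fun p : ℝ × 𝔼 => f p.2) (univ ×ˢ U) :=
      hf.comp contDiffOn_snd fun p hp => hp.2
    exact (contDiffOn_fst.smul h1).prodMk h1
  -- The homotopy runs through `t f` from the zero section to `f`; `P j (t f, f)` is the
  -- first-variation flux at `t f` in the direction `f`.
  refine ⟨fun j f x => ∫ t in Icc (0 : ℝ) 1, P j (fun y => (t • f y, f y)) x, fun j => ?_,
    fun j f x h0 => ?_, fun j f x h0 => ?_, fun f hf x hx => ?_⟩
  · obtain ⟨Λ, hΛ, h⟩ := hP j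
    -- The jet of the pair `(t f, f)` as a function of `t` and the jet of `f`. Its smoothness makes
    -- the integral over `t` a local operator again.
    set S : ℝ → JetCoord n (r + r) F → JetCoord n (r + r) (F × F) := fun t u =>
      jetMap n (r + r) (.inl ℝ F F) (t • u) + jetMap n (r + r) (.inr ℝ F F) u with hS
    have hH : ContDiffOn ℝ ∞ (fun p : ℝ × (𝔼 × JetCoord n (r + r) F) =>
        Λ (p.2.1, S p.1 p.2.2)) (univ ×ˢ (U ×ˢ univ)) := by
      have hSs : ContDiff ℝ ∞ (fun p : ℝ × (𝔼 × JetCoord n (r + r) F) => S p.1 p.2.2) := by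
        refine ContDiff.add ?_ ?_
        · exact (jetMap n (r + r) (.inl ℝ F F)).contDiff.comp
            (contDiff_fst.smul (contDiff_snd.comp contDiff_snd))
        · exact (jetMap n (r + r) (.inr ℝ F F)).contDiff.comp (contDiff_snd.comp contDiff_snd)
      have h1 : ContDiff ℝ ∞ (fun p : ℝ × (𝔼 × JetCoord n (r + r) F) => (p.2.1, S p.1 p.2.2)) :=
        (contDiff_fst.comp contDiff_snd).prodMk hSs
      exact ContDiffOn.comp hΛ h1.contDiffOn fun p hp => ⟨hp.2.1, mem_univ _⟩
    refine ⟨fun z => ∫ t in Icc (0 : ℝ) 1, Λ (z.1, S t z.2), ?_, fun f hf x hx => ?_⟩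
    · refine contDiffOn_setIntegral hcl measurableSet_Icc (hU.prod isOpen_univ)
        (fun t _ => ?_) fun k => ?_
      · exact hH.comp (contDiff_prodMk_right t).contDiffOn fun z hz => ⟨mem_univ _, hz⟩
      · exact (contDiffOn_iteratedFDeriv_partial (isOpen_univ.prod (hU.prod isOpen_univ)) hH
          k).continuousOn.mono (prod_mono (subset_univ _) subset_rfl)
    · refine setIntegral_congr_fun measurableSet_Icc fun t _ => ?_
      dsimp only
      have hft : ContDiffOn ℝ ∞ (fun y => t • f y) U := contDiffOn_const.smul hf
      rw [h _ (hft.prodMk hf) x hx, jetCoord_prodMk hU hft hf hx, jetCoord_smul hU hf t hx]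
  · have : ∀ t : ℝ, P j (fun y => (t • f y, f y)) x = 0 := fun t => hP0 j _ x h0
    simp [this]
  · have : ∀ t : ℝ, P j (fun y => (t • f y, f y)) x = 0 := fun t => hPL j _ x h0
    simp [this]
  · have hg : ∀ j, ContDiffOn ℝ ∞ (fun p : ℝ × 𝔼 => P j (fun y => (p.1 • f y, f y)) p.2)
        (univ ×ˢ U) := by
      intro j
      obtain ⟨Λ, hΛ, h⟩ := hP j
      have h1 := contDiffOn_jetCoord_param (r := r + r) hU (hpair hf)
      have h2 := ContDiffOn.comp hΛ (contDiffOn_snd.prodMk h1)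
        fun p (hp : p ∈ univ ×ˢ U) => ⟨hp.2, mem_univ _⟩
      refine h2.congr fun p hp => ?_
      exact h _ (contDiffOn_section (hpair hf) p.1) p.2 hp.2
    have ho : IsOpen ((univ : Set ℝ) ×ˢ U) := isOpen_univ.prod hU
    have hg' : ∀ j, ContinuousOn (fun p : ℝ × 𝔼 =>
        fderiv ℝ (P j fun y => (p.1 • f y, f y)) p.2) (univ ×ˢ U) := by
      intro j
      have h1 := (hg j).continuousOn_fderiv_of_isOpen ho (by simp)
      have h2 : ContinuousOn (fun p : ℝ × 𝔼 => (fderiv ℝ (fun p : ℝ × 𝔼 =>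
          P j (fun y => (p.1 • f y, f y)) p.2) p).comp (.inr ℝ ℝ 𝔼)) (univ ×ˢ U) :=
        h1.clm_comp continuousOn_const
      refine h2.congr fun p hp => ?_
      have h3 := (((hg j).contDiffAt (ho.mem_nhds hp)).differentiableAt (by simp)).hasFDerivAt
      exact (HasFDerivAt.comp (f := fun y => (p.1, y)) p.2 h3
        (hasFDerivAt_prodMk_right p.1 p.2)).fderiv
    have hQ : ∀ j, fderiv ℝ (fun x => ∫ t in Icc (0 : ℝ) 1, P j (fun y => (t • f y, f y)) x) x
        (EuclideanSpace.single j (1 : ℝ)) = ∫ t in (0 : ℝ)..1,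
          fderiv ℝ (P j fun y => (t • f y, f y)) x (EuclideanSpace.single j (1 : ℝ)) := by
      intro j
      have h1 := hasFDerivAt_setIntegral (μ := volume) hcl measurableSet_Icc
        (H := fun t x => P j (fun y => (t • f y, f y)) x)
        (H' := fun t x => fderiv ℝ (P j fun y => (t • f y, f y)) x) hU
        (fun z hz => (hg j).continuousOn.comp (continuousOn_id.prodMk continuousOn_const)
          fun t _ => ⟨mem_univ _, hz⟩)
        ((hg' j).mono (prod_mono (subset_univ _) subset_rfl))
        (fun t _ z hz => by
          have h2 := contDiffOn_section (hg j) t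
          exact ((h2.contDiffAt (hU.mem_nhds hz)).differentiableAt (by simp)).hasFDerivAt) hx
      have h3 : ContinuousOn (fun t : ℝ => fderiv ℝ (P j fun y => (t • f y, f y)) x)
          (Icc 0 1) := (hg' j).comp (continuousOn_id.prodMk continuousOn_const)
        fun t _ => ⟨mem_univ _, hx⟩
      rw [h1.fderiv, (setIntegral_clm_apply hcl measurableSet_Icc h3 _).2,
        integral_Icc_eq_integral_Ioc, intervalIntegral.integral_of_le zero_le_one]
    have hcont : ∀ j, Continuous fun t : ℝ =>
        fderiv ℝ (P j fun y => (t • f y, f y)) x (EuclideanSpace.single j (1 : ℝ)) := fun j =>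
      ((hg' j).comp_continuous (continuous_id.prodMk continuous_const)
        fun t => ⟨mem_univ _, hx⟩).clm_apply continuous_const
    have hec := continuous_eulerExpr_smul hU hL hf hx (f x)
    simp only [hQ]
    rw [← intervalIntegral.integral_finsetSum fun j _ => (hcont j).intervalIntegrable _ _,
      ← intervalIntegral.integral_add (hec.intervalIntegrable _ _)
        ((continuous_finsetSum _ fun j _ => hcont j).intervalIntegrable _ _)]
    -- The derivative of the Lagrangian along the homotopy, rewritten by the first variation
    -- formula; integration over `[0, 1]` gives the claim.
    have hd : ∀ t : ℝ, HasDerivAt (fun t : ℝ => L (x, t • jetCoord r f x))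
        (eulerExpr L (fun y => t • f y) x (f x) + ∑ j,
          fderiv ℝ (P j fun y => (t • f y, f y)) x (EuclideanSpace.single j (1 : ℝ))) t := by
      intro t
      have hft : ContDiffOn ℝ ∞ (fun y => t • f y) U := contDiffOn_const.smul hf
      rw [← hPe (fun y => t • f y) f hft hf x hx, jetCoord_smul hU hf t hx]
      have h1 : HasFDerivAt L (fderiv ℝ L (x, t • jetCoord r f x)) (x, t • jetCoord r f x) :=
        ((hL.contDiffAt ((hU.prod isOpen_univ).mem_nhds ⟨hx, mem_univ _⟩)).differentiableAt
          (by simp)).hasFDerivAt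
      have h2 : HasDerivAt (fun t : ℝ => (x, t • jetCoord r f x)) (0, jetCoord r f x) t := by
        have := (hasDerivAt_id t).smul_const (jetCoord r f x)
        rw [one_smul] at this
        exact (hasDerivAt_const t x).prodMk this
      exact h1.comp_hasDerivAt t h2
    have hftc := intervalIntegral.integral_eq_sub_of_hasDerivAt (fun t _ => hd t)
      ((hec.add (continuous_finsetSum _ fun j _ => hcont j)).intervalIntegrable 0 1)
    rw [hftc, one_smul, zero_smul]

end Homotopy

/-! ## Forms supported in a coordinate domain -/

section Chart

variable {n : ℕ} {M : Type*} [TopologicalSpace M] [ChartedSpace (EuclideanSpace ℝ (Fin n)) M]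
  [IsManifold (𝓡 n) ∞ M] [T2Space M]
  {F : Type*} [NormedAddCommGroup F] [NormedSpace ℝ F] [FiniteDimensional ℝ F]
  {E : M → Type*} [TopologicalSpace (TotalSpace F E)] [∀ p, TopologicalSpace (E p)]
  [∀ p, AddCommGroup (E p)] [∀ p, Module ℝ (E p)] [FiberBundle F E] [VectorBundle ℝ F E]
  [ContMDiffVectorBundle ∞ F E (𝓡 n)]

local notation "cht" => chartAt (EuclideanSpace ℝ (Fin n))
local notation "𝔼" => EuclideanSpace ℝ (Fin n)

/-- Extension by zero on the jet bundle: the image of `C` is closed, so near any other point of `M`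
the form is identically zero and has a representative of any order. -/
theorem exists_form_of_chart {k r : ℕ} {q : M} {U C : Set 𝔼} (hU : IsOpen U)
    (hUq : U ⊆ coordDom n F E q) (hC : IsCompact C) (hCU : C ⊆ U)
    {L : 𝔼 × JetCoord n r F → Cov n k} (hL : ContDiffOn ℝ ∞ L (U ×ˢ univ))
    (h0 : ∀ φ : Sec n F E, ∀ x ∈ U, x ∉ C → L (x, jetCoord r (φ.rep q) x) = 0) :
    ∃ η : PreForm n F E k, LocallyHorizontal r η ∧ RepOn q (comp q η) r U L ∧
      ∀ j, j.1 ∉ (cht q).symm '' C → η j = 0 := by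
  classical
  set η : PreForm n F E k := fun j => if j.1 ∈ (cht q).symm '' C then ofChart q j.1
    (L (cht q j.1, jetCoord r ((InfJet.repr j).rep q) (cht q j.1))) else 0 with hη
  have hrep : RepOn q (comp q η) r U L := by
    refine ⟨hL, fun φ x hx => ?_⟩
    have hxq := hUq hx
    have hs := (cht q).map_target hxq.1
    by_cases hxC : x ∈ C
    · have h1 : η (φ.jet ((cht q).symm x)) = ofChart q ((cht q).symm x)
          (L (x, jetCoord r (φ.rep q) x)) := by
        refine (if_pos ⟨x, hxC, rfl⟩).trans ?_
        have h2 : cht q ((cht q).symm x) = x := (cht q).right_inv hxq.1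
        have h3 := jetCoord_eq_of_jet_eq (q := q) (repr_jet (φ.jet ((cht q).symm x)))
          (chart_symm_mem_dom hxq) r
        change ofChart q ((cht q).symm x) (L (cht q ((cht q).symm x), jetCoord r
          ((InfJet.repr (φ.jet ((cht q).symm x))).rep q) (cht q ((cht q).symm x)))) = _
        refine congrArg (fun a => ofChart q ((cht q).symm x) (L a)) (Prod.ext h2 ?_)
        refine h3.trans ?_
        exact congrArg (jetCoord r (φ.rep q)) h2
      change toChart q ((cht q).symm x) (η (φ.jet ((cht q).symm x))) = _
      rw [h1, toChart_ofChart hs]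
    · have h1 : η (φ.jet ((cht q).symm x)) = 0 := by
        refine if_neg ?_
        rintro ⟨y, hy, hyx⟩
        exact hxC ((cht q).symm.injOn (hUq (hCU hy)).1 hxq.1 hyx ▸ hy)
      change toChart q ((cht q).symm x) (η (φ.jet ((cht q).symm x))) = _
      rw [h1, h0 φ x hx hxC]
      exact map_zero (toChartL k q _)
  have hoff : ∀ j, j.1 ∉ (cht q).symm '' C → η j = 0 := fun j hj => if_neg hj
  refine ⟨η, fun p => ?_, hrep, hoff⟩
  by_cases hp : p ∈ (cht q).symm '' C
  · obtain ⟨x, hx, rfl⟩ := hp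
    refine ⟨q, U, L, hU, hUq, chart_symm_mem_dom (hUq (hCU hx)), ?_, hrep⟩
    rw [(cht q).right_inv (hUq (hCU hx)).1]
    exact hCU hx
  · have hcl := (isCompact_image_chart_symm hC fun x hx => (hUq (hCU hx)).1).isClosed
    refine ⟨p, coordDom n F E p ∩ ((cht p).target ∩ (cht p).symm ⁻¹' ((cht q).symm '' C)ᶜ),
      fun _ => 0, (isOpen_coordDom p).inter
      ((cht p).isOpen_inter_preimage_symm hcl.isOpen_compl), inter_subset_left, mem_dom_self p,
      ⟨chart_mem_coordDom (mem_dom_self p), mem_chart_target _ p, ?_⟩, contDiffOn_const,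
      fun φ x hx => ?_⟩
    · rwa [mem_preimage, (cht p).left_inv (mem_chart_source _ p)]
    · change toChart p ((cht p).symm x) (η (φ.jet ((cht p).symm x))) = _
      rw [hoff (φ.jet ((cht p).symm x)) hx.2.2]
      exact map_zero (toChartL k p _)

end Chart

/-! ### Vector fields as forms of codegree one -/

section Flux

variable {m : ℕ}

/-- The projection which forgets a coordinate. -/
def dropL (j : Fin (m + 1)) : EuclideanSpace ℝ (Fin (m + 1)) →L[ℝ] EuclideanSpace ℝ (Fin m) :=
  LinearMap.toContinuousLinearMap
    { toFun := fun x => WithLp.toLp 2 fun i => x (j.succAbove i)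
      map_add' := fun _ _ => rfl
      map_smul' := fun _ _ => rfl }

/-- The form of codegree one with given flux components. -/
def fluxForm (P : Fin (m + 1) → ℝ) : Cov (m + 1) m :=
  ∑ j, (P j * (-1) ^ (j : ℕ)) • (volCov m).compContinuousLinearMap (dropL j)

theorem dropL_single_succAbove (j : Fin (m + 1)) (i : Fin m) :
    dropL j (EuclideanSpace.single (j.succAbove i) (1 : ℝ)) = EuclideanSpace.single i 1 := by
  ext l
  change (EuclideanSpace.single (j.succAbove i) (1 : ℝ)) (j.succAbove l) = _
  simp

theorem dropL_single_self (j : Fin (m + 1)) : dropL j (EuclideanSpace.single j (1 : ℝ)) = 0 := by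
  ext l
  change (EuclideanSpace.single j (1 : ℝ)) (j.succAbove l) = _
  simp [Fin.succAbove_ne]

/-- `dropL j` maps the frame with `e_i` removed to the standard frame if `i = j`, and kills one of
its members otherwise; the two signs `(-1) ^ i` cancel. -/
theorem fluxL_fluxForm (P : Fin (m + 1) → ℝ) (i : Fin (m + 1)) : fluxL i (fluxForm P) = P i := by
  have h : ∀ j, fluxL i ((volCov m).compContinuousLinearMap (dropL j)) =
      if j = i then (-1) ^ (i : ℕ) else 0 := by
    intro j
    change (-1) ^ (i : ℕ) * volCov m (fun l => dropL j (i.removeNth (fun i =>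
      EuclideanSpace.single i (1 : ℝ)) l)) = _
    split_ifs with hj
    · subst hj
      have : (fun l => dropL j (j.removeNth (fun i =>
          EuclideanSpace.single i (1 : ℝ)) l)) = fun l => EuclideanSpace.single l 1 :=
        funext fun l => dropL_single_succAbove j l
      rw [this]
      change _ * onFrame (volCov m) = _
      rw [onFrame_volCov, mul_one]
    · obtain ⟨l, hl⟩ := Fin.exists_succAbove_eq hj
      rw [(volCov m).map_coord_zero l, mul_zero]
      change dropL j (EuclideanSpace.single (i.succAbove l) 1) = 0
      rw [hl, dropL_single_self]
  rw [fluxForm, map_sum]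
  simp only [map_smul, h, smul_eq_mul, mul_ite, mul_zero, Finset.sum_ite_eq', Finset.mem_univ,
    if_true]
  rw [mul_assoc, ← mul_pow]
  simp

end Flux

/-! ## Primitives of divergences -/

section Divergence

variable {m : ℕ} {M : Type*} [TopologicalSpace M] [ChartedSpace (EuclideanSpace ℝ (Fin (m + 1))) M]
  [IsManifold (𝓡 (m + 1)) ∞ M] [T2Space M]
  {F : Type*} [NormedAddCommGroup F] [NormedSpace ℝ F] [FiniteDimensional ℝ F]
  {E : M → Type*} [TopologicalSpace (TotalSpace F E)] [∀ p, TopologicalSpace (E p)]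
  [∀ p, AddCommGroup (E p)] [∀ p, Module ℝ (E p)] [FiberBundle F E] [VectorBundle ℝ F E]
  [ContMDiffVectorBundle ∞ F E (𝓡 (m + 1))]

local notation "cht" => chartAt (EuclideanSpace ℝ (Fin (m + 1)))
local notation "𝔼" => EuclideanSpace ℝ (Fin (m + 1))

theorem dH_zero {k : ℕ} : dH (0 : PreForm (m + 1) F E k) = 0 := by
  have := dH_smul (n := m + 1) (F := F) (E := E) (k := k) IsHorizontal.zero 0
  rwa [zero_smul, zero_smul] at this

/-- The operators `P j` become the components of a form through `fluxForm`, and by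
`onFrame_extDeriv` its differential is their divergence. The support clauses survive because
`fluxForm` is zero when all components are. -/
theorem exists_form_of_divergence {s : ℕ} {q : M} {U C : Set 𝔼} (hU : IsOpen U)
    (hUq : U ⊆ coordDom (m + 1) F E q) (hC : IsCompact C) (hCU : C ⊆ U)
    {P : Fin (m + 1) → (𝔼 → F) → 𝔼 → ℝ} (hP : ∀ j, IsLocOp U s (P j))
    (h0 : ∀ j f x, x ∈ U → x ∉ C → P j f x = 0) :
    ∃ η : PreForm (m + 1) F E m, LocallyHorizontal s η ∧
      (∀ φ : Sec (m + 1) F E, ∀ x ∈ U, (∀ j, P j (φ.rep q) x = 0) →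
        η (φ.jet ((cht q).symm x)) = 0) ∧
      (∀ j, j.1 ∉ (cht q).symm '' C → η j = 0) ∧
      (∀ j, j.1 ∉ (cht q).symm '' C → dH η j = 0) ∧
      ∀ φ : Sec (m + 1) F E, ∀ x ∈ U,
        onFrame (toChart q ((cht q).symm x) (dH η (φ.jet ((cht q).symm x)))) =
          ∑ j, fderiv ℝ (P j (φ.rep q)) x (EuclideanSpace.single j (1 : ℝ)) := by
  choose Λ hΛ h using hP
  set L : 𝔼 × JetCoord (m + 1) s F → Cov (m + 1) m := fun z => fluxForm fun j => Λ j z with hL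
  have hLs : ContDiffOn ℝ ∞ L (U ×ˢ univ) := ContDiffOn.sum fun j _ =>
    ((hΛ j).mul contDiffOn_const).smul contDiffOn_const
  have hLP : ∀ φ : Sec (m + 1) F E, ∀ x ∈ U, L (x, jetCoord s (φ.rep q) x) =
      fluxForm fun j => P j (φ.rep q) x := fun φ x hx => by
    rw [hL]
    dsimp only
    congr 1
    funext j
    exact (h j _ ((contDiffOn_rep φ q).mono hUq) x hx).symm
  have hz : fluxForm (fun _ : Fin (m + 1) => (0 : ℝ)) = 0 := by simp [fluxForm]
  obtain ⟨η, hη, hrep, hoff⟩ := exists_form_of_chart (E := E) hU hUq hC hCU hLs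
    fun φ x hx hxC => by
      rw [hLP φ x hx, ← hz]
      congr 1
      funext j
      exact h0 j _ x hx hxC
  have hcl := (isCompact_image_chart_symm hC fun x hx => (hUq (hCU hx)).1).isClosed
  refine ⟨η, hη, fun φ x hx hx0 => ?_, hoff, fun j hj => ?_, fun φ x hx => ?_⟩
  · refine toChart_injective (q := q) ((cht q).map_target (hUq hx).1) ?_
    refine (hrep.2 φ x hx).trans ?_
    rw [hLP φ x hx]
    simp only [hx0, hz]
    exact (map_zero (toChartL (n := m + 1) m q ((cht q).symm x))).symm
  · induction j using InfJet.ind with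
    | h φ p =>
    refine (dH_congr hη.isHorizontal IsHorizontal.zero φ φ ?_).trans (congrFun dH_zero _)
    filter_upwards [hcl.isOpen_compl.mem_nhds hj] with p' hp'
    exact hoff (φ.jet p') hp'
  · refine (congrArg onFrame (comp_dH hη.isHorizontal φ (hUq hx))).trans ?_
    rw [onFrame_extDeriv (((hrep.contDiffOn hU hUq φ).contDiffAt
      (hU.mem_nhds hx)).differentiableAt (by simp))]
    refine Finset.sum_congr rfl fun j _ => ?_
    refine congrArg (fun T : 𝔼 →L[ℝ] ℝ => T _) (Filter.EventuallyEq.fderiv_eq ?_)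
    filter_upwards [hU.mem_nhds hx] with y hy
    rw [hrep.2 φ y hy, hLP φ y hy, fluxL_fluxForm]

theorem exists_det_toChart (q p : M) : ∃ c : ℝ, (p ∈ (cht q).source → c ≠ 0) ∧
    ∀ a : Cov (m + 1) (m + 1), onFrame (toChart q p a) = c * onFrame a := by
  refine ⟨(fderiv ℝ (transition q p) (cht q p)).det, fun hp hc => ?_, fun a => onFrame_comp a _⟩
  have h1 : onFrame (toChart q p (volCov (m + 1))) = 0 := by
    rw [toChart_eq, onFrame_comp, hc, zero_mul]
  have h2 : toChart q p (0 : Cov (m + 1) (m + 1)) = 0 := map_zero (toChartL (m + 1) q p)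
  have h3 := toChart_injective hp ((onFrame_eq_zero_iff.1 h1).trans h2.symm)
  have h4 := onFrame_volCov (m + 1)
  rw [h3, onFrame_eq_zero_iff.2 rfl] at h4
  exact zero_ne_one h4

/-- A top form supported in a coordinate domain is, up to its values along the zero section and
its Euler–Lagrange form, the differential of a form with the same support. -/
theorem exists_local_primitive {q : M} {r : ℕ} {α : PreForm (m + 1) F E (m + 1)}
    (hα : IsHorizontal α) {K : Set M} (hK : IsCompact K)
    (hKq : K ⊆ dom (n := m + 1) F E q) (h0 : ∀ j, j.1 ∉ K → α j = 0)
    {L : 𝔼 × JetCoord (m + 1) r F → Cov (m + 1) (m + 1)}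
    (hL : RepOn q (comp q α) r (coordDom (m + 1) F E q) L)
    (hLK : ∀ x ∈ coordDom (m + 1) F E q, (cht q).symm x ∉ K → ∀ u, L (x, u) = 0) :
    ∃ η : PreForm (m + 1) F E m, LocallyHorizontal (r + r) η ∧ (∀ j, j.1 ∉ K → η j = 0) ∧
      (∀ (φ : Sec (m + 1) F E) p, (∀ᶠ p' in 𝓝 p, φ p' = 0) → η (φ.jet p) = 0) ∧
      ∀ (φ : Sec (m + 1) F E) (p : M),
        (Continuous fun t : ℝ => onFrame (euler α ((t • φ).jet p) (φ p))) ∧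
        onFrame (dH η (φ.jet p)) = onFrame (α (φ.jet p)) -
          onFrame (α ((0 : Sec (m + 1) F E).jet p)) -
          ∫ t in (0 : ℝ)..1, onFrame (euler α ((t • φ).jet p) (φ p)) := by
  have hU := isOpen_coordDom (n := m + 1) (F := F) (E := E) q
  set C := cht q '' K with hCdef
  have hC : IsCompact C := hK.image_of_continuousOn ((cht q).continuousOn.mono fun p hp =>
    (hKq hp).1)
  have hCU : C ⊆ coordDom (m + 1) F E q := by
    rintro _ ⟨p, hp, rfl⟩
    exact chart_mem_coordDom (hKq hp)
  have hCK : (cht q).symm '' C = K := by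
    rw [hCdef, image_image]
    refine (image_congr fun p hp => (cht q).left_inv (hKq hp).1).trans (image_id _)
  have hL0 : ∀ x ∈ coordDom (m + 1) F E q, x ∉ C → ∀ u, L (x, u) = 0 :=
    fun x hx hxC => hLK x hx fun h => hxC ⟨_, h, (cht q).right_inv hx.1⟩
  have hLs : ContDiffOn ℝ ∞ (fun z => onFrameL (m + 1) (L z)) (coordDom (m + 1) F E q ×ˢ univ) :=
    (onFrameL (m + 1)).contDiff.comp_contDiffOn hL.1
  obtain ⟨Q, hQ, hQ0, hQL, hQe⟩ := exists_homotopy_divergence hU hLs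
  obtain ⟨η, hη, hη0, hηK, hdK, hd⟩ := exists_form_of_divergence (E := E) hU subset_rfl hC hCU hQ
    fun j f x hx hxC => hQL j f x (by
      filter_upwards [(hU.sdiff hC.isClosed).mem_nhds ⟨hx, hxC⟩] with y hy u
      rw [hL0 y hy.1 hy.2 u, map_zero])
  rw [hCK] at hηK hdK
  refine ⟨η, hη, hηK, fun φ p hφ => ?_, fun φ p => ?_⟩
  · by_cases hp : p ∈ K
    · have hpd := hKq hp
      have h1 := hη0 φ (cht q p) (chart_mem_coordDom hpd) fun j => hQ0 j _ _ (by
        have h2 := (cht q).continuousAt_symm (chart_mem_coordDom hpd).1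
        rw [ContinuousAt, (cht q).left_inv hpd.1] at h2
        filter_upwards [hU.mem_nhds (chart_mem_coordDom hpd), h2.eventually hφ] with x hx hx0
        exact (rep_eq_zero_iff φ hx).2 hx0)
      rwa [(cht q).left_inv hpd.1] at h1
    · exact hηK (φ.jet p) hp
  · by_cases hp : p ∈ K
    · have hpd := hKq hp
      obtain ⟨c, hc, hdet⟩ := exists_det_toChart (m := m) q p
      have hc := hc hpd.1
      have hx := chart_mem_coordDom hpd
      have hf := contDiffOn_rep φ q
      set x := cht q p with hxdef
      have hpx : (cht q).symm x = p := (cht q).left_inv hpd.1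
      -- The integrand of the homotopy formula is expressed through `euler`, which does not depend
      -- on the chart, so that contributions from different charts can be added later. The factor
      -- `c` is the Jacobian determinant.
      have key : ∀ t : ℝ, eulerExpr (fun z => onFrameL (m + 1) (L z)) (fun y => t • φ.rep q y) x
          (φ.rep q x) = c * onFrame (euler α ((t • φ).jet p) (φ p)) := fun t => by
        have h1 := toChart_euler hα hU subset_rfl hL (t • φ) hx (φ.rep q x)
        have h2 : (trivializationAt F E q).symmₗ ℝ ((cht q).symm x) (φ.rep q x) =
            φ ((cht q).symm x) := by
          have := (trivializationAt F E q).symmₗ_linearMapAt (R := ℝ) hx.2 (φ ((cht q).symm x))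
          rwa [(trivializationAt F E q).coe_linearMapAt_of_mem (R := ℝ) hx.2] at this
        rw [h2] at h1
        rw [hpx] at h1
        rw [← hdet, h1]
        refine (eulerExpr_congr_field ?_ _).trans
          (eulerExpr_clm hU hL.1 (contDiffOn_rep (t • φ) q) hx (onFrameL (m + 1)) (φ.rep q x))
        filter_upwards [hU.mem_nhds hx] with y hy
        exact (rep_smul t φ hy).symm
      have hcont := continuous_eulerExpr_smul hU hLs hf hx (φ.rep q x)
      refine ⟨?_, ?_⟩
      · refine ((continuous_const (y := c⁻¹)).mul hcont).congr fun t => ?_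
        exact (congrArg (c⁻¹ * ·) (key t)).trans (inv_mul_cancel_left₀ hc _)
      · have h1 := hd φ x hx
        have h2 := hQe _ hf x hx
        have h3 := fun ψ : Sec (m + 1) F E => hL.2 ψ x hx
        have h4 : jetCoord r ((0 : Sec (m + 1) F E).rep q) x = 0 := by
          refine (jetCoord_congr (f' := fun _ => 0) ?_ r).trans ?_
          · filter_upwards [hU.mem_nhds hx] with y hy using rep_zero hy
          · funext k
            simp [jetCoord, iteratedFDeriv_fun_zero]
        simp only [hpx] at h1 h3
        have h5 := h3 φ
        have h6 := h3 0
        rw [h4] at h6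
        -- Every term carries the same nonzero factor `c`, so the identity may be checked in the
        -- chart at `q`.
        refine mul_left_cancel₀ hc ?_
        rw [← hdet, h1, mul_sub, mul_sub, ← hdet, ← hdet,
          ← intervalIntegral.integral_const_mul]
        simp only [← key]
        rw [show toChart q p (α (φ.jet p)) = _ from h5,
          show toChart q p (α ((0 : Sec (m + 1) F E).jet p)) = _ from h6]
        exact eq_sub_of_add_eq' h2.symm
    -- Off the support every term of the formula vanishes.
    · have hev : ∀ ψ : Sec (m + 1) F E, euler α (ψ.jet p) = 0 := fun ψ => by
        refine (euler_congr hα IsHorizontal.zero ?_ ψ).trans (by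
          rw [euler_zero]; rfl)
        filter_upwards [hK.isClosed.isOpen_compl.mem_nhds hp] with p' hp' χ
        exact h0 (χ.jet p') hp'
      have hev' : (fun t : ℝ => onFrame (euler α ((t • φ).jet p) (φ p))) = fun _ => 0 := by
        funext t
        rw [hev]
        exact onFrame_eq_zero_iff.2 rfl
      rw [hev', hdK (φ.jet p) hp, h0 (φ.jet p) hp, h0 (Sec.jet 0 p) hp]
      refine ⟨continuous_const, ?_⟩
      rw [intervalIntegral.integral_zero, sub_zero, sub_self]
      exact onFrame_eq_zero_iff.2 rfl

end Divergence

/-! ## Locally finite sums -/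

section Gluing

variable {n : ℕ} {M : Type*} [TopologicalSpace M] [ChartedSpace (EuclideanSpace ℝ (Fin n)) M]
  [IsManifold (𝓡 n) ∞ M] [T2Space M]
  {F : Type*} [NormedAddCommGroup F] [NormedSpace ℝ F] [FiniteDimensional ℝ F]
  {E : M → Type*} [TopologicalSpace (TotalSpace F E)] [∀ p, TopologicalSpace (E p)]
  [∀ p, AddCommGroup (E p)] [∀ p, Module ℝ (E p)] [FiberBundle F E] [VectorBundle ℝ F E]
  [ContMDiffVectorBundle ∞ F E (𝓡 n)]

local notation "cht" => chartAt (EuclideanSpace ℝ (Fin n))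
local notation "𝔼" => EuclideanSpace ℝ (Fin n)

/-- The partition is indexed by the points of `M`, so that each member comes with its own chart. -/
theorem exists_partition [SecondCountableTopology M] {O : M → Set M} (hO : ∀ p, O p ∈ 𝓝 p) :
    ∃ ρ : SmoothPartitionOfUnity M (𝓡 n) M univ,
      ∀ p, IsCompact (tsupport (ρ p)) ∧ tsupport (ρ p) ⊆ O p := by
  have := ChartedSpace.locallyCompactSpace 𝔼 M
  have h1 : ∀ p, ∃ V : Set M, IsOpen V ∧ p ∈ V ∧ ∃ K, IsCompact K ∧ V ⊆ K ∧ K ⊆ O p := fun p => by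
    obtain ⟨K, hK, hKO, hc⟩ := local_compact_nhds (hO p)
    exact ⟨interior K, isOpen_interior, mem_interior_iff_mem_nhds.2 hK, K, hc, interior_subset, hKO⟩
  choose V hV hpV K hK hVK hKO using h1
  obtain ⟨ρ, hρ⟩ := SmoothPartitionOfUnity.exists_isSubordinate (𝓡 n) isClosed_univ V hV
    fun p _ => mem_iUnion.2 ⟨p, hpV p⟩
  exact ⟨ρ, fun p => ⟨(hK p).of_isClosed_subset (isClosed_tsupport _) ((hρ p).trans (hVK p)),
    (hρ p).trans ((hVK p).trans (hKO p))⟩⟩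

theorem LocallyFinite.exists_finset_eventually {ι : Type*} {K : ι → Set M} (hK : LocallyFinite K)
    (p : M) : ∃ S : Finset ι, ∀ᶠ p' in 𝓝 p, ∀ i ∉ S, p' ∉ K i := by
  obtain ⟨N, hN, hfin⟩ := hK p
  refine ⟨hfin.toFinset, ?_⟩
  filter_upwards [hN] with p' hp' i hi h
  exact hi (hfin.mem_toFinset.2 ⟨p', h, hp'⟩)

theorem finsum_apply_eq_sum {ι : Type*} {k : ℕ} {K : ι → Set M} {η : ι → PreForm n F E k}
    (h0 : ∀ i j, j.1 ∉ K i → η i j = 0) {S : Finset ι} {j : InfJet n F E}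
    (hS : ∀ i ∉ S, j.1 ∉ K i) : ∑ᶠ i, η i j = (∑ i ∈ S, η i) j := by
  rw [Finset.sum_apply]
  refine finsum_eq_sum_of_support_subset _ fun i hi => ?_
  by_contra h
  exact hi (h0 i j (hS i h))

theorem LocallyHorizontal.finsum {ι : Type*} {k r : ℕ} {K : ι → Set M} (hK : LocallyFinite K)
    {η : ι → PreForm n F E k} (h : ∀ i, LocallyHorizontal r (η i))
    (h0 : ∀ i j, j.1 ∉ K i → η i j = 0) : LocallyHorizontal r (fun j => ∑ᶠ i, η i j) :=
  .congr fun p => by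
    obtain ⟨S, hS⟩ := LocallyFinite.exists_finset_eventually hK p
    refine ⟨∑ i ∈ S, η i, .sum S fun i _ => h i, ?_⟩
    filter_upwards [hS] with p' hp' φ
    exact finsum_apply_eq_sum h0 (j := φ.jet p') hp'

theorem dH_sum {ι : Type*} {k : ℕ} (t : Finset ι) {η : ι → PreForm n F E k}
    (h : ∀ i ∈ t, IsHorizontal (η i)) : dH (∑ i ∈ t, η i) = ∑ i ∈ t, dH (η i) := by
  classical
  induction t using Finset.induction_on with
  | empty =>
    have := dH_smul (n := n) (F := F) (E := E) (k := k) IsHorizontal.zero 0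
    rwa [zero_smul, zero_smul] at this
  | insert i t hi ih =>
    rw [Finset.sum_insert hi, Finset.sum_insert hi, dH_add (h i (Finset.mem_insert_self i t))
      (IsHorizontal.sum t fun l hl => h l (Finset.mem_insert_of_mem hl)),
      ih fun l hl => h l (Finset.mem_insert_of_mem hl)]

theorem dH_finsum_apply {ι : Type*} {k r : ℕ} {K : ι → Set M} (hK : LocallyFinite K)
    {η : ι → PreForm n F E k} (h : ∀ i, LocallyHorizontal r (η i))
    (h0 : ∀ i j, j.1 ∉ K i → η i j = 0) (φ : Sec n F E) {p : M} {S : Finset ι}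
    (hS : ∀ᶠ p' in 𝓝 p, ∀ i ∉ S, p' ∉ K i) :
    dH (fun j => ∑ᶠ i, η i j) (φ.jet p) = ∑ i ∈ S, dH (η i) (φ.jet p) := by
  have hη := fun i => (h i).isHorizontal
  refine (dH_congr (LocallyHorizontal.finsum hK h h0).isHorizontal
    (IsHorizontal.sum S fun i _ => hη i) φ φ ?_).trans ?_
  · filter_upwards [hS] with p' hp'
    exact finsum_apply_eq_sum h0 (j := φ.jet p') hp'
  · rw [dH_sum S fun i _ => hη i, Finset.sum_apply]

theorem SmoothPartitionOfUnity.locallyFinite_tsupport {ι : Type*} {s : Set M}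
    (ρ : SmoothPartitionOfUnity ι (𝓡 n) M s) : LocallyFinite fun i => tsupport (ρ i) :=
  ρ.locallyFinite.closure

theorem SmoothPartitionOfUnity.sum_eq_one_of_forall_notMem {ι : Type*}
    (ρ : SmoothPartitionOfUnity ι (𝓡 n) M univ) {S : Finset ι} {p : M}
    (hS : ∀ i ∉ S, p ∉ tsupport (ρ i)) : ∑ i ∈ S, ρ i p = 1 := by
  rw [← ρ.sum_eq_one (mem_univ p)]
  refine (finsum_eq_sum_of_support_subset _ fun i hi => ?_).symm
  by_contra h
  exact hS i h (subset_tsupport _ hi)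

theorem RepOn.base_smul {k r : ℕ} {α : PreForm n F E k} {q : M} {U : Set 𝔼}
    {L : 𝔼 × JetCoord n r F → Cov n k} (h : RepOn q (comp q α) r U L) (hUq : U ⊆ (cht q).target)
    {ρ : M → ℝ} (hρ : ContMDiff (𝓡 n) 𝓘(ℝ, ℝ) ∞ ρ) :
    RepOn q (comp q fun j => ρ j.1 • α j) r U fun z => ρ ((cht q).symm z.1) • L z := by
  refine ⟨(((contDiffOn_comp_chart_symm hρ q).mono hUq).comp contDiffOn_fst
    fun z hz => hz.1).smul h.1, fun φ x hx => ?_⟩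
  dsimp only
  rw [← h.2 φ x hx]
  exact map_smul (toChartL (n := n) k q ((cht q).symm x)) (ρ ((cht q).symm x)) _

end Gluing

/-! ### Primitives of top forms with vanishing Euler–Lagrange form -/

section Divergence

variable {m : ℕ} {M : Type*} [TopologicalSpace M] [ChartedSpace (EuclideanSpace ℝ (Fin (m + 1))) M]
  [IsManifold (𝓡 (m + 1)) ∞ M] [T2Space M] [SecondCountableTopology M]
  {F : Type*} [NormedAddCommGroup F] [NormedSpace ℝ F] [FiniteDimensional ℝ F]
  {E : M → Type*} [TopologicalSpace (TotalSpace F E)] [∀ p, TopologicalSpace (E p)]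
  [∀ p, AddCommGroup (E p)] [∀ p, Module ℝ (E p)] [FiberBundle F E] [VectorBundle ℝ F E]
  [ContMDiffVectorBundle ∞ F E (𝓡 (m + 1))]

local notation "cht" => chartAt (EuclideanSpace ℝ (Fin (m + 1)))
local notation "𝔼" => EuclideanSpace ℝ (Fin (m + 1))

/-- A top form with vanishing Euler–Lagrange form is, up to its values along the zero section, the
differential of a form that vanishes along the zero section. -/
theorem exists_primitive_sub_zero {α : PreForm (m + 1) F E (m + 1)} (hα : IsHorizontal α)
    (hE : euler α = 0) :
    ∃ β : PreForm (m + 1) F E m, IsHorizontal β ∧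
      (∀ (φ : Sec (m + 1) F E) p, (∀ᶠ p' in 𝓝 p, φ p' = 0) → β (φ.jet p) = 0) ∧
      ∀ (φ : Sec (m + 1) F E) (p : M),
        dH β (φ.jet p) = α (φ.jet p) - α ((0 : Sec (m + 1) F E).jet p) := by
  obtain ⟨r, hr⟩ := isHorizontal_iff_repOn.1 hα
  obtain ⟨ρ, hρ⟩ := exists_partition (n := m + 1)
    fun p : M => (isOpen_dom (n := m + 1) (F := F) (E := E) p).mem_nhds (mem_dom_self p)
  have hρs : ∀ i, ContMDiff (𝓡 (m + 1)) 𝓘(ℝ, ℝ) ∞ (ρ i) := fun i => (ρ i).contMDiff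
  have hρα : ∀ i, IsHorizontal (fun j => ρ i j.1 • α j) := fun i => hα.base_smul (hρs i)
  have hoff : ∀ i (j : InfJet (m + 1) F E), j.1 ∉ tsupport (ρ i) → ρ i j.1 • α j = 0 :=
    fun i j hj => by rw [image_eq_zero_of_notMem_tsupport hj, zero_smul]
  choose L hL using hr
  -- The pieces `ρ i α` are supported in charts, but their Euler forms need not vanish, since `ρ i`
  -- is not constant.
  have hex := fun i => exists_local_primitive (hρα i) (hρ i).1 (hρ i).2 (hoff i)
    ((hL i).base_smul (fun x hx => hx.1) (hρs i)) fun x _ hxK u => by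
      rw [image_eq_zero_of_notMem_tsupport hxK, zero_smul]
  choose η hη hη0 hηz hηd using hex
  have hlf := SmoothPartitionOfUnity.locallyFinite_tsupport ρ
  refine ⟨fun j => ∑ᶠ i, η i j, (LocallyHorizontal.finsum hlf hη hη0).isHorizontal,
    fun φ p hφ => ?_, fun φ p => ?_⟩
  · exact (finsum_congr fun i => hηz i φ p hφ).trans finsum_zero
  · obtain ⟨S, hS⟩ := LocallyFinite.exists_finset_eventually hlf p
    -- The Euler forms of the pieces add up to that of `α`, which is zero.
    have h1 : ∀ ψ : Sec (m + 1) F E,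
        ∑ i ∈ S, euler (fun j => ρ i j.1 • α j) (ψ.jet p) = 0 := fun ψ => by
      rw [← Finset.sum_apply (a := ψ.jet p), ← euler_sum S fun i _ => hρα i]
      refine (euler_congr (IsHorizontal.sum S fun i _ => hρα i) hα ?_ ψ).trans (by rw [hE]; rfl)
      filter_upwards [hS] with p' hp' χ
      rw [Finset.sum_apply]
      change ∑ i ∈ S, ρ i p' • α (χ.jet p') = _
      rw [← Finset.sum_smul, SmoothPartitionOfUnity.sum_eq_one_of_forall_notMem ρ hp', one_smul]
    have hone := SmoothPartitionOfUnity.sum_eq_one_of_forall_notMem ρ hS.self_of_nhds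
    have h2 : ∀ ψ : Sec (m + 1) F E, ∑ i ∈ S, onFrame (ρ i p • α (ψ.jet p)) =
        onFrame (α (ψ.jet p)) := fun ψ => by
      refine (map_sum (onFrameL (m + 1)) (fun i => ρ i p • α (ψ.jet p)) S).symm.trans ?_
      rw [← Finset.sum_smul, hone, one_smul]
      rfl
    refine onFrame_injective ?_
    refine (congrArg onFrame (dH_finsum_apply hlf hη hη0 φ hS)).trans ?_
    refine (map_sum (onFrameL (m + 1)) _ S).trans ?_
    refine (Finset.sum_congr rfl fun i _ => (hηd i φ p).2).trans ?_
    rw [Finset.sum_sub_distrib, Finset.sum_sub_distrib]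
    -- The error integrals are linear in the Euler forms, so their sum vanishes although no single
    -- one has to.
    have h3 : ∑ i ∈ S, ∫ t in (0 : ℝ)..1,
        onFrame (euler (fun j => ρ i j.1 • α j) ((t • φ).jet p) (φ p)) = 0 := by
      rw [← intervalIntegral.integral_finsetSum fun i _ =>
        ((hηd i φ p).1).intervalIntegrable 0 1]
      refine (intervalIntegral.integral_congr (g := fun _ => 0) fun t _ => ?_).trans (by simp)
      let T : M → E p →ₗ[ℝ] Cov (m + 1) (m + 1) := fun i =>
        euler (fun j => ρ i j.1 • α j) ((t • φ).jet p)
      have hT : ∑ i ∈ S, T i = 0 := h1 (t • φ)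
      have h4 : ∑ i ∈ S, onFrameL (m + 1) (T i (φ p)) = 0 := by
        rw [← map_sum, ← LinearMap.sum_apply, hT, LinearMap.zero_apply, map_zero]
      exact h4
    rw [h3, sub_zero]
    have h4 := map_sub (onFrameL (m + 1)) (α (φ.jet p)) (α ((0 : Sec (m + 1) F E).jet p))
    exact (congrArg₂ (· - ·) (h2 φ) (h2 0)).trans h4.symm

end Divergence

/-! ## Families of forms that depend locally on a function on the base -/

section ParamLocal

variable {n : ℕ} {M : Type*} [TopologicalSpace M] [ChartedSpace (EuclideanSpace ℝ (Fin n)) M]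
  [IsManifold (𝓡 n) ∞ M] [T2Space M]
  {F : Type*} [NormedAddCommGroup F] [NormedSpace ℝ F] [FiniteDimensional ℝ F]
  {E : M → Type*} [TopologicalSpace (TotalSpace F E)] [∀ p, TopologicalSpace (E p)]
  [∀ p, AddCommGroup (E p)] [∀ p, Module ℝ (E p)] [FiberBundle F E] [VectorBundle ℝ F E]
  [ContMDiffVectorBundle ∞ F E (𝓡 n)]

local notation "cht" => chartAt (EuclideanSpace ℝ (Fin n))
local notation "𝔼" => EuclideanSpace ℝ (Fin n)

theorem exists_function_of_coord (q : M) {C : Set 𝔼} (hC : IsCompact C)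
    (hCq : C ⊆ (cht q).target) {χ : 𝔼 → ℝ} (hχ : ContDiff ℝ ∞ χ) (h0 : ∀ x ∉ C, χ x = 0) :
    ∃ ρ : M → ℝ, ContMDiff (𝓡 n) 𝓘(ℝ, ℝ) ∞ ρ ∧ (∀ x ∈ (cht q).target, ρ ((cht q).symm x) = χ x) ∧
      ∀ p ∉ (cht q).symm '' C, ρ p = 0 := by
  classical
  let ρ : M → ℝ := fun p => if p ∈ (cht q).source then χ (cht q p) else 0
  have hρ0 : ∀ p ∉ (cht q).symm '' C, ρ p = 0 := fun p hp => by
    by_cases h : p ∈ (cht q).source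
    · exact (if_pos h).trans (h0 _ fun hc => hp ⟨_, hc, (cht q).left_inv h⟩)
    · exact if_neg h
  have hcl := (isCompact_image_chart_symm hC hCq).isClosed
  have hsupp : tsupport ρ ⊆ (cht q).symm '' C := closure_minimal (fun p hp => by
    by_contra h
    exact hp (hρ0 p h)) hcl
  refine ⟨ρ, contMDiff_of_tsupport fun p hp => ?_, fun x hx => ?_, hρ0⟩
  · obtain ⟨x, hx, rfl⟩ := hsupp hp
    have hs := (cht q).map_target (hCq hx)
    have h1 : ContMDiffAt (𝓡 n) 𝓘(ℝ, ℝ) ∞ (χ ∘ cht q) ((cht q).symm x) :=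
      hχ.contMDiff.contMDiffAt.comp _ (contMDiffOn_chart.contMDiffAt
        ((cht q).open_source.mem_nhds hs))
    refine h1.congr_of_eventuallyEq ?_
    filter_upwards [(cht q).open_source.mem_nhds hs] with p hp using if_pos hp
  · exact (if_pos ((cht q).map_target hx)).trans (by rw [(cht q).right_inv hx])

/-- `B ρ` is, near `p`, a differential operator in the section and in the function `ρ`. -/
def ParamLocal (p : M) (U : Set 𝔼) (B : (M → ℝ) → InfJet n F E → ℝ) : Prop :=
  ∃ (r : ℕ) (A : (𝔼 → F × ℝ) → 𝔼 → ℝ), IsLocOp U r A ∧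
    ∀ ρ : M → ℝ, ContMDiff (𝓡 n) 𝓘(ℝ, ℝ) ∞ ρ → ∀ (φ : Sec n F E), ∀ x ∈ U,
      B ρ (φ.jet ((cht p).symm x)) = A (fun y => (φ.rep p y, ρ ((cht p).symm y))) x

variable {p : M} {U : Set (EuclideanSpace ℝ (Fin n))}

theorem contDiffOn_rep_prod (hUp : U ⊆ coordDom n F E p) (φ : Sec n F E) {ρ : M → ℝ}
    (hρ : ContMDiff (𝓡 n) 𝓘(ℝ, ℝ) ∞ ρ) :
    ContDiffOn ℝ ∞ (fun y => (φ.rep p y, ρ ((cht p).symm y))) U :=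
  ((contDiffOn_rep φ p).mono hUp).prodMk
    ((contDiffOn_comp_chart_symm hρ p).mono fun _ hx => (hUp hx).1)

theorem ParamLocal.of_repOn (hU : IsOpen U) (hUp : U ⊆ coordDom n F E p) {B : InfJet n F E → ℝ}
    {r : ℕ} {L : 𝔼 × JetCoord n r F → ℝ} (h : RepOn p B r U L) : ParamLocal p U fun _ => B :=
  ⟨r, _, (isLocOp_of_contDiffOn h.1).comp_left hU (.fst ℝ F ℝ), fun _ _ φ x hx => h.2 φ x hx⟩

theorem ParamLocal.base : ParamLocal (F := F) (E := E) p U fun ρ j => ρ j.1 :=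
  ⟨0, _, isLocOp_eval.clm (.snd ℝ F ℝ), fun _ _ _ _ _ => rfl⟩

theorem ParamLocal.add {B B' : (M → ℝ) → InfJet n F E → ℝ} (h : ParamLocal p U B)
    (h' : ParamLocal p U B') : ParamLocal p U fun ρ j => B ρ j + B' ρ j := by
  obtain ⟨r, A, hA, h⟩ := h
  obtain ⟨r', A', hA', h'⟩ := h'
  exact ⟨max r r', _, (hA.mono (le_max_left _ _)).add (hA'.mono (le_max_right _ _)),
    fun ρ hρ φ x hx => congrArg₂ (· + ·) (h ρ hρ φ x hx) (h' ρ hρ φ x hx)⟩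

theorem ParamLocal.mul {B B' : (M → ℝ) → InfJet n F E → ℝ} (h : ParamLocal p U B)
    (h' : ParamLocal p U B') : ParamLocal p U fun ρ j => B ρ j * B' ρ j := by
  obtain ⟨r, A, hA, h⟩ := h
  obtain ⟨r', A', hA', h'⟩ := h'
  exact ⟨max r r', _, (hA.mono (le_max_left _ _)).smul (hA'.mono (le_max_right _ _)),
    fun ρ hρ φ x hx => congrArg₂ (· * ·) (h ρ hρ φ x hx) (h' ρ hρ φ x hx)⟩

theorem ParamLocal.congr {B B' : (M → ℝ) → InfJet n F E → ℝ} (h : ParamLocal p U B)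
    (e : ∀ ρ, ContMDiff (𝓡 n) 𝓘(ℝ, ℝ) ∞ ρ → ∀ (φ : Sec n F E), ∀ x ∈ U,
      B' ρ (φ.jet ((cht p).symm x)) = B ρ (φ.jet ((cht p).symm x))) : ParamLocal p U B' := by
  obtain ⟨r, A, hA, h⟩ := h
  exact ⟨r, A, hA, fun ρ hρ φ x hx => (e ρ hρ φ x hx).trans (h ρ hρ φ x hx)⟩

theorem ParamLocal.sum {ι : Type*} (t : Finset ι) {B : ι → (M → ℝ) → InfJet n F E → ℝ}
    (h : ∀ i, ParamLocal p U (B i)) : ParamLocal p U fun ρ j => ∑ i ∈ t, B i ρ j := by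
  classical
  induction t using Finset.induction_on with
  | empty => exact ⟨0, _, isLocOp_of_fun (contDiffOn_const (c := (0 : ℝ))), fun _ _ _ _ _ => by simp⟩
  | insert i t hi ih =>
    simp only [Finset.sum_insert hi]
    exact (h i).add ih

/-- A family of top forms that depends locally on a function on the base. -/
structure LocalFamily (p : M) (U : Set 𝔼) (Φ : (M → ℝ) → PreForm n F E n) : Prop where
  horizontal : ∀ ρ, ContMDiff (𝓡 n) 𝓘(ℝ, ℝ) ∞ ρ → IsHorizontal (Φ ρ)
  paramLocal : ParamLocal p U fun ρ j => onFrame (comp p (Φ ρ) j)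

theorem LocalFamily.const (hU : IsOpen U) (hUp : U ⊆ coordDom n F E p) {α : PreForm n F E n}
    (hα : IsHorizontal α) : LocalFamily p U fun _ => α := by
  obtain ⟨r, h⟩ := isHorizontal_iff_repOn.1 hα
  obtain ⟨L, hL⟩ := h p
  have h1 : RepOn p (fun j => onFrame (comp p α j)) r U fun z => onFrameL n (L z) :=
    ⟨(onFrameL n).contDiff.comp_contDiffOn (hL.mono hUp).1,
      fun φ x hx => congrArg onFrame (hL.2 φ x (hUp hx))⟩
  exact ⟨fun _ _ => hα, .of_repOn hU hUp h1⟩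

theorem LocalFamily.base_smul (hU : IsOpen U) (hUp : U ⊆ coordDom n F E p)
    {α : PreForm n F E n} (hα : IsHorizontal α) :
    LocalFamily p U fun ρ j => ρ j.1 • α j :=
  ⟨fun _ hρ => hα.base_smul hρ, (ParamLocal.base.mul
    (LocalFamily.const hU hUp hα).paramLocal).congr fun ρ _ _ _ _ =>
      (congrArg onFrame (map_smul (toChartL n p _) _ _)).trans (map_smul (onFrameL n) _ _)⟩

theorem LocalFamily.add {Φ Ψ : (M → ℝ) → PreForm n F E n} (hΦ : LocalFamily p U Φ)
    (hΨ : LocalFamily p U Ψ) : LocalFamily p U fun ρ => Φ ρ + Ψ ρ :=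
  ⟨fun ρ hρ => (hΦ.horizontal ρ hρ).add (hΨ.horizontal ρ hρ),
    (hΦ.paramLocal.add hΨ.paramLocal).congr fun ρ _ _ _ _ =>
      (congrArg onFrame (map_add (toChartL n p _) _ _)).trans (map_add (onFrameL n) _ _)⟩

/-- With `ρ` frozen, the Euler expression is the partial Euler expression of a Lagrangian in the
pair `(φ, ρ)`, hence a local operator in both. -/
theorem LocalFamily.sourceCoord_euler (hU : IsOpen U) (hUp : U ⊆ coordDom n F E p)
    {Φ : (M → ℝ) → PreForm n F E n} (hΦ : LocalFamily p U Φ) (a : Fin (Module.finrank ℝ F)) :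
    ParamLocal p U fun ρ => sourceCoord p (euler (Φ ρ)) a := by
  obtain ⟨hh, r, A, ⟨Λ, hΛ, hA⟩, h⟩ := hΦ
  refine ⟨r + r, _, isLocOp_eulerExpr hU hΛ (Module.finBasis ℝ F a, (0 : ℝ)), fun ρ hρ φ x hx => ?_⟩
  have hρ' := (contDiffOn_comp_chart_symm hρ p).mono fun _ hx => (hUp hx).1
  set L : 𝔼 × JetCoord n r F → ℝ := fun z => Λ (z.1, jetMap n r (.inl ℝ F ℝ) z.2 +
      jetMap n r (.inr ℝ F ℝ) (jetCoord r (fun y => ρ ((cht p).symm y)) z.1)) with hL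
  have hLs : ContDiffOn ℝ ∞ L (U ×ˢ univ) := by
    have h2 : ContDiffOn ℝ ∞ (fun z : 𝔼 × JetCoord n r F => jetMap n r (.inl ℝ F ℝ) z.2 +
      jetMap n r (.inr ℝ F ℝ) (jetCoord r (fun y => ρ ((cht p).symm y)) z.1)) (U ×ˢ univ) :=
      ((jetMap n r (.inl ℝ F ℝ)).contDiff.comp contDiff_snd).contDiffOn.add
        ((jetMap n r (.inr ℝ F ℝ)).contDiff.comp_contDiffOn
          ((contDiffOn_jetCoord hU hρ' r).comp contDiffOn_fst fun z hz => hz.1))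
    have h3 := contDiffOn_fst.prodMk h2
    exact ContDiffOn.comp hΛ h3 fun z (hz : z ∈ U ×ˢ univ) => ⟨hz.1, mem_univ _⟩
  have hrep : RepOn p (comp p (Φ ρ)) r U fun z => L z • volCov n := by
    refine ⟨hLs.smul contDiffOn_const, fun ψ y hy => ?_⟩
    have hψ := (contDiffOn_rep ψ p).mono hUp
    refine (eq_onFrame_smul_volCov _).trans (congrArg (· • volCov n) ?_)
    refine (h ρ hρ ψ y hy).trans ((hA _ (contDiffOn_rep_prod hUp ψ hρ) y hy).trans ?_)
    rw [jetCoord_prodMk hU hψ hρ' hy]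
  refine (HorizontalComplex.sourceCoord_euler (hh ρ hρ) hU hUp hrep φ hx a).trans ?_
  refine Eq.trans ?_ (eulerExpr_param hU hΛ ((contDiffOn_rep φ p).mono hUp) hρ' hx _)
  congr 1
  funext z
  rw [map_smul, onFrameL_apply, onFrame_volCov, smul_eq_mul, mul_one]

variable {ν : M → Cov n n} {w : Pairing n F E}

/-- On a neighbourhood of each point the bracket is given by finitely many smooth coefficients. -/
theorem exists_localFamily_topBracket (hν : IsVolumeForm ν) (hw : IsSkewPairing w) (p : M) :
    ∃ U : Set 𝔼, IsOpen U ∧ cht p p ∈ U ∧ U ⊆ coordDom n F E p ∧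
      ∀ U' ⊆ U, IsOpen U' → ∀ Φ Ψ : (M → ℝ) → PreForm n F E n, LocalFamily p U' Φ →
        LocalFamily p U' Ψ → LocalFamily p U' fun ρ => topBracket ν w (Φ ρ) (Ψ ρ) := by
  obtain ⟨U, s, W, hU, hpU, hUp, hW, h⟩ := exists_pairing_coord hν hw p
  refine ⟨U, hU, hpU, hUp, fun U' hU' hU'o Φ Ψ hΦ hΨ => ⟨fun ρ hρ => isHorizontal_topBracket hν hw
    (hΦ.horizontal ρ hρ) (hΨ.horizontal ρ hρ), ?_⟩⟩
  have hU'p := hU'.trans hUp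
  -- The coefficients are functions of coordinates. Evaluated on a representing section they become
  -- functions on the jet bundle, and the choice of the section does not matter.
  have hWe : ∀ a b (φ : Sec n F E), ∀ x ∈ U', W a b (cht p ((cht p).symm x),
      jetCoord s ((InfJet.repr (φ.jet ((cht p).symm x))).rep p) (cht p ((cht p).symm x))) =
        W a b (x, jetCoord s (φ.rep p) x) := fun a b φ x hx => by
    have h2 : jetCoord s ((InfJet.repr (φ.jet ((cht p).symm x))).rep p) (cht p ((cht p).symm x)) =
        jetCoord s (φ.rep p) (cht p ((cht p).symm x)) :=
      jetCoord_eq_of_jet_eq (repr_jet (φ.jet ((cht p).symm x))) (chart_symm_mem_dom (hU'p hx)) s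
    rw [h2, (cht p).right_inv (hU'p hx).1]
  have hWl : ∀ a b, ParamLocal (F := F) (E := E) p U' fun _ j =>
      W a b (cht p j.1, jetCoord s ((InfJet.repr j).rep p) (cht p j.1)) := fun a b =>
    .of_repOn hU'o hU'p (r := s) (L := W a b) ⟨(hW a b).mono (prod_mono hU' subset_rfl), hWe a b⟩
  refine ParamLocal.congr (ParamLocal.sum Finset.univ fun a => ParamLocal.sum Finset.univ fun b =>
    (((hΦ.sourceCoord_euler hU'o hU'p a).mul (hΨ.sourceCoord_euler hU'o hU'p b)).mul (hWl a b)))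
    fun ρ hρ φ x hx => ?_
  refine (h (euler (Φ ρ)) (euler (Ψ ρ)) φ x (hU' hx)).trans ?_
  exact Finset.sum_congr rfl fun a _ => Finset.sum_congr rfl fun b _ =>
    congrArg _ (hWe a b φ x hx).symm

/-! ## The Jacobiator -/

theorem IsLocOp.congr_field {F V : Type*} [NormedAddCommGroup F] [NormedSpace ℝ F]
    [NormedAddCommGroup V] [NormedSpace ℝ V] {U : Set (EuclideanSpace ℝ (Fin n))} {r : ℕ}
    {A : (𝔼 → F) → 𝔼 → V} (hA : IsLocOp U r A) {f f' : 𝔼 → F} (hf : ContDiffOn ℝ ∞ f U)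
    (hf' : ContDiffOn ℝ ∞ f' U) {x : 𝔼} (hx : x ∈ U) (h : f =ᶠ[𝓝 x] f') : A f x = A f' x := by
  obtain ⟨L, -, hL⟩ := hA
  rw [hL f hf x hx, hL f' hf' x hx, jetCoord_congr h r]

theorem topBracket_add_right (hw : IsSkewPairing w) {β β' : PreForm n F E n} (hβ : IsHorizontal β)
    (hβ' : IsHorizontal β') (α : PreForm n F E n) :
    topBracket ν w α (β + β') = topBracket ν w α β + topBracket ν w α β' := by
  rw [topBracket_skew hw, topBracket_add_left hβ hβ', topBracket_skew hw α, topBracket_skew hw α,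
    neg_add]

theorem topBracket_smul_right (hw : IsSkewPairing w) {β : PreForm n F E n} (hβ : IsHorizontal β)
    (c : ℝ) (α : PreForm n F E n) : topBracket ν w α (c • β) = c • topBracket ν w α β := by
  rw [topBracket_skew hw, topBracket_smul_left hβ, topBracket_skew hw α, smul_neg]

variable (ν w) in
/-- The cyclic sum `[[α, β], γ] + [[β, γ], α] + [[γ, α], β]`. -/
def jac (α β γ : PreForm n F E n) : PreForm n F E n :=
  topBracket ν w (topBracket ν w α β) γ + topBracket ν w (topBracket ν w β γ) α +
    topBracket ν w (topBracket ν w γ α) β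

theorem jac_add_left (hν : IsVolumeForm ν) (hw : IsSkewPairing w) {α α' β γ : PreForm n F E n}
    (hα : IsHorizontal α) (hα' : IsHorizontal α') (hβ : IsHorizontal β) (hγ : IsHorizontal γ) :
    jac ν w (α + α') β γ = jac ν w α β γ + jac ν w α' β γ := by
  unfold jac
  rw [topBracket_add_left hα hα', topBracket_add_right hw hα hα', topBracket_add_right hw hα hα',
    topBracket_add_left (isHorizontal_topBracket hν hw hα hβ)
      (isHorizontal_topBracket hν hw hα' hβ),
    topBracket_add_left (isHorizontal_topBracket hν hw hγ hα)
      (isHorizontal_topBracket hν hw hγ hα')]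
  abel

theorem jac_smul_left (hν : IsVolumeForm ν) (hw : IsSkewPairing w) {α β γ : PreForm n F E n}
    (hα : IsHorizontal α) (hβ : IsHorizontal β) (hγ : IsHorizontal γ) (c : ℝ) :
    jac ν w (c • α) β γ = c • jac ν w α β γ := by
  unfold jac
  rw [topBracket_smul_left hα, topBracket_smul_right hw hα, topBracket_smul_right hw hα,
    topBracket_smul_left (isHorizontal_topBracket hν hw hα hβ),
    topBracket_smul_left (isHorizontal_topBracket hν hw hγ hα), smul_add, smul_add]

theorem jac_sum_left (hν : IsVolumeForm ν) (hw : IsSkewPairing w) {ι : Type*} (t : Finset ι)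
    {α : ι → PreForm n F E n} {β γ : PreForm n F E n} (hα : ∀ i, IsHorizontal (α i))
    (hβ : IsHorizontal β) (hγ : IsHorizontal γ) :
    jac ν w (∑ i ∈ t, α i) β γ = ∑ i ∈ t, jac ν w (α i) β γ := by
  classical
  induction t using Finset.induction_on with
  | empty =>
    have := jac_smul_left hν hw (α := 0) IsHorizontal.zero hβ hγ 0
    rwa [zero_smul, zero_smul] at this
  | insert i t hi ih =>
    rw [Finset.sum_insert hi, Finset.sum_insert hi,
      jac_add_left hν hw (hα i) (IsHorizontal.sum t fun i _ => hα i) hβ hγ, ih]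

theorem jac_congr_left (hν : IsVolumeForm ν) (hw : IsSkewPairing w) {α α' β γ : PreForm n F E n}
    (hα : IsHorizontal α) (hα' : IsHorizontal α') (hβ : IsHorizontal β) (hγ : IsHorizontal γ)
    {p : M} (h : ∀ᶠ p' in 𝓝 p, ∀ φ : Sec n F E, α (φ.jet p') = α' (φ.jet p')) (φ : Sec n F E) :
    jac ν w α β γ (φ.jet p) = jac ν w α' β γ (φ.jet p) := by
  have e : ∀ᶠ p' in 𝓝 p, ∀ φ : Sec n F E, euler α (φ.jet p') = euler α' (φ.jet p') := by
    filter_upwards [h.eventually_nhds] with p' hp' φ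
    exact euler_congr hα hα' hp' φ
  have e0 := e.self_of_nhds φ
  have h1 : topBracket ν w (topBracket ν w α β) γ (φ.jet p) =
      topBracket ν w (topBracket ν w α' β) γ (φ.jet p) := by
    refine topBracket_congr_left (euler_congr (isHorizontal_topBracket hν hw hα hβ)
      (isHorizontal_topBracket hν hw hα' hβ) ?_ φ) γ
    filter_upwards [e] with p' hp' ψ using topBracket_congr_left (hp' ψ) β
  have h3 : topBracket ν w (topBracket ν w γ α) β (φ.jet p) =
      topBracket ν w (topBracket ν w γ α') β (φ.jet p) := by
    refine topBracket_congr_left (euler_congr (isHorizontal_topBracket hν hw hγ hα)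
      (isHorizontal_topBracket hν hw hγ hα') ?_ φ) β
    filter_upwards [e] with p' hp' ψ
    rw [topBracket_skew hw γ α, topBracket_skew hw γ α']
    exact congrArg Neg.neg (topBracket_congr_left (hp' ψ) γ)
  have h2 : topBracket ν w (topBracket ν w β γ) α (φ.jet p) =
      topBracket ν w (topBracket ν w β γ) α' (φ.jet p) := by
    rw [topBracket_skew hw _ α, topBracket_skew hw _ α']
    exact congrArg Neg.neg (topBracket_congr_left e0 _)
  exact congrArg₂ (· + ·) (congrArg₂ (· + ·) h1 h2) h3

theorem jac_zero_left (hν : IsVolumeForm ν) (hw : IsSkewPairing w) {β γ : PreForm n F E n}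
    (hβ : IsHorizontal β) (hγ : IsHorizontal γ) : jac ν w 0 β γ = 0 := by
  have := jac_smul_left hν hw (α := 0) IsHorizontal.zero hβ hγ 0
  rwa [zero_smul, zero_smul] at this

theorem IsOmegaC.jac (hν : IsVolumeForm ν) (hw : IsSkewPairing w) {α β γ : PreForm n F E n}
    (hα : IsOmegaC α) (hβ : IsOmegaC β) (hγ : IsOmegaC γ) : IsOmegaC (jac ν w α β γ) :=
  (((hα.topBracket hν hw hβ).topBracket hν hw hγ).add
    ((hβ.topBracket hν hw hγ).topBracket hν hw hα)).add
    ((hγ.topBracket hν hw hα).topBracket hν hw hβ)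

theorem IsOmegaC.base_smul {k : ℕ} {α : PreForm n F E k} (hα : IsOmegaC α) {ρ : M → ℝ}
    (hρ : ContMDiff (𝓡 n) 𝓘(ℝ, ℝ) ∞ ρ) (hρc : HasCompactSupport ρ) :
    IsOmegaC (fun j => ρ j.1 • α j) where
  horizontal := hα.horizontal.base_smul hρ
  compact φ := ⟨tsupport ρ, hρc, fun p hp => by
    change ρ p • _ = _
    rw [image_eq_zero_of_notMem_tsupport hp, zero_smul]⟩
  compact_euler h φ := by
    subst h
    refine ⟨tsupport ρ, hρc, fun p hp => ?_⟩
    refine (euler_congr (hα.horizontal.base_smul hρ) IsHorizontal.zero ?_ φ.1).trans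
      (by rw [euler_zero]; rfl)
    filter_upwards [(isClosed_tsupport ρ).isOpen_compl.mem_nhds hp] with p' hp' ψ
    change ρ p' • _ = _
    rw [image_eq_zero_of_notMem_tsupport hp', zero_smul]
    rfl

variable [MeasurableSpace M] [BorelSpace M] [SecondCountableTopology M]

theorem functional_jac (hν : IsVolumeForm ν) (hw : IsSkewPairing w) (hJ : JacobiIdentity ν w)
    {α β γ : PreForm n F E n} (hα : IsOmegaC α) (hβ : IsOmegaC β) (hγ : IsOmegaC γ) :
    functional ν (jac ν w α β γ) = 0 := by
  have h := hJ _ _ _ ⟨α, hα, rfl⟩ ⟨β, hβ, rfl⟩ ⟨γ, hγ, rfl⟩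
  have h1 := hα.topBracket hν hw hβ
  have h2 := hβ.topBracket hν hw hγ
  have h3 := hγ.topBracket hν hw hα
  have h1' := h1.topBracket hν hw hγ
  have h2' := h2.topBracket hν hw hα
  have h3' := h3.topBracket hν hw hβ
  have h12 := h1'.add h2'
  rw [poissonBracket_functional hν w hα hβ, poissonBracket_functional hν w hβ hγ,
    poissonBracket_functional hν w hγ hα, poissonBracket_functional hν w h1 hγ,
    poissonBracket_functional hν w h2 hα, poissonBracket_functional hν w h3 hβ,
    ← functional_add hν h1'.horizontal h2'.horizontal h1'.compact h2'.compact,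
    ← functional_add hν h12.horizontal h3'.horizontal h12.compact h3'.compact] at h
  exact h

theorem euler_jac (hν : IsVolumeForm ν) (hw : IsSkewPairing w) (hJ : JacobiIdentity ν w)
    {α β γ : PreForm n F E n} (hα : IsOmegaC α) (hβ : IsOmegaC β) (hγ : IsOmegaC γ) :
    euler (jac ν w α β γ) = 0 :=
  euler_eq_zero_of_functional_eq_zero hν (hα.jac hν hw hβ hγ).horizontal
    (hα.jac hν hw hβ hγ).compact (functional_jac hν hw hJ hα hβ hγ)

/-- Along the zero section the Jacobiator of `ρ α`, `β`, `γ` is locally a divergence of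
differential operators in `ρ`. -/
theorem exists_divergence_jac (hν : IsVolumeForm ν) (hw : IsSkewPairing w)
    (hJ : JacobiIdentity ν w) {α β γ : PreForm n F E n} (hα : IsOmegaC α) (hβ : IsOmegaC β)
    (hγ : IsOmegaC γ) (p : M) :
    ∃ (U : Set 𝔼) (s : ℕ) (P : Fin n → (𝔼 → ℝ) → 𝔼 → ℝ), IsOpen U ∧ cht p p ∈ U ∧
      U ⊆ coordDom n F E p ∧ (∀ j, IsLocOp U s (P j)) ∧
      (∀ j ρ x, (∀ᶠ y in 𝓝 x, ρ y = 0) → P j ρ x = 0) ∧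
      ∀ ρ : M → ℝ, ContMDiff (𝓡 n) 𝓘(ℝ, ℝ) ∞ ρ → ∀ x ∈ U,
        onFrame (toChart p ((cht p).symm x) (jac ν w (fun j => ρ j.1 • α j) β γ
          ((0 : Sec n F E).jet ((cht p).symm x)))) =
        ∑ j, fderiv ℝ (P j fun y => ρ ((cht p).symm y)) x (EuclideanSpace.single j (1 : ℝ)) := by
  obtain ⟨U₀, hU₀, hp₀, hU₀p, hbr⟩ := exists_localFamily_topBracket hν hw p
  obtain ⟨U₁, ε, hU₁, hp₁, hU₁p, hε0, hε⟩ := hν.exists_sign (mem_chart_target _ p)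
  set U := U₀ ∩ U₁ with hUdef
  have hU : IsOpen U := hU₀.inter hU₁
  have hUp : U ⊆ coordDom n F E p := inter_subset_left.trans hU₀p
  have hbr := hbr U inter_subset_left hU
  have fα := LocalFamily.base_smul hU hUp hα.horizontal
  have fβ := LocalFamily.const hU hUp hβ.horizontal
  have fγ := LocalFamily.const hU hUp hγ.horizontal
  have fJ : LocalFamily p U fun ρ => jac ν w (fun j => ρ j.1 • α j) β γ :=
    ((hbr _ _ (hbr _ _ fα fβ) fγ).add (hbr _ _ (hbr _ _ fβ fγ) fα)).add
      (hbr _ _ (hbr _ _ fγ fα) fβ)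
  obtain ⟨r, A, hA, h⟩ := fJ.paramLocal
  -- Along the zero section the first component of the field `(φ, ρ)` vanishes, and only an operator
  -- in `ρ` remains.
  have h0 : ∀ ρ : M → ℝ, ContMDiff (𝓡 n) 𝓘(ℝ, ℝ) ∞ ρ → ∀ x ∈ U,
      onFrame (comp p (jac ν w (fun j => ρ j.1 • α j) β γ)
        ((0 : Sec n F E).jet ((cht p).symm x))) =
      A (fun y => ContinuousLinearMap.inr ℝ F ℝ (ρ ((cht p).symm y))) x := fun ρ hρ x hx => by
    refine (h ρ hρ 0 x hx).trans (hA.congr_field (contDiffOn_rep_prod hUp 0 hρ)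
      ((ContinuousLinearMap.inr ℝ F ℝ).contDiff.comp_contDiffOn
        ((contDiffOn_comp_chart_symm hρ p).mono fun _ hx => (hUp hx).1)) hx ?_)
    filter_upwards [hU.mem_nhds hx] with y hy
    rw [rep_zero (hUp hy)]
    rfl
  have hA₀ := hA.comp_left hU (ContinuousLinearMap.inr ℝ F ℝ)
  -- Homogeneity is known for functions on `M`. A function on `U` agrees near `x` with one on `M`
  -- after a cut-off, and the operator is local.
  have hlin : ∀ (t : ℝ) (ρ : 𝔼 → ℝ), ContDiffOn ℝ ∞ ρ U → ∀ x ∈ U,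
      A (fun y => ContinuousLinearMap.inr ℝ F ℝ (t * ρ y)) x =
        t • A (fun y => ContinuousLinearMap.inr ℝ F ℝ (ρ y)) x := fun t ρ hρ x hx => by
    obtain ⟨χ, hχ, hχU, hχc, hχ1⟩ := exists_cutoff (n := n) x (hU.mem_nhds hx)
    have hχ := contMDiff_iff_contDiff.1 hχ
    have hg : ContDiff ℝ ∞ fun y => χ y * ρ y := contDiff_iff_contDiffAt.2 fun y => by
      by_cases hy : y ∈ tsupport χ
      · exact hχ.contDiffAt.mul (hρ.contDiffAt (hU.mem_nhds (hχU hy)))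
      · refine contDiffAt_const (c := (0 : ℝ)) |>.congr_of_eventuallyEq ?_
        filter_upwards [(isClosed_tsupport χ).isOpen_compl.mem_nhds hy] with z hz
        rw [image_eq_zero_of_notMem_tsupport hz, zero_mul]
    obtain ⟨σ, hσ, hσe, -⟩ := exists_function_of_coord p hχc
      (hχU.trans fun y hy => (hUp hy).1) hg fun y hy => by
        rw [image_eq_zero_of_notMem_tsupport hy, zero_mul]
    have hev : ∀ᶠ y in 𝓝 x, σ ((cht p).symm y) = ρ y := by
      filter_upwards [hU.mem_nhds hx, hχ1] with y hy h1
      rw [hσe y (hUp hy).1, h1, one_mul]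
    have hσU := (contDiffOn_comp_chart_symm hσ p).mono fun _ hx => (hUp hx).1
    have e1 := hA₀.congr_field hσU hρ hx hev
    have e2 := hA₀.congr_field (hσU.const_smul t) (hρ.const_smul t) hx
      (hev.mono fun y hy => congrArg (t • ·) hy)
    have hc : ContMDiff (𝓡 n) 𝓘(ℝ, ℝ) ∞ fun p => t * σ p := contMDiff_const.mul hσ
    refine Eq.trans e2.symm (Eq.trans ?_ (congrArg (t • ·) e1))
    refine (h0 (fun p => t * σ p) hc x hx).symm.trans (Eq.trans ?_
      (congrArg (t • ·) (h0 σ hσ x hx)))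
    have e3 : (fun j : InfJet n F E => (t * σ j.1) • α j) = t • fun j => σ j.1 • α j :=
      funext fun j => mul_smul t (σ j.1) (α j)
    rw [e3, jac_smul_left hν hw (hα.horizontal.base_smul hσ) hβ.horizontal hγ.horizontal]
    exact (congrArg onFrame (map_smul (toChartL n p _) _ _)).trans (map_smul (onFrameL n) _ _)
  -- The Jacobi identity for the functionals of `ρ α`, `β`, `γ`, evaluated at the zero section. The
  -- function `ρ` is arbitrary among those supported in the chart, which gives far more than the
  -- vanishing of one integral.
  have hint : ∀ χ : 𝔼 → ℝ, ContDiff ℝ ∞ χ → HasCompactSupport χ → tsupport χ ⊆ U →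
      ∫ x in tsupport χ, A (fun y => ContinuousLinearMap.inr ℝ F ℝ (χ y)) x = 0 :=
    fun χ hχ hχc hχU => by
    obtain ⟨ρ, hρ, hρe, hρ0⟩ := exists_function_of_coord p hχc
      (hχU.trans fun y hy => (hUp hy).1) hχ fun y hy => image_eq_zero_of_notMem_tsupport hy
    have hK := isCompact_image_chart_symm hχc (hχU.trans fun y hy => (hUp hy).1)
    have hρc : HasCompactSupport ρ := HasCompactSupport.intro hK hρ0
    have hρα := hα.base_smul hρ hρc
    have hj := hρα.jac hν hw hβ hγ
    let z : SecC n F E := ⟨0, Sec.CompactSupport.of_forall_notMem isCompact_empty fun _ _ => rfl⟩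
    have h1 := congrFun (functional_jac hν hw hJ hρα hβ hγ) z
    have h2 := integralForm_eq_chart (lam := fun p => jac ν w (fun j => ρ j.1 • α j) β γ (z.1.jet p))
      hν hχc (hχU.trans fun y hy => (hUp hy).1) (fun y hy => hε y (hχU hy).2) (fun p' hp' => by
        refine (jac_congr_left hν hw hρα.horizontal IsHorizontal.zero hβ.horizontal hγ.horizontal
          ?_ z.1).trans (by rw [jac_zero_left hν hw hβ.horizontal hγ.horizontal]; rfl)
        filter_upwards [hK.isClosed.isOpen_compl.mem_nhds hp'] with p'' hp'' ψ
        change ρ p'' • _ = _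
        rw [hρ0 p'' hp'', zero_smul]
        rfl) (continuous_density hν hj.horizontal z.1)
    have h3 := (mul_eq_zero.1 (h2.symm.trans h1)).resolve_left hε0
    refine Eq.trans (setIntegral_congr_fun hχc.measurableSet fun x hx => ?_) h3
    refine Eq.trans ?_ (h0 ρ hρ x (hχU hx)).symm
    have hχs : ContDiffOn ℝ ∞ χ U := hχ.contDiffOn
    refine hA₀.congr_field hχs ((contDiffOn_comp_chart_symm hρ p).mono fun _ hx => (hUp hx).1)
      (hχU hx) ?_
    filter_upwards [hU.mem_nhds (hχU hx)] with y hy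
    rw [hρe y (hUp hy).1]
  obtain ⟨P, hP, hP0, hPe⟩ := exists_eq_divergence_of_integral_eq_zero hU hA₀ hlin hint
  exact ⟨U, r + r, P, hU, ⟨hp₀, hp₁⟩, hUp, hP, hP0, fun ρ hρ x hx => (h0 ρ hρ x hx).trans
    (hPe _ ((contDiffOn_comp_chart_symm hρ p).mono fun _ hx => (hUp hx).1) x hx)⟩

end ParamLocal

/-! ## Primitives of the Jacobiator -/

section JacPrimitive

variable {m : ℕ} {M : Type*} [TopologicalSpace M] [ChartedSpace (EuclideanSpace ℝ (Fin (m + 1))) M]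
  [IsManifold (𝓡 (m + 1)) ∞ M] [T2Space M] [SecondCountableTopology M]
  [MeasurableSpace M] [BorelSpace M]
  {F : Type*} [NormedAddCommGroup F] [NormedSpace ℝ F] [FiniteDimensional ℝ F]
  {E : M → Type*} [TopologicalSpace (TotalSpace F E)] [∀ p, TopologicalSpace (E p)]
  [∀ p, AddCommGroup (E p)] [∀ p, Module ℝ (E p)] [FiberBundle F E] [VectorBundle ℝ F E]
  [ContMDiffVectorBundle ∞ F E (𝓡 (m + 1))]
  {ν : M → Cov (m + 1) (m + 1)} {w : Pairing (m + 1) F E}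

local notation "cht" => chartAt (EuclideanSpace ℝ (Fin (m + 1)))
local notation "𝔼" => EuclideanSpace ℝ (Fin (m + 1))

/-- The fluxes found by `exists_divergence_jac` do not involve the section, so they give a form
pulled back from the base. Their locality in `ρ` confines it to the support of `ρ`. -/
theorem exists_primitive_jac_smul (hν : IsVolumeForm ν) (hw : IsSkewPairing w)
    (hJ : JacobiIdentity ν w) {α β γ : PreForm (m + 1) F E (m + 1)} (hα : IsOmegaC α)
    (hβ : IsOmegaC β) (hγ : IsOmegaC γ) (p : M) :
    ∃ O ∈ 𝓝 p, ∀ ρ : M → ℝ, ContMDiff (𝓡 (m + 1)) 𝓘(ℝ, ℝ) ∞ ρ → HasCompactSupport ρ →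
      tsupport ρ ⊆ O → ∃ η : PreForm (m + 1) F E m, IsHorizontal η ∧
        (∀ j, j.1 ∉ tsupport ρ → η j = 0) ∧ ∀ (φ : Sec (m + 1) F E) p,
          dH η (φ.jet p) = jac ν w (fun j => ρ j.1 • α j) β γ ((0 : Sec (m + 1) F E).jet p) := by
  obtain ⟨U, s, P, hU, hpU, hUp, hP, hP0, h⟩ := exists_divergence_jac hν hw hJ hα hβ hγ p
  refine ⟨(cht p).source ∩ cht p ⁻¹' U, ((cht p).isOpen_inter_preimage hU).mem_nhds
    ⟨mem_chart_source _ p, hpU⟩, fun ρ hρ hρc hρO => ?_⟩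
  set C := cht p '' tsupport ρ with hCdef
  have hC : IsCompact C := IsCompact.image_of_continuousOn hρc
    ((cht p).continuousOn.mono fun p hp => (hρO hp).1)
  have hCU : C ⊆ U := by
    rintro _ ⟨p', hp', rfl⟩
    exact (hρO hp').2
  have hCK : (cht p).symm '' C = tsupport ρ := by
    rw [hCdef, image_image]
    exact (image_congr fun p' hp => (cht p).left_inv (hρO hp).1).trans (image_id _)
  have hρU := (contDiffOn_comp_chart_symm hρ p).mono fun _ hx => (hUp hx).1
  obtain ⟨η, hη, -, hη0, hd0, hd⟩ := exists_form_of_divergence (E := E) hU hUp hC hCU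
    (fun j => isLocOp_of_fun (F := F) (r := 0) ((hP j).contDiffOn hU hρU)) fun j f x hx hxC =>
      hP0 j _ x <| by
        filter_upwards [(hU.sdiff hC.isClosed).mem_nhds ⟨hx, hxC⟩] with y hy
        exact image_eq_zero_of_notMem_tsupport fun hK =>
          hy.2 ⟨_, hK, (cht p).right_inv (hUp hy.1).1⟩
  rw [hCK] at hη0 hd0
  refine ⟨η, hη.isHorizontal, hη0, fun φ p' => ?_⟩
  by_cases hp' : p' ∈ tsupport ρ
  · have hx := hCU ⟨p', hp', rfl⟩
    have e1 := hd φ _ hx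
    have e2 := h ρ hρ _ hx
    rw [(cht p).left_inv (hρO hp').1] at e1 e2
    refine toChart_injective (q := p) (hρO hp').1 (onFrame_injective (e1.trans e2.symm))
  · refine (hd0 (φ.jet p') hp').trans ?_
    refine ((jac_congr_left hν hw (hα.horizontal.base_smul hρ) IsHorizontal.zero hβ.horizontal
      hγ.horizontal ?_ 0).trans (by
        rw [jac_zero_left hν hw hβ.horizontal hγ.horizontal]; rfl)).symm
    filter_upwards [(isClosed_tsupport ρ).isOpen_compl.mem_nhds hp'] with p'' hp'' ψ
    change ρ p'' • _ = _
    rw [image_eq_zero_of_notMem_tsupport hp'', zero_smul]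
    rfl

theorem exists_primitive_jac_along_zero (hν : IsVolumeForm ν) (hw : IsSkewPairing w)
    (hJ : JacobiIdentity ν w) {α β γ : PreForm (m + 1) F E (m + 1)} (hα : IsOmegaC α)
    (hβ : IsOmegaC β) (hγ : IsOmegaC γ) :
    ∃ (η : PreForm (m + 1) F E m) (K : Set M), IsHorizontal η ∧ IsCompact K ∧
      (∀ j, j.1 ∉ K → η j = 0) ∧ ∀ (φ : Sec (m + 1) F E) p,
        dH η (φ.jet p) = jac ν w α β γ ((0 : Sec (m + 1) F E).jet p) := by
  choose O hO hex using exists_primitive_jac_smul hν hw hJ hα hβ hγ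
  obtain ⟨ρ, hρ⟩ := exists_partition (n := m + 1) hO
  have hρs : ∀ i, ContMDiff (𝓡 (m + 1)) 𝓘(ℝ, ℝ) ∞ (ρ i) := fun i => (ρ i).contMDiff
  choose η hη hη0 hηd using fun i => hex i (ρ i) (hρs i) (hρ i).1 (hρ i).2
  let z : SecC (m + 1) F E :=
    ⟨0, Sec.CompactSupport.of_forall_notMem isCompact_empty fun _ _ => rfl⟩
  obtain ⟨K₁, hK₁, h₁⟩ := hγ.compact_euler rfl z
  obtain ⟨K₂, hK₂, h₂⟩ := (hβ.topBracket hν hw hγ).compact_euler rfl z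
  obtain ⟨K₃, hK₃, h₃⟩ := hβ.compact_euler rfl z
  -- Each double bracket has the Euler form of `γ`, of the bracket of `β` and `γ`, or of `β` as a
  -- factor. The compact set therefore does not depend on the first argument and serves all the
  -- pieces `ρ i α` at once.
  have hjac : ∀ (α' : PreForm (m + 1) F E (m + 1)) p, p ∉ K₁ ∪ K₂ ∪ K₃ →
      jac ν w α' β γ ((0 : Sec (m + 1) F E).jet p) = 0 := fun α' p hp => by
    simp only [mem_union, not_or] at hp
    have e1 := topBracket_of_euler_eq_zero (ν := ν) (w := w) (h₁ p hp.1.1) (topBracket ν w α' β)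
    have e2 := topBracket_of_euler_eq_zero (ν := ν) (w := w) (h₂ p hp.1.2) α'
    have e3 := topBracket_of_euler_eq_zero (ν := ν) (w := w) (h₃ p hp.2) (topBracket ν w γ α')
    have e1' := (congrFun (topBracket_skew hw (topBracket ν w α' β) γ) _).trans
      ((congrArg Neg.neg e1).trans neg_zero)
    have e3' := (congrFun (topBracket_skew hw (topBracket ν w γ α') β) _).trans
      ((congrArg Neg.neg e3).trans neg_zero)
    refine (congrArg₂ (· + ·) (congrArg₂ (· + ·) e1' e2) e3').trans ?_
    simp
  have hK : IsCompact (K₁ ∪ K₂ ∪ K₃) := (hK₁.union hK₂).union hK₃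
  have hlf := SmoothPartitionOfUnity.locallyFinite_tsupport ρ
  -- Only finitely many members of the partition meet the compact set, so the primitive is a finite
  -- sum with compact support.
  have hfin := hlf.finite_nonempty_inter_compact hK
  set S := hfin.toFinset with hS
  have hSn : ∀ p ∈ K₁ ∪ K₂ ∪ K₃, ∀ i ∉ S, p ∉ tsupport (ρ i) := fun p hp i hi hpi =>
    hi (hfin.mem_toFinset.2 ⟨p, hpi, hp⟩)
  refine ⟨∑ i ∈ S, η i, ⋃ i ∈ S, tsupport (ρ i), IsHorizontal.sum S fun i _ => hη i,
    S.isCompact_biUnion fun i _ => (hρ i).1, fun j hj => ?_, fun φ p => ?_⟩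
  · rw [Finset.sum_apply]
    refine Finset.sum_eq_zero fun i hi => hη0 i j fun h => hj (mem_biUnion hi h)
  · rw [dH_sum S fun i _ => hη i, Finset.sum_apply]
    refine (Finset.sum_congr rfl fun i _ => hηd i φ p).trans ?_
    by_cases hp : p ∈ K₁ ∪ K₂ ∪ K₃
    · rw [← Finset.sum_apply (a := (0 : Sec (m + 1) F E).jet p),
        ← jac_sum_left hν hw S (fun i => hα.horizontal.base_smul (hρs i)) hβ.horizontal
          hγ.horizontal]
      refine jac_congr_left hν hw (IsHorizontal.sum S fun i _ => hα.horizontal.base_smul (hρs i))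
        hα.horizontal hβ.horizontal hγ.horizontal ?_ 0
      -- The bracket differentiates `ρ i`, so the members in `S` must sum to one near `p` and not
      -- only at `p`. The remaining supports have a closed union that misses `p`.
      have hcl : IsClosed (⋃ i : {i // i ∉ S}, tsupport (ρ i.1)) :=
        (hlf.comp_injective Subtype.val_injective).isClosed_iUnion fun i => isClosed_tsupport _
      filter_upwards [hcl.isOpen_compl.mem_nhds (x := p) fun h => by
        obtain ⟨i, hi⟩ := mem_iUnion.1 h
        exact hSn p hp i.1 i.2 hi] with p' hp' ψ
      rw [Finset.sum_apply]
      change ∑ i ∈ S, ρ i p' • α (ψ.jet p') = _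
      rw [← Finset.sum_smul, SmoothPartitionOfUnity.sum_eq_one_of_forall_notMem ρ fun i hi h =>
        hp' (mem_iUnion.2 ⟨⟨i, hi⟩, h⟩), one_smul]
    · rw [hjac _ p hp]
      exact Finset.sum_eq_zero fun i _ => hjac _ p hp

/-- The Jacobiator is exact. -/
theorem exists_primitive_jac (hν : IsVolumeForm ν) (hw : IsSkewPairing w)
    (hJ : JacobiIdentity ν w) {α β γ : PreForm (m + 1) F E (m + 1)} (hα : IsOmegaC α)
    (hβ : IsOmegaC β) (hγ : IsOmegaC γ) :
    ∃ η : PreForm (m + 1) F E m, IsOmegaC η ∧ dH η = jac ν w α β γ := by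
  -- `η₁` accounts for the difference from the value along the zero section and vanishes wherever
  -- the section does; `η₂` accounts for that value and is supported in a fixed compact set.
  obtain ⟨η₁, h₁, hz, hd₁⟩ := exists_primitive_sub_zero (hα.jac hν hw hβ hγ).horizontal
    (euler_jac hν hw hJ hα hβ hγ)
  obtain ⟨η₂, K, h₂, hK, h0, hd₂⟩ := exists_primitive_jac_along_zero hν hw hJ hα hβ hγ
  refine ⟨η₁ + η₂, ⟨h₁.add h₂, fun φ => ?_, fun h => absurd h (by omega)⟩, funext fun j => ?_⟩
  · refine ⟨closure {p | φ.1 p ≠ 0} ∪ K, IsCompact.union φ.2 hK, fun p hp => ?_⟩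
    rw [mem_union, not_or] at hp
    have e1 := hz φ.1 p (by
      filter_upwards [isClosed_closure.isOpen_compl.mem_nhds hp.1] with p' hp'
      by_contra h
      exact hp' (subset_closure h))
    exact (congrArg₂ (· + ·) e1 (h0 (φ.1.jet p) hp.2)).trans (add_zero 0)
  · induction j using InfJet.ind with
    | h φ p =>
    rw [dH_add h₁ h₂]
    exact (congrArg₂ (· + ·) (hd₁ φ p) (hd₂ φ p)).trans (sub_add_cancel _ _)

end JacPrimitive

/-! ### The Jacobiator over a zero-dimensional base -/

section Zero

variable {M : Type*} [TopologicalSpace M] [ChartedSpace (EuclideanSpace ℝ (Fin 0)) M]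
  [IsManifold (𝓡 0) ∞ M] [T2Space M] [SecondCountableTopology M]
  [MeasurableSpace M] [BorelSpace M]
  {F : Type*} [NormedAddCommGroup F] [NormedSpace ℝ F] [FiniteDimensional ℝ F]
  {E : M → Type*} [TopologicalSpace (TotalSpace F E)] [∀ p, TopologicalSpace (E p)]
  [∀ p, AddCommGroup (E p)] [∀ p, Module ℝ (E p)] [FiberBundle F E] [VectorBundle ℝ F E]
  [ContMDiffVectorBundle ∞ F E (𝓡 0)]
  {ν : M → Cov 0 0} {w : Pairing 0 F E}

local notation "cht" => chartAt (EuclideanSpace ℝ (Fin 0))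
local notation "𝔼" => EuclideanSpace ℝ (Fin 0)

/-- The divergence in the homotopy formula is an empty sum, and the Euler term vanishes by
assumption. -/
theorem apply_eq_apply_zero_of_euler_eq_zero {α : PreForm 0 F E 0} (hα : IsHorizontal α)
    (hE : euler α = 0) (φ : Sec 0 F E) (p : M) : α (φ.jet p) = α ((0 : Sec 0 F E).jet p) := by
  obtain ⟨r, L, hL, he⟩ := euler_apply_self hα p
  have hU := isOpen_coordDom (n := 0) (F := F) (E := E) p
  have hx := chart_mem_coordDom (mem_dom_self (n := 0) (F := F) (E := E) p)
  obtain ⟨Q, -, -, -, hQ⟩ := exists_homotopy_divergence hU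
    ((onFrameL 0).contDiff.comp_contDiffOn hL.1)
  have h1 := hQ _ (contDiffOn_rep φ p) _ hx
  have hpx : (cht p).symm (cht p p) = p := (cht p).left_inv (mem_chart_source _ p)
  have h2 := fun ψ : Sec 0 F E => hL.2 ψ _ hx
  simp only [hpx, comp] at h2
  have h3 : ∀ ψ : Sec 0 F E, α (ψ.jet p) = L (cht p p, jetCoord r (ψ.rep p) (cht p p)) := fun ψ =>
    (toChart_self p _).symm.trans (h2 ψ)
  have h4 : jetCoord r ((0 : Sec 0 F E).rep p) (cht p p) = 0 := by
    refine (jetCoord_congr (f' := fun _ => 0) ?_ r).trans ?_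
    · filter_upwards [hU.mem_nhds hx] with y hy using rep_zero hy
    · funext k
      simp [jetCoord, iteratedFDeriv_fun_zero]
  have h5 : ∀ t : ℝ, eulerExpr (fun z => onFrameL 0 (L z)) (fun y => t • φ.rep p y) (cht p p)
      (φ.rep p (cht p p)) = 0 := fun t => by
    have e2 : (trivializationAt F E p).linearMapAt ℝ p
        ((trivializationAt F E p).symmₗ ℝ p (φ.rep p (cht p p))) = φ.rep p (cht p p) :=
      (trivializationAt F E p).linearMapAt_symmₗ (mem_baseSet_trivializationAt F E p) _
    have e1 := he (t • φ) ((trivializationAt F E p).symmₗ ℝ p (φ.rep p (cht p p)))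
    rw [e2, hE] at e1
    refine (eulerExpr_congr_field ?_ _).trans ((eulerExpr_clm hU hL.1
      (contDiffOn_rep (t • φ) p) hx (onFrameL 0) (φ.rep p (cht p p))).trans ?_)
    · filter_upwards [hU.mem_nhds hx] with y hy
      exact (rep_smul t φ hy).symm
    · rw [← e1]
      exact map_zero (onFrameL 0)
  dsimp only [Function.comp_apply] at h1
  rw [← h4, ← h3, ← h3] at h1
  simp only [Function.comp_def, h5, Finset.univ_eq_empty, Finset.sum_empty,
    intervalIntegral.integral_zero, add_zero] at h1
  exact onFrame_injective (sub_eq_zero.1 h1)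

/-- Both parts of the general argument degenerate: the Jacobiator equals its value along the zero
section, and that value is an empty divergence. -/
theorem jac_eq_zero (hν : IsVolumeForm ν) (hw : IsSkewPairing w)
    (hJ : JacobiIdentity ν w) {α β γ : PreForm 0 F E 0} (hα : IsOmegaC α)
    (hβ : IsOmegaC β) (hγ : IsOmegaC γ) : jac ν w α β γ = 0 := by
  refine funext fun j => ?_
  induction j using InfJet.ind with
  | h φ p =>
  refine (apply_eq_apply_zero_of_euler_eq_zero (hα.jac hν hw hβ hγ).horizontal
    (euler_jac hν hw hJ hα hβ hγ) φ p).trans ?_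
  obtain ⟨U, s, P, hU, hpU, hUp, -, -, h⟩ := exists_divergence_jac hν hw hJ hα hβ hγ p
  -- The constant function `ρ = 1` gives back `α` itself.
  have h1 := h (fun _ => 1) contMDiff_const _ hpU
  rw [Finset.univ_eq_empty, Finset.sum_empty, (cht p).left_inv (mem_chart_source _ p),
    toChart_self] at h1
  simp only [one_smul] at h1
  exact onFrame_eq_zero_iff.1 h1

end Zero

/-! ## Families parametrized by a compact Lie group -/

section Family

variable {d : ℕ} {G : Type*} [Group G] [TopologicalSpace G]
  [ChartedSpace (EuclideanSpace ℝ (Fin d)) G]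
  {Z Z' W : Type*} [NormedAddCommGroup Z] [NormedSpace ℝ Z]
  [NormedAddCommGroup Z'] [NormedSpace ℝ Z'] [NormedAddCommGroup W] [NormedSpace ℝ W]

local notation "chG" => chartAt (EuclideanSpace ℝ (Fin d))

variable (d) in
/-- `Φ g z` is smooth in `g : G` and `z ∈ U` together. -/
def SmoothFamily (Φ : G → Z → W) (U : Set Z) : Prop := ∀ g₀ : G, ContDiffOn ℝ ∞
  (fun p : EuclideanSpace ℝ (Fin d) × Z => Φ ((chG g₀).symm p.1) p.2) ((chG g₀).target ×ˢ U)

namespace SmoothFamily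

variable {Φ : G → Z → W} {U : Set Z}

theorem contDiffOn (h : SmoothFamily d Φ U) (g : G) : ContDiffOn ℝ ∞ (Φ g) U := by
  have h1 := h g
  have h2 : ContDiffOn ℝ ∞ (fun z : Z => (chG g g, z)) U := contDiffOn_const.prodMk contDiffOn_id
  have h3 := h1.comp h2 fun z hz => ⟨mem_chart_target _ g, hz⟩
  refine h3.congr fun z hz => ?_
  simp only [Function.comp_apply]
  rw [(chG g).left_inv (mem_chart_source _ g)]

theorem comp (h : SmoothFamily d Φ U) {V : Set Z'} {f : Z' → Z} (hf : ContDiffOn ℝ ∞ f V)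
    (hm : MapsTo f V U) : SmoothFamily d (fun g z => Φ g (f z)) V := fun g₀ =>
  (h g₀).comp (contDiffOn_fst.prodMk (hf.comp contDiffOn_snd fun z hz => hz.2))
    fun z hz => ⟨hz.1, hm hz.2⟩

theorem continuousOn_iteratedFDeriv (h : SmoothFamily d Φ U) (hU : IsOpen U) (k : ℕ) :
    ContinuousOn (fun p : G × Z => iteratedFDeriv ℝ k (Φ p.1) p.2) (univ ×ˢ U) := by
  rintro ⟨g₀, z₀⟩ ⟨-, hz₀⟩
  have h1 := (contDiffOn_iteratedFDeriv_partial ((chG g₀).open_target.prod hU) (h g₀) k).continuousOn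
  have h2 : ContinuousAt (fun p : G × Z => (chG g₀ p.1, p.2)) (g₀, z₀) :=
    (((chG g₀).continuousAt (mem_chart_source _ g₀)).comp continuousAt_fst).prodMk continuousAt_snd
  have hm : (chG g₀ g₀, z₀) ∈ (chG g₀).target ×ˢ U := ⟨mem_chart_target _ g₀, hz₀⟩
  have h3 := (h1.continuousAt (((chG g₀).open_target.prod hU).mem_nhds hm)).comp_of_eq h2 rfl
  refine (h3.congr ?_).continuousWithinAt
  filter_upwards [(continuousAt_fst (p := (g₀, z₀))).eventually
    ((chG g₀).open_source.mem_nhds (mem_chart_source _ g₀))] with p hp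
  simp only [Function.comp_apply]
  rw [(chG g₀).left_inv hp]

theorem continuous_left (h : SmoothFamily d Φ U) (hU : IsOpen U) {z : Z} (hz : z ∈ U) :
    Continuous fun g => Φ g z := by
  have h1 := (h.continuousOn_iteratedFDeriv hU 0).comp_continuous
    (continuous_id.prodMk continuous_const) fun g => ⟨mem_univ g, hz⟩
  exact ((continuousMultilinearCurryFin0 ℝ Z W).continuous.comp h1).congr fun g => by simp

theorem continuousOn_fderiv (h : SmoothFamily d Φ U) (hU : IsOpen U) :
    ContinuousOn (fun p : G × Z => fderiv ℝ (Φ p.1) p.2) (univ ×ˢ U) := by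
  have h1 := (continuousMultilinearCurryFin1 ℝ Z W).continuous.comp_continuousOn
    (h.continuousOn_iteratedFDeriv hU 1)
  refine h1.congr fun p _ => ?_
  ext v
  simp [iteratedFDeriv_one_apply]

variable [CompactSpace G] [MeasurableSpace G] [BorelSpace G] {μ : Measure G}
  [IsFiniteMeasure μ] [FiniteDimensional ℝ Z] [CompleteSpace W]

theorem contDiffOn_integral (h : SmoothFamily d Φ U) (hU : IsOpen U) :
    ContDiffOn ℝ ∞ (fun z => ∫ g, Φ g z ∂μ) U := by
  simpa only [Measure.restrict_univ] using contDiffOn_setIntegral (μ := μ) isCompact_univ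
    MeasurableSet.univ hU (fun g _ => h.contDiffOn g) fun k => h.continuousOn_iteratedFDeriv hU k

theorem hasFDerivAt_integral (h : SmoothFamily d Φ U) (hU : IsOpen U) {z : Z} (hz : z ∈ U) :
    HasFDerivAt (fun z => ∫ g, Φ g z ∂μ) (∫ g, fderiv ℝ (Φ g) z ∂μ) z := by
  simpa only [Measure.restrict_univ] using hasFDerivAt_setIntegral (μ := μ) isCompact_univ
    MeasurableSet.univ hU (fun z hz => (h.continuous_left hU hz).continuousOn)
    (h.continuousOn_fderiv hU) (fun g _ z hz => (((h.contDiffOn g).contDiffAt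
      (hU.mem_nhds hz)).differentiableAt (by simp)).hasFDerivAt) hz

theorem integrable (h : SmoothFamily d Φ U) (hU : IsOpen U) {z : Z} (hz : z ∈ U) :
    Integrable (fun g => Φ g z) μ := by
  have := (h.continuous_left hU hz).continuousOn.integrableOn_compact' (μ := μ)
    isCompact_univ MeasurableSet.univ
  rwa [IntegrableOn, Measure.restrict_univ] at this

theorem integrable_fderiv (h : SmoothFamily d Φ U) (hU : IsOpen U) {z : Z} (hz : z ∈ U) :
    Integrable (fun g => fderiv ℝ (Φ g) z) μ := by
  have h1 : ContinuousOn (fun g => fderiv ℝ (Φ g) z) univ := (h.continuousOn_fderiv hU).comp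
    (continuousOn_id.prodMk continuousOn_const) fun g _ => ⟨mem_univ g, hz⟩
  have := h1.integrableOn_compact' (μ := μ) isCompact_univ MeasurableSet.univ
  rwa [IntegrableOn, Measure.restrict_univ] at this

end SmoothFamily

end Family

/-! ## Pull-back by bundle automorphisms -/

section Pull

variable {n : ℕ} {M : Type*} [TopologicalSpace M] [ChartedSpace (EuclideanSpace ℝ (Fin n)) M]
  [IsManifold (𝓡 n) ∞ M] [T2Space M]
  {F : Type*} [NormedAddCommGroup F] [NormedSpace ℝ F] [FiniteDimensional ℝ F]
  {E : M → Type*} [TopologicalSpace (TotalSpace F E)] [∀ p, TopologicalSpace (E p)]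
  [∀ p, AddCommGroup (E p)] [∀ p, Module ℝ (E p)] [FiberBundle F E] [VectorBundle ℝ F E]
  [ContMDiffVectorBundle ∞ F E (𝓡 n)]
  {d : ℕ} {G : Type*} [Group G] [TopologicalSpace G] [ChartedSpace (EuclideanSpace ℝ (Fin d)) G]
  [LieGroup (𝓡 d) ∞ G]

local notation "cht" => chartAt (EuclideanSpace ℝ (Fin n))
local notation "chG" => chartAt (EuclideanSpace ℝ (Fin d))
local notation "𝔼" => EuclideanSpace ℝ (Fin n)

namespace FibreAction

variable (A : FibreAction n F E d G)

theorem smoothFamily_localAct (q : M) :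
    SmoothFamily d (fun g => A.localAct g q) (coordDom n F E q ×ˢ univ) := by
  intro g₀ z hz
  refine (contMDiffAt_iff_contDiffAt.1 ?_).contDiffWithinAt
  have h1 : ContMDiffAt 𝓘(ℝ, EuclideanSpace ℝ (Fin d) × (𝔼 × F)) (𝓡 d) ∞
      (fun p : EuclideanSpace ℝ (Fin d) × (𝔼 × F) => (chG g₀).symm p.1) z :=
    ContMDiffAt.comp z (contMDiffOn_chart_symm.contMDiffAt
      ((chG g₀).open_target.mem_nhds hz.1)) (contMDiffAt_iff_contDiffAt.2 contDiffAt_fst)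
  have h2 : ContMDiffAt 𝓘(ℝ, EuclideanSpace ℝ (Fin d) × (𝔼 × F)) ((𝓡 n).prod 𝓘(ℝ, F)) ∞
      (fun p : EuclideanSpace ℝ (Fin d) × (𝔼 × F) => ofCoord (E := E) q p.2) z :=
    ContMDiffAt.comp (f := Prod.snd) z ((contMDiffOn_ofCoord (F := F) q).contMDiffAt
      (((isOpen_coordDom q).prod isOpen_univ).mem_nhds hz.2))
      (contMDiffAt_iff_contDiffAt.2 contDiffAt_snd)
  have h3 := ContMDiffAt.comp z (A.smooth _) (h1.prodMk h2)
  refine ContMDiffAt.comp z ((contMDiffOn_trivialization_snd q).contMDiffAt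
    ((trivializationAt F E q).open_source.mem_nhds ?_)) h3
  rw [(trivializationAt F E q).mem_source]
  change (ofCoord (E := E) q z.2).1 ∈ _
  rw [ofCoord_proj hz.2.1]
  exact hz.2.1.2

theorem onSec_rep (g : G) (φ : Sec n F E) {q : M} {x : 𝔼} (hx : x ∈ coordDom n F E q) :
    (A.onSec g φ).rep q x = A.localAct g q (x, φ.rep q x) := by
  change _ = (trivializationAt F E q ⟨(ofCoord (E := E) q (x, φ.rep q x)).1,
    A.act g (ofCoord (E := E) q (x, φ.rep q x)).1 (ofCoord (E := E) q (x, φ.rep q x)).2⟩).2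
  rw [ofCoord_rep φ hx]
  rfl

theorem jetCoord_onSec (g : G) (φ : Sec n F E) {q : M} {x : 𝔼} (hx : x ∈ coordDom n F E q)
    (r : ℕ) : jetCoord r ((A.onSec g φ).rep q) x =
      prolong r (A.localAct g q) (x, jetCoord r (φ.rep q) x) := by
  have ho := isOpen_coordDom (n := n) (F := F) (E := E) q
  rw [← jetCoord_prolong (((A.smoothFamily_localAct q).contDiffOn g).contDiffAt
    ((ho.prod isOpen_univ).mem_nhds ⟨hx, mem_univ _⟩))
    ((contDiffOn_rep φ q).contDiffAt (ho.mem_nhds hx))]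
  refine jetCoord_congr ?_ r
  filter_upwards [ho.mem_nhds hx] with y hy using A.onSec_rep g φ hy

theorem smoothFamily_rep {V : Type*} [NormedAddCommGroup V] [NormedSpace ℝ V] {q : M} {r : ℕ}
    {L : 𝔼 × JetCoord n r F → V} (hL : ContDiffOn ℝ ∞ L (coordDom n F E q ×ˢ univ)) :
    SmoothFamily d (fun g z => L (z.1, prolong r (A.localAct g q) z))
      (coordDom n F E q ×ˢ univ) := fun g₀ => by
  have h1 := contDiffOn_prolong (r := r) (chG g₀).open_target (isOpen_coordDom q)
    (A.smoothFamily_localAct q g₀)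
  exact hL.comp ((contDiffOn_fst.comp contDiffOn_snd fun z hz => hz.2).prodMk h1)
    fun z hz => ⟨hz.2.1, mem_univ _⟩

theorem repOn_pull {V : Type*} [NormedAddCommGroup V] [NormedSpace ℝ V] {q : M} {r : ℕ}
    {B : InfJet n F E → V} {L : 𝔼 × JetCoord n r F → V}
    (hL : RepOn q B r (coordDom n F E q) L) (g : G) :
    RepOn q (fun j => B (A.onJet g j)) r (coordDom n F E q)
      fun z => L (z.1, prolong r (A.localAct g q) z) := by
  refine ⟨(A.smoothFamily_rep hL.1).contDiffOn g, fun φ x hx => ?_⟩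
  dsimp only
  rw [← A.jetCoord_onSec g φ hx, ← hL.2 (A.onSec g φ) x hx]
  rfl

theorem isHorizontal_pull {k : ℕ} {α : PreForm n F E k} (hα : IsHorizontal α) (g : G) :
    IsHorizontal (fun j => α (A.onJet g j)) := by
  obtain ⟨r, h⟩ := isHorizontal_iff_repOn.1 hα
  refine isHorizontal_iff_repOn.2 ⟨r, fun q => ?_⟩
  obtain ⟨L, hL⟩ := h q
  exact ⟨_, A.repOn_pull hL g⟩

/-- The action covers the identity, so composing with `jψ_g` amounts to computing along the section
`ψ_g ∘ φ`. -/
theorem dH_pull {k : ℕ} {α : PreForm n F E k} (hα : IsHorizontal α) (g : G) :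
    dH (fun j => α (A.onJet g j)) = fun j => dH α (A.onJet g j) := by
  refine funext fun j => ?_
  induction j using InfJet.ind with
  | h φ p =>
  exact (dH_apply_self (A.isHorizontal_pull hα g) φ p).trans
    (dH_apply_self hα (A.onSec g φ) p).symm

variable [CompactSpace G] [T2Space G] [MeasurableSpace G] [BorelSpace G] {μ : Measure G}
  [IsProbabilityMeasure μ]

theorem integrable_pull {k : ℕ} {α : PreForm n F E k} (hα : IsHorizontal α) (j : InfJet n F E) :
    Integrable (fun g => α (A.onJet g j)) μ := by
  induction j using InfJet.ind with
  | h φ p =>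
  obtain ⟨r, h⟩ := isHorizontal_iff_repOn.1 hα
  obtain ⟨L, hL⟩ := h p
  have hx := chart_mem_coordDom (mem_dom_self (n := n) (F := F) (E := E) p)
  refine ((A.smoothFamily_rep hL.1).integrable (μ := μ) ((isOpen_coordDom p).prod isOpen_univ)
    (z := (cht p p, jetCoord r (φ.rep p) (cht p p))) ⟨hx, mem_univ _⟩).congr
      (Filter.Eventually.of_forall fun g => ?_)
  have h1 := (A.repOn_pull hL g).2 φ _ hx
  rw [(cht p).left_inv (mem_chart_source _ p)] at h1
  exact h1.symm.trans (toChart_self p _)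

/-- The representatives of the pulled-back forms are one smooth family over the compact group, of
the same order `r` for all `g`, so their integral is smooth of order `r`. -/
theorem isHorizontal_average {k : ℕ} {β : PreForm n F E k} (hβ : IsHorizontal β) :
    IsHorizontal (A.average μ β) := by
  obtain ⟨r, h⟩ := isHorizontal_iff_repOn.1 hβ
  refine isHorizontal_iff_repOn.2 ⟨r, fun q => ?_⟩
  obtain ⟨L, hL⟩ := h q
  refine ⟨fun z => ∫ g, L (z.1, prolong r (A.localAct g q) z) ∂μ,
    (A.smoothFamily_rep hL.1).contDiffOn_integral ((isOpen_coordDom q).prod isOpen_univ),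
    fun φ x hx => ?_⟩
  refine ((toChartL k q ((cht q).symm x)).integral_comp_comm (μ := μ)
    (A.integrable_pull hβ (φ.jet ((cht q).symm x)))).symm.trans ?_
  exact integral_congr_ae (Filter.Eventually.of_forall fun g => (A.repOn_pull hL g).2 φ x hx)

/-- Differentiation under the integral over the compact group; the alternatization in the exterior
derivative is continuous and linear and commutes with the integral. -/
theorem dH_average {k : ℕ} {β : PreForm n F E k} (hβ : IsHorizontal β) :
    dH (A.average μ β) = A.average μ (dH β) := by
  refine funext fun j => ?_
  induction j using InfJet.ind with
  | h φ p =>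
  obtain ⟨r, h⟩ := isHorizontal_iff_repOn.1 hβ
  obtain ⟨L, hL⟩ := h p
  have hx := chart_mem_coordDom (mem_dom_self (n := n) (F := F) (E := E) p)
  have hU := isOpen_coordDom (n := n) (F := F) (E := E) p
  have hfam := (A.smoothFamily_rep hL.1).comp (contDiffOn_id_jetCoord hU (contDiffOn_rep φ p) r)
    fun x hx => ⟨hx, mem_univ _⟩
  have e1 : (fun x => comp p (A.average μ β) (φ.jet ((cht p).symm x))) =ᶠ[𝓝 (cht p p)]
      fun x => ∫ g, L (x, prolong r (A.localAct g p) (x, jetCoord r (φ.rep p) x)) ∂μ := by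
    filter_upwards [hU.mem_nhds hx] with x hx
    refine ((toChartL k p ((cht p).symm x)).integral_comp_comm (μ := μ)
      (A.integrable_pull hβ (φ.jet ((cht p).symm x)))).symm.trans ?_
    exact integral_congr_ae (Filter.Eventually.of_forall fun g => (A.repOn_pull hL g).2 φ x hx)
  refine (dH_apply_self (A.isHorizontal_average hβ) φ p).trans (e1.extDeriv_eq.trans ?_)
  have e2 : ∀ g, extDeriv (fun x => L (x, prolong r (A.localAct g p) (x, jetCoord r (φ.rep p) x)))
      (cht p p) = dH β (A.onJet g (φ.jet p)) := fun g => by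
    refine Eq.trans ?_ (dH_apply_self hβ (A.onSec g φ) p).symm
    refine Filter.EventuallyEq.extDeriv_eq ?_
    filter_upwards [hU.mem_nhds hx] with x hx using ((A.repOn_pull hL g).2 φ x hx).symm
  change _ = ∫ g, dH β (A.onJet g (φ.jet p)) ∂μ
  simp only [← e2, extDeriv]
  rw [(hfam.hasFDerivAt_integral hU hx).fderiv]
  exact ((ContinuousAlternatingMap.alternatizeUncurryFinCLM (𝕜 := ℝ) (E := 𝔼) (F := ℝ)
    (n := k)).integral_comp_comm (hfam.integrable_fderiv (μ := μ) hU hx)).symm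

theorem average_of_invariant {k : ℕ} {α : PreForm n F E k} (hα : A.IsInvariant α) :
    A.average μ α = α := funext fun j => by
  change ∫ g, α (A.onJet g j) ∂μ = α j
  simp only [hα _ j]
  exact (integral_const _).trans (by simp)

/-- For a left action, invariance of the average requires right invariance of the measure. A right
translate of `μ` is again a Haar probability measure on the compact group, hence equal to `μ` by
uniqueness. -/
theorem isInvariant_average [μ.IsHaarMeasure] {k : ℕ} (β : PreForm n F E k) :
    A.IsInvariant (A.average μ β) := fun h j => by
  have : IsTopologicalGroup G := topologicalGroup_of_lieGroup (G := G) (𝓡 d) ∞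
  have hm : Measurable fun g : G => g * h := (continuous_mul_const h).measurable
  have e : μ.map (fun g => g * h) = μ := by
    have : IsProbabilityMeasure (μ.map fun g => g * h) :=
      Measure.isProbabilityMeasure_map hm.aemeasurable
    have : (μ.map fun g => g * h).IsHaarMeasure :=
      { lt_top_of_isCompact := fun K _ => measure_lt_top _ K
        open_pos := fun U hU hne => by
          rw [Measure.map_apply hm hU.measurableSet]
          obtain ⟨u, hu⟩ := hne
          exact (hU.preimage (continuous_mul_const h)).measure_ne_zero μ
            ⟨u * h⁻¹, by simpa using hu⟩ }
    exact Measure.isHaarMeasure_eq_of_isProbabilityMeasure _ _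
  change ∫ g, β (A.onJet g (A.onJet h j)) ∂μ = ∫ g, β (A.onJet g j) ∂μ
  simp only [← A.onJet_mul]
  conv_rhs => rw [← e]
  exact (integral_map_equiv (MeasurableEquiv.mulRight h) fun g => β (A.onJet g j)).symm

end FibreAction

/-! ## Invariant forms -/

theorem dH_eq_zero_of_eventually {k : ℕ} {α : PreForm n F E k} (hα : IsHorizontal α)
    {φ : Sec n F E} {p : M} (h : ∀ᶠ p' in 𝓝 p, α (φ.jet p') = 0) : dH α (φ.jet p) = 0 :=
  (dH_congr hα IsHorizontal.zero φ φ h).trans (by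
    have h0 : dH (0 : PreForm n F E k) = 0 := by
      have := dH_smul (n := n) (F := F) (E := E) (k := k) IsHorizontal.zero 0
      rwa [zero_smul, zero_smul] at this
    exact congrFun h0 _)

/-- `dH` is local, so supports do not grow. In degree `n` the Euler condition is automatic because
the Euler form of an exact form vanishes. -/
theorem IsOmegaC.dH {k : ℕ} {α : PreForm n F E k} (hα : IsOmegaC α) : IsOmegaC (dH α) where
  horizontal := hα.horizontal.dH
  compact φ := by
    obtain ⟨K, hK, h⟩ := hα.compact φ
    refine ⟨K, hK, fun p hp => dH_eq_zero_of_eventually hα.horizontal ?_⟩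
    filter_upwards [hK.isClosed.isOpen_compl.mem_nhds hp] with p' hp' using h p' hp'
  compact_euler h φ := by
    subst h
    exact ⟨∅, isCompact_empty, fun p _ => congrFun (euler_dH hα.horizontal) (φ.1.jet p)⟩

namespace FibreAction

variable (A : FibreAction n F E d G)

theorem act_zero_eq_zero_iff (g : G) (p : M) :
    A.act g p 0 = 0 ↔ A.localAct g p (cht p p, 0) = 0 := by
  have hx := chart_mem_coordDom (mem_dom_self (n := n) (F := F) (E := E) p)
  have h1 := rep_eq_zero_iff (A.onSec g 0) hx
  rw [A.onSec_rep g 0 hx, rep_zero hx, (cht p).left_inv (mem_chart_source _ p)] at h1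
  exact h1.symm

/-- The images of the zero section have a common compact support. -/
theorem exists_compact_act_zero [CompactSpace G] [T2Space G] [SecondCountableTopology M] :
    ∃ K : Set M, IsCompact K ∧ ∀ g, ∀ p ∉ K, A.act g p 0 = 0 := by
  have := ChartedSpace.locallyCompactSpace 𝔼 M
  have : IsTopologicalGroup G := topologicalGroup_of_lieGroup (G := G) (𝓡 d) ∞
  let K : CompactExhaustion M := CompactExhaustion.choice M
  -- The group elements that fix the zero section off `K i`. Each `S i` is a closed subgroup, and
  -- together they exhaust the group, since each `ψ_g` preserves compact supports.
  let S : ℕ → Set G := fun i => {g | ∀ p ∉ K i, A.act g p 0 = 0}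
  have hmono : Monotone S := fun i j hij g hg p hp => hg p fun h => hp (K.subset hij h)
  have hmul : ∀ i g h, g ∈ S i → h ∈ S i → g * h ∈ S i := fun i g h hg hh p hp => by
    rw [A.act_mul, hh p hp, hg p hp]
  have hinv : ∀ i g, g ∈ S i → g⁻¹ ∈ S i := fun i g hg p hp => by
    rw [← hg p hp, ← A.act_mul, inv_mul_cancel, A.act_one, hg p hp]
  have hcl : ∀ i, IsClosed (S i) := fun i => by
    have : S i = ⋂ p : M, ⋂ _ : p ∉ K i, (fun g => A.localAct g p (cht p p, 0)) ⁻¹' {0} := by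
      ext g
      simp only [S, mem_setOf_eq, mem_iInter, mem_preimage, mem_singleton_iff,
        A.act_zero_eq_zero_iff]
    rw [this]
    refine isClosed_iInter fun p => isClosed_iInter fun _ => IsClosed.preimage
      ((A.smoothFamily_localAct p).continuous_left ((isOpen_coordDom p).prod isOpen_univ)
        ⟨chart_mem_coordDom (mem_dom_self p), mem_univ _⟩) isClosed_singleton
  have hun : ⋃ i, S i = univ := eq_univ_of_forall fun g => by
    obtain ⟨i, hi⟩ := K.exists_superset_of_isCompact (A.compact g (0 : Sec n F E)
      (Sec.CompactSupport.of_forall_notMem isCompact_empty fun _ _ => rfl))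
    refine mem_iUnion.2 ⟨i, fun p hp => ?_⟩
    by_contra h
    exact hp (hi (subset_closure h))
  -- Baire category: one of these subgroups has interior points.
  obtain ⟨i₀, g₀, hg₀⟩ := nonempty_interior_of_iUnion_of_closed hcl hun
  have hg₀' := interior_subset hg₀
  -- Translating that interior by `g g₀⁻¹` places each `g` in the interior of a later subgroup. By
  -- compactness one of the directed open sets is the whole group.
  obtain ⟨i, hi⟩ := isCompact_univ.elim_directed_cover (fun i => interior (S i))
    (fun i => isOpen_interior) (fun g _ => by
      obtain ⟨j, hj⟩ := mem_iUnion.1 (hun.symm ▸ mem_univ g : g ∈ ⋃ i, S i)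
      have hi := hmono (le_max_left i₀ j)
      refine mem_iUnion.2 ⟨max i₀ j, mem_interior.2 ⟨(fun h => g₀ * g⁻¹ * h) ⁻¹' interior (S i₀),
        fun h hh => ?_, isOpen_interior.preimage (continuous_const_mul _), by
          simpa using hg₀⟩⟩
      have h1 := hmul _ _ _ (hmul _ _ _ (hmono (le_max_right i₀ j) hj) (hinv _ _ (hi hg₀')))
        (hi (interior_subset hh))
      simpa [mul_assoc] using h1)
    (Monotone.directed_le fun i j hij => interior_mono (hmono hij))
  exact ⟨K i, K.isCompact i, fun g p hp => interior_subset (hi (mem_univ g)) p hp⟩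

section Average

variable [CompactSpace G] [T2Space G] [MeasurableSpace G] [BorelSpace G] {μ : Measure G}
  [IsProbabilityMeasure μ] [SecondCountableTopology M]

/-- Off a compact set that is independent of `g`, the section `ψ_g ∘ φ` has the jet of the zero
section, on which `β` has compact support. The restriction `k ≠ n` makes the condition on Euler
forms void. -/
theorem isOmegaC_average {k : ℕ} (hk : k ≠ n) {β : PreForm n F E k} (hβ : IsOmegaC β) :
    IsOmegaC (A.average μ β) where
  horizontal := A.isHorizontal_average hβ.horizontal
  compact φ := by
    obtain ⟨K, hK, h0⟩ := A.exists_compact_act_zero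
    let z : SecC n F E :=
      ⟨0, Sec.CompactSupport.of_forall_notMem isCompact_empty fun _ _ => rfl⟩
    obtain ⟨K', hK', h⟩ := hβ.compact z
    refine ⟨K ∪ K' ∪ closure {p | φ.1 p ≠ 0}, (hK.union hK').union φ.2, fun p hp => ?_⟩
    simp only [mem_union, not_or] at hp
    have e : ∀ g, A.onJet g (φ.1.jet p) = z.1.jet p := fun g => by
      refine jet_eq_of_eventuallyEq (φ := A.onSec g φ.1) ?_
      filter_upwards [hK.isClosed.isOpen_compl.mem_nhds hp.1.1,
        isClosed_closure.isOpen_compl.mem_nhds hp.2] with p' h1 h2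
      have h3 : φ.1 p' = 0 := by
        by_contra hne
        exact h2 (subset_closure hne)
      change A.act g p' (φ.1 p') = 0
      rw [h3, h0 g p' h1]
    change ∫ g, β (A.onJet g (φ.1.jet p)) ∂μ = 0
    refine (integral_congr_ae (g := fun _ => (0 : Cov n k)) (Filter.Eventually.of_forall
      fun g => ?_)).trans (integral_zero _ _)
    exact (congrArg (fun j => β j) (e g)).trans (h p hp.1.2)
  compact_euler h := absurd h hk

theorem isOmegaG_average [μ.IsHaarMeasure] {k : ℕ} (hk : k ≠ n) {β : PreForm n F E k}
    (hβ : IsOmegaC β) : A.IsOmegaG (A.average μ β) :=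
  ⟨A.isOmegaC_average hk hβ, A.isInvariant_average β⟩

theorem dH_average_of_invariant {k : ℕ} {β : PreForm n F E k} (hβ : IsOmegaC β)
    (h : A.IsInvariant (dH β)) : dH (A.average μ β) = dH β := by
  rw [A.dH_average hβ.horizontal, A.average_of_invariant h]

end Average

theorem IsInvariant.dH {A : FibreAction n F E d G} {k : ℕ} {α : PreForm n F E k}
    (hα : A.IsInvariant α) (hh : IsHorizontal α) : A.IsInvariant (dH α) := fun g j => by
  have h1 := congrFun (A.dH_pull hh g) j
  have h2 : (fun j => α (A.onJet g j)) = α := funext fun j => hα g j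
  rw [h2] at h1
  exact h1.symm

/-- The linearization of `ψ_g` along the fibre at `φ p`. -/
def vert (g : G) (φ : Sec n F E) (p : M) : E p →ₗ[ℝ] E p :=
  ((trivializationAt F E p).symmₗ ℝ p).comp
    (((fderiv ℝ (A.localAct g p) (cht p p, φ.rep p (cht p p))).comp
      (ContinuousLinearMap.inr ℝ 𝔼 F) : F →ₗ[ℝ] F).comp
        ((trivializationAt F E p).linearMapAt ℝ p))

/-- Naturality of the Euler expression with the identity on the base, so with determinant one, and
`Ψ` the coordinate expression of `ψ_g`. A nonlinear action enters only through its vertical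
linearization. -/
theorem euler_pull {α : PreForm n F E n} (hα : IsHorizontal α) (g : G) (φ : Sec n F E) (p : M) :
    euler (fun j => α (A.onJet g j)) (φ.jet p) =
      (euler α ((A.onSec g φ).jet p)).comp (A.vert g φ p) := by
  obtain ⟨r, h⟩ := isHorizontal_iff_repOn.1 hα
  obtain ⟨L, hL⟩ := h p
  have hU := isOpen_coordDom (n := n) (F := F) (E := E) p
  have hx := chart_mem_coordDom (mem_dom_self (n := n) (F := F) (E := E) p)
  have hrep := A.repOn_pull hL g
  have hΨ := (A.smoothFamily_localAct p).contDiffOn g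
  have hpb := mem_baseSet_trivializationAt F E p
  refine source_ext_self (n := n) (F := F) fun v => ?_
  have e1 := euler_eq_of_repOn (A.isHorizontal_pull hα g) hU subset_rfl hrep φ hx v
  have e2 : A.vert g φ p ((trivializationAt F E p).symmₗ ℝ p v) =
      (trivializationAt F E p).symmₗ ℝ p
        (fderiv ℝ (A.localAct g p) (cht p p, φ.rep p (cht p p)) (0, v)) := by
    simp only [vert, LinearMap.comp_apply, (trivializationAt F E p).linearMapAt_symmₗ hpb v]
    rfl
  have e3 := euler_eq_of_repOn hα hU subset_rfl hL (A.onSec g φ) hx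
    (fderiv ℝ (A.localAct g p) (cht p p, φ.rep p (cht p p)) (0, v))
  rw [← e2] at e3
  refine e1.trans (Eq.trans ?_ e3.symm)
  have h2 : (ContinuousLinearMap.id ℝ 𝔼).det = 1 := by simp [ContinuousLinearMap.det]
  have h1 := eulerExpr_naturality hU hU (κ := id) (κ' := id) contDiffOn_id contDiffOn_id
    (mapsTo_id _) (mapsTo_id _) (fun _ _ => rfl) (fun _ _ => rfl) hΨ hrep.1 hL.1
    (fun f hf x hx => by
      rw [fderiv_id, h2, one_smul]
      simp only [id]
      rw [jetCoord_prolong (hΨ.contDiffAt ((hU.prod isOpen_univ).mem_nhds ⟨hx, mem_univ _⟩))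
        (hf.contDiffAt (hU.mem_nhds hx))]) (contDiffOn_rep φ p) hx v
  refine h1.trans ?_
  rw [fderiv_id, h2, one_smul]
  refine eulerExpr_congr_field ?_ _
  filter_upwards [hU.mem_nhds hx] with y hy using (A.onSec_rep g φ hy).symm

theorem isOmegaC_pull {α : PreForm n F E n} (hα : IsOmegaC α) (g : G) :
    IsOmegaC (fun j => α (A.onJet g j)) where
  horizontal := A.isHorizontal_pull hα.horizontal g
  compact φ := hα.compact (A.onSecC g φ)
  compact_euler _ φ := by
    obtain ⟨K, hK, h⟩ := hα.compact_euler rfl (A.onSecC g φ)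
    refine ⟨K, hK, fun p hp => (A.euler_pull hα.horizontal g φ.1 p).trans ?_⟩
    exact (congrArg (fun T : E p →ₗ[ℝ] Cov n n => T.comp (A.vert g φ.1 p)) (h p hp)).trans
      (LinearMap.zero_comp _)

end FibreAction

/-! ## Invariance of the bracket -/

theorem contDiffOn_smul_const {V W : Type*} [NormedAddCommGroup V] [NormedSpace ℝ V]
    [NormedAddCommGroup W] [NormedSpace ℝ W] {U : Set W} {c : W → ℝ} (hc : ContDiffOn ℝ ∞ c U)
    (v : V) : ContDiffOn ℝ ∞ (fun x => c x • v) U :=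
  hc.smul contDiffOn_const

/-- A Lagrangian of order zero needs no integration by parts, and the derivative of a linear one is
the linear map itself. -/
theorem eulerExpr_linear {V : Type*} [NormedAddCommGroup V] [NormedSpace ℝ V] {U : Set 𝔼}
    (hU : IsOpen U) {T : 𝔼 → F →L[ℝ] V} (hT : ContDiffOn ℝ ∞ T U) (f : 𝔼 → F) {x : 𝔼}
    (hx : x ∈ U) (v : F) :
    eulerExpr (fun z : 𝔼 × JetCoord n 0 F => T z.1 (z.2 0 0)) f x v = T x v := by
  set S : JetCoord n 0 F →L[ℝ] F :=
    (ContinuousMultilinearMap.apply ℝ (fun _ : Fin 0 => 𝔼) F 0).comp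
      (ContinuousLinearMap.proj (R := ℝ) (φ := fun k : Fin 1 => 𝔼 [×(k : ℕ)]→L[ℝ] F) 0) with hS
  have hd : DifferentiableAt ℝ (fun z : 𝔼 × JetCoord n 0 F => T z.1 (S z.2))
      (x, jetCoord 0 f x) :=
    ((((hT.contDiffAt (hU.mem_nhds hx)).differentiableAt (by simp)).comp (x, jetCoord 0 f x)
      differentiableAt_fst).clm_apply (S.differentiableAt.comp _ differentiableAt_snd))
  have h1 : fderiv ℝ (fun z : 𝔼 × JetCoord n 0 F => T z.1 (S z.2)) (x, jetCoord 0 f x)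
      (0, Pi.single 0 (elemTensor (fun i : Fin 0 => i.elim0) v)) =
      T x (S (Pi.single 0 (elemTensor (fun i : Fin 0 => i.elim0) v))) := by
    have h2 := hd.hasFDerivAt.comp (jetCoord 0 f x) (hasFDerivAt_prodMk_right x (jetCoord 0 f x))
    have h3 : HasFDerivAt ((fun z : 𝔼 × JetCoord n 0 F => T z.1 (S z.2)) ∘ fun u => (x, u))
      ((T x).comp S) (jetCoord 0 f x) := ((T x).comp S).hasFDerivAt
    exact DFunLike.congr_fun (h2.unique h3) _
  have h4 : S (Pi.single 0 (elemTensor (fun i : Fin 0 => i.elim0) v)) = v := by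
    simp [hS, elemTensor]
  rw [h4] at h1
  refine Eq.trans ?_ h1
  refine (Fin.sum_univ_one _).trans ?_
  change (-1 : ℝ) ^ 0 • ∑ i : Fin 0 → Fin n, iteratedFDeriv ℝ 0
    (fun y => fderiv ℝ (fun z : 𝔼 × JetCoord n 0 F => T z.1 (S z.2))
      (y, jetCoord 0 f y) (0, Pi.single 0 (elemTensor i v))) x
    (fun l => EuclideanSpace.single (i l) (1 : ℝ)) = _
  rw [pow_zero, one_smul]
  refine (Fintype.sum_unique _).trans ((iteratedFDeriv_zero_apply _).trans ?_)
  exact congrArg (fun i : Fin 0 → Fin n => fderiv ℝ (fun z : 𝔼 × JetCoord n 0 F => T z.1 (S z.2))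
    (x, jetCoord 0 f x) (0, Pi.single 0 (elemTensor i v))) (Subsingleton.elim _ _)

theorem cutoffSource_eq_zero {p : M} {ρ : M → ℝ} (l : F →ₗ[ℝ] ℝ) {j : InfJet n F E}
    (h : ρ j.1 = 0) : cutoffSource p ρ l j = 0 := by
  refine LinearMap.ext fun v => ?_
  let a : E j.1 →ₗ[ℝ] ℝ := l.comp ((trivializationAt F E p).linearMapAt ℝ j.1)
  change a v • (ρ j.1 • ofChart p j.1 (volCov n)) = 0
  rw [h, zero_smul, smul_zero]

theorem cutoffSource_eq_smul {p : M} (ρ : M → ℝ) {χ : M → ℝ} (l : F →ₗ[ℝ] ℝ) {j : InfJet n F E}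
    (h : χ j.1 = 1) : cutoffSource p ρ l j = ρ j.1 • cutoffSource p χ l j := by
  refine LinearMap.ext fun v => ?_
  let a : E j.1 →ₗ[ℝ] ℝ := l.comp ((trivializationAt F E p).linearMapAt ℝ j.1)
  change a v • (ρ j.1 • ofChart p j.1 (volCov n)) =
    ρ j.1 • (a v • (χ j.1 • ofChart p j.1 (volCov n)))
  rw [h, one_smul, smul_comm]

/-- A form of order zero whose Euler–Lagrange form is `ρ ℓ(θ) ∧ d^nx`. -/
theorem exists_test_form (p : M) {ρ : M → ℝ} (hρ : ContMDiff (𝓡 n) 𝓘(ℝ, ℝ) ∞ ρ)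
    (hρc : HasCompactSupport ρ) (hρp : tsupport ρ ⊆ dom (n := n) F E p) (l : F →ₗ[ℝ] ℝ) :
    ∃ α : PreForm n F E n, IsOmegaC α ∧ euler α = cutoffSource p ρ l := by
  have hU := isOpen_coordDom (n := n) (F := F) (E := E) p
  have hC : IsCompact (cht p '' tsupport ρ) := IsCompact.image_of_continuousOn hρc
    ((cht p).continuousOn.mono fun p hp => (hρp hp).1)
  have hCU : cht p '' tsupport ρ ⊆ coordDom n F E p := by
    rintro _ ⟨p', hp', rfl⟩
    exact chart_mem_coordDom (hρp hp')
  have hCK : (cht p).symm '' (cht p '' tsupport ρ) = tsupport ρ := by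
    rw [image_image]
    exact (image_congr fun p' hp => (cht p).left_inv (hρp hp).1).trans (image_id _)
  have hρU : ContDiffOn ℝ ∞ (fun x => ρ ((cht p).symm x)) (coordDom n F E p) :=
    (contDiffOn_comp_chart_symm hρ p).mono fun x hx => hx.1
  -- The test form is `ρ ℓ(u) d^nx`, linear in the fibre coordinate. Its Euler form can therefore be
  -- prescribed.
  set lT : F →L[ℝ] Cov n n := l.toContinuousLinearMap.smulRight (volCov n)
  set T : 𝔼 → F →L[ℝ] Cov n n := fun x => ρ ((cht p).symm x) • lT with hTdef
  have hT : ContDiffOn ℝ ∞ T (coordDom n F E p) := contDiffOn_smul_const hρU lT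
  have hL : ContDiffOn ℝ ∞ (fun z : 𝔼 × JetCoord n 0 F => T z.1 (z.2 0 0))
      (coordDom n F E p ×ˢ univ) := by
    refine (hT.comp contDiffOn_fst fun z hz => hz.1).clm_apply (ContDiff.contDiffOn ?_)
    exact ((ContinuousMultilinearMap.apply ℝ (fun _ : Fin 0 => 𝔼) F 0).comp
      (ContinuousLinearMap.proj (R := ℝ)
        (φ := fun k : Fin 1 => 𝔼 [×(k : ℕ)]→L[ℝ] F) 0)).contDiff.comp contDiff_snd
  have hρ0 : ∀ x ∈ coordDom n F E p, x ∉ cht p '' tsupport ρ → ρ ((cht p).symm x) = 0 :=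
    fun x hx hxC => image_eq_zero_of_notMem_tsupport fun h =>
      hxC ⟨_, h, (cht p).right_inv hx.1⟩
  obtain ⟨α, hα, hrep, hoff⟩ := exists_form_of_chart (E := E) hU subset_rfl hC hCU hL
    fun φ x hx hxC => by
      change ρ ((cht p).symm x) • lT _ = 0
      rw [hρ0 x hx hxC, zero_smul]
  rw [hCK] at hoff
  have hoffe : ∀ (φ : Sec n F E), ∀ p' ∉ tsupport ρ, euler α (φ.jet p') = 0 := fun φ p' hp' => by
    refine (euler_congr hα.isHorizontal IsHorizontal.zero ?_ φ).trans (by rw [euler_zero]; rfl)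
    filter_upwards [(isClosed_tsupport ρ).isOpen_compl.mem_nhds hp'] with p'' hp'' ψ
    exact hoff (ψ.jet p'') hp''
  refine ⟨α, ⟨hα.isHorizontal, fun φ => ⟨_, hρc, fun p' hp' => hoff (φ.1.jet p') hp'⟩,
    fun _ φ => ⟨_, hρc, fun p' hp' => hoffe φ.1 p' hp'⟩⟩, funext fun j => ?_⟩
  induction j using InfJet.ind with
  | h φ p' =>
  by_cases hp' : p' ∈ tsupport ρ
  · have hd := hρp hp'
    refine source_ext (n := n) (F := F) (p := p') hd fun v => ?_
    refine Eq.trans ?_ (cutoffSource_apply (j := φ.jet p') hd v).symm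
    have h1 := toChart_euler hα.isHorizontal hU subset_rfl hrep φ (chart_mem_coordDom hd) v
    rw [eulerExpr_linear hU hT _ (chart_mem_coordDom hd), (cht p).left_inv hd.1] at h1
    refine h1.trans ?_
    simp only [hTdef, (cht p).left_inv hd.1]
    rw [mul_comm, mul_smul]
    rfl
  · exact (hoffe φ p' hp').trans
      (cutoffSource_eq_zero l (j := φ.jet p') (image_eq_zero_of_notMem_tsupport hp')).symm

variable {ν : M → Cov n n} {w : Pairing n F E}
  [MeasurableSpace M] [BorelSpace M] [SecondCountableTopology M]

namespace FibreAction

variable {A : FibreAction n F E d G}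

theorem IsCanonical.functional_eq (hA : A.IsCanonical ν w) (hν : IsVolumeForm ν)
    {α β : PreForm n F E n} (hα : IsOmegaC α) (hβ : IsOmegaC β) (g : G) :
    functional ν (topBracket ν w (fun j => α (A.onJet g j)) (fun j => β (A.onJet g j))) =
      functional ν (fun j => topBracket ν w α β (A.onJet g j)) := by
  have h := hA g _ _ ⟨α, hα, rfl⟩ ⟨β, hβ, rfl⟩
  rw [poissonBracket_functional hν w hα hβ] at h
  exact (poissonBracket_functional hν w (A.isOmegaC_pull hα g)
    (A.isOmegaC_pull hβ g)).symm.trans h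

theorem topBracket_pull {α β : PreForm n F E n} (hα : IsHorizontal α) (hβ : IsHorizontal β)
    (g : G) (φ : Sec n F E) (p : M) :
    topBracket ν w (fun j => α (A.onJet g j)) (fun j => β (A.onJet g j)) (φ.jet p) =
      w (φ.jet p) ((euler α ((A.onSec g φ).jet p)).comp (A.vert g φ p))
        ((euler β ((A.onSec g φ).jet p)).comp (A.vert g φ p)) • ν p :=
  congrArg₂ (fun ξ η : E p →ₗ[ℝ] Cov n n => w (φ.jet p) ξ η • ν p)
    (A.euler_pull hα g φ p) (A.euler_pull hβ g φ p)

/-- Canonicity only equates two integrals. Using `ρ` instead of `χ` in the first test form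
multiplies the difference of the integrands by `ρ`, because `w` does not differentiate its
arguments. Hence the difference is orthogonal to all test functions and vanishes pointwise. -/
theorem IsCanonical.cutoffSource_eq (hA : A.IsCanonical ν w) (hν : IsVolumeForm ν)
    (hw : IsSkewPairing w) (g : G) (φ : SecC n F E) {p : M} {χ : M → ℝ}
    (hχ : ContMDiff (𝓡 n) 𝓘(ℝ, ℝ) ∞ χ) (hχc : HasCompactSupport χ)
    (hχp : tsupport χ ⊆ dom (n := n) F E p) (h1 : ∀ᶠ p' in 𝓝 p, χ p' = 1) (l l' : F →ₗ[ℝ] ℝ) :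
    w (φ.1.jet p) ((cutoffSource p χ l ((A.onSec g φ.1).jet p)).comp (A.vert g φ.1 p))
        ((cutoffSource p χ l' ((A.onSec g φ.1).jet p)).comp (A.vert g φ.1 p)) =
      w ((A.onSec g φ.1).jet p) (cutoffSource p χ l ((A.onSec g φ.1).jet p))
        (cutoffSource p χ l' ((A.onSec g φ.1).jet p)) := by
  obtain ⟨α, hα, hEα⟩ := exists_test_form (E := E) p hχ hχc hχp l
  obtain ⟨β, hβ, hEβ⟩ := exists_test_form (E := E) p hχ hχc hχp l'
  obtain ⟨U₁, ε, hU₁, hp₁, hU₁p, hε0, hε⟩ := hν.exists_sign (mem_chart_target _ p)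
  obtain ⟨N, hN1, hN, hpN⟩ := mem_nhds_iff.1 h1
  set U := (U₁ ∩ coordDom n F E p) ∩ ((cht p).target ∩ (cht p).symm ⁻¹' N) with hUdef
  have hU : IsOpen U := (hU₁.inter (isOpen_coordDom p)).inter ((cht p).isOpen_inter_preimage_symm hN)
  have hpx := (cht p).left_inv (mem_chart_source 𝔼 p)
  have hxU : cht p p ∈ U := ⟨⟨hp₁, chart_mem_coordDom (mem_dom_self p)⟩, mem_chart_target _ p, by
    rw [mem_preimage, hpx]; exact hpN⟩
  have hUt : U ⊆ (cht p).target := fun x hx => hx.2.1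
  set δ : PreForm n F E n := topBracket ν w (fun j => α (A.onJet g j)) (fun j => β (A.onJet g j)) -
    fun j => topBracket ν w α β (A.onJet g j) with hδ
  have hhor : ∀ {α β : PreForm n F E n}, IsOmegaC α → IsOmegaC β → IsOmegaC (topBracket ν w
      (fun j => α (A.onJet g j)) (fun j => β (A.onJet g j))) ∧
      IsOmegaC (fun j => topBracket ν w α β (A.onJet g j)) := fun hα hβ =>
    ⟨(A.isOmegaC_pull hα g).topBracket hν hw (A.isOmegaC_pull hβ g),
      A.isOmegaC_pull (hα.topBracket hν hw hβ) g⟩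
  have hδh : IsHorizontal δ := (hhor hα hβ).1.horizontal.sub (hhor hα hβ).2.horizontal
  have key : ∀ x ∈ U, frameCoord (fun p => δ (φ.1.jet p)) p x = 0 := by
    refine eqOn_zero_of_setIntegral_smul_eq_zero hU ?_ fun χ' hχ' hχ'c hχ'U => ?_
    · obtain ⟨r, hr⟩ := isHorizontal_iff_repOn.1 hδh
      obtain ⟨L, hL⟩ := hr p
      have hc := (hL.mono (U' := U) fun x hx => hx.1.2).contDiffOn hU (fun x hx => hx.1.2) φ.1
      exact (onFrameL n).continuous.comp_continuousOn hc.continuousOn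
    · obtain ⟨ρ, hρ, hρe, hρ0⟩ := exists_function_of_coord p hχ'c (hχ'U.trans hUt) hχ'
        fun y hy => image_eq_zero_of_notMem_tsupport hy
      have hK := isCompact_image_chart_symm hχ'c (hχ'U.trans hUt)
      have hρc : HasCompactSupport ρ := HasCompactSupport.intro hK hρ0
      have hρs : tsupport ρ ⊆ (cht p).symm '' tsupport χ' := closure_minimal (fun q hq => by
        by_contra h
        exact hq (hρ0 q h)) hK.isClosed
      have hρp : tsupport ρ ⊆ dom (n := n) F E p := hρs.trans (by
        rintro _ ⟨x, hx, rfl⟩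
        exact chart_symm_mem_dom (hχ'U hx).1.2)
      obtain ⟨α', hα', hEα'⟩ := exists_test_form (E := E) p hρ hρc hρp l
      set δ' : PreForm n F E n := topBracket ν w (fun j => α' (A.onJet g j))
        (fun j => β (A.onJet g j)) - fun j => topBracket ν w α' β (A.onJet g j) with hδ'
      have hδ'h : IsHorizontal δ' := (hhor hα' hβ).1.horizontal.sub (hhor hα' hβ).2.horizontal
      have hf : functional ν δ' = 0 := by
        rw [hδ', functional_sub hν (hhor hα' hβ).1.horizontal (hhor hα' hβ).2.horizontal
          (hhor hα' hβ).1.compact (hhor hα' hβ).2.compact, hA.functional_eq hν hα' hβ g, sub_self]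
      -- On the region where `χ = 1` the Euler form of `α'` is `ρ` times that of `α`, and
      -- bilinearity of `w` takes the factor out of both brackets.
      have hrel : ∀ q ∈ (cht p).symm '' U, δ' (φ.1.jet q) = ρ q • δ (φ.1.jet q) := by
        rintro _ ⟨x, hx, rfl⟩
        set q := (cht p).symm x
        have hχq : χ q = 1 := hN1 hx.2.2
        have e1 : euler α' ((A.onSec g φ.1).jet q) = ρ q • euler α ((A.onSec g φ.1).jet q) := by
          rw [hEα', hEα]
          exact cutoffSource_eq_smul ρ l (j := (A.onSec g φ.1).jet q) hχq
        have e2 := topBracket_pull (A := A) (ν := ν) (w := w) hα'.horizontal hβ.horizontal g φ.1 q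
        have e3 := topBracket_pull (A := A) (ν := ν) (w := w) hα.horizontal hβ.horizontal g φ.1 q
        have e4 : topBracket ν w α' β ((A.onSec g φ.1).jet q) =
            ρ q • topBracket ν w α β ((A.onSec g φ.1).jet q) := by
          change w _ (euler α' _) _ • ν q = ρ q • w _ (euler α _) _ • ν q
          rw [e1, map_smul, smul_smul]
          rfl
        have e5 : topBracket ν w (fun j => α' (A.onJet g j)) (fun j => β (A.onJet g j))
            (φ.1.jet q) = ρ q • topBracket ν w (fun j => α (A.onJet g j))
              (fun j => β (A.onJet g j)) (φ.1.jet q) := by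
          rw [e2, e3, e1]
          let ξ : E q →ₗ[ℝ] Cov n n := euler α ((A.onSec g φ.1).jet q)
          let η : E q →ₗ[ℝ] Cov n n := (euler β ((A.onSec g φ.1).jet q)).comp (A.vert g φ.1 q)
          let B : (E q →ₗ[ℝ] Cov n n) →ₗ[ℝ] (E q →ₗ[ℝ] Cov n n) →ₗ[ℝ] ℝ := w (φ.1.jet q)
          change B (ρ q • ξ.comp (A.vert g φ.1 q)) η • ν q =
            ρ q • B (ξ.comp (A.vert g φ.1 q)) η • ν q
          rw [map_smul, LinearMap.smul_apply, smul_assoc]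
        refine (congrArg₂ (· - ·) e5 e4).trans (smul_sub (ρ q) _ _).symm
      have h2 := integralForm_eq_chart (lam := fun p => δ' (φ.1.jet p))
        hν hχ'c (hχ'U.trans hUt) (fun y hy => hε y (hχ'U hy).1.1) (fun p' hp' => by
          have h3 : ∀ ψ : Sec n F E, euler α' (ψ.jet p') = 0 := fun ψ => by
            rw [hEα']
            exact cutoffSource_eq_zero l (j := ψ.jet p') (hρ0 p' hp')
          have e2 := topBracket_of_euler_eq_zero (ν := ν) (w := w)
            (((A.euler_pull hα'.horizontal g φ.1 p').trans (congrArg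
              (fun T : E p' →ₗ[ℝ] Cov n n => T.comp (A.vert g φ.1 p')) (h3 _))).trans
                (LinearMap.zero_comp _)) (fun j => β (A.onJet g j))
          have e3 := topBracket_of_euler_eq_zero (ν := ν) (w := w) (h3 (A.onSec g φ.1)) β
          exact (congrArg₂ (· - ·) e2 e3).trans (sub_zero 0))
        (continuous_density hν hδ'h φ.1)
      have h4 := (mul_eq_zero.1 (h2.symm.trans (congrFun hf φ))).resolve_left hε0
      refine Eq.trans (setIntegral_congr_fun hχ'c.measurableSet fun x hx => ?_) h4
      have h5 := hrel _ ⟨x, hχ'U hx, rfl⟩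
      simp only [frameCoord]
      rw [h5, hρe x (hUt (hχ'U hx))]
      exact ((congrArg onFrame (map_smul (toChartL (n := n) (k := n) p ((cht p).symm x)) (χ' x)
        (δ (φ.1.jet ((cht p).symm x))))).trans (map_smul (onFrameL n) _ _)).symm
  have h6 := key _ hxU
  simp only [frameCoord] at h6
  rw [hpx, toChart_self] at h6
  have h7 := onFrame_eq_zero_iff.1 h6
  have h8 := sub_eq_zero.1 h7
  rw [topBracket_pull (A := A) hα.horizontal hβ.horizontal, hEα, hEβ] at h8
  have h9 : topBracket ν w α β (A.onJet g (φ.1.jet p)) =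
      w ((A.onSec g φ.1).jet p) (cutoffSource p χ l ((A.onSec g φ.1).jet p))
        (cutoffSource p χ l' ((A.onSec g φ.1).jet p)) • ν p := by
    rw [← hEα, ← hEβ]
    rfl
  exact smul_left_injective ℝ (hν.ne_zero p) (h8.trans h9)

/-- Bilinear extension from the frame of cut-off forms. The result is a property of `w` alone, in
which Euler forms no longer appear. -/
theorem IsCanonical.pairing_eq (hA : A.IsCanonical ν w) (hν : IsVolumeForm ν)
    (hw : IsSkewPairing w) (g : G) (φ : SecC n F E) (p : M) (ξ η : PreSource n F E n) :
    w (φ.1.jet p) ((ξ ((A.onSec g φ.1).jet p)).comp (A.vert g φ.1 p))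
        ((η ((A.onSec g φ.1).jet p)).comp (A.vert g φ.1 p)) =
      w ((A.onSec g φ.1).jet p) (ξ ((A.onSec g φ.1).jet p)) (η ((A.onSec g φ.1).jet p)) := by
  obtain ⟨χ, hχ, hχs, hχc, hχ1⟩ := exists_cutoff (n := n) p
    ((isOpen_dom (n := n) (F := F) (E := E) p).mem_nhds (mem_dom_self p))
  set j := (A.onSec g φ.1).jet p
  set T : E p →ₗ[ℝ] E p := A.vert g φ.1 p
  let R : (E p →ₗ[ℝ] Cov n n) →ₗ[ℝ] (E p →ₗ[ℝ] Cov n n) := LinearMap.lcomp ℝ (Cov n n) T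
  let B₁ : (E p →ₗ[ℝ] Cov n n) →ₗ[ℝ] (E p →ₗ[ℝ] Cov n n) →ₗ[ℝ] ℝ :=
    (w (φ.1.jet p)).compl₁₂ R R
  let B₂ : (E p →ₗ[ℝ] Cov n n) →ₗ[ℝ] (E p →ₗ[ℝ] Cov n n) →ₗ[ℝ] ℝ := w j
  have hb : ∀ a b, B₁ (cutoffSource p χ ((Module.finBasis ℝ F).coord a) j)
      (cutoffSource p χ ((Module.finBasis ℝ F).coord b) j) =
      B₂ (cutoffSource p χ ((Module.finBasis ℝ F).coord a) j)
      (cutoffSource p χ ((Module.finBasis ℝ F).coord b) j) := fun a b =>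
    hA.cutoffSource_eq hν hw g φ hχ hχc hχs hχ1 _ _
  change B₁ (ξ j) (η j) = B₂ (ξ j) (η j)
  have eξ := eq_sum_sourceCoord ξ (j := j) (p := p) (mem_dom_self p) hχ1.self_of_nhds
  have eη := eq_sum_sourceCoord η (j := j) (p := p) (mem_dom_self p) hχ1.self_of_nhds
  let c : Fin (Module.finrank ℝ F) → (E p →ₗ[ℝ] Cov n n) := fun a =>
    cutoffSource p χ ((Module.finBasis ℝ F).coord a) j
  have hb' : ∀ a b, B₁ (c a) (c b) = B₂ (c a) (c b) := hb
  have h : ∀ s t : Fin (Module.finrank ℝ F) → ℝ,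
      B₁ (∑ a, s a • c a) (∑ a, t a • c a) = B₂ (∑ a, s a • c a) (∑ a, t a • c a) := fun s t => by
    simp only [map_sum, LinearMap.sum_apply, map_smul, LinearMap.smul_apply, hb']
  exact ((congrArg₂ (fun ξ η => B₁ ξ η) eξ eη).trans (h (fun a => sourceCoord p ξ a j)
    fun a => sourceCoord p η a j)).trans (congrArg₂ (fun ξ η => B₂ ξ η) eξ eη).symm

theorem IsCanonical.isInvariant_topBracket (hA : A.IsCanonical ν w) (hν : IsVolumeForm ν)
    (hw : IsSkewPairing w) {α β : PreForm n F E n} (hα : IsHorizontal α) (hβ : IsHorizontal β)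
    (hαi : A.IsInvariant α) (hβi : A.IsInvariant β) : A.IsInvariant (topBracket ν w α β) :=
  fun g j => by
  obtain ⟨φ, p, rfl⟩ := exists_secC_jet_eq j
  have h1 := topBracket_pull (A := A) (ν := ν) (w := w) hα hβ g φ.1 p
  have eα : (fun j => α (A.onJet g j)) = α := funext fun j => hαi g j
  have eβ : (fun j => β (A.onJet g j)) = β := funext fun j => hβi g j
  rw [eα, eβ, hA.pairing_eq hν hw g φ p] at h1
  exact h1.symm

theorem IsOmegaG.topBracket (hA : A.IsCanonical ν w) (hν : IsVolumeForm ν)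
    (hw : IsSkewPairing w) {α β : PreForm n F E n} (hα : A.IsOmegaG α) (hβ : A.IsOmegaG β) :
    A.IsOmegaG (topBracket ν w α β) :=
  ⟨hα.1.topBracket hν hw hβ.1, hA.isInvariant_topBracket hν hw hα.1.horizontal hβ.1.horizontal
    hα.2 hβ.2⟩

end FibreAction

end Pull

/-! ## An sh-Lie structure from a bracket that satisfies the Jacobi identity up to boundaries -/

section ShLie

variable {V : Type*} [AddCommGroup V] [Module ℝ V]

theorem koszulSign_eq_one {k : ℕ} {d : Fin k → ℤ} (h : ∀ a, d a = 0) (σ : Equiv.Perm (Fin k)) :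
    koszulSign d σ = 1 :=
  Finset.prod_eq_one fun a _ => Finset.prod_eq_one fun b _ => by simp [h]

theorem eq_zero_of_eq_neg {v : V} (h : v = -v) : v = 0 := by
  have h1 : (2 : ℝ) • v = 0 := by rw [two_smul]; nth_rewrite 2 [h]; exact add_neg_cancel v
  exact (smul_eq_zero.1 h1).resolve_left two_ne_zero

theorem fin_three_cases (i : Fin 3) : i = 0 ∨ i = 1 ∨ i = 2 := by
  fin_cases i <;> simp

/-- The Jacobiator of a bilinear map. -/
def jacobiator (b : V →ₗ[ℝ] V →ₗ[ℝ] V) (x y z : V) : V :=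
  b (b x y) z + b (b y z) x + b (b z x) y

/-- A skew bilinear map as an alternating map. -/
def altTwo (b : V →ₗ[ℝ] V →ₗ[ℝ] V) (hb : ∀ x y, b x y = -b y x) : V [⋀^Fin 2]→ₗ[ℝ] V where
  toFun x := b (x 0) (x 1)
  map_update_add' x i u v := by fin_cases i <;> simp
  map_update_smul' x i c u := by fin_cases i <;> simp
  map_eq_zero_of_eq' x i j h hij := by
    have h0 : ∀ u, b u u = 0 := fun u => eq_zero_of_eq_neg (hb u u)
    fin_cases i <;> fin_cases j <;> clear hb <;> simp_all

/-- The Jacobiator of a skew bilinear map as an alternating map. -/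
def altJacobiator (b : V →ₗ[ℝ] V →ₗ[ℝ] V) (hb : ∀ x y, b x y = -b y x) :
    V [⋀^Fin 3]→ₗ[ℝ] V where
  toFun x := jacobiator b (x 0) (x 1) (x 2)
  map_update_add' x i u v := by
    rename_i inst
    obtain rfl : inst = instDecidableEqFin 3 := Subsingleton.elim _ _
    obtain rfl | rfl | rfl := fin_three_cases i <;> simp [jacobiator] <;> abel
  map_update_smul' x i c u := by
    rename_i inst
    obtain rfl : inst = instDecidableEqFin 3 := Subsingleton.elim _ _
    obtain rfl | rfl | rfl := fin_three_cases i <;> simp [jacobiator]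
  map_eq_zero_of_eq' x i j h hij := by
    have h0 : ∀ u, b u u = 0 := fun u => eq_zero_of_eq_neg (hb u u)
    have h1 : ∀ u v, b (b u v) u + b (b v u) u = 0 := fun u v => by rw [hb v u]; simp
    have h2 : ∀ u v, b (b v u) u + b (b u v) u = 0 := fun u v => by rw [hb v u]; simp
    clear hb
    obtain rfl | rfl | rfl := fin_three_cases i <;> obtain rfl | rfl | rfl := fin_three_cases j <;>
      simp_all [jacobiator]

variable {X : ℤ → Submodule ℝ V}

/-- The structure maps of an sh-Lie structure with at most three inputs. -/
def shMap (δ : V →ₗ[ℝ] V) (b : V [⋀^Fin 2]→ₗ[ℝ] V) (t : V [⋀^Fin 3]→ₗ[ℝ] V) :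
    (k : ℕ) → V [⋀^Fin k]→ₗ[ℝ] V
  | 0 => 0
  | 1 => AlternatingMap.ofSubsingleton ℝ V V 0 δ
  | 2 => b
  | 3 => t
  | _ + 4 => 0

section Maps

variable {δ : V →ₗ[ℝ] V} {b : V [⋀^Fin 2]→ₗ[ℝ] V} {t : V [⋀^Fin 3]→ₗ[ℝ] V}

theorem shMap_of_four_le {k : ℕ} (hk : 4 ≤ k) : shMap δ b t k = 0 := by
  obtain ⟨k, rfl⟩ := Nat.exists_eq_add_of_le' hk
  rfl

theorem alt_eq_zero {k : ℕ} {f : V [⋀^Fin (k + 1)]→ₗ[ℝ] V} {p : V → Prop}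
    (h : ∀ x : Fin (k + 1) → V, p (x 0) → f x = 0) {x : Fin (k + 1) → V} (a : Fin (k + 1))
    (ha : p (x a)) : f x = 0 := by
  by_cases h0 : a = 0
  · exact h x (h0 ▸ ha)
  have h1 := f.map_swap x (i := 0) (j := a) (Ne.symm h0)
  rw [h _ (by simpa using ha)] at h1
  exact neg_eq_zero.1 h1.symm

theorem shMap_eq_zero {p : V → Prop} (hb : ∀ x, p (x 0) → b x = 0) (ht : ∀ x, p (x 0) → t x = 0)
    {k : ℕ} (hk : k ≠ 1) {x : Fin k → V} (a : Fin k) (ha : p (x a)) : shMap δ b t k x = 0 := by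
  match k, hk, x, a, ha with
  | 0, _, _, _, _ => rfl
  | 2, _, x, a, ha => exact alt_eq_zero hb a ha
  | 3, _, x, a, ha => exact alt_eq_zero ht a ha
  | _ + 4, _, _, _, _ => rfl

/-- Here `p` stands for "killed by the brackets"; it holds for boundaries and for values of `t`. The
compositions of an inner map with `r` inputs and an outer one with `q + 1` that are left over are
`l₂ l₂`, `l₃ l₂` and `l₁ l₃`. -/
theorem shMap_comp_eq_zero {p : V → Prop} (hb : ∀ x, p (x 0) → b x = 0)
    (ht : ∀ x, p (x 0) → t x = 0) (hδ : ∀ x, p (δ x)) (hδδ : ∀ x, δ (δ x) = 0) (htp : ∀ x, p (t x))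
    (hδb : ∀ x, δ (b x) = 0) {r q : ℕ} (h2 : ¬(r = 2 ∧ (q = 1 ∨ q = 2))) (h3 : ¬(r = 3 ∧ q = 0))
    (y : Fin r → V) (z : Fin q → V) :
    shMap δ b t (q + 1) (Matrix.vecCons (shMap δ b t r y) z) = 0 := by
  have hz : ∀ {u : V}, u = 0 → shMap δ b t (q + 1) (Matrix.vecCons u z) = 0 := fun hu =>
    (shMap δ b t (q + 1)).map_coord_zero 0 hu
  match r, y, h2, h3 with
  | 0, y, _, _ => exact hz rfl
  | 1, y, _, _ =>
    match q, z with
    | 0, z => exact hδδ _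
    | q + 1, z => exact shMap_eq_zero hb ht (by omega) 0 (hδ (y 0))
  | 2, y, h2, _ =>
    match q, z, h2 with
    | 0, z, _ => exact hδb y
    | 1, z, h2 => exact absurd ⟨rfl, Or.inl rfl⟩ h2
    | 2, z, h2 => exact absurd ⟨rfl, Or.inr rfl⟩ h2
    | q + 3, z, _ => rfl
  | 3, y, _, h3 =>
    match q, z, h3 with
    | 0, z, h3 => exact absurd ⟨rfl, rfl⟩ h3
    | q + 1, z, _ => exact shMap_eq_zero hb ht (by omega) 0 (htp y)
  | r + 4, y, _, _ => exact hz rfl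

/-- An input killed by the brackets annihilates the inner map if it is fed there, since `r ≠ 1`, and
otherwise the outer map, which then has at least two inputs. -/
theorem shMap_comp_eq_zero_of_mem {p : V → Prop} (hb : ∀ x, p (x 0) → b x = 0)
    (ht : ∀ x, p (x 0) → t x = 0) {r q : ℕ} (hr : r ≠ 1) (y : Fin r → V) (z : Fin q → V)
    (h : (∃ a, p (y a)) ∨ ∃ a, p (z a)) :
    shMap δ b t (q + 1) (Matrix.vecCons (shMap δ b t r y) z) = 0 := by
  obtain ⟨a, ha⟩ | ⟨a, ha⟩ := h
  · exact (shMap δ b t (q + 1)).map_coord_zero 0 (shMap_eq_zero hb ht hr a ha)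
  · have := a.2
    exact shMap_eq_zero hb ht (by omega) a.succ ha

end Maps

instance {N p : ℕ} (σ : Equiv.Perm (Fin N)) : Decidable (IsUnshuffle p σ) :=
  inferInstanceAs (Decidable (∀ a b : Fin N, a < b → ((b : ℕ) < p ∨ p ≤ (a : ℕ)) → σ a < σ b))

theorem filter_isUnshuffle_three :
    (Finset.univ.filter fun σ : Equiv.Perm (Fin 3) => IsUnshuffle 2 σ) =
      {1, ⟨![0, 2, 1], ![0, 2, 1], by decide, by decide⟩,
        ⟨![1, 2, 0], ![2, 0, 1], by decide, by decide⟩} := by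
  decide

theorem filter_isUnshuffle_four :
    (Finset.univ.filter fun σ : Equiv.Perm (Fin 4) => IsUnshuffle 2 σ) =
      {1, ⟨![0, 2, 1, 3], ![0, 2, 1, 3], by decide, by decide⟩,
        ⟨![0, 3, 1, 2], ![0, 2, 3, 1], by decide, by decide⟩,
        ⟨![1, 2, 0, 3], ![2, 0, 1, 3], by decide, by decide⟩,
        ⟨![1, 3, 0, 2], ![2, 0, 3, 1], by decide, by decide⟩,
        ⟨![2, 3, 0, 1], ![2, 3, 0, 1], by decide, by decide⟩} := by
  decide

theorem sum_unshuffle_bracket {b : V →ₗ[ℝ] V →ₗ[ℝ] V} (hb : ∀ x y, b x y = -b y x)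
    (x : Fin 3 → V) :
    ∑ σ : Equiv.Perm (Fin 3) with IsUnshuffle 2 σ, ((Equiv.Perm.sign σ : ℤˣ) : ℤ) •
      b (b (x (σ 0)) (x (σ 1))) (x (σ 2)) = jacobiator b (x 0) (x 1) (x 2) := by
  rw [filter_isUnshuffle_three, Finset.sum_insert (by decide), Finset.sum_insert (by decide),
    Finset.sum_singleton, show Equiv.Perm.sign (⟨![0, 2, 1], ![0, 2, 1], by decide, by decide⟩ :
      Equiv.Perm (Fin 3)) = -1 by decide, show Equiv.Perm.sign (⟨![1, 2, 0], ![2, 0, 1], by decide,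
      by decide⟩ : Equiv.Perm (Fin 3)) = 1 by decide, jacobiator, hb (x 2) (x 0)]
  simp
  abel

/-- For any skew bracket this sum is an alternating combination of brackets of Jacobiators with the
remaining element, and those vanish by `hJ`. -/
theorem sum_unshuffle_jacobiator {b : V →ₗ[ℝ] V →ₗ[ℝ] V} (hb : ∀ x y, b x y = -b y x)
    (hJ : ∀ x y z u, b (jacobiator b x y z) u = 0) (x : Fin 4 → V) :
    ∑ σ : Equiv.Perm (Fin 4) with IsUnshuffle 2 σ, ((Equiv.Perm.sign σ : ℤˣ) : ℤ) •
      jacobiator b (b (x (σ 0)) (x (σ 1))) (x (σ 2)) (x (σ 3)) = 0 := by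
  rw [filter_isUnshuffle_four, Finset.sum_insert (by decide), Finset.sum_insert (by decide),
    Finset.sum_insert (by decide), Finset.sum_insert (by decide), Finset.sum_insert (by decide),
    Finset.sum_singleton,
    show Equiv.Perm.sign (⟨![0, 2, 1, 3], ![0, 2, 1, 3], by decide, by decide⟩ :
      Equiv.Perm (Fin 4)) = -1 by decide,
    show Equiv.Perm.sign (⟨![0, 3, 1, 2], ![0, 2, 3, 1], by decide, by decide⟩ :
      Equiv.Perm (Fin 4)) = 1 by decide,
    show Equiv.Perm.sign (⟨![1, 2, 0, 3], ![2, 0, 1, 3], by decide, by decide⟩ :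
      Equiv.Perm (Fin 4)) = 1 by decide,
    show Equiv.Perm.sign (⟨![1, 3, 0, 2], ![2, 0, 3, 1], by decide, by decide⟩ :
      Equiv.Perm (Fin 4)) = -1 by decide,
    show Equiv.Perm.sign (⟨![2, 3, 0, 1], ![2, 3, 0, 1], by decide, by decide⟩ :
      Equiv.Perm (Fin 4)) = 1 by decide]
  simp only [Equiv.Perm.coe_one, id_eq, Equiv.coe_fn_mk, Matrix.cons_val, Units.val_one,
    Units.val_neg, one_smul, neg_smul, Equiv.Perm.sign_one]
  generalize x 0 = x, x 1 = y, x 2 = z, x 3 = u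
  have h1 := hJ x y z u
  have h2 := hJ x y u z
  have h3 := hJ x z u y
  have h4 := hJ y z u x
  have j : ∀ a c d e, jacobiator b (b a c) d e =
      b (b (b a c) d) e + b (b d e) (b a c) - b (b (b a c) e) d := fun a c d e => by
    rw [jacobiator, hb e (b a c), map_neg, LinearMap.neg_apply, sub_eq_add_neg]
  simp only [jacobiator, map_add, LinearMap.add_apply, hb z x, hb u x, hb u y, map_neg,
    LinearMap.neg_apply] at h1 h2 h3 h4
  simp only [j]
  rw [hb (b z u) (b x y), hb (b y u) (b x z), hb (b y z) (b x u)]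
  -- The combination `b(J(x,y,z),u) - b(J(x,y,u),z) + b(J(x,z,u),y) - b(J(y,z,u),x)`, whose terms
  -- match those of the sum over unshuffles.
  have h := congrArg₂ (· + ·) (congrArg₂ (· - ·) h1 h2) (congrArg₂ (· - ·) h3 h4)
  simp only [sub_zero, add_zero] at h
  refine Eq.trans ?_ h
  abel

theorem sum_three_eq_zero {f : Fin 3 → V} {v : V} (h0 : f 0 = 0) (h1 : f 1 = v) (h2 : f 2 = -v) :
    ∑ i, f i = 0 := by
  rw [Fin.sum_univ_three, h0, h1, h2, zero_add, add_neg_cancel]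

theorem sum_four_eq_zero {f : Fin 4 → V} (h0 : f 0 = 0) (h1 : f 1 = 0) (h2 : f 2 = 0)
    (h3 : f 3 = 0) : ∑ i, f i = 0 := by
  rw [Fin.sum_univ_four, h0, h1, h2, h3, add_zero, add_zero, add_zero]

/-- A skew bracket of degree zero elements that satisfies the Jacobi identity up to boundaries
extends to an sh-Lie structure. -/
theorem exists_shLie {X : ℤ → Submodule ℝ V} {δ : V →ₗ[ℝ] V} {b : V →ₗ[ℝ] V →ₗ[ℝ] V}
    (hδX : ∀ i, ∀ x ∈ X i, δ x ∈ X (i - 1)) (hδ0 : ∀ x ∈ X 0, δ x = 0) (hδδ : ∀ x, δ (δ x) = 0)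
    (hb : ∀ x y, b x y = -b y x) (hbX : ∀ x y, b x y ∈ X 0)
    (hb0 : ∀ i, i ≠ 0 → ∀ x ∈ X i, ∀ y, b x y = 0) (hbδ : ∀ x y, b (δ x) y = 0)
    (hJ : ∀ x y z, ∃ v ∈ X 1, δ v = jacobiator b x y z) :
    ∃ S : ShLie V X, (∀ v, S.l 1 ![v] = δ v) ∧ (∀ v u, S.l 2 ![v, u] = b v u) ∧
      ∀ (k : ℕ) (d : Fin k → ℤ) (x : Fin k → V), (∀ a, x a ∈ X (d a)) → 2 ≤ k →
        (4 ≤ k ∨ ∃ a, d a ≠ 0) → S.l k x = 0 := by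
  set δ₁ : X 1 →ₗ[ℝ] V := δ.comp (X 1).subtype
  -- Primitives must depend linearly on the Jacobiator for `l₃` to be multilinear: choose a linear
  -- section of `δ` over its range on degree one, and extend it linearly to all of `V`.
  obtain ⟨s₀, hs₀⟩ := δ₁.rangeRestrict.exists_rightInverse_of_surjective δ₁.range_rangeRestrict
  obtain ⟨s₁, hs₁⟩ := LinearMap.exists_extend s₀
  set s : V →ₗ[ℝ] V := (X 1).subtype.comp s₁
  have hsX : ∀ v, s v ∈ X 1 := fun v => (s₁ v).2
  have hs : ∀ x y z, δ (s (jacobiator b x y z)) = jacobiator b x y z := fun x y z => by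
    obtain ⟨v, hv, h⟩ := hJ x y z
    have hm : jacobiator b x y z ∈ LinearMap.range δ₁ := ⟨⟨v, hv⟩, h⟩
    have h1 : s₁ (jacobiator b x y z) = s₀ ⟨_, hm⟩ := DFunLike.congr_fun hs₁ ⟨_, hm⟩
    have h2 := congrArg Subtype.val (DFunLike.congr_fun hs₀ ⟨_, hm⟩)
    change δ (s₁ (jacobiator b x y z)) = _
    rw [h1]
    exact h2
  -- Jacobiators are boundaries, and the bracket kills boundaries.
  have hbJ : ∀ x y z u, b (jacobiator b x y z) u = 0 := fun x y z u => by
    rw [← hs, hbδ]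
  set B := altTwo b hb
  -- The sign makes `l₁ l₃` cancel the Jacobiator in the identity with three inputs.
  set t : V [⋀^Fin 3]→ₗ[ℝ] V := (-s).compAlternatingMap (altJacobiator b hb)
  have htv : ∀ x, t x = -s (jacobiator b (x 0) (x 1) (x 2)) := fun x => rfl
  set p : V → Prop := fun v => ∀ y, b v y = 0
  have hpX : ∀ {i}, i ≠ 0 → ∀ {x}, x ∈ X i → p x := fun hi x hx => hb0 _ hi x hx
  have hB : ∀ x, p (x 0) → B x = 0 := fun x hx => hx _
  have ht : ∀ x, p (x 0) → t x = 0 := fun x hx => by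
    rw [htv, jacobiator, hx, hb (x 2), hx, hb _ (x 0), hx]
    simp
  have htX : ∀ x, t x ∈ X 1 := fun x => by rw [htv]; exact neg_mem (hsX _)
  have hmem : ∀ {k : ℕ} (hk : k ≠ 1) {d : Fin k → ℤ} {x : Fin k → V}, (∀ a, x a ∈ X (d a)) →
      (¬∀ a, d a = 0) → shMap δ B t k x = 0 := fun hk d x hx h => by
    obtain ⟨a, ha⟩ := not_forall.1 h
    exact shMap_eq_zero hB ht hk a (hpX ha (hx a))
  refine ⟨
    { l := fun k => (shMap δ B t k).toMultilinearMap
      l_zero := rfl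
      degree := ?_
      skew := ?_
      jacobi := ?_ }, fun v => rfl, fun v u => rfl, fun k d x hx hk h => ?_⟩
  · intro k hk d x hx
    change shMap δ B t k x ∈ _
    by_cases h : k = 1
    · subst h
      have h1 := hδX _ _ (hx 0)
      have e : (∑ a, d a) + ((1 : ℕ) : ℤ) - 2 = d 0 - 1 := by simp; ring
      rw [e]
      exact h1
    by_cases hd : ∀ a, d a = 0
    · rw [Finset.sum_eq_zero fun a _ => hd a]
      match k, hk, h, x with
      | 2, _, _, x => exact hbX _ _
      | 3, _, _, x => exact htX x
      | k + 4, _, _, x => exact zero_mem _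
    · rw [hmem h hx hd]
      exact zero_mem _
  · intro k d x hx σ
    change shMap δ B t k (x ∘ σ) = _ • shMap δ B t k x
    by_cases h : k = 1
    · subst h
      obtain rfl : σ = 1 := Subsingleton.elim _ _
      have e : koszulSign d 1 = 1 := Finset.prod_eq_one fun a _ => Finset.prod_eq_one fun b _ => by
        rw [if_neg]
        rintro ⟨h, -⟩
        exact h.ne (Subsingleton.elim _ _)
      rw [e]
      simp
    by_cases hd : ∀ a, d a = 0
    · rw [koszulSign_eq_one hd, mul_one]
      exact (shMap δ B t k).map_perm x σ
    · rw [hmem h hx hd, smul_zero]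
      exact hmem h (d := d ∘ σ) (fun a => hx (σ a)) fun h' => hd fun a => by
        simpa using h' (σ.symm a)
  · intro N d x hx
    -- The index `i` stands for an inner map with `i + 1` inputs. Terms vanish unless they are one
    -- of the three surviving compositions and all inputs have degree zero; in that case all Koszul
    -- signs are one.
    have hz : ∀ (i : Fin N) (σ : Equiv.Perm (Fin N)),
        (¬((i : ℕ) + 1 = 2 ∧ (N - ((i : ℕ) + 1) = 1 ∨ N - ((i : ℕ) + 1) = 2)) ∧
          ¬((i : ℕ) + 1 = 3 ∧ N - ((i : ℕ) + 1) = 0)) ∨ (¬∀ a, d a = 0) →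
        shMap δ B t (N - ((i : ℕ) + 1) + 1) (Matrix.vecCons
          (shMap δ B t ((i : ℕ) + 1) (fun a => x (σ ⟨a, by have := a.2; have := i.2; omega⟩)))
          (fun b : Fin (N - ((i : ℕ) + 1)) =>
            x (σ ⟨(i : ℕ) + 1 + b, by have := b.2; omega⟩))) = 0 := fun i σ h => by
      have h' := shMap_comp_eq_zero hB ht (fun x => hbδ x) hδδ
        (fun x => hpX one_ne_zero (htX x)) (fun x => hδ0 _ (hbX _ _)) (r := (i : ℕ) + 1)
        (q := N - ((i : ℕ) + 1))
      by_cases h1 : ¬((i : ℕ) + 1 = 2 ∧ (N - ((i : ℕ) + 1) = 1 ∨ N - ((i : ℕ) + 1) = 2)) ∧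
          ¬((i : ℕ) + 1 = 3 ∧ N - ((i : ℕ) + 1) = 0)
      · exact h' h1.1 h1.2 _ _
      obtain ⟨a, ha⟩ := not_forall.1 (h.resolve_left h1)
      refine shMap_comp_eq_zero_of_mem hB ht (by omega) _ _ ?_
      have hp : p (x (σ (σ.symm a))) := by
        rw [Equiv.apply_symm_apply]
        exact hpX ha (hx a)
      by_cases hlt : (σ.symm a : ℕ) < (i : ℕ) + 1
      · exact Or.inl ⟨⟨σ.symm a, hlt⟩, hp⟩
      · refine Or.inr ⟨⟨σ.symm a - ((i : ℕ) + 1), by have := (σ.symm a).2; omega⟩, ?_⟩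
        have e : (⟨(i : ℕ) + 1 + ((σ.symm a : ℕ) - ((i : ℕ) + 1)), by
            have := (σ.symm a).2; omega⟩ : Fin N) = σ.symm a := Fin.ext (by simp; omega)
        exact (congrArg (fun c => p (x (σ c))) e).mpr hp
    by_cases hd : ∀ a, d a = 0
    · simp only [koszulSign_eq_one hd]
      -- Three inputs: the term `l₂ l₂` is the Jacobiator and `l₁ l₃`, with the identity as its only
      -- unshuffle, is its negative.
      by_cases h3 : N = 3
      · subst h3
        refine sum_three_eq_zero (v := jacobiator b (x 0) (x 1) (x 2)) ?_ ?_ ?_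
        · exact Finset.sum_eq_zero fun σ _ =>
            (congrArg _ (hz 0 σ (Or.inl (by simp)))).trans (smul_zero _)
        · refine Eq.trans (Finset.sum_congr (Finset.ext fun σ => ?_) fun σ _ => ?_)
            (sum_unshuffle_bracket hb x)
          · simp only [Finset.mem_filter]
            rfl
          · exact congrArg₂ (fun (c : ℤˣ) (v : V) => (c : ℤ) • v)
              (show 1 * Equiv.Perm.sign σ * (-1) ^ 2 = Equiv.Perm.sign σ by
                rw [one_mul, neg_one_sq, mul_one]) rfl
        · refine Eq.trans (Finset.sum_congr (s₂ := {1}) (Finset.ext fun σ => ?_) fun σ _ => rfl) ?_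
          · have h := Finset.ext_iff.1 (show (Finset.univ.filter fun σ : Equiv.Perm (Fin 3) =>
              IsUnshuffle 3 σ) = {1} by decide) σ
            rw [← h]
            simp only [Finset.mem_filter]
            rfl
          · rw [Finset.sum_singleton, Equiv.Perm.sign_one]
            refine (congrArg (fun c : ℤˣ => (c : ℤ) • δ (t x))
              (show 1 * 1 * (-1) ^ 0 = (1 : ℤˣ) by simp)).trans ?_
            rw [Units.val_one, one_smul, htv, map_neg, hs]
      -- Four inputs: only `l₃ l₂` could contribute, and its sum is `-s` applied to the sum of
      -- Jacobiators that vanishes by `sum_unshuffle_jacobiator`.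
      by_cases h4 : N = 4
      · subst h4
        refine sum_four_eq_zero ?_ ?_ ?_ ?_
        · exact Finset.sum_eq_zero fun σ _ =>
            (congrArg _ (hz 0 σ (Or.inl (by simp)))).trans (smul_zero _)
        · have h := congrArg (fun v => -s v) (sum_unshuffle_jacobiator hb hbJ x)
          simp only [map_zero, neg_zero] at h
          refine Eq.trans ?_ h
          rw [map_sum, ← Finset.sum_neg_distrib]
          refine Finset.sum_congr (Finset.ext fun σ => ?_) fun σ _ => ?_
          · simp only [Finset.mem_filter]
            rfl
          · rw [map_zsmul, ← smul_neg]
            exact congrArg₂ (fun (c : ℤˣ) (v : V) => (c : ℤ) • v)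
              (show 1 * Equiv.Perm.sign σ * (-1) ^ 4 = Equiv.Perm.sign σ by
                rw [one_mul, Even.neg_one_pow (by decide), mul_one]) rfl
        · exact Finset.sum_eq_zero fun σ _ =>
            (congrArg _ (hz 2 σ (Or.inl (by simp)))).trans (smul_zero _)
        · exact Finset.sum_eq_zero fun σ _ =>
            (congrArg _ (hz 3 σ (Or.inl (by simp)))).trans (smul_zero _)
      exact Finset.sum_eq_zero fun i _ => Finset.sum_eq_zero fun σ _ =>
        (congrArg _ (hz i σ (Or.inl (by have := i.2; omega)))).trans (smul_zero _)
    · exact Finset.sum_eq_zero fun i _ => Finset.sum_eq_zero fun σ _ =>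
        (congrArg _ (hz i σ (Or.inr hd))).trans (smul_zero _)
  · obtain h | h := h
    · change shMap δ B t k x = 0
      rw [shMap_of_four_le h]
      rfl
    · exact hmem (by omega) hx (not_forall.2 h)

end ShLie

/-! ### From a complex with a bracket in top form degree to an sh-Lie structure -/

section Complex

variable {n : ℕ} {X : ℕ → Type*} [∀ k, AddCommGroup (X k)] [∀ k, Module ℝ (X k)]

/-- The differential on the total space of a complex `X 0 → X 1 → ⋯ → X n`. -/
def totalDiff (n : ℕ) (D : (k : ℕ) → X k →ₗ[ℝ] X (k + 1)) :
    ((k : Fin (n + 1)) → X (k : ℕ)) →ₗ[ℝ] ((k : Fin (n + 1)) → X (k : ℕ)) :=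
  LinearMap.pi fun k => match k with
    | ⟨0, _⟩ => 0
    | ⟨k + 1, h⟩ => (D k).comp (LinearMap.proj (⟨k, Nat.lt_of_succ_lt h⟩ : Fin (n + 1)))

/-- A skew bracket on the last piece of a complex that satisfies the Jacobi identity up to
boundaries extends to an sh-Lie structure on the complex. -/
theorem exists_shLie_complex {D : (k : ℕ) → X k →ₗ[ℝ] X (k + 1)} {B : X n →ₗ[ℝ] X n →ₗ[ℝ] X n}
    (hD : ∀ k x, D (k + 1) (D k x) = 0) (hB : ∀ x y, B x y = -B y x)
    (hBD : ∀ v y, B (totalDiff n D v (Fin.last n)) y = 0)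
    (hJ : ∀ x y z : X n, ∃ v ∈ gradedPiece (fun k : Fin (n + 1) => X (k : ℕ)) 1,
      totalDiff n D v = Pi.single (Fin.last n) (B (B x y) z + B (B y z) x + B (B z x) y)) :
    ∃ S : ShLie ((k : Fin (n + 1)) → X (k : ℕ)) (gradedPiece (fun k : Fin (n + 1) => X (k : ℕ))),
      (∀ v, S.l 1 ![v] = totalDiff n D v) ∧
      (∀ f g : X n, S.l 2 ![Pi.single (Fin.last n) f, Pi.single (Fin.last n) g] (Fin.last n) =
        B f g) ∧
      ∀ (k : ℕ) (d : Fin k → ℤ) (x : Fin k → ((k : Fin (n + 1)) → X (k : ℕ))),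
        (∀ a, x a ∈ gradedPiece (fun k : Fin (n + 1) => X (k : ℕ)) (d a)) → 2 ≤ k →
          (4 ≤ k ∨ ∃ a, d a ≠ 0) → S.l k x = 0 := by
  let V := (k : Fin (n + 1)) → X (k : ℕ)
  let pr : V →ₗ[ℝ] X n := LinearMap.proj (Fin.last n)
  let ι : X n →ₗ[ℝ] V := LinearMap.single ℝ (fun k : Fin (n + 1) => X (k : ℕ)) (Fin.last n)
  have hprι : ∀ x, pr (ι x) = x := fun x => Pi.single_eq_same _ _
  -- The bracket on the total space reads only the components of form degree `n`, that is of degree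
  -- zero, so it vanishes on elements of any other degree.
  let b : V →ₗ[ℝ] V →ₗ[ℝ] V := (B.compl₁₂ pr pr).compr₂ ι
  have hb : ∀ v w, b v w = ι (B (pr v) (pr w)) := fun v w => rfl
  have hι : ∀ x, ι x ∈ gradedPiece (fun k : Fin (n + 1) => X (k : ℕ)) 0 := fun x k hk =>
    Pi.single_eq_of_ne (M := fun k : Fin (n + 1) => X (k : ℕ)) (i := Fin.last n)
      (fun h => hk (by rw [h]; simp)) x
  refine (exists_shLie (V := V) (δ := totalDiff n D) (b := b)
    (X := gradedPiece (fun k : Fin (n + 1) => X (k : ℕ))) ?_ ?_ ?_ ?_ ?_ ?_ ?_ ?_).imp fun S h =>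
      ⟨h.1, fun f g => (congrArg pr (h.2.1 _ _)).trans ?_, h.2.2⟩
  rotate_right
  · change pr (ι (B (pr (ι f)) (pr (ι g)))) = _
    rw [hprι, hprι, hprι]
  · intro i x hx k hk
    obtain ⟨k, hk'⟩ := k
    cases k with
    | zero => rfl
    | succ k =>
      refine (congrArg (D k) (hx ⟨k, _⟩ fun h => hk ?_)).trans (map_zero (D k))
      simp only at h ⊢
      push_cast
      omega
  · intro x hx
    refine funext fun ⟨k, hk'⟩ => ?_
    cases k with
    | zero => rfl
    | succ k =>
      refine (congrArg (D k) (hx ⟨k, _⟩ ?_)).trans (map_zero (D k))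
      simp only
      omega
  · intro x
    refine funext fun ⟨k, hk'⟩ => ?_
    match k, hk' with
    | 0, _ => rfl
    | 1, _ => exact map_zero (D 0)
    | k + 2, _ => exact hD k _
  · intro v w
    rw [hb, hb, hB, map_neg]
  · intro v w
    exact hι _
  · intro i hi x hx y
    have h : pr x = 0 := hx _ (by simpa using hi.symm)
    rw [hb, h, map_zero, LinearMap.zero_apply, map_zero]
  · intro v y
    rw [hb]
    exact (congrArg ι (hBD v (pr y))).trans (map_zero ι)
  · intro x y z
    obtain ⟨v, hv, h⟩ := hJ (pr x) (pr y) (pr z)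
    refine ⟨v, hv, h.trans ?_⟩
    simp only [jacobiator, hb, hprι, ← map_add]
    rfl

end Complex

/-! ## The reduced complex -/

section Reduced

variable {n : ℕ} {M : Type*} [TopologicalSpace M] [ChartedSpace (EuclideanSpace ℝ (Fin n)) M]
  [IsManifold (𝓡 n) ∞ M] [T2Space M]
  {F : Type*} [NormedAddCommGroup F] [NormedSpace ℝ F] [FiniteDimensional ℝ F]
  {E : M → Type*} [TopologicalSpace (TotalSpace F E)] [∀ p, TopologicalSpace (E p)]
  [∀ p, AddCommGroup (E p)] [∀ p, Module ℝ (E p)] [FiberBundle F E] [VectorBundle ℝ F E]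
  [ContMDiffVectorBundle ∞ F E (𝓡 n)]
  {ν : M → Cov n n} {w : Pairing n F E}
  {d : ℕ} {G : Type*} [Group G] [TopologicalSpace G] [ChartedSpace (EuclideanSpace ℝ (Fin d)) G]
  [LieGroup (𝓡 d) ∞ G]

namespace FibreAction

variable (A : FibreAction n F E d G)

theorem pull_injective {k : ℕ} : Function.Injective (A.pull (k := k)) := fun _ _ e =>
  funext fun c => Quotient.inductionOn c fun j => congrFun e j

theorem isInvariant_pull {k : ℕ} (h : A.OrbitForm k) : A.IsInvariant (A.pull h) := fun g j =>
  congrArg h (Quotient.sound (A.orbitSetoid.symm ⟨g, rfl⟩))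

/-- The form on the orbit space defined by an invariant form. -/
def descend {k : ℕ} {α : PreForm n F E k} (hα : A.IsInvariant α) : A.OrbitForm k :=
  Quotient.lift α fun j _ ⟨g, hg⟩ => ((hα g j).symm.trans (congrArg α hg))

/-- The reduced horizontal forms. -/
def reducedForms (k : ℕ) : Submodule ℝ (A.OrbitForm k) where
  carrier := {h | A.IsReduced h}
  zero_mem' := ⟨IsOmegaC.zero, A.isInvariant_pull 0⟩
  add_mem' {h h'} hh hh' := ⟨hh.1.add hh'.1, A.isInvariant_pull (h + h')⟩
  smul_mem' c h hh := ⟨hh.1.smul c, A.isInvariant_pull (c • h)⟩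

variable {A} in
theorem IsOmegaG.descend {k : ℕ} {α : PreForm n F E k} (hα : A.IsOmegaG α) :
    A.descend hα.2 ∈ A.reducedForms k := hα

variable {A} in
theorem IsOmegaG.dH {k : ℕ} {α : PreForm n F E k} (hα : A.IsOmegaG α) : A.IsOmegaG (dH α) :=
  ⟨hα.1.dH, hα.2.dH hα.1.horizontal⟩

/-- The reduced differential. -/
def reducedDiff (k : ℕ) : A.reducedForms k →ₗ[ℝ] A.reducedForms (k + 1) where
  toFun h := ⟨_, (IsOmegaG.dH h.2).descend⟩
  map_add' h h' := Subtype.ext (A.pull_injective (dH_add h.2.1.horizontal h'.2.1.horizontal))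
  map_smul' c h := Subtype.ext (A.pull_injective (dH_smul h.2.1.horizontal c))

theorem pull_reducedDiff (k : ℕ) (h : A.reducedForms k) :
    A.pull (A.reducedDiff k h).1 = HorizontalComplex.dH (A.pull h.1) := rfl

theorem reducedDiff_reducedDiff (k : ℕ) (h : A.reducedForms k) :
    A.reducedDiff (k + 1) (A.reducedDiff k h) = 0 :=
  Subtype.ext (A.pull_injective (dH_dH h.2.1.horizontal))

variable [MeasurableSpace M] [BorelSpace M] [SecondCountableTopology M]

variable {A} in
/-- The bracket of reduced top forms. -/
def reducedBracket (hA : A.IsCanonical ν w) (hν : IsVolumeForm ν) (hw : IsSkewPairing w) :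
    A.reducedForms n →ₗ[ℝ] A.reducedForms n →ₗ[ℝ] A.reducedForms n :=
  LinearMap.mk₂ ℝ (fun f g => ⟨_, (IsOmegaG.topBracket hA hν hw f.2 g.2).descend⟩)
    (fun f f' g => Subtype.ext (A.pull_injective
      (topBracket_add_left f.2.1.horizontal f'.2.1.horizontal (A.pull g.1))))
    (fun c f g => Subtype.ext (A.pull_injective
      (topBracket_smul_left f.2.1.horizontal c (A.pull g.1))))
    (fun f g g' => Subtype.ext (A.pull_injective
      (topBracket_add_right hw g.2.1.horizontal g'.2.1.horizontal (A.pull f.1))))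
    (fun c f g => Subtype.ext (A.pull_injective
      (topBracket_smul_right hw g.2.1.horizontal c (A.pull f.1))))

variable {A} in
theorem reducedBracket_skew (hA : A.IsCanonical ν w) (hν : IsVolumeForm ν) (hw : IsSkewPairing w)
    (f g : A.reducedForms n) : reducedBracket hA hν hw f g = -reducedBracket hA hν hw g f :=
  Subtype.ext (A.pull_injective (topBracket_skew hw (A.pull f.1) (A.pull g.1)))

variable [T2Space G] [CompactSpace G] [MeasurableSpace G] [BorelSpace G] (μ : Measure G)
  [μ.IsHaarMeasure] [IsProbabilityMeasure μ]

theorem isOmegaG_average_of_dH_eq {k : ℕ} (hk : k < n) {α : PreForm n F E (k + 1)}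
    {β : PreForm n F E k} (hα : A.IsOmegaG α) (hβ : IsOmegaC β) (h : dH β = α) :
    A.IsOmegaG (A.average μ β) ∧ HorizontalComplex.dH (A.average μ β) = α :=
  ⟨A.isOmegaG_average hk.ne hβ, by
    subst h
    exact A.dH_average_of_invariant hβ hα.2⟩

end FibreAction

variable {A : FibreAction n F E d G} [MeasurableSpace M] [BorelSpace M] [SecondCountableTopology M]

/-- For `n > 0` the last component of a boundary is exact and has zero Euler form, and the bracket
sees only Euler forms. For `n = 0` the total differential is zero. -/
theorem FibreAction.reducedBracket_totalDiff (hA : A.IsCanonical ν w) (hν : IsVolumeForm ν)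
    (hw : IsSkewPairing w) (v : (k : Fin (n + 1)) → A.reducedForms (k : ℕ))
    (y : A.reducedForms n) :
    FibreAction.reducedBracket hA hν hw
      (totalDiff n (X := fun k => A.reducedForms k) A.reducedDiff v (Fin.last n)) y = 0 := by
  cases n with
  | zero => exact LinearMap.congr_fun (map_zero (FibreAction.reducedBracket hA hν hw)) y
  | succ m =>
    refine Subtype.ext (A.pull_injective (funext fun j => ?_))
    have h := euler_dH (v ⟨m, Nat.lt_succ_of_lt (Nat.lt_succ_self m)⟩).2.1.horizontal
    exact topBracket_of_euler_eq_zero (congrFun h j) (A.pull y.1)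

/-- The Jacobiator of invariant forms is invariant, so the average of a primitive is an invariant
primitive. It has form degree `n - 1`, hence degree one. For `n = 0` the Jacobiator vanishes and no
primitive is needed. -/
theorem FibreAction.exists_primitive_jacobiator [T2Space G] [CompactSpace G] [MeasurableSpace G]
    [BorelSpace G] (μ : Measure G) [μ.IsHaarMeasure] [IsProbabilityMeasure μ]
    (hA : A.IsCanonical ν w) (hν : IsVolumeForm ν)
    (hw : IsSkewPairing w) (hJ : JacobiIdentity ν w) (x y z : A.reducedForms n) :
    ∃ v ∈ gradedPiece (fun k : Fin (n + 1) => A.reducedForms (k : ℕ)) 1,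
      totalDiff n (X := fun k => A.reducedForms k) A.reducedDiff v =
      Pi.single (M := fun k : Fin (n + 1) => A.reducedForms (k : ℕ)) (Fin.last n)
        (reducedBracket hA hν hw (reducedBracket hA hν hw x y) z +
          reducedBracket hA hν hw (reducedBracket hA hν hw y z) x +
          reducedBracket hA hν hw (reducedBracket hA hν hw z x) y) := by
  set J := reducedBracket hA hν hw (reducedBracket hA hν hw x y) z +
          reducedBracket hA hν hw (reducedBracket hA hν hw y z) x +
          reducedBracket hA hν hw (reducedBracket hA hν hw z x) y with hJdef
  have hJ' : A.pull J.1 = jac ν w (A.pull x.1) (A.pull y.1) (A.pull z.1) := rfl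
  cases n with
  | zero =>
    have h0 : J = 0 := Subtype.ext (A.pull_injective
      (hJ'.trans (jac_eq_zero hν hw hJ x.2.1 y.2.1 z.2.1)))
    rw [h0]
    exact ⟨0, zero_mem _, (map_zero _).trans (Pi.single_zero _).symm⟩
  | succ m =>
    obtain ⟨η, hη, h⟩ := exists_primitive_jac hν hw hJ x.2.1 y.2.1 z.2.1
    obtain ⟨h1, h2⟩ := A.isOmegaG_average_of_dH_eq μ (Nat.lt_succ_self m) J.2 hη (h.trans hJ'.symm)
    let i : Fin (m + 1 + 1) := ⟨m, Nat.lt_succ_of_lt (Nat.lt_succ_self m)⟩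
    let e : A.reducedForms m := ⟨_, h1.descend⟩
    have he : A.reducedDiff m e = J := Subtype.ext (A.pull_injective h2)
    refine ⟨Pi.single (M := fun k : Fin (m + 1 + 1) => A.reducedForms (k : ℕ)) i e, ?_, ?_⟩
    · intro k hk
      refine Pi.single_eq_of_ne (M := fun k : Fin (m + 1 + 1) => A.reducedForms (k : ℕ)) (i := i)
        (fun h => hk ?_) e
      rw [h]
      simp [i]
    · refine funext fun ⟨k, hk⟩ => ?_
      cases k with
      | zero =>
        exact (Pi.single_eq_of_ne (M := fun k : Fin (m + 1 + 1) => A.reducedForms (k : ℕ))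
          (i := Fin.last (m + 1)) (fun h => by simp [Fin.ext_iff] at h) J).symm
      | succ k =>
        by_cases hkm : k = m
        · subst hkm
          refine ((congrArg (A.reducedDiff k) (Pi.single_eq_same (M := fun k : Fin (k + 1 + 1) =>
            A.reducedForms (k : ℕ)) i e)).trans he).trans ?_
          exact (Pi.single_eq_same (M := fun k : Fin (k + 1 + 1) => A.reducedForms (k : ℕ))
            (Fin.last _) J).symm
        · refine ((congrArg (A.reducedDiff k) (Pi.single_eq_of_ne
            (M := fun k : Fin (m + 1 + 1) => A.reducedForms (k : ℕ)) (i := i)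
            (i' := ⟨k, Nat.lt_of_succ_lt hk⟩) (fun h => hkm (congrArg Fin.val h)) e)).trans
              (map_zero _)).trans ?_
          exact (Pi.single_eq_of_ne (M := fun k : Fin (m + 1 + 1) => A.reducedForms (k : ℕ))
            (i := Fin.last (m + 1)) (i' := ⟨k + 1, hk⟩)
            (fun h => hkm (by simpa [Fin.ext_iff] using h)) J).symm

end Reduced

end HorizontalComplex

end

/-! ### The theorem, assembled from averaging, the reduced complex and the sh-Lie construction -/

theorem mainTheorem5
    {n : ℕ} {M : Type*} [TopologicalSpace M] [ChartedSpace (EuclideanSpace ℝ (Fin n)) M]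
    [IsManifold (𝓡 n) ∞ M] [T2Space M] [SecondCountableTopology M]
    [MeasurableSpace M] [BorelSpace M]
    {F : Type*} [NormedAddCommGroup F] [NormedSpace ℝ F] [FiniteDimensional ℝ F]
    {E : M → Type*} [TopologicalSpace (TotalSpace F E)] [∀ p, TopologicalSpace (E p)]
    [∀ p, AddCommGroup (E p)] [∀ p, Module ℝ (E p)] [FiberBundle F E] [VectorBundle ℝ F E]
    [ContMDiffVectorBundle ∞ F E (𝓡 n)]
    (ν : M → HorizontalComplex.Cov n n) (hν : HorizontalComplex.IsVolumeForm ν)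
    (w : HorizontalComplex.Pairing n F E) (hw : HorizontalComplex.IsSkewPairing w)
    (hJacobi : HorizontalComplex.JacobiIdentity ν w)
    (hexact : HorizontalComplex.HorizontalExact n F E)
    {d : ℕ} {G : Type*} [Group G] [TopologicalSpace G]
    [ChartedSpace (EuclideanSpace ℝ (Fin d)) G] [LieGroup (𝓡 d) ∞ G] [T2Space G] [CompactSpace G]
    [MeasurableSpace G] [BorelSpace G]
    (μ : Measure G) [μ.IsHaarMeasure] [IsProbabilityMeasure μ]
    (A : HorizontalComplex.FibreAction n F E d G) (hA : A.IsCanonical ν w) :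
    -- the Haar average of a primitive of an invariant form is an invariant primitive
    (∀ k : ℕ, k < n → ∀ (α : HorizontalComplex.PreForm n F E (k + 1))
      (β : HorizontalComplex.PreForm n F E k), A.IsOmegaG α → HorizontalComplex.IsOmegaC β →
      HorizontalComplex.dH β = α →
      A.IsOmegaG (A.average μ β) ∧ HorizontalComplex.dH (A.average μ β) = α) ∧
    -- closed invariant forms of degree `< n` are differentials of invariant forms
    (0 < n → ∀ α : HorizontalComplex.PreForm n F E 0, A.IsOmegaG α →
      HorizontalComplex.dH α = 0 → α = 0) ∧
    (∀ k : ℕ, k + 1 < n → ∀ α : HorizontalComplex.PreForm n F E (k + 1), A.IsOmegaG α →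
      HorizontalComplex.dH α = 0 →
      ∃ γ : HorizontalComplex.PreForm n F E k, A.IsOmegaG γ ∧ HorizontalComplex.dH γ = α) ∧
    -- the spaces `Ω^{k,0}_c(J^∞E/G)` and the reduced differential
    ∃ (X : (k : ℕ) → Submodule ℝ (A.OrbitForm k)) (D : (k : ℕ) → X k →ₗ[ℝ] X (k + 1)),
      (∀ k (h : A.OrbitForm k), h ∈ X k ↔ A.IsReduced h) ∧
      (∀ k (h : X k), A.pull (D k h).1 = HorizontalComplex.dH (A.pull h.1)) ∧
      (∀ k (h : X k), D (k + 1) (D k h) = 0) ∧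
      -- exactness
      (0 < n → ∀ h : X 0, D 0 h = 0 → h = 0) ∧
      (∀ k : ℕ, k + 1 < n → ∀ h : X (k + 1), D (k + 1) h = 0 → ∃ h' : X k, D k h' = h) ∧
      -- the induced sh-Lie structure
      ∃ S : HorizontalComplex.ShLie ((k : Fin (n + 1)) → X (k : ℕ))
          (HorizontalComplex.gradedPiece (fun k : Fin (n + 1) => X (k : ℕ))),
        (∀ v, S.l 1 ![v] 0 = 0) ∧
        (∀ v (k : ℕ) (hk : k < n), S.l 1 ![v] ⟨k + 1, Nat.succ_lt_succ hk⟩ =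
          D k (v ⟨k, Nat.lt_succ_of_lt hk⟩)) ∧
        (∀ f₁ f₂ : X n,
          A.pull (S.l 2 ![Pi.single (Fin.last n) f₁, Pi.single (Fin.last n) f₂] (Fin.last n)).1 =
            HorizontalComplex.topBracket ν w (A.pull f₁.1) (A.pull f₂.1)) ∧
        (∀ (k : ℕ) (i : Fin k → ℤ) (x : Fin k → ((k : Fin (n + 1)) → X (k : ℕ))),
          (∀ a, x a ∈ HorizontalComplex.gradedPiece (fun k : Fin (n + 1) => X (k : ℕ)) (i a)) →
          2 ≤ k → (4 ≤ k ∨ ∃ a, i a ≠ 0) → S.l k x = 0) := by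
  refine ⟨fun k hk α β hα hβ h => A.isOmegaG_average_of_dH_eq μ hk hα hβ h,
    fun hn α hα h => hexact.1 hn α hα.1 h, fun k hk α hα h => ?_,
    A.reducedForms, A.reducedDiff, fun k h => Iff.rfl, A.pull_reducedDiff,
    A.reducedDiff_reducedDiff, fun hn h hh => ?_, fun k hk h hh => ?_, ?_⟩
  · obtain ⟨β, hβ, hd⟩ := hexact.2 k hk α hα.1 h
    exact ⟨_, A.isOmegaG_average_of_dH_eq μ (Nat.lt_of_succ_lt hk) hα hβ hd⟩
  · exact Subtype.ext (A.pull_injective (hexact.1 hn _ h.2.1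
      (congrArg (fun f : A.reducedForms 1 => A.pull f.1) hh)))
  · obtain ⟨β, hβ, hd⟩ := hexact.2 k hk _ h.2.1
      (congrArg (fun f : A.reducedForms (k + 2) => A.pull f.1) hh)
    obtain ⟨h1, h2⟩ := A.isOmegaG_average_of_dH_eq μ (Nat.lt_of_succ_lt hk) h.2 hβ hd
    exact ⟨⟨_, h1.descend⟩, Subtype.ext (A.pull_injective h2)⟩
  · have key := HorizontalComplex.exists_shLie_complex (n := n)
      (X := fun k => A.reducedForms k) (D := A.reducedDiff)
      (B := HorizontalComplex.FibreAction.reducedBracket hA hν hw) A.reducedDiff_reducedDiff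
      (HorizontalComplex.FibreAction.reducedBracket_skew hA hν hw)
    have h1 := key (HorizontalComplex.FibreAction.reducedBracket_totalDiff hA hν hw)
    have h2 := h1
      (HorizontalComplex.FibreAction.exists_primitive_jacobiator μ hA hν hw hJacobi)
    obtain ⟨S, h1, h2, h3⟩ := h2
    refine ⟨S, ?_, ?_, ?_, ?_⟩
    · exact fun v => congrFun (h1 v) 0
    · exact fun v k hk => congrFun (h1 v) ⟨k + 1, _⟩
    · exact fun f g => congrArg (fun f : A.reducedForms n => A.pull f.1) (h2 f g)
    · exact h3
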